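/- **Setting.** Let $\Lambda\in\mathbb R^{2\times2}$ be invertible, $\Lambda^*=2\pi(\Lambda^\top)^{-1}$, and let $W=\{\Lambda\mu:\mu\in(-\tfrac12,\tfrac12]^2\}$, $W^*=\{\Lambda^*\mu:\mu\in(-\tfrac12,\tfrac12]^2\}$. Let $\zeta:\mathbb R^3\to\mathbb R^3$ be a bijection such that $\zeta$ and $\zeta^{-1}$ are Lipschitz and $\zeta(y+(\Lambda j,0))=\zeta(y)+(\Lambda j,0)$ for $y\in\mathbb R^3$, $j\in\mathbb Z^2$. Put $\Gamma=\{\zeta(\tilde y,0):\tilde y\in\mathbb R^2\}$ and $\Gamma_\Lambda=\{x\in\Gamma:(x_1,x_2)\in W\}$; for a function $\varphi$ on $\Gamma$ write $\varphi_\zeta(\tilde y)=\varphi(\zeta(\tilde y,0))$, and let $dS=|\partial_1\zeta(\tilde y,0)\times\partial_2\zeta(\tilde y,0)|\,d\tilde y$ be the surface measure. **Spaces.** For $s,r\in\mathbb R$ let $H^s_r(\mathbb R^2)$ be the space of tempered distributions $u$ with finite norm $\|u\|_{H^s_r}=\big(\int(1+|z|^2)^s|\hat w(z)|^2dz\big)^{1/2}$,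 $w=(1+|x|^2)^{r/2}u$, where $\hat w(z)=\frac1{2\pi}\int e^{-iz\cdot x}w(x)\,dx$. For $0\le s\le1$ let $H^s_r(\Gamma)$ be the space of functions $\varphi$ on $\Gamma$ with $\varphi_\zeta\in H^s_r(\mathbb R^2)$, normed by $\|\varphi_\zeta\|_{H^s_r}$; for $-1\le s<0$ it is the dual of $H^{-s}_{-r}(\Gamma)$ with respect to the scalar product $\int_\Gamma\varphi\overline\psi\,dS$. Functionals $F$ on functions on $\Gamma$ are lifted to $\mathbb R^2$ by $F_\zeta(v_\zeta)=F(v)$. Let $\mathcal D'_\Lambda$ be the space of distributions $\psi(\alpha,x)$ on $\mathbb R^2\times\mathbb R^2$ that are $\Lambda^*$-periodic in $\alpha$ and satisfy $\psi(\alpha,x+\Lambda j)=e^{i\alpha\cdot\Lambda j}\psi(\alpha,x)$, with Fourier coefficients given by $\psi(\alpha,x)=|\det\Lambda|^{-1/2}\sum_{j\in\mathbb Z^2}\hat\psi(\alpha,j)e^{i(\Lambda^*j+\alpha)\cdot x}$. For integers $\ell\ge0$ the space $H^\ell_{\mathbf 0}(W^*;H^s_\alpha(W))$ consists of the $\psi\in\mathcal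 D'_\Lambda$ with $$\|\psi\|^2=\sum_{|\gamma|\le\ell}\int_{W^*}\sum_{j\in\mathbb Z^2}(1+|j|^2)^s\,|\partial_\alpha^\gamma\hat\psi(\alpha,j)|^2\,d\alpha<\infty ,$$ with weak derivatives on $\mathbb R^2$; for non-integer $r=\ell+\theta>0$, $0<\theta<1$, $H^r_{\mathbf 0}(W^*;H^s_\alpha(W))$ is the interpolation space $[H^\ell_{\mathbf 0}(W^*;H^s_\alpha(W)),H^{\ell+1}_{\mathbf 0}(W^*;H^s_\alpha(W))]_\theta$ (real method, exponent $2$); for $r<0$ it is the dual of $H^{-r}_{\mathbf 0}(W^*;H^{-s}_\alpha(W))$ with respect to the scalar product of $L^2(W^*;L^2(W))$. The space $H^r_{\mathbf 0}(W^*;H^s_\alpha(\Gamma_\Lambda))$, with its norm, consists of the $\psi$ on $\mathbb R^2\times\Gamma$ whose lift in $x\in\Gamma$ belongs to $H^r_{\mathbf 0}(W^*;H^s_\alpha(W))$; as on $\Gamma$, for $s\ge0$ functions are lifted by composition with $\zeta(\cdot,0)$, and for $s<0$ elements are functionals (functions being identified with functionals through $dS$) and are lifted as such. **Theorem.** The Bloch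 transform $$J_\Gamma\varphi(\alpha,x)=\frac{|\det\Lambda|^{1/2}}{2\pi}\sum_{j\in\mathbb Z^2}\varphi\big(x+(\Lambda j,0)\big)\,e^{-i\alpha\cdot\Lambda j},\qquad \alpha\in\mathbb R^2,\ x\in\Gamma,$$ (the series converging in the sense of distributions) is, for all $s\in[-1,1]$ and $r\in\mathbb R$, a linear bijection from $H^s_r(\Gamma)$ onto $H^r_{\mathbf 0}(W^*;H^s_\alpha(\Gamma_\Lambda))$ that is bounded together with its inverse, and it is an isometry for $s=r=0$. Its inverse is its $L^2$-adjoint: for $\varphi\in H^s_r(\Gamma)$ and $\psi\in H^{-r}_{\mathbf 0}(W^*;H^{-s}_\alpha(\Gamma_\Lambda))$ one has $\langle J_\Gamma\varphi,\psi\rangle=\langle\varphi,J_\Gamma^{-1}\psi\rangle$, where the brackets are the extensions by continuity of the scalar products of $L^2(W^*;L^2(\Gamma_\Lambda))$ and $L^2(\Gamma)$; for $s=r=0$ this holds both for the scalar products that define the norms (those of the lifts) and for those taken with $dS$. Moreover $$J_\Gamma^{-1}\psi\big(x+(\Lambda j,0)\big)=\frac{|\det\Lambda|^{1/2}}{2\pi}\int_{W^*}\psi(\alpha,x)\,e^{i\alpha\cdot\Lambda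 j}\,d\alpha,\qquad x\in\Gamma_\Lambda,\ j\in\mathbb Z^2,$$ for functions $\psi$, and in the sense of distributions (on all of $\Gamma$, for every $j$) in general. -/

import Mathlib

open MeasureTheory Filter Topology
open scoped SchwartzMap FourierTransform ENNReal LineDeriv

noncomputable section

namespace BlochSurface

/-- The plane `ℝ²` (horizontal variables, and quasiperiodicities). -/
abbrev Plane := EuclideanSpace ℝ (Fin 2)

/-- The space `ℝ³`. -/
abbrev Space := EuclideanSpace ℝ (Fin 3)

/-- Integer vectors. -/
abbrev Idx := Fin 2 → ℤ

/-! ### Lattices and cells -/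

/-- The point `A μ` of the plane. -/
def mulPt (A : Matrix (Fin 2) (Fin 2) ℝ) (μ : Fin 2 → ℝ) : Plane :=
  WithLp.toLp 2 (A.mulVec μ)

/-- The lattice point `A j`, `j ∈ ℤ²`. -/
def latt (A : Matrix (Fin 2) (Fin 2) ℝ) (j : Idx) : Plane := mulPt A (fun i => (j i : ℝ))

/-- The dual periodicity matrix `Λ* = 2π (Λᵀ)⁻¹`. -/
def dualMat (Λ : Matrix (Fin 2) (Fin 2) ℝ) : Matrix (Fin 2) (Fin 2) ℝ :=
  (2 * Real.pi) • (Λ.transpose)⁻¹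

/-- The fundamental cell `{A μ : -1/2 < μ₁, μ₂ ≤ 1/2}`; it is `W` for `A = Λ` and `W*` for
`A = Λ*`. -/
def cell (A : Matrix (Fin 2) (Fin 2) ℝ) : Set Plane :=
  {x | ∃ μ : Fin 2 → ℝ, (∀ i, -1 / 2 < μ i ∧ μ i ≤ 1 / 2) ∧ x = mulPt A μ}

/-- `exp (i x · y)`. -/
def phase (x y : Plane) : ℂ := Complex.exp (Complex.I * ((inner ℝ x y : ℝ) : ℂ))

/-- The normalizing factor `|det Λ|^{1/2} / (2π)`. -/
def blochConst (Λ : Matrix (Fin 2) (Fin 2) ℝ) : ℂ :=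
  ((Real.sqrt |Λ.det| / (2 * Real.pi) : ℝ) : ℂ)

/-- The weight `(1 + |j|²)^s`. -/
def idxWeight (s : ℝ) (j : Idx) : ℝ≥0∞ :=
  ENNReal.ofReal ((1 + ((j 0 : ℝ) ^ 2 + (j 1 : ℝ) ^ 2)) ^ s)

/-! ### Distributions -/

/-- The translate `x ↦ v (x - a)`. -/
def transl (a : Plane) (v : 𝓢(Plane, ℂ)) : 𝓢(Plane, ℂ) := SchwartzMap.compSubConstCLM ℂ a v

/-- Complex conjugate of a test function. -/
def conjTest (v : 𝓢(Plane, ℂ)) : 𝓢(Plane, ℂ) :=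
  SchwartzMap.postcompCLM (Complex.conjCLE : ℂ →L[ℝ] ℂ) v

/-- The tempered distribution `T` is the function `f`. -/
def Represents (T : 𝓢'(Plane, ℂ)) (f : Plane → ℂ) : Prop :=
  ∀ v : 𝓢(Plane, ℂ), Integrable (fun x => f x * v x) ∧ T v = ∫ x, f x * v x

/-- Tempered distributions in two variables `(α, x) ∈ ℝ² × ℝ²`, written as distributions in `α`
with values in the distributions in `x`; `ψ η v` is the value at the test function
`(α, x) ↦ η(α) v(x)`.  (By the kernel theorem these are the tempered distributions on
`ℝ² × ℝ²`.) -/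
abbrev Dist₂ := 𝓢'(Plane, 𝓢'(Plane, ℂ))

/-- The distribution `ψ` in two variables is the function `f`. -/
def Represents₂ (ψ : Dist₂) (f : Plane → Plane → ℂ) : Prop :=
  ∀ η v : 𝓢(Plane, ℂ),
    Integrable (fun p : Plane × Plane => f p.1 p.2 * (η p.1 * v p.2)) ∧
      ψ η v = ∫ p : Plane × Plane, f p.1 p.2 * (η p.1 * v p.2)

/-- The class `D'_Λ`: `ψ` is `Λ*`-periodic in `α`, and quasiperiodic in `x` with respect to `Λ`,
with quasiperiodicity `α`, i.e. `ψ(α, x + Λj) = exp(i α·Λj) ψ(α, x)`. -/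
def IsQuasiperiodic (Λ : Matrix (Fin 2) (Fin 2) ℝ) (ψ : Dist₂) : Prop :=
  (∀ (m : Idx) (η v : 𝓢(Plane, ℂ)), ψ (transl (latt (dualMat Λ) m) η) v = ψ η v) ∧
  (∀ (j : Idx) (η v : 𝓢(Plane, ℂ)),
    ψ η (transl (latt Λ j) v) =
      ψ (SchwartzMap.smulLeftCLM ℂ (fun α : Plane => phase α (latt Λ j)) η) v)

/-! ### Weighted Sobolev spaces on the plane -/

/-- The norm of `H^s_r(ℝ²)`, i.e. the `H^s`-norm of `(1+|x|²)^{r/2} T`; it is `∞` off the space.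
Mathlib's Fourier transform has the kernel `exp(-2πi x·ξ)`, so that the frequency variable is
`z = 2πξ` and `∫ (1+|z|²)^s |û(z)|² dz = ∫ (1+|2πξ|²)^s |𝓕 u(ξ)|² dξ`. -/
def sobolevNorm (s r : ℝ) (T : 𝓢'(Plane, ℂ)) : ℝ≥0∞ :=
  ⨅ (g : Plane → ℂ) (_ : Represents
      (𝓕 (TemperedDistribution.smulLeftCLM ℂ
        (fun x : Plane => (((1 + ‖x‖ ^ 2) ^ (r / 2) : ℝ) : ℂ)) T)) g),
    (∫⁻ ξ, ENNReal.ofReal ((1 + (2 * Real.pi * ‖ξ‖) ^ 2) ^ s) * ‖g ξ‖ₑ ^ 2) ^ (1 / 2 : ℝ)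

/-! ### The spaces `H^r_0(W*; H^s_α(W))` -/

/-- `ψ(α, x) = |det Λ|^{-1/2} ∑_j c_j(α) exp(i (Λ*j + α)·x)` in the sense of distributions: the
functions `c_j` are the Fourier coefficients of `ψ` in `x`. -/
def IsFourierExpansion (Λ : Matrix (Fin 2) (Fin 2) ℝ) (ψ : Dist₂) (c : Idx → Plane → ℂ) : Prop :=
  (∀ j, LocallyIntegrable (c j)) ∧
  ∀ η v : 𝓢(Plane, ℂ), HasSum
    (fun j : Idx => ((Real.sqrt |Λ.det| : ℝ) : ℂ)⁻¹ *
      ∫ α, c j α * η α * ∫ x, phase (latt (dualMat Λ) j + α) x * v x) (ψ η v)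

/-- The derivative `∂^γ` of a test function, `γ ∈ ℕ²`. -/
def partialDeriv (γ : ℕ × ℕ) (η : 𝓢(Plane, ℂ)) : 𝓢(Plane, ℂ) :=
  (fun f : 𝓢(Plane, ℂ) => ∂_{(EuclideanSpace.single 0 1 : Plane)} f)^[γ.1]
    ((fun f : 𝓢(Plane, ℂ) => ∂_{(EuclideanSpace.single 1 1 : Plane)} f)^[γ.2] η)

/-- `d` is the weak derivative `∂^γ c` on the plane. -/
def IsWeakDeriv (γ : ℕ × ℕ) (c d : Plane → ℂ) : Prop :=
  LocallyIntegrable d ∧ ∀ η : 𝓢(Plane, ℂ), HasCompactSupport η →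
    ∫ α, c α * partialDeriv γ η α = (-1) ^ (γ.1 + γ.2) * ∫ α, d α * η α

/-- The multi-indices of order at most `l`. -/
def multiIdx (l : ℕ) : Finset (ℕ × ℕ) :=
  (Finset.range (l + 1) ×ˢ Finset.range (l + 1)).filter (fun γ => γ.1 + γ.2 ≤ l)

/-- The norm of `H^l_0(W*; H^s_α(W))` for an integer `l ≥ 0`:
`[∑_{|γ| ≤ l} ∫_{W*} ∑_j (1+|j|²)^s |∂^γ ψ̂(α, j)|² dα]^{1/2}`; it is `∞` off the space.
Coefficients and weak derivatives are unique almost everywhere, so that the infimum is over one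
value or none. -/
def intNorm (Λ : Matrix (Fin 2) (Fin 2) ℝ) (s : ℝ) (l : ℕ) (ψ : Dist₂) : ℝ≥0∞ :=
  ⨅ (c : Idx → Plane → ℂ) (d : ℕ × ℕ → Idx → Plane → ℂ)
    (_ : IsFourierExpansion Λ ψ c ∧ ∀ γ ∈ multiIdx l, ∀ j, IsWeakDeriv γ (c j) (d γ j)),
    (∑ γ ∈ multiIdx l, ∑' j : Idx,
      idxWeight s j * ∫⁻ α in cell (dualMat Λ), ‖d γ j α‖ₑ ^ 2) ^ (1 / 2 : ℝ)

/-- The square of the (quadratic) K-functional of the pair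
`H^l_0(W*; H^s_α(W)) ⊃ H^{l+1}_0(W*; H^s_α(W))`. -/
def kFunctionalSq (Λ : Matrix (Fin 2) (Fin 2) ℝ) (s : ℝ) (l : ℕ) (t : ℝ) (ψ : Dist₂) : ℝ≥0∞ :=
  ⨅ (ψ₀ : Dist₂) (ψ₁ : Dist₂)
    (_ : IsQuasiperiodic Λ ψ₀ ∧ IsQuasiperiodic Λ ψ₁ ∧ ψ₀ + ψ₁ = ψ),
    intNorm Λ s l ψ₀ ^ 2 + ENNReal.ofReal (t ^ 2) * intNorm Λ s (l + 1) ψ₁ ^ 2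

/-- The norm of the interpolation space
`[H^l_0(W*; H^s_α(W)), H^{l+1}_0(W*; H^s_α(W))]_θ`, `0 < θ < 1`, by the K-method with exponent 2
(for pairs of Hilbert spaces it gives the same space as the complex method). -/
def interpNorm (Λ : Matrix (Fin 2) (Fin 2) ℝ) (s : ℝ) (l : ℕ) (θ : ℝ) (ψ : Dist₂) : ℝ≥0∞ :=
  (∫⁻ t in Set.Ioi (0 : ℝ),
    ENNReal.ofReal (t ^ (-2 * θ - 1)) * kFunctionalSq Λ s l t ψ) ^ (1 / 2 : ℝ)

/-- The norm of `H^r_0(W*; H^s_α(W))` for `r ≥ 0`. -/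
def posNorm (Λ : Matrix (Fin 2) (Fin 2) ℝ) (s r : ℝ) (ψ : Dist₂) : ℝ≥0∞ :=
  open Classical in
  if Int.fract r = 0 then intNorm Λ s ⌊r⌋₊ ψ else interpNorm Λ s ⌊r⌋₊ (Int.fract r) ψ

/-- Finite sums `∑ η_k(α) v_k(x)` of products of test functions. -/
abbrev TestSum := List (𝓢(Plane, ℂ) × 𝓢(Plane, ℂ))

/-- The periodization
`P(α, x) = ∑_k (∑_m η_k(α + Λ*m)) (∑_j v_k(x + Λj) exp(-i α·Λj))`. It is smooth, `Λ*`-periodic in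
`α` and `α`-quasiperiodic in `x`; the functions of this form serve as test functions on
`W* × W`. -/
def periodization (Λ : Matrix (Fin 2) (Fin 2) ℝ) (L : TestSum) (α x : Plane) : ℂ :=
  (L.map (fun p => (∑' m : Idx, p.1 (α + latt (dualMat Λ) m)) *
    (∑' j : Idx, p.2 (x + latt Λ j) * phase (-α) (latt Λ j)))).sum

/-- The `L²(W*; L²(W))` pairing of `ψ ∈ D'_Λ` with the periodization `P` of `L`: if `ψ` is a
function, unfolding the sums gives
`∫_{W*} ∫_W ψ conj(P) dx dα = ∫_{ℝ²} ∫_{ℝ²} ψ(α, x) conj(∑_k η_k(α) v_k(x)) dx dα`. -/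
def pairTest (ψ : Dist₂) (L : TestSum) : ℂ :=
  (L.map (fun p => ψ (conjTest p.1) (conjTest p.2))).sum

/-- The norm of `H^r_0(W*; H^s_α(W))`, `r ∈ ℝ`; for `r < 0` it is the norm of the dual of
`H^{-r}_0(W*; H^{-s}_α(W))` with respect to the inner product of `L²(W*; L²(W))`. -/
def cellNorm (Λ : Matrix (Fin 2) (Fin 2) ℝ) (s r : ℝ) (ψ : Dist₂) : ℝ≥0∞ :=
  open Classical in
  if 0 ≤ r then posNorm Λ s r ψ
  else ⨆ (L : TestSum) (V : Dist₂) (_ : Represents₂ V (periodization Λ L)),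
    ‖pairTest ψ L‖ₑ / posNorm Λ (-s) (-r) V

/-! ### Periodic surfaces -/

/-- The point `(y, 0)` of `ℝ³`. -/
def embed (y : Plane) : Space := WithLp.toLp 2 ![y 0, y 1, 0]

/-- The horizontal part of a point of `ℝ³`. -/
def horiz (x : Space) : Plane := WithLp.toLp 2 ![x 0, x 1]

/-- A `Λ`-periodic Lipschitz diffeomorphism of `ℝ³`: `ζ` and its inverse are Lipschitz, and `ζ`
commutes with the horizontal lattice translations. -/
structure PeriodicDiffeo (Λ : Matrix (Fin 2) (Fin 2) ℝ) where
  /-- the bijection -/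
  ζ : Space ≃ Space
  lipschitz : ∃ K, LipschitzWith K ζ
  lipschitz_symm : ∃ K, LipschitzWith K ζ.symm
  periodic : ∀ (y : Space) (j : Idx), ζ (y + embed (latt Λ j)) = ζ y + embed (latt Λ j)

namespace PeriodicDiffeo

variable {Λ : Matrix (Fin 2) (Fin 2) ℝ} (S : PeriodicDiffeo Λ)

/-- The parametrization `y ↦ ζ(y, 0)`. -/
def param (y : Plane) : Space := S.ζ (embed y)

/-- The surface `Γ = {ζ(y, 0) : y ∈ ℝ²}`. -/
def surface : Set Space := Set.range S.param

/-- The part `Γ_Λ` of `Γ` over the cell `W`. -/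
def surfaceCell : Set S.surface := {x | horiz (x : Space) ∈ cell Λ}

/-- The point `ζ(y, 0)` as a point of `Γ`. -/
def point (y : Plane) : S.surface := ⟨S.param y, y, rfl⟩

theorem embed_add (y a : Plane) : embed (y + a) = embed y + embed a := by
  ext i
  fin_cases i <;> simp [embed]

/-- The translation `x ↦ x + (Λj, 0)` of `Γ`. -/
def shift (j : Idx) (x : S.surface) : S.surface :=
  ⟨(x : Space) + embed (latt Λ j), by
    obtain ⟨y, hy⟩ := x.2
    exact ⟨y + latt Λ j, by rw [← hy, param, param, embed_add, S.periodic]⟩⟩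

/-- The surface density `|∂₁ζ(y, 0) × ∂₂ζ(y, 0)|`, so that `dS = density dy`. -/
def density (y : Plane) : ℝ :=
  ‖(WithLp.toLp 2 (crossProduct
    (WithLp.ofLp (fderiv ℝ S.param y (EuclideanSpace.single 0 1)))
    (WithLp.ofLp (fderiv ℝ S.param y (EuclideanSpace.single 1 1)))) : Space)‖

/-! Generalized functions on `Γ` are handled through their lifts to `ℝ²`.
An element of order `s ≥ 0` is a function `φ` on `Γ`, with lift `φ_ζ(y) = φ(ζ(y, 0))`.
An element of order `s < 0` is a functional on functions on `Γ`, lifted by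
`F_ζ(v_ζ) = F(v)`; a function `φ` on `Γ` is identified with the functional
`v ↦ ∫_Γ φ v dS`, the lift of which is `φ_ζ` times the surface density. -/

/-- The factor in the lift of functions, seen as elements of order `s`. -/
def liftFactor (s : ℝ) (y : Plane) : ℂ :=
  open Classical in if 0 ≤ s then 1 else ((S.density y : ℝ) : ℂ)

/-- `T` is the lift of the function `φ` on `Γ`, seen as an element of order `s`. -/
def IsLift (s : ℝ) (T : 𝓢'(Plane, ℂ)) (φ : S.surface → ℂ) : Prop :=
  Represents T (fun y => S.liftFactor s y * φ (S.point y))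

/-- `ψ` is the lift of the function `f` on `ℝ² × Γ`, seen as an element of order `s` in the second
variable. -/
def IsLift₂ (s : ℝ) (ψ : Dist₂) (f : Plane → S.surface → ℂ) : Prop :=
  Represents₂ ψ (fun α y => S.liftFactor s y * f α (S.point y))

/-- The norm of `H^s_r(Γ)`: for `s ≥ 0` the norm of the lift in `H^s_r(ℝ²)`; for `s < 0` the norm
of the dual of `H^{-s}_{-r}(Γ)` with respect to the inner product of `L²(Γ)`. In the latter case
`v` is the lift of a function on `Γ`. -/
def surfaceNorm (_S : PeriodicDiffeo Λ) (s r : ℝ) (T : 𝓢'(Plane, ℂ)) : ℝ≥0∞ :=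
  open Classical in
  if 0 ≤ s then sobolevNorm s r T
  else ⨆ v : 𝓢(Plane, ℂ), ‖T (conjTest v)‖ₑ / sobolevNorm (-s) (-r) (v : 𝓢'(Plane, ℂ))

/-- The space `H^s_r(Γ)` (of lifts). -/
def sobolev (s r : ℝ) : Set (𝓢'(Plane, ℂ)) :=
  {T | (0 ≤ s → ∃ φ : S.surface → ℂ, S.IsLift s T φ) ∧ S.surfaceNorm s r T < ∞}

/-- The space `H^r_0(W*; H^s_α(Γ_Λ))` (of lifts). -/
def blochSobolev (_S : PeriodicDiffeo Λ) (s r : ℝ) : Set Dist₂ :=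
  {ψ | IsQuasiperiodic Λ ψ ∧ cellNorm Λ s r ψ < ∞}

/-- The Bloch transform of a function on `Γ`:
`|det Λ|^{1/2}/(2π) ∑_j φ(x + (Λj, 0)) exp(-i α·Λj)`. -/
def blochFun (φ : S.surface → ℂ) (α : Plane) (x : S.surface) : ℂ :=
  blochConst Λ * ∑' j : Idx, φ (S.shift j x) * phase (-α) (latt Λ j)

/-- The scalar product `∫_Γ φ₁ conj(φ₂) dS` of `L²(Γ)`. -/
def innerSurface (φ₁ φ₂ : S.surface → ℂ) : ℂ :=
  ∫ y, φ₁ (S.point y) * star (φ₂ (S.point y)) * ((S.density y : ℝ) : ℂ)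

/-- The scalar product `∫_{W*} ∫_{Γ_Λ} f₁ conj(f₂) dS dα` of `L²(W*; L²(Γ_Λ))`. -/
def innerCell (f₁ f₂ : Plane → S.surface → ℂ) : ℂ :=
  ∫ α in cell (dualMat Λ), ∫ y in cell Λ,
    f₁ α (S.point y) * star (f₂ α (S.point y)) * ((S.density y : ℝ) : ℂ)

/-- `z` is the value at `(T, G)` of the extension by continuity of the `L²` scalar product to
`H^s_r(Γ) × H^{-s}_{-r}(Γ)`. (In terms of lifts this is the flat pairing: if `s ≠ 0`, the surface
density is contained in the lift of the factor of negative order.) -/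
def IsSurfacePairing (s r : ℝ) (T G : 𝓢'(Plane, ℂ)) (z : ℂ) : Prop :=
  ∃ v : ℕ → 𝓢(Plane, ℂ),
    Tendsto (fun n => S.surfaceNorm (-s) (-r) (G - (v n : 𝓢'(Plane, ℂ)))) atTop (𝓝 0) ∧
    Tendsto (fun n => T (conjTest (v n))) atTop (𝓝 z)

/-- `z` is the value at `(ψ₁, ψ₂)` of the extension by continuity of the `L²` scalar product to
`H^r_0(W*; H^s_α(Γ_Λ)) × H^{-r}_0(W*; H^{-s}_α(Γ_Λ))`. -/
def IsCellPairing (_S : PeriodicDiffeo Λ) (s r : ℝ) (ψ₁ ψ₂ : Dist₂) (z : ℂ) : Prop :=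
  ∃ (L : ℕ → TestSum) (V : ℕ → Dist₂),
    (∀ n, Represents₂ (V n) (periodization Λ (L n))) ∧
    Tendsto (fun n => cellNorm Λ (-s) (-r) (ψ₂ - V n)) atTop (𝓝 0) ∧
    Tendsto (fun n => pairTest ψ₁ (L n)) atTop (𝓝 z)

/-- `ψ` is the Bloch transform of the generalized function `T` on `Γ`: the series
`|det Λ|^{1/2}/(2π) ∑_j T(x + (Λj, 0)) exp(-i α·Λj)` converges to `ψ` in the sense of
distributions. (The translation by `(Λj, 0)` on `Γ` is the translation by `Λj` of the lifts.) -/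
def IsBlochTransform (_S : PeriodicDiffeo Λ) (T : 𝓢'(Plane, ℂ)) (ψ : Dist₂) : Prop :=
  ∀ η v : 𝓢(Plane, ℂ), HasSum
    (fun j : Idx => blochConst Λ *
      ((∫ α, η α * phase (-α) (latt Λ j)) * T (transl (latt Λ j) v))) (ψ η v)

end PeriodicDiffeo

end BlochSurface

end

noncomputable section

namespace BlochSurface

/-! ### The `L²` norm and the bilinear pairing of Schwartz functions -/

/-! Everything happens on lifts, that is, on tempered distributions on the plane, where the
horizontal translations of the surface become translations by `Λj`. The transform is defined by
duality: `blochJ hΛ T η v` is `T` applied to the Schwartz function `blochTest Λ η v`, a rapidly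
convergent sum of lattice translates of `v` whose coefficients are, up to a factor, the Fourier
coefficients of the periodization of `η`. By Poisson summation, on the Fourier side `blochTest` is
multiplication by this periodization (`poisson`, `uft_blochTest`). Two consequences carry the proof.

Bijectivity. If the dual lattice translates of `η` sum up to one, `blochTest Λ η v` is a multiple of
`v`, so that testing in `α` against such an `η` inverts the transform (`inversion`). Conversely,
periodicity and quasiperiodicity suffice to rebuild a distribution from this one test
(`blochJ_blochInv`). So the transform maps all tempered distributions bijectively onto the
quasiperiodic ones, and only norms remain to be compared.

Norms. The Fourier coefficients of the transform of `T` are the pieces of the Fourier transform of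
`T`, cut along the dual lattice (`isFourierExpansion_blochJ`, `Fh_apply_of_isFourierExpansion`). The
sum over `j` of integrals over `W*` reassembles into an integral over the plane, and derivatives in
`α` become moments of `T`. Write `D_s = (1 + |D|²)^{s/2}` and `M_r` for multiplication by `(1 +
|x|²)^{r/2}`. For an integer `r ≥ 0` the norm is comparable to that of `D_s M_r T` in `L²`
(`dom_moment`, `nequiv_intNorm`). For fractional `r` the K-functional of two weighted `L²` spaces is
computed pointwise, once the weight stands outside, as in `M_r D_s T` (`nequiv_interpNorm`). For `r
< 0` one dualizes: the admissible test functions on `W* × W` are precisely the Bloch transforms of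
Schwartz functions (`represents₂_unfold`, `exists_unfold_eq`).

The analytic core is `commute_dnorm`: for `|s| ≤ 1` the `L²` norms of `D_s M_r T` and `M_r D_s T`
are equivalent. A fractional power is an integral of resolvents of `1 + |D|²`; the commutator of a
weight with a resolvent is a first order term, which is small if the weight varies slowly. Replacing
`|x|` by `ε|x|` makes it vary slowly and changes the weight only by bounded factors. The duality
used for `s < 0` and for `r < 0` passes through the same statement.

The geometry of the surface disappears from the norms: for `s ≥ 0` they are defined by the lift, and
for `s < 0` the dual norm over Schwartz lifts is again the planar norm (`exists_surfaceNorm_equiv`).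
The adjoint formula holds because both pairings are limits along the same sequence of Schwartz
functions (`exists_pairing`). The scalar products with `dS` are compared by Parseval's identity in
`α` at almost every point (`cellCoef_blochJ`, `hasSum_cellCoef`), the surface density being
`Λ`-periodic and independent of `α`. -/

/-- Multiplication of a Schwartz function by `g`. -/
abbrev Sm (g : Plane → ℂ) : 𝓢(Plane, ℂ) →L[ℂ] 𝓢(Plane, ℂ) := SchwartzMap.smulLeftCLM ℂ g

/-- The Fourier multiplier with symbol `g`. -/
abbrev Fm (g : Plane → ℂ) : 𝓢(Plane, ℂ) →L[ℂ] 𝓢(Plane, ℂ) := SchwartzMap.fourierMultiplierCLM ℂ g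

/-- The `L²` norm of a Schwartz function. -/
def l2 (v : 𝓢(Plane, ℂ)) : ℝ := ‖v.toLp 2 (volume : Measure Plane)‖

/-- The bilinear pairing `∫ u v`. -/
def bil (u v : 𝓢(Plane, ℂ)) : ℂ := ∫ x, u x * v x

theorem l2_nonneg (v : 𝓢(Plane, ℂ)) : 0 ≤ l2 v := norm_nonneg _

theorem l2_add_le (u v : 𝓢(Plane, ℂ)) : l2 (u + v) ≤ l2 u + l2 v := by
  have : (u + v).toLp 2 (volume : Measure Plane) =
      u.toLp 2 volume + v.toLp 2 volume :=
    map_add (SchwartzMap.toLpCLM ℂ ℂ 2 (volume : Measure Plane)) u v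
  simpa [l2, this] using norm_add_le _ _

theorem l2_smul (c : ℂ) (v : 𝓢(Plane, ℂ)) : l2 (c • v) = ‖c‖ * l2 v := by
  have : (c • v).toLp 2 (volume : Measure Plane) = c • v.toLp 2 volume :=
    map_smul (SchwartzMap.toLpCLM ℂ ℂ 2 (volume : Measure Plane)) c v
  simp [l2, this, norm_smul]

theorem l2_neg (v : 𝓢(Plane, ℂ)) : l2 (-v) = l2 v := by
  simpa using l2_smul (-1) v

theorem l2_sub_le (u v : 𝓢(Plane, ℂ)) : l2 (u - v) ≤ l2 u + l2 v := by
  simpa [sub_eq_add_neg, l2_neg] using l2_add_le u (-v)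

theorem l2_zero : l2 0 = 0 := by simpa using l2_smul 0 0

theorem l2_sum_le {ι : Type*} (s : Finset ι) (f : ι → 𝓢(Plane, ℂ)) :
    l2 (∑ i ∈ s, f i) ≤ ∑ i ∈ s, l2 (f i) := by
  classical
  induction s using Finset.induction_on with
  | empty => simp [l2_zero]
  | insert a s ha ih =>
    rw [Finset.sum_insert ha, Finset.sum_insert ha]
    exact (l2_add_le _ _).trans (by gcongr)

theorem l2_sq (v : 𝓢(Plane, ℂ)) : l2 v ^ 2 = ∫ x, ‖v x‖ ^ 2 := by
  have h := SchwartzMap.norm_toLp' (f := v) (p := 2) (μ := (volume : Measure Plane))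
    (by simp) (by simp)
  rw [l2, h]
  simp only [ENNReal.toReal_ofNat]
  rw [← Real.rpow_natCast, ← Real.rpow_mul (integral_nonneg fun x => by positivity)]
  norm_num

theorem enorm_l2 (v : 𝓢(Plane, ℂ)) : ENNReal.ofReal (l2 v) = eLpNorm v 2 := by
  rw [l2, SchwartzMap.norm_toLp, ENNReal.ofReal_toReal (v.eLpNorm_lt_top 2 volume).ne]

theorem l2_eq_zero {v : 𝓢(Plane, ℂ)} (h : l2 v = 0) : v = 0 := by
  have h1 : v.toLp 2 (volume : Measure Plane) = (0 : 𝓢(Plane, ℂ)).toLp 2 := by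
    have h2 : (0 : 𝓢(Plane, ℂ)).toLp 2 (volume : Measure Plane) = 0 := by
      rw [← norm_eq_zero]; exact l2_zero
    rw [h2, ← norm_eq_zero]; exact h
  exact SchwartzMap.injective_toLp 2 (volume : Measure Plane) h1

theorem l2_fourier (v : 𝓢(Plane, ℂ)) : l2 (𝓕 v) = l2 v := by
  rw [← sq_eq_sq₀ (l2_nonneg _) (l2_nonneg _), l2_sq, l2_sq, SchwartzMap.integral_norm_sq_fourier]

theorem l2_fourierInv (v : 𝓢(Plane, ℂ)) : l2 (𝓕⁻ v) = l2 v := by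
  rw [← l2_fourier, FourierTransform.fourier_fourierInv_eq]

theorem l2_le_of_norm_le {u v : 𝓢(Plane, ℂ)} {C : ℝ} (hC : 0 ≤ C) (h : ∀ x, ‖u x‖ ≤ C * ‖v x‖) :
    l2 u ≤ C * l2 v := by
  have : ENNReal.ofReal (l2 u) ≤ ENNReal.ofReal (C * l2 v) := by
    rw [ENNReal.ofReal_mul hC, enorm_l2, enorm_l2]
    exact eLpNorm_le_mul_eLpNorm_of_ae_le_mul (Eventually.of_forall h) 2
  exact (ENNReal.ofReal_le_ofReal_iff (mul_nonneg hC (l2_nonneg _))).1 this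

theorem l2_Sm_le {g : Plane → ℂ} (hg : g.HasTemperateGrowth) {C : ℝ} (hC : ∀ x, ‖g x‖ ≤ C)
    (v : 𝓢(Plane, ℂ)) : l2 (Sm g v) ≤ C * l2 v := by
  refine l2_le_of_norm_le ((norm_nonneg _).trans (hC 0)) fun x => ?_
  rw [SchwartzMap.smulLeftCLM_apply_apply hg, norm_smul]
  gcongr
  exact hC x

theorem l2_Fm_le {g : Plane → ℂ} (hg : g.HasTemperateGrowth) {C : ℝ} (hC : ∀ x, ‖g x‖ ≤ C)
    (v : 𝓢(Plane, ℂ)) : l2 (Fm g v) ≤ C * l2 v := by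
  rw [SchwartzMap.fourierMultiplierCLM_apply, l2_fourierInv, ← l2_fourier v]
  exact l2_Sm_le hg hC _

theorem l2_Sm_le_l2_Sm {g h : Plane → ℂ} (hg : g.HasTemperateGrowth) (hh : h.HasTemperateGrowth)
    {C : ℝ} (hC : 0 ≤ C) (hle : ∀ x, ‖g x‖ ≤ C * ‖h x‖) (v : 𝓢(Plane, ℂ)) :
    l2 (Sm g v) ≤ C * l2 (Sm h v) := by
  refine l2_le_of_norm_le hC fun x => ?_
  rw [SchwartzMap.smulLeftCLM_apply_apply hg, SchwartzMap.smulLeftCLM_apply_apply hh, norm_smul,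
    norm_smul, ← mul_assoc]
  gcongr
  exact hle x

theorem l2_Fm_le_l2_Fm {g h : Plane → ℂ} (hg : g.HasTemperateGrowth) (hh : h.HasTemperateGrowth)
    {C : ℝ} (hC : 0 ≤ C) (hle : ∀ x, ‖g x‖ ≤ C * ‖h x‖) (v : 𝓢(Plane, ℂ)) :
    l2 (Fm g v) ≤ C * l2 (Fm h v) := by
  simp only [SchwartzMap.fourierMultiplierCLM_apply, l2_fourierInv]
  exact l2_Sm_le_l2_Sm hg hh hC hle _

theorem integrable_mul (u v : 𝓢(Plane, ℂ)) : Integrable (fun x => u x * v x) := by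
  have := (Sm u v).integrable (μ := volume)
  refine this.congr (Eventually.of_forall fun x => ?_)
  simp [SchwartzMap.smulLeftCLM_apply_apply u.hasTemperateGrowth]

theorem conjTest_apply (v : 𝓢(Plane, ℂ)) (x : Plane) : conjTest v x = star (v x) := rfl

theorem conjTest_conjTest (v : 𝓢(Plane, ℂ)) : conjTest (conjTest v) = v := by
  ext x; simp [conjTest_apply]

theorem l2_conjTest (v : 𝓢(Plane, ℂ)) : l2 (conjTest v) = l2 v := by
  rw [← sq_eq_sq₀ (l2_nonneg _) (l2_nonneg _), l2_sq, l2_sq]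
  simp [conjTest_apply]

theorem bil_comm (u v : 𝓢(Plane, ℂ)) : bil u v = bil v u := by
  simp [bil, mul_comm]

theorem bil_conjTest (u : 𝓢(Plane, ℂ)) : bil u (conjTest u) = ((l2 u ^ 2 : ℝ) : ℂ) := by
  rw [l2_sq, bil, ← integral_complex_ofReal]
  refine integral_congr_ae (Eventually.of_forall fun x => ?_)
  simp only [conjTest_apply, RCLike.star_def, Complex.mul_conj, Complex.normSq_eq_norm_sq]

theorem bil_conjTest_eq_inner (u v : 𝓢(Plane, ℂ)) :
    bil u (conjTest v) = inner ℂ (v.toLp 2 (volume : Measure Plane)) (u.toLp 2 volume) := by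
  rw [SchwartzMap.inner_toL2_toL2_eq v u volume, bil]
  simp [conjTest_apply]

theorem norm_bil_le (u v : 𝓢(Plane, ℂ)) : ‖bil u v‖ ≤ l2 u * l2 v := by
  have := bil_conjTest_eq_inner u (conjTest v)
  rw [conjTest_conjTest] at this
  rw [this, mul_comm, ← l2_conjTest v]
  exact norm_inner_le_norm _ _

/-- A Schwartz function is bounded in `L²` if its pairings with Schwartz functions are. -/
theorem l2_le_of_bil_le {u : 𝓢(Plane, ℂ)} {C : ℝ} (h : ∀ v, ‖bil u v‖ ≤ C * l2 v) : l2 u ≤ C := by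
  have h1 := h (conjTest u)
  rw [bil_conjTest, l2_conjTest, Complex.norm_real, Real.norm_of_nonneg (sq_nonneg _), sq] at h1
  rcases (l2_nonneg u).eq_or_lt with h0 | h0
  · rw [← h0]
    -- The hypothesis at any nonzero test function forces `C ≥ 0`, which is all that is needed when
    -- `u` has norm zero.
    obtain ⟨w, hw⟩ : ∃ w : 𝓢(Plane, ℂ), 0 < l2 w := by
      let b : ContDiffBump (0 : Plane) := ⟨1, 2, by norm_num, by norm_num⟩
      have hcs : HasCompactSupport (fun x => ((b x : ℝ) : ℂ)) :=
        b.hasCompactSupport.comp_left Complex.ofReal_zero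
      have hsm : ContDiff ℝ ((⊤ : ℕ∞) : WithTop ℕ∞) (fun x => ((b x : ℝ) : ℂ)) :=
        Complex.ofRealCLM.contDiff.comp b.contDiff
      refine ⟨hcs.toSchwartzMap hsm, (l2_nonneg _).lt_of_ne fun h => ?_⟩
      have h2 := congrArg (fun f : 𝓢(Plane, ℂ) => f 0) (l2_eq_zero h.symm)
      have h3 : ((b 0 : ℝ) : ℂ) = 0 := h2
      rw [b.one_of_mem_closedBall (by simp [b.rIn_pos.le])] at h3
      simp at h3
    by_contra hC
    push Not at hC
    have := (norm_nonneg _).trans (h w)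
    nlinarith
  · exact le_of_mul_le_mul_right h1 h0

theorem bil_Sm (g : Plane → ℂ) (u v : 𝓢(Plane, ℂ)) : bil (Sm g u) v = bil u (Sm g v) := by
  by_cases hg : g.HasTemperateGrowth
  · simp only [bil, SchwartzMap.smulLeftCLM_apply_apply hg, smul_eq_mul]
    congr 1 with x
    ring
  -- Without temperate growth the multiplication operator is zero by definition, so both sides
  -- vanish.
  · simp [SchwartzMap.smulLeftCLM, hg, bil]

theorem fourierInv_eq_fourier_neg' (v : 𝓢(Plane, ℂ)) (x : Plane) : (𝓕⁻ v) x = (𝓕 v) (-x) := rfl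

/-- For the bilinear pairing the transpose of a multiplier has the reflected symbol, whence the
assumption that `g` is even. -/
theorem bil_Fm {g : Plane → ℂ} (hg : g.HasTemperateGrowth) (heven : ∀ x, g (-x) = g x)
    (u v : 𝓢(Plane, ℂ)) : bil (Fm g u) v = bil u (Fm g v) := by
  simp only [bil, SchwartzMap.fourierMultiplierCLM_apply]
  rw [SchwartzMap.integral_fourierInv_mul_eq,
    ← SchwartzMap.integral_fourierInv_mul_eq u (Sm g (𝓕 v)),
    ← integral_neg_eq_self (fun x => (Sm g (𝓕 u)) x * 𝓕⁻ v x)]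
  congr 1 with x
  rw [SchwartzMap.smulLeftCLM_apply_apply hg, SchwartzMap.smulLeftCLM_apply_apply hg,
    fourierInv_eq_fourier_neg', fourierInv_eq_fourier_neg', heven, neg_neg, smul_eq_mul, smul_eq_mul]
  ring

/-- The two Fourier transforms differ by a reflection, which commutes with multiplication by an even
function. This identifies the transpose that defines multipliers on distributions. -/
theorem fourier_Sm_fourierInv {g : Plane → ℂ} (hg : g.HasTemperateGrowth)
    (heven : ∀ x, g (-x) = g x) (v : 𝓢(Plane, ℂ)) : 𝓕 (Sm g (𝓕⁻ v)) = Fm g v := by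
  ext x
  rw [SchwartzMap.fourierMultiplierCLM_apply, fourierInv_eq_fourier_neg']
  have : Sm g (𝓕⁻ v) = SchwartzMap.compCLMOfContinuousLinearEquiv ℂ
      ((LinearIsometryEquiv.neg ℝ (E := Plane)).toContinuousLinearEquiv) (Sm g (𝓕 v)) := by
    ext y
    rw [SchwartzMap.smulLeftCLM_apply_apply hg, fourierInv_eq_fourier_neg']
    change _ = Sm g (𝓕 v) (-y)
    rw [SchwartzMap.smulLeftCLM_apply_apply hg, heven]
  rw [this]
  set w := Sm g (𝓕 v)
  have h1 : ∀ y, (𝓕 w) y = 𝓕 (w : Plane → ℂ) y := fun y => rfl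
  rw [h1, SchwartzMap.fourier_coe, Real.fourier_eq, Real.fourier_eq, ← integral_neg_eq_self]
  congr 1 with y
  simp only [inner_neg_left, inner_neg_right]
  congr 1
  change w (- -y) = w y
  rw [neg_neg]

/-! ### The `L²` norm on tempered distributions -/

/-- The `L²` norm of a tempered distribution; it is `∞` off `L²`. -/
def dnorm (T : 𝓢'(Plane, ℂ)) : ℝ≥0∞ := ⨆ v : 𝓢(Plane, ℂ), ‖T v‖ₑ / ENNReal.ofReal (l2 v)

theorem enorm_le_dnorm (T : 𝓢'(Plane, ℂ)) (v : 𝓢(Plane, ℂ)) :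
    ‖T v‖ₑ ≤ dnorm T * ENNReal.ofReal (l2 v) := by
  -- A Schwartz function of norm zero vanishes, so the quotient 0/0 in the supremum loses nothing.
  rcases (l2_nonneg v).eq_or_lt with h0 | h0
  · simp [l2_eq_zero h0.symm]
  · rw [← ENNReal.div_le_iff (by simpa using h0) ENNReal.ofReal_ne_top]
    exact le_iSup (fun v => ‖T v‖ₑ / ENNReal.ofReal (l2 v)) v

theorem dnorm_le {T : 𝓢'(Plane, ℂ)} {C : ℝ≥0∞}
    (h : ∀ v, ‖T v‖ₑ ≤ C * ENNReal.ofReal (l2 v)) : dnorm T ≤ C := by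
  refine iSup_le fun v => ?_
  exact ENNReal.div_le_of_le_mul (h v)

theorem dnorm_add_le (S T : 𝓢'(Plane, ℂ)) : dnorm (S + T) ≤ dnorm S + dnorm T := by
  refine dnorm_le fun v => ?_
  rw [add_mul]
  exact (enorm_add_le (S v) (T v)).trans (add_le_add (enorm_le_dnorm S v) (enorm_le_dnorm T v))

theorem dnorm_smul_le (c : ℂ) (T : 𝓢'(Plane, ℂ)) : dnorm (c • T) ≤ ‖c‖ₑ * dnorm T := by
  refine dnorm_le fun v => ?_
  change ‖c • T v‖ₑ ≤ _
  rw [enorm_smul, mul_assoc]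
  gcongr
  exact enorm_le_dnorm T v

theorem dnorm_zero : dnorm 0 = 0 := by
  refine le_antisymm (dnorm_le fun v => ?_) zero_le
  change ‖(0 : ℂ)‖ₑ ≤ _
  simp

theorem dnorm_sum_le {ι : Type*} (s : Finset ι) (f : ι → 𝓢'(Plane, ℂ)) :
    dnorm (∑ i ∈ s, f i) ≤ ∑ i ∈ s, dnorm (f i) := by
  classical
  induction s using Finset.induction_on with
  | empty => simp [dnorm_zero]
  | insert a s ha ih =>
    rw [Finset.sum_insert ha, Finset.sum_insert ha]
    exact (dnorm_add_le _ _).trans (by gcongr)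

theorem dnorm_coe (u : 𝓢(Plane, ℂ)) : dnorm (u : 𝓢'(Plane, ℂ)) = ENNReal.ofReal (l2 u) := by
  have hap : ∀ v, (u : 𝓢'(Plane, ℂ)) v = bil v u := fun v => by
    simp [bil]
  refine le_antisymm (dnorm_le fun v => ?_) ?_
  · rw [hap, ← ofReal_norm, ← ENNReal.ofReal_mul (l2_nonneg _), mul_comm]
    exact ENNReal.ofReal_le_ofReal (norm_bil_le _ _)
  · by_cases h : dnorm (u : 𝓢'(Plane, ℂ)) = ∞
    · simp [h]
    rw [← ENNReal.ofReal_toReal h]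
    refine ENNReal.ofReal_le_ofReal (l2_le_of_bil_le fun v => ?_)
    have := enorm_le_dnorm (u : 𝓢'(Plane, ℂ)) v
    rw [← ENNReal.ofReal_toReal h, ← ENNReal.ofReal_mul ENNReal.toReal_nonneg, ← ofReal_norm,
      ENNReal.ofReal_le_ofReal_iff (mul_nonneg ENNReal.toReal_nonneg (l2_nonneg _)), hap,
      bil_comm] at this
    exact this

theorem dnorm_fourier (T : 𝓢'(Plane, ℂ)) : dnorm (𝓕 T) = dnorm T := by
  have key : ∀ S : 𝓢'(Plane, ℂ), dnorm (𝓕 S) ≤ dnorm S := fun S => dnorm_le fun v => by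
    rw [TemperedDistribution.fourier_apply, ← l2_fourier v]
    exact enorm_le_dnorm _ _
  refine le_antisymm (key T) (dnorm_le fun v => ?_)
  have := enorm_le_dnorm (𝓕 T) (𝓕⁻ v)
  rwa [TemperedDistribution.fourier_apply, FourierTransform.fourier_fourierInv_eq,
    l2_fourierInv] at this

theorem dnorm_fourierInv (T : 𝓢'(Plane, ℂ)) : dnorm (𝓕⁻ T) = dnorm T := by
  rw [← dnorm_fourier, FourierTransform.fourier_fourierInv_eq]

/-- Multiplication of a tempered distribution by `g`. -/
abbrev SmD (g : Plane → ℂ) : 𝓢'(Plane, ℂ) →L[ℂ] 𝓢'(Plane, ℂ) :=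
  TemperedDistribution.smulLeftCLM ℂ g

/-- The Fourier multiplier with symbol `g` on tempered distributions. -/
abbrev FmD (g : Plane → ℂ) : 𝓢'(Plane, ℂ) →L[ℂ] 𝓢'(Plane, ℂ) :=
  TemperedDistribution.fourierMultiplierCLM ℂ g

theorem SmD_apply (g : Plane → ℂ) (T : 𝓢'(Plane, ℂ)) (v : 𝓢(Plane, ℂ)) :
    SmD g T v = T (Sm g v) := rfl

theorem FmD_apply {g : Plane → ℂ} (hg : g.HasTemperateGrowth) (heven : ∀ x, g (-x) = g x)
    (T : 𝓢'(Plane, ℂ)) (v : 𝓢(Plane, ℂ)) : FmD g T v = T (Fm g v) := by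
  rw [TemperedDistribution.fourierMultiplierCLM_apply_apply, fourier_Sm_fourierInv hg heven]

theorem dnorm_SmD_le {g h : Plane → ℂ} (hg : g.HasTemperateGrowth) (hh : h.HasTemperateGrowth)
    {C : ℝ} (hC : 0 ≤ C) (hle : ∀ x, ‖g x‖ ≤ C) (T : 𝓢'(Plane, ℂ)) :
    dnorm (SmD (g * h) T) ≤ ENNReal.ofReal C * dnorm (SmD h T) := by
  refine dnorm_le fun v => ?_
  rw [SmD_apply, mul_comm g h, ← SchwartzMap.smulLeftCLM_smulLeftCLM_apply hh hg, ← SmD_apply]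
  refine (enorm_le_dnorm _ _).trans ?_
  rw [mul_comm (ENNReal.ofReal C), mul_assoc, ← ENNReal.ofReal_mul hC]
  gcongr
  exact l2_Sm_le hg hle v

/-! ### Weights -/

/-- The weight `(1 + |εx|²)^{r/2}`. -/
def wt (ε r : ℝ) (x : Plane) : ℂ := (((1 + (ε * ‖x‖) ^ 2) ^ (r / 2) : ℝ) : ℂ)

theorem one_add_sq_pos (ε : ℝ) (x : Plane) : 0 < 1 + (ε * ‖x‖) ^ 2 := by positivity

theorem norm_wt (ε r : ℝ) (x : Plane) : ‖wt ε r x‖ = (1 + (ε * ‖x‖) ^ 2) ^ (r / 2) := by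
  rw [wt, Complex.norm_real, Real.norm_of_nonneg (by positivity)]

theorem hasTemperateGrowth_wt_real (ε r : ℝ) :
    (fun x : Plane => (1 + (ε * ‖x‖) ^ 2) ^ (r / 2)).HasTemperateGrowth := by
  have h := (Function.hasTemperateGrowth_one_add_norm_sq_rpow Plane (r / 2)).comp
    (ε • ContinuousLinearMap.id ℝ Plane).hasTemperateGrowth
  have he : (fun x : Plane => (1 + (ε * ‖x‖) ^ 2) ^ (r / 2)) =
      (fun x : Plane => (1 + ‖x‖ ^ 2) ^ (r / 2)) ∘ (ε • ContinuousLinearMap.id ℝ Plane) := by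
    ext x
    simp [norm_smul, mul_pow]
  rw [he]
  exact h

@[fun_prop]
theorem hasTemperateGrowth_wt (ε r : ℝ) : (wt ε r).HasTemperateGrowth :=
  Function.Complex.hasTemperateGrowth_ofReal.comp (hasTemperateGrowth_wt_real ε r)

theorem wt_neg_arg (ε r : ℝ) (x : Plane) : wt ε r (-x) = wt ε r x := by simp [wt]

theorem wt_mul_wt (ε r r' : ℝ) : wt ε r * wt ε r' = wt ε (r + r') := by
  ext x
  simp only [Pi.mul_apply, wt, ← Complex.ofReal_mul]
  rw [← Real.rpow_add (one_add_sq_pos ε x), add_div]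

theorem wt_zero (ε : ℝ) : wt ε 0 = fun _ => 1 := by ext x; simp [wt]

/-- For either sign of `p` one of the two inequalities is monotonicity and the other pays the factor
`l ^ |p|`; stating both removes the case distinction from the comparison of weights. -/
theorem rpow_le_of_comparable {A B l : ℝ} (hA : 0 < A) (hAB : A ≤ B) (hl : 1 ≤ l) (hBA : B ≤ l * A)
    (p : ℝ) : A ^ p ≤ l ^ |p| * B ^ p ∧ B ^ p ≤ l ^ |p| * A ^ p := by
  have hB : 0 < B := hA.trans_le hAB
  have hl0 : 0 < l := by linarith
  have h1 : (1 : ℝ) ≤ l ^ |p| := Real.one_le_rpow hl (abs_nonneg p)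
  rcases le_total 0 p with hp | hp
  · rw [abs_of_nonneg hp] at *
    refine ⟨(Real.rpow_le_rpow hA.le hAB hp).trans (le_mul_of_one_le_left (by positivity) h1), ?_⟩
    rw [← Real.mul_rpow hl0.le hA.le]
    exact Real.rpow_le_rpow hB.le hBA hp
  · rw [abs_of_nonpos hp] at *
    refine ⟨?_, (Real.rpow_le_rpow_of_nonpos hA hAB hp).trans
      (le_mul_of_one_le_left (by positivity) h1)⟩
    have h2 : (l * A) ^ p ≤ B ^ p := Real.rpow_le_rpow_of_nonpos hB hBA hp
    rw [Real.mul_rpow hl0.le hA.le] at h2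
    calc A ^ p = l ^ (-p) * (l ^ p * A ^ p) := by
          rw [← mul_assoc, ← Real.rpow_add hl0]; simp
      _ ≤ l ^ (-p) * B ^ p := by gcongr

/-- Weights with different scaling parameters are comparable. -/
theorem exists_wt_le {ε δ : ℝ} (hε : 0 < ε) (hδ : 0 < δ) (r : ℝ) :
    ∃ C : ℝ, 0 < C ∧ ∀ x, ‖wt ε r x‖ ≤ C * ‖wt δ r x‖ := by
  wlog h : ε ≤ δ generalizing ε δ with H
  · push Not at h
    refine ⟨(ε ^ 2 / δ ^ 2) ^ |r / 2|, by positivity, fun x => ?_⟩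
    simp only [norm_wt]
    refine (rpow_le_of_comparable (one_add_sq_pos δ x) (by gcongr) ?_ ?_ (r / 2)).2
    · rw [le_div_iff₀ (by positivity)]; nlinarith
    · rw [mul_add, mul_one]
      have : 1 ≤ ε ^ 2 / δ ^ 2 := by rw [le_div_iff₀ (by positivity)]; nlinarith
      have h2 : ε ^ 2 / δ ^ 2 * (δ * ‖x‖) ^ 2 = (ε * ‖x‖) ^ 2 := by field_simp
      linarith
  · refine ⟨(δ ^ 2 / ε ^ 2) ^ |r / 2|, by positivity, fun x => ?_⟩
    simp only [norm_wt]
    refine (rpow_le_of_comparable (one_add_sq_pos ε x) (by gcongr) ?_ ?_ (r / 2)).1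
    · rw [le_div_iff₀ (by positivity)]; nlinarith
    · rw [mul_add, mul_one]
      have : 1 ≤ δ ^ 2 / ε ^ 2 := by rw [le_div_iff₀ (by positivity)]; nlinarith
      have h2 : δ ^ 2 / ε ^ 2 * (ε * ‖x‖) ^ 2 = (δ * ‖x‖) ^ 2 := by field_simp
      linarith

/-! ### Derivatives -/

/-- The standard basis vectors of the plane. -/
abbrev ei (j : Fin 2) : Plane := EuclideanSpace.single j 1

/-- The coordinate functions. -/
def coord (j : Fin 2) (x : Plane) : ℂ := ((x j : ℝ) : ℂ)

theorem coord_eq_inner (j : Fin 2) : coord j = fun x : Plane => ((inner ℝ x (ei j) : ℝ) : ℂ) := by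
  ext x
  simp [coord, EuclideanSpace.inner_single_right]

@[fun_prop]
theorem hasTemperateGrowth_coord (j : Fin 2) : (coord j).HasTemperateGrowth := by
  rw [coord_eq_inner]
  exact Function.Complex.hasTemperateGrowth_ofReal.comp (Function.hasTemperateGrowth_inner_left (ei j))

theorem abs_coord_le (x : Plane) (j : Fin 2) : |x j| ≤ ‖x‖ := by
  simpa using PiLp.norm_apply_le x j

theorem norm_sq_eq (x : Plane) : ‖x‖ ^ 2 = x 0 ^ 2 + x 1 ^ 2 := by
  simp [EuclideanSpace.norm_sq_eq]

/-- The constant `2πi`. -/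
def tpi : ℂ := 2 * Real.pi * Complex.I

theorem tpi_ne_zero : tpi ≠ 0 := by simp [tpi, Real.pi_ne_zero, Complex.I_ne_zero]

theorem one_le_norm_tpi : 1 ≤ ‖tpi‖ := by
  simp only [tpi, norm_mul, Complex.norm_I, mul_one, Complex.norm_ofNat, Complex.norm_real,
    Real.norm_of_nonneg Real.pi_pos.le]
  linarith [Real.pi_gt_three]

/-- With the kernel `exp(-2πi x·ξ)` the multiplier with symbol `ξ_j` is `X_j = (2πi)⁻¹ ∂_j`. The
commutators below are computed with `X_j`. -/
theorem lineDeriv_eq_Fm (j : Fin 2) (u : 𝓢(Plane, ℂ)) : ∂_{ei j} u = tpi • Fm (coord j) u := by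
  rw [SchwartzMap.lineDeriv_eq_fourierMultiplierCLM, coord_eq_inner,
    ← SchwartzMap.fourierMultiplierCLM_ofReal ℂ (Function.hasTemperateGrowth_inner_left (ei j))]
  rfl

/-- Leibniz' rule for `X_j = (2πi)⁻¹ ∂_j`. -/
theorem Fm_coord_Sm {a a' : Plane → ℂ} (ha : a.HasTemperateGrowth) (ha' : a'.HasTemperateGrowth)
    (j : Fin 2) (h : ∀ x, fderiv ℝ a x (ei j) = tpi * a' x) (u : 𝓢(Plane, ℂ)) :
    Fm (coord j) (Sm a u) = Sm a (Fm (coord j) u) + Sm a' u := by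
  have key : ∂_{ei j} (Sm a u) = Sm a (∂_{ei j} u) + tpi • Sm a' u := by
    ext x
    rw [SchwartzMap.lineDerivOp_apply_eq_fderiv]
    have hfun : ((Sm a u : 𝓢(Plane, ℂ)) : Plane → ℂ) = fun x => a x * u x := by
      ext y; rw [SchwartzMap.smulLeftCLM_apply_apply ha, smul_eq_mul]
    rw [hfun, fderiv_fun_mul (ha.1.differentiable (by simp) x) (u.differentiable x)]
    simp only [add_apply, smul_apply, h, smul_eq_mul,
      SchwartzMap.smulLeftCLM_apply_apply ha,
      SchwartzMap.smulLeftCLM_apply_apply ha', SchwartzMap.lineDerivOp_apply_eq_fderiv]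
    ring
  rw [lineDeriv_eq_Fm, lineDeriv_eq_Fm, map_smul, ← smul_add] at key
  exact smul_right_injective _ tpi_ne_zero key

/-- The derivative of `(1 + |εx|²)^p`. -/
theorem hasFDerivAt_wt (ε r : ℝ) (x : Plane) (j : Fin 2) :
    fderiv ℝ (wt ε r) x (ei j) = r * ε ^ 2 * coord j x * wt ε (r - 2) x := by
  have h1 : HasFDerivAt (fun y : Plane => 1 + (ε * ‖y‖) ^ 2)
      (ε ^ 2 • (2 • (innerSL ℝ x))) x := by
    have := (((hasStrictFDerivAt_norm_sq x).hasFDerivAt).const_smul (ε ^ 2)).const_add 1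
    refine this.congr_of_eventuallyEq (Eventually.of_forall fun y => ?_)
    simp [mul_pow]
  have h2 := h1.rpow_const (p := r / 2) (Or.inl (one_add_sq_pos ε x).ne')
  have h3 : HasFDerivAt (wt ε r) _ x := Complex.ofRealCLM.hasFDerivAt.comp x h2
  rw [h3.fderiv]
  simp only [ContinuousLinearMap.comp_apply, smul_apply, wt, coord,
    Complex.ofRealCLM_apply]
  have : (r - 2) / 2 = r / 2 - 1 := by ring
  rw [this]
  simp [EuclideanSpace.inner_single_right]
  ring

/-! ### Resolvents of `1 + |D|²` -/

/-- The symbol of the resolvent `(t + 1 + |D|²)⁻¹`. -/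
def resSymb (t : ℝ) (ξ : Plane) : ℂ := (((t + (1 + ‖ξ‖ ^ 2))⁻¹ : ℝ) : ℂ)

/-- As a rescaled weight of order -2 the symbol inherits temperate growth from the weights. -/
theorem resSymb_eq {t : ℝ} (ht : 0 ≤ t) :
    resSymb t = fun ξ => ((1 + t : ℝ) : ℂ)⁻¹ * wt (Real.sqrt (1 + t))⁻¹ (-2) ξ := by
  ext ξ
  have h : (0 : ℝ) < 1 + t := by linarith
  simp only [resSymb, wt, ← Complex.ofReal_inv, ← Complex.ofReal_mul]
  congr 1
  rw [show (-2 / 2 : ℝ) = -1 by norm_num, Real.rpow_neg_one, mul_pow, inv_pow, Real.sq_sqrt h.le,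
    ← mul_inv]
  congr 1
  field_simp
  ring

theorem hasTemperateGrowth_resSymb {t : ℝ} (ht : 0 ≤ t) : (resSymb t).HasTemperateGrowth := by
  rw [resSymb_eq ht]
  fun_prop

theorem norm_resSymb {t : ℝ} (ht : 0 ≤ t) (ξ : Plane) : ‖resSymb t ξ‖ = (t + (1 + ‖ξ‖ ^ 2))⁻¹ := by
  rw [resSymb, Complex.norm_real, Real.norm_of_nonneg (by positivity)]

theorem wt_one_two (ξ : Plane) : wt 1 2 ξ = ((1 + ‖ξ‖ ^ 2 : ℝ) : ℂ) := by
  simp [wt]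

/-- In the form `1 + ∑ X_j²` the operator is open to Leibniz' rule. -/
theorem Fm_wt_one_two (u : 𝓢(Plane, ℂ)) :
    Fm (wt 1 2) u = u + ∑ j, Fm (coord j) (Fm (coord j) u) := by
  have h : (wt 1 2 : Plane → ℂ) =
      fun ξ => (fun _ => (1 : ℂ)) ξ + ∑ j, (coord j * coord j) ξ := by
    ext ξ
    rw [wt_one_two, norm_sq_eq]
    simp [coord, sq]
  have h1 : ∀ j ∈ (Finset.univ : Finset (Fin 2)), (coord j * coord j).HasTemperateGrowth :=
    fun j _ => by fun_prop
  have h3 : (∑ j, (coord j * coord j) : Plane → ℂ).HasTemperateGrowth := by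
    rw [Fin.sum_univ_two]; fun_prop
  have h2 : Fm (wt 1 2) = Fm (fun _ => (1 : ℂ)) + ∑ j, Fm (coord j * coord j) := by
    rw [← SchwartzMap.fourierMultiplierCLM_sum ℂ h1, h]
    ext1 f
    simp only [SchwartzMap.fourierMultiplierCLM_apply, add_apply]
    rw [← FourierTransform.fourierInv_add]
    congr 1
    have : (fun ξ : Plane => (1 : ℂ) + ∑ j, (coord j * coord j) ξ) =
      (fun _ => (1 : ℂ)) + (fun ξ => ∑ j, (coord j * coord j) ξ) := rfl
    rw [this, SchwartzMap.smulLeftCLM_add (by fun_prop) (by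
      simpa [Fin.sum_univ_two] using (by fun_prop))]
    rfl
  rw [h2]
  simp [SchwartzMap.fourierMultiplierCLM_fourierMultiplierCLM_apply, hasTemperateGrowth_coord]

theorem resolvent_apply {t : ℝ} (ht : 0 ≤ t) (u : 𝓢(Plane, ℂ)) :
    Fm (resSymb t) (((t : ℝ) : ℂ) • u + Fm (wt 1 2) u) = u := by
  have h1 : ((t : ℝ) : ℂ) • u = Fm (fun _ => ((t : ℝ) : ℂ)) u := by simp
  have h2 : Fm (fun _ => ((t : ℝ) : ℂ)) u + Fm (wt 1 2) u =
      Fm ((fun _ => ((t : ℝ) : ℂ)) + wt 1 2) u := by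
    simp only [SchwartzMap.fourierMultiplierCLM_apply]
    rw [SchwartzMap.smulLeftCLM_add (by fun_prop) (by fun_prop), ← FourierTransform.fourierInv_add]
    rfl
  rw [h1, h2, SchwartzMap.fourierMultiplierCLM_fourierMultiplierCLM_apply
    (hasTemperateGrowth_resSymb ht) (by fun_prop)]
  have h3 : resSymb t * ((fun _ => ((t : ℝ) : ℂ)) + wt 1 2) = fun _ => (1 : ℂ) := by
    ext ξ
    simp only [Pi.mul_apply, Pi.add_apply, wt_one_two, resSymb, ← Complex.ofReal_add,
      ← Complex.ofReal_mul]
    rw [inv_mul_cancel₀ (by positivity)]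
    simp
  rw [h3]
  simp

theorem resolvent_apply' {t : ℝ} (ht : 0 ≤ t) (u : 𝓢(Plane, ℂ)) :
    ((t : ℝ) : ℂ) • Fm (resSymb t) u + Fm (wt 1 2) (Fm (resSymb t) u) = u := by
  have h := resolvent_apply ht u
  rw [map_add, map_smul] at h
  rw [SchwartzMap.fourierMultiplierCLM_fourierMultiplierCLM_apply (by fun_prop)
    (hasTemperateGrowth_resSymb ht), mul_comm,
    ← SchwartzMap.fourierMultiplierCLM_fourierMultiplierCLM_apply
    (hasTemperateGrowth_resSymb ht) (by fun_prop)]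
  exact h

theorem Fm_comm {g h : Plane → ℂ} (hg : g.HasTemperateGrowth) (hh : h.HasTemperateGrowth)
    (u : 𝓢(Plane, ℂ)) : Fm g (Fm h u) = Fm h (Fm g u) := by
  rw [SchwartzMap.fourierMultiplierCLM_fourierMultiplierCLM_apply hg hh, mul_comm,
    ← SchwartzMap.fourierMultiplierCLM_fourierMultiplierCLM_apply hh hg]

theorem Sm_comm {g h : Plane → ℂ} (hg : g.HasTemperateGrowth) (hh : h.HasTemperateGrowth)
    (u : 𝓢(Plane, ℂ)) : Sm g (Sm h u) = Sm h (Sm g u) := by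
  rw [SchwartzMap.smulLeftCLM_smulLeftCLM_apply hg hh, mul_comm,
    ← SchwartzMap.smulLeftCLM_smulLeftCLM_apply hh hg]

theorem l2_resolvent_le {t : ℝ} (ht : 0 ≤ t) (u : 𝓢(Plane, ℂ)) :
    l2 (Fm (resSymb t) u) ≤ (1 + t)⁻¹ * l2 u := by
  refine l2_Fm_le (hasTemperateGrowth_resSymb ht) (fun ξ => ?_) u
  rw [norm_resSymb ht]
  gcongr ?_⁻¹
  nlinarith [sq_nonneg ‖ξ‖]

theorem inv_le_inv_sqrt {t : ℝ} (ht : 0 ≤ t) : (1 + t)⁻¹ ≤ (Real.sqrt (1 + t))⁻¹ := by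
  gcongr
  rw [Real.sqrt_le_left (by linarith)]
  nlinarith

/-- With `m = t + 1 + q²` both `y` and `√(1 + t)` are at most `√m`. So a factor of first order costs
the resolvent half of its decay in `t`. -/
theorem norm_mul_le_aux {t : ℝ} (ht : 0 ≤ t) {y q : ℝ}
    (hy : y ^ 2 ≤ t + (1 + q ^ 2)) :
    y * (t + (1 + q ^ 2))⁻¹ ≤ (Real.sqrt (1 + t))⁻¹ := by
  have h1 : 0 < t + (1 + q ^ 2) := by positivity
  set m := t + (1 + q ^ 2)
  have h2 : y ≤ Real.sqrt m := Real.le_sqrt_of_sq_le hy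
  have h3 : Real.sqrt (1 + t) ≤ Real.sqrt m := Real.sqrt_le_sqrt (by simp only [m]; nlinarith)
  have h4 : 0 < Real.sqrt (1 + t) := Real.sqrt_pos.2 (by linarith)
  rw [← div_eq_mul_inv, div_le_iff₀ h1, inv_mul_eq_div, le_div_iff₀ h4]
  calc y * Real.sqrt (1 + t) ≤ Real.sqrt m * Real.sqrt m := by gcongr
    _ = m := Real.mul_self_sqrt h1.le

theorem l2_resolvent_coord_le {t : ℝ} (ht : 0 ≤ t) (j : Fin 2) (u : 𝓢(Plane, ℂ)) :
    l2 (Fm (resSymb t) (Fm (coord j) u)) ≤ (Real.sqrt (1 + t))⁻¹ * l2 u := by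
  have hR := hasTemperateGrowth_resSymb ht
  rw [SchwartzMap.fourierMultiplierCLM_fourierMultiplierCLM_apply hR (by fun_prop)]
  refine l2_Fm_le (by fun_prop) (fun ξ => ?_) u
  rw [Pi.mul_apply, norm_mul, norm_resSymb ht, mul_comm, coord, Complex.norm_real,
    Real.norm_eq_abs]
  refine norm_mul_le_aux ht ?_
  have := abs_coord_le ξ j
  nlinarith [abs_nonneg (ξ j), norm_nonneg ξ]

/-! ### The `H¹` norm and its resolvent estimates -/

/-- The norm of `H¹`. -/
def h1 (u : 𝓢(Plane, ℂ)) : ℝ := l2 (Fm (wt 1 1) u)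

theorem h1_nonneg (u : 𝓢(Plane, ℂ)) : 0 ≤ h1 u := l2_nonneg _

theorem h1_resolvent_le {t : ℝ} (ht : 0 ≤ t) (u : 𝓢(Plane, ℂ)) :
    h1 (Fm (resSymb t) u) ≤ (Real.sqrt (1 + t))⁻¹ * l2 u := by
  have hR := hasTemperateGrowth_resSymb ht
  rw [h1, SchwartzMap.fourierMultiplierCLM_fourierMultiplierCLM_apply (by fun_prop) hR]
  refine l2_Fm_le (by fun_prop) (fun ξ => ?_) u
  rw [Pi.mul_apply, norm_mul, norm_resSymb ht, norm_wt]
  refine norm_mul_le_aux ht ?_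
  rw [← Real.rpow_natCast, ← Real.rpow_mul (by positivity)]
  norm_num
  exact ht

theorem h1_resolvent_le' {t : ℝ} (ht : 0 ≤ t) (u : 𝓢(Plane, ℂ)) :
    h1 (Fm (resSymb t) u) ≤ (1 + t)⁻¹ * h1 u := by
  rw [h1, Fm_comm (by fun_prop) (hasTemperateGrowth_resSymb ht)]
  exact l2_resolvent_le ht _

theorem one_le_norm_wt {ε s : ℝ} (hs : 0 ≤ s) (ξ : Plane) : 1 ≤ ‖wt ε s ξ‖ := by
  rw [norm_wt]
  exact Real.one_le_rpow (by nlinarith [sq_nonneg (ε * ‖ξ‖)]) (by positivity)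

theorem l2_le_l2_Fm_wt {s : ℝ} (hs : 0 ≤ s) (u : 𝓢(Plane, ℂ)) : l2 u ≤ l2 (Fm (wt 1 s) u) := by
  have h := l2_Fm_le_l2_Fm (g := fun _ => (1 : ℂ)) (h := wt 1 s) (by fun_prop) (by fun_prop)
    zero_le_one (fun x => by simpa using one_le_norm_wt hs x) u
  simpa using h

theorem l2_coord_le_h1 (j : Fin 2) (u : 𝓢(Plane, ℂ)) : l2 (Fm (coord j) u) ≤ h1 u := by
  have h := l2_Fm_le_l2_Fm (g := coord j) (h := wt 1 1) (by fun_prop) (by fun_prop)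
    zero_le_one (fun x => ?_) u
  · simpa [h1] using h
  · rw [norm_wt, coord, Complex.norm_real, Real.norm_eq_abs, one_mul, one_mul,
      ← Real.sqrt_eq_rpow]
    refine Real.le_sqrt_of_sq_le ?_
    have := abs_coord_le x j
    nlinarith [abs_nonneg (x j), norm_nonneg x]

/-- `D_1 = D_{-1} (1 + ∑ X_j²)`, and the symbols of `D_{-1}` and `D_{-1} X_j` are bounded by one. -/
theorem h1_le (u : 𝓢(Plane, ℂ)) : h1 u ≤ l2 u + ∑ j, l2 (Fm (coord j) u) := by
  have e : Fm (wt 1 1) u = Fm (wt 1 (-1)) (Fm (wt 1 2) u) := by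
    rw [SchwartzMap.fourierMultiplierCLM_fourierMultiplierCLM_apply (by fun_prop) (by fun_prop),
      wt_mul_wt]
    norm_num
  rw [h1, e, Fm_wt_one_two, map_add, map_sum]
  refine (l2_add_le _ _).trans (add_le_add ?_ ((l2_sum_le _ _).trans ?_))
  · refine (l2_Fm_le (C := 1) (by fun_prop) (fun ξ => ?_) u).trans (by simp)
    rw [norm_wt]
    exact Real.rpow_le_one_of_one_le_of_nonpos (by nlinarith [sq_nonneg (1 * ‖ξ‖)]) (by norm_num)
  · refine Finset.sum_le_sum fun j _ => ?_
    rw [SchwartzMap.fourierMultiplierCLM_fourierMultiplierCLM_apply (by fun_prop) (by fun_prop)]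
    refine (l2_Fm_le (C := 1) (by fun_prop) (fun ξ => ?_) _).trans (by simp)
    rw [Pi.mul_apply, norm_mul, norm_wt, coord, Complex.norm_real, Real.norm_eq_abs,
      show (-1 / 2 : ℝ) = -(1 / 2) by norm_num, Real.rpow_neg (by positivity), inv_mul_eq_div,
      div_le_one (by positivity), one_mul, ← Real.sqrt_eq_rpow]
    refine Real.le_sqrt_of_sq_le ?_
    have := abs_coord_le ξ j
    nlinarith [abs_nonneg (ξ j), norm_nonneg ξ]

/-! ### Commutators of weights with resolvents -/

/-- A weight whose logarithmic derivatives `b j`, and the derivatives `c j` of these, are bounded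
by `K`. -/
structure SlowWeight (K : ℝ) where
  /-- the weight -/
  ρ : Plane → ℂ
  /-- the logarithmic derivatives -/
  b : Fin 2 → Plane → ℂ
  /-- their derivatives -/
  c : Fin 2 → Plane → ℂ
  ρ_temperate : ρ.HasTemperateGrowth
  b_temperate : ∀ j, (b j).HasTemperateGrowth
  c_temperate : ∀ j, (c j).HasTemperateGrowth
  norm_b_le : ∀ j x, ‖b j x‖ ≤ K
  norm_c_le : ∀ j x, ‖c j x‖ ≤ K
  fderiv_ρ : ∀ j x, fderiv ℝ ρ x (ei j) = tpi * (b j x * ρ x)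
  fderiv_b : ∀ j x, fderiv ℝ (b j) x (ei j) = tpi * c j x

namespace SlowWeight

variable {K : ℝ}

theorem K_nonneg (w : SlowWeight K) : 0 ≤ K := (norm_nonneg _).trans (w.norm_b_le 0 0)

theorem coord_ρ (w : SlowWeight K) (j : Fin 2) (v : 𝓢(Plane, ℂ)) :
    Fm (coord j) (Sm w.ρ v) = Sm w.ρ (Fm (coord j) v) + Sm (w.b j) (Sm w.ρ v) := by
  rw [SchwartzMap.smulLeftCLM_smulLeftCLM_apply (w.b_temperate j) w.ρ_temperate]
  exact Fm_coord_Sm w.ρ_temperate ((w.b_temperate j).mul w.ρ_temperate) j (w.fderiv_ρ j) v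

theorem coord_b (w : SlowWeight K) (j : Fin 2) (v : 𝓢(Plane, ℂ)) :
    Fm (coord j) (Sm (w.b j) v) = Sm (w.b j) (Fm (coord j) v) + Sm (w.c j) v :=
  Fm_coord_Sm (w.b_temperate j) (w.c_temperate j) j (w.fderiv_b j) v

/-- The first order operator `P` with `[1 + |D|², ρ] = P ρ`. -/
def P (w : SlowWeight K) (v : 𝓢(Plane, ℂ)) : 𝓢(Plane, ℂ) :=
  ∑ j, (Fm (coord j) (Sm (w.b j) v) + Fm (coord j) (Sm (w.b j) v) - Sm (w.c j) v -
    Sm (w.b j) (Sm (w.b j) v))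

/-- Leibniz twice: `X_j² ρ = ρ X_j² + (2 X_j b_j - c_j - b_j²) ρ`. The error acts on `ρ v`, not on
`v`, and has `X_j` on the left, next to where the resolvent will stand. -/
theorem commutator (w : SlowWeight K) (v : 𝓢(Plane, ℂ)) :
    Fm (wt 1 2) (Sm w.ρ v) = Sm w.ρ (Fm (wt 1 2) v) + w.P (Sm w.ρ v) := by
  have key : ∀ j, Fm (coord j) (Fm (coord j) (Sm w.ρ v)) = Sm w.ρ (Fm (coord j) (Fm (coord j) v)) +
      (Fm (coord j) (Sm (w.b j) (Sm w.ρ v)) + Fm (coord j) (Sm (w.b j) (Sm w.ρ v)) -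
        Sm (w.c j) (Sm w.ρ v) - Sm (w.b j) (Sm (w.b j) (Sm w.ρ v))) := by
    intro j
    have e1 := w.coord_ρ j v
    have e2 := w.coord_ρ j (Fm (coord j) v)
    have e3 := w.coord_b j (Sm w.ρ v)
    have e4 : Sm w.ρ (Fm (coord j) v) = Fm (coord j) (Sm w.ρ v) - Sm (w.b j) (Sm w.ρ v) := by
      rw [e1]; abel
    conv_lhs => rw [e1, map_add, e2, e4, map_sub]
    have e5 : Sm (w.b j) (Fm (coord j) (Sm w.ρ v)) =
        Fm (coord j) (Sm (w.b j) (Sm w.ρ v)) - Sm (w.c j) (Sm w.ρ v) := by rw [e3]; abel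
    rw [e5]
    abel
  rw [Fm_wt_one_two, Fm_wt_one_two, P, map_add, map_sum, Finset.sum_congr rfl fun j _ => key j,
    Finset.sum_add_distrib]
  abel

/-- The size of the operator `P`. -/
def kap (K : ℝ) : ℝ := 2 * (3 * K + K ^ 2)

theorem kap_nonneg (w : SlowWeight K) : 0 ≤ kap K := by
  have := w.K_nonneg
  unfold kap; positivity

theorem l2_b_le (w : SlowWeight K) (j : Fin 2) (v : 𝓢(Plane, ℂ)) : l2 (Sm (w.b j) v) ≤ K * l2 v :=
  l2_Sm_le (w.b_temperate j) (w.norm_b_le j) v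

theorem l2_c_le (w : SlowWeight K) (j : Fin 2) (v : 𝓢(Plane, ℂ)) : l2 (Sm (w.c j) v) ≤ K * l2 v :=
  l2_Sm_le (w.c_temperate j) (w.norm_c_le j) v

theorem l2_bb_le (w : SlowWeight K) (j : Fin 2) (v : 𝓢(Plane, ℂ)) : l2 (Sm (w.b j) (Sm (w.b j) v)) ≤ K ^ 2 * l2 v := by
  refine (w.l2_b_le j _).trans ?_
  rw [sq, mul_assoc]
  exact mul_le_mul_of_nonneg_left (w.l2_b_le j v) w.K_nonneg

/-- The outer `X_j` is absorbed by the resolvent at the price of half of its decay; the terms of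
order zero decay faster. -/
theorem l2_resolvent_P_le (w : SlowWeight K) {t : ℝ} (ht : 0 ≤ t) (v : 𝓢(Plane, ℂ)) :
    l2 (Fm (resSymb t) (w.P v)) ≤ kap K * (Real.sqrt (1 + t))⁻¹ * l2 v := by
  set q := (Real.sqrt (1 + t))⁻¹
  have hq : 0 ≤ q := by positivity
  have hK := w.K_nonneg
  rw [P, map_sum]
  refine (l2_sum_le _ _).trans ?_
  have hj : ∀ j, l2 (Fm (resSymb t) (Fm (coord j) (Sm (w.b j) v) + Fm (coord j) (Sm (w.b j) v) -
      Sm (w.c j) v - Sm (w.b j) (Sm (w.b j) v))) ≤ (3 * K + K ^ 2) * q * l2 v := by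
    intro j
    rw [map_sub, map_sub, map_add]
    have e1 : l2 (Fm (resSymb t) (Fm (coord j) (Sm (w.b j) v))) ≤ q * (K * l2 v) :=
      (l2_resolvent_coord_le ht j _).trans (mul_le_mul_of_nonneg_left (w.l2_b_le j v) hq)
    have e0 : ∀ u, l2 (Fm (resSymb t) u) ≤ q * l2 u := fun u =>
      (l2_resolvent_le ht u).trans
        (mul_le_mul_of_nonneg_right (inv_le_inv_sqrt ht) (l2_nonneg _))
    have e2 := (e0 (Sm (w.c j) v)).trans (mul_le_mul_of_nonneg_left (w.l2_c_le j v) hq)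
    have e3 := (e0 (Sm (w.b j) (Sm (w.b j) v))).trans
      (mul_le_mul_of_nonneg_left (w.l2_bb_le j v) hq)
    refine (l2_sub_le _ _).trans ((add_le_add ((l2_sub_le _ _).trans (add_le_add
      ((l2_add_le _ _).trans (add_le_add e1 e1)) e2)) e3).trans (le_of_eq ?_))
    ring
  refine (Finset.sum_le_sum fun j _ => hj j).trans (le_of_eq ?_)
  simp [kap]
  ring

/-- Here `X_j` is moved onto `v` instead, which leaves the full decay of the resolvent available but
costs an `H¹` norm. -/
theorem l2_P_le (w : SlowWeight K) (v : 𝓢(Plane, ℂ)) : l2 (w.P v) ≤ kap K * h1 v := by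
  have hK := w.K_nonneg
  have h0 : l2 v ≤ h1 v := l2_le_l2_Fm_wt zero_le_one v
  refine (l2_sum_le _ _).trans ?_
  have hj : ∀ j, l2 (Fm (coord j) (Sm (w.b j) v) + Fm (coord j) (Sm (w.b j) v) -
      Sm (w.c j) v - Sm (w.b j) (Sm (w.b j) v)) ≤ (3 * K + K ^ 2) * h1 v := by
    intro j
    have e : Fm (coord j) (Sm (w.b j) v) + Fm (coord j) (Sm (w.b j) v) -
      Sm (w.c j) v - Sm (w.b j) (Sm (w.b j) v) = Sm (w.b j) (Fm (coord j) v) +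
      Sm (w.b j) (Fm (coord j) v) + Sm (w.c j) v - Sm (w.b j) (Sm (w.b j) v) := by
      rw [w.coord_b]; abel
    rw [e]
    have e1 : l2 (Sm (w.b j) (Fm (coord j) v)) ≤ K * h1 v :=
      (w.l2_b_le j _).trans (mul_le_mul_of_nonneg_left (l2_coord_le_h1 j v) hK)
    have e2 := (w.l2_c_le j v).trans (mul_le_mul_of_nonneg_left h0 hK)
    have e3 := (w.l2_bb_le j v).trans (mul_le_mul_of_nonneg_left h0 (sq_nonneg K))
    refine (l2_sub_le _ _).trans ((add_le_add ((l2_add_le _ _).trans (add_le_add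
      ((l2_add_le _ _).trans (add_le_add e1 e1)) e2)) e3).trans (le_of_eq ?_))
    ring
  refine (Finset.sum_le_sum fun j _ => hj j).trans (le_of_eq ?_)
  simp [kap]
  ring

/-- With `R = (t + 1 + |D|²)⁻¹`, the commutator formula reads `(t + 1 + |D|²) ρ R u = ρ u + P ρ R
u`; apply `R`. -/
theorem resolvent_identity (w : SlowWeight K) {t : ℝ} (ht : 0 ≤ t) (u : 𝓢(Plane, ℂ)) :
    Sm w.ρ (Fm (resSymb t) u) =
      Fm (resSymb t) (Sm w.ρ u) + Fm (resSymb t) (w.P (Sm w.ρ (Fm (resSymb t) u))) := by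
  rw [← map_add]
  have h := resolvent_apply ht (Sm w.ρ (Fm (resSymb t) u))
  rw [w.commutator, ← add_assoc, ← map_smul, ← map_add, resolvent_apply' ht] at h
  exact h.symm

/-- The error term in the resolvent identity is at most half of the left side and is absorbed. This
is where slowness of the weight enters. -/
theorem l2_ρ_resolvent_le (w : SlowWeight K) (hK : kap K ≤ 1 / 2) {t : ℝ} (ht : 0 ≤ t) (u : 𝓢(Plane, ℂ)) :
    l2 (Sm w.ρ (Fm (resSymb t) u)) ≤ 2 * (1 + t)⁻¹ * l2 (Sm w.ρ u) := by
  set v := Sm w.ρ (Fm (resSymb t) u)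
  have h1 : l2 v ≤ _ := (congrArg l2 (w.resolvent_identity ht u)).le.trans (l2_add_le _ _)
  have h2 := l2_resolvent_le ht (Sm w.ρ u)
  have h3 := w.l2_resolvent_P_le ht v
  have h4 : (Real.sqrt (1 + t))⁻¹ ≤ 1 := inv_le_one_of_one_le₀ (Real.one_le_sqrt.2 (by linarith))
  have h5 : kap K * (Real.sqrt (1 + t))⁻¹ * l2 v ≤ 1 / 2 * 1 * l2 v := by
    gcongr
    exact l2_nonneg _
  linarith

/-- Together with the decay of `ρ R u` this gives commutators of size `(1 + t)^{-3/2}`. No smallness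
of `K` is required here. -/
theorem l2_commutator_resolvent_le (w : SlowWeight K) {t : ℝ} (ht : 0 ≤ t) (u : 𝓢(Plane, ℂ)) :
    l2 (Sm w.ρ (Fm (resSymb t) u) - Fm (resSymb t) (Sm w.ρ u)) ≤
      kap K * (Real.sqrt (1 + t))⁻¹ * l2 (Sm w.ρ (Fm (resSymb t) u)) := by
  have h : Sm w.ρ (Fm (resSymb t) u) - Fm (resSymb t) (Sm w.ρ u) =
      Fm (resSymb t) (w.P (Sm w.ρ (Fm (resSymb t) u))) := by
    rw [sub_eq_iff_eq_add, add_comm]; exact w.resolvent_identity ht u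
  rw [h]
  exact w.l2_resolvent_P_le ht _

/-- Decay `(1 + t)⁻²` at the cost of an `H¹` norm. It serves the case `s = 1`, where `(1 +
t)^{-3/2}` is not integrable against `t^{1/2}`. -/
theorem l2_commutator_resolvent_le_h1 (w : SlowWeight K) (hK : kap K ≤ 1 / 2) {t : ℝ} (ht : 0 ≤ t)
    (u : 𝓢(Plane, ℂ)) :
    l2 (Sm w.ρ (Fm (resSymb t) u) - Fm (resSymb t) (Sm w.ρ u)) ≤
      2 * kap K * ((1 + t)⁻¹) ^ 2 * h1 (Sm w.ρ u) := by
  set v := Sm w.ρ (Fm (resSymb t) u) with hv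
  have h : v - Fm (resSymb t) (Sm w.ρ u) = Fm (resSymb t) (w.P v) := by
    rw [sub_eq_iff_eq_add, add_comm]; exact w.resolvent_identity ht u
  have hk := w.kap_nonneg
  have h2 : h1 v ≤ (1 + t)⁻¹ * h1 (Sm w.ρ u) + 1 * (1 / 2 * h1 v) := by
    have e : h1 v ≤ h1 (Fm (resSymb t) (Sm w.ρ u)) + h1 (Fm (resSymb t) (w.P v)) := by
      refine (congrArg h1 (w.resolvent_identity ht u)).le.trans ?_
      rw [h1, map_add]
      exact l2_add_le _ _
    refine e.trans (add_le_add (h1_resolvent_le' ht _) ((h1_resolvent_le ht _).trans ?_))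
    have h4 : (Real.sqrt (1 + t))⁻¹ ≤ 1 := inv_le_one_of_one_le₀ (Real.one_le_sqrt.2 (by linarith))
    have h5 : l2 (w.P v) ≤ 1 / 2 * h1 v :=
      (w.l2_P_le v).trans (mul_le_mul_of_nonneg_right hK (h1_nonneg _))
    exact mul_le_mul h4 h5 (l2_nonneg _) zero_le_one
  have h3 : h1 v ≤ 2 * ((1 + t)⁻¹ * h1 (Sm w.ρ u)) := by linarith
  rw [h]
  calc l2 (Fm (resSymb t) (w.P v)) ≤ (1 + t)⁻¹ * (kap K * (2 * ((1 + t)⁻¹ * h1 (Sm w.ρ u)))) := by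
        refine (l2_resolvent_le ht _).trans ?_
        gcongr
        exact (w.l2_P_le v).trans (by gcongr)
    _ = _ := by ring

end SlowWeight

/-! ### Commutators of weights with fractional powers of `1 + |D|²` -/

/-- `A^σ` is a constant multiple of `∫ t^σ (t⁻¹ - (t + A)⁻¹) dt` for `0 < σ < 1`, applied with `σ =
s/2` and `A = 1 + |ξ|²`. -/
theorem wt_one_eq_integral {s : ℝ} (hs : s / 2 ∈ Set.Ioo (0 : ℝ) 1) (ξ : Plane) :
    ∫ t in Set.Ioi (0 : ℝ), Real.rpowIntegrand₀₁ (s / 2) t (1 + ‖ξ‖ ^ 2) =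
      ‖wt 1 s ξ‖ * ∫ t in Set.Ioi (0 : ℝ), Real.rpowIntegrand₀₁ (s / 2) t 1 := by
  rw [Real.integral_rpowIntegrand₀₁_eq_rpow_mul_const hs (by positivity), norm_wt, one_mul]

theorem bil_eq_fourier (h k : 𝓢(Plane, ℂ)) : bil h k = ∫ ξ, 𝓕 h ξ * 𝓕⁻ k ξ := by
  have := SchwartzMap.integral_fourierInv_mul_eq (𝓕 h) k
  rw [FourierTransform.fourierInv_fourier_eq] at this
  exact this

theorem bil_Fm_eq_fourier {g : Plane → ℂ} (hg : g.HasTemperateGrowth) (h k : 𝓢(Plane, ℂ)) :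
    bil (Fm g h) k = ∫ ξ, g ξ * (𝓕 h ξ * 𝓕⁻ k ξ) := by
  rw [bil_eq_fourier, SchwartzMap.fourierMultiplierCLM_apply,
    FourierTransform.fourier_fourierInv_eq]
  congr 1 with ξ
  rw [SchwartzMap.smulLeftCLM_apply_apply hg, smul_eq_mul, mul_assoc]

theorem bil_sub (a b c : 𝓢(Plane, ℂ)) : bil (a - b) c = bil a c - bil b c := by
  simp only [bil]
  rw [← integral_sub (integrable_mul _ _) (integrable_mul _ _)]
  congr 1 with x
  simp only [sub_apply]
  ring

theorem integrable_wt_mul (s : ℝ) (H : 𝓢(Plane, ℂ)) : Integrable (fun ξ => ‖wt 1 s ξ‖ * ‖H ξ‖) := by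
  refine (Sm (wt 1 s) H).integrable.norm.congr (Eventually.of_forall fun ξ => ?_)
  simp only [SchwartzMap.smulLeftCLM_apply_apply (hasTemperateGrowth_wt 1 s), norm_smul]

theorem measurable_rpowIntegrand (σ : ℝ) :
    Measurable (fun p : Plane × ℝ => Real.rpowIntegrand₀₁ σ p.2 (1 + ‖p.1‖ ^ 2)) := by
  unfold Real.rpowIntegrand₀₁
  fun_prop

/-- Weak form of the representation of `D_s` by resolvents. On the Fourier side it is Fubini's
theorem; the kernel is nonnegative, so the scalar formula itself gives absolute integrability. -/
theorem integral_rpowIntegrand_bil {s : ℝ} (hs : s / 2 ∈ Set.Ioo (0 : ℝ) 1) (h k : 𝓢(Plane, ℂ)) :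
    IntegrableOn (fun t : ℝ => ((t ^ (s / 2) : ℝ) : ℂ) *
      (((t⁻¹ : ℝ) : ℂ) * bil h k - bil (Fm (resSymb t) h) k)) (Set.Ioi 0) ∧
    ∫ t in Set.Ioi (0 : ℝ), ((t ^ (s / 2) : ℝ) : ℂ) *
      (((t⁻¹ : ℝ) : ℂ) * bil h k - bil (Fm (resSymb t) h) k) =
    ((∫ t in Set.Ioi (0 : ℝ), Real.rpowIntegrand₀₁ (s / 2) t 1 : ℝ) : ℂ) *
      bil (Fm (wt 1 s) h) k := by
  set I : ℝ := ∫ t in Set.Ioi (0 : ℝ), Real.rpowIntegrand₀₁ (s / 2) t 1 with hI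
  let H : 𝓢(Plane, ℂ) := Sm (𝓕 h : 𝓢(Plane, ℂ)) (𝓕⁻ k)
  have hH : ∀ ξ, H ξ = 𝓕 h ξ * 𝓕⁻ k ξ := fun ξ => by
    simp only [H, SchwartzMap.smulLeftCLM_apply_apply (𝓕 h : 𝓢(Plane, ℂ)).hasTemperateGrowth, smul_eq_mul]
  let Φ : Plane × ℝ → ℂ := fun p =>
    ((Real.rpowIntegrand₀₁ (s / 2) p.2 (1 + ‖p.1‖ ^ 2) : ℝ) : ℂ) * H p.1
  have hΦm : Measurable Φ :=
    (Complex.measurable_ofReal.comp (measurable_rpowIntegrand _)).mul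
      (H.continuous.measurable.comp measurable_fst)
  have hnn : ∀ (ξ : Plane), ∀ t ∈ Set.Ioi (0 : ℝ),
      0 ≤ Real.rpowIntegrand₀₁ (s / 2) t (1 + ‖ξ‖ ^ 2) := fun ξ t ht =>
    Real.rpowIntegrand₀₁_nonneg hs.1 (le_of_lt ht) (by positivity)
  have hint : Integrable Φ ((volume : Measure Plane).prod (volume.restrict (Set.Ioi (0 : ℝ)))) := by
    rw [integrable_prod_iff hΦm.aestronglyMeasurable]
    constructor
    · refine Eventually.of_forall fun ξ => ?_
      have h0 : IntegrableOn (fun t => Real.rpowIntegrand₀₁ (s / 2) t (1 + ‖ξ‖ ^ 2))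
          (Set.Ioi 0) := Real.integrableOn_rpowIntegrand₀₁_Ioi hs (by positivity)
      exact (Integrable.ofReal (𝕜 := ℂ) h0).mul_const (H ξ)
    · refine ((integrable_wt_mul s H).mul_const I).congr (Eventually.of_forall fun ξ => ?_)
      simp only [Φ, norm_mul, integral_mul_const]
      have : ∫ t in Set.Ioi (0 : ℝ), ‖((Real.rpowIntegrand₀₁ (s / 2) t (1 + ‖ξ‖ ^ 2) : ℝ) : ℂ)‖ =
          ‖wt 1 s ξ‖ * I := by
        rw [hI, ← wt_one_eq_integral hs]
        refine setIntegral_congr_fun measurableSet_Ioi fun t ht => ?_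
        simp only [Complex.norm_real, Real.norm_of_nonneg (hnn ξ t ht)]
      rw [this]; ring
  have hinner : ∀ t ∈ Set.Ioi (0 : ℝ), ∫ ξ, Φ (ξ, t) = ((t ^ (s / 2) : ℝ) : ℂ) *
      (((t⁻¹ : ℝ) : ℂ) * bil h k - bil (Fm (resSymb t) h) k) := by
    intro t ht
    have ht' : (0 : ℝ) ≤ t := le_of_lt ht
    have hR := hasTemperateGrowth_resSymb ht'
    rw [bil_Fm_eq_fourier hR, bil_eq_fourier, ← integral_const_mul, ← integral_sub,
      ← integral_const_mul]
    · congr 1 with ξ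
      simp only [Φ, hH, Real.rpowIntegrand₀₁, resSymb]
      push_cast
      ring
    · exact (H.integrable.congr (Eventually.of_forall hH)).const_mul _
    · refine (Sm (resSymb t) H).integrable.congr (Eventually.of_forall fun ξ => ?_)
      simp only [SchwartzMap.smulLeftCLM_apply_apply hR, smul_eq_mul, hH]
  refine ⟨?_, ?_⟩
  · refine (hint.integral_prod_right).congr ?_
    filter_upwards [ae_restrict_mem measurableSet_Ioi] with t ht using hinner t ht
  · rw [← setIntegral_congr_fun measurableSet_Ioi hinner]
    rw [← integral_integral_swap (f := fun ξ t => Φ (ξ, t)) hint,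
      bil_Fm_eq_fourier (by fun_prop), ← integral_const_mul]
    congr 1 with ξ
    simp only [Φ]
    rw [integral_mul_const, integral_complex_ofReal, wt_one_eq_integral hs, hH, ← hI]
    have : wt 1 s ξ = ((‖wt 1 s ξ‖ : ℝ) : ℂ) := by rw [norm_wt, wt]
    rw [this]
    push_cast
    simp only [Complex.norm_real, norm_norm]
    ring

theorem integrableOn_rpow_mul_rpow {σ q : ℝ} (hσ : 0 < σ) (hq : σ + 1 < q) :
    IntegrableOn (fun t : ℝ => t ^ σ * (1 + t) ^ (-q)) (Set.Ioi 0) := by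
  have h1 : IntegrableOn (fun t : ℝ => (1 + t) ^ (σ - q)) (Set.Ioi 0) := by
    have := integrableOn_add_rpow_Ioi_of_lt (a := σ - q) (m := 1) (c := 0) (by linarith)
      (by norm_num)
    simpa [add_comm] using this
  refine h1.mono' (by
    have : Measurable (fun t : ℝ => t ^ σ * (1 + t) ^ (-q)) := by fun_prop
    exact this.aestronglyMeasurable) ?_
  filter_upwards [ae_restrict_mem measurableSet_Ioi] with t ht
  have ht' : (0 : ℝ) < t := ht
  rw [Real.norm_of_nonneg (by positivity), sub_eq_add_neg, Real.rpow_add (by linarith)]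
  gcongr
  linarith

/-- If the commutators of `a` with the resolvents decay, the commutator with the fractional power
is bounded. -/
theorem exists_l2_commutator_le {s q : ℝ} (hs : s / 2 ∈ Set.Ioo (0 : ℝ) 1) (hq : s / 2 + 1 < q) :
    ∃ C : ℝ, 0 < C ∧ ∀ (a : Plane → ℂ) (u : 𝓢(Plane, ℂ)) (K : ℝ), 0 ≤ K →
      (∀ t, 0 < t → l2 (Sm a (Fm (resSymb t) u) - Fm (resSymb t) (Sm a u)) ≤ K * (1 + t) ^ (-q)) →
      l2 (Fm (wt 1 s) (Sm a u) - Sm a (Fm (wt 1 s) u)) ≤ C * K := by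
  set I : ℝ := ∫ t in Set.Ioi (0 : ℝ), Real.rpowIntegrand₀₁ (s / 2) t 1 with hI
  have hIpos : 0 < I := Real.integral_rpowIntegrand₀₁_one_pos hs
  set B : ℝ := ∫ t in Set.Ioi (0 : ℝ), t ^ (s / 2) * (1 + t) ^ (-q)
  have hB : 0 ≤ B := setIntegral_nonneg measurableSet_Ioi fun t ht => by
    have : (0 : ℝ) < t := ht
    positivity
  -- `B + 1` instead of `B` makes the constant visibly positive.
  refine ⟨I⁻¹ * (B + 1), by positivity, fun a u K hK hdec => ?_⟩
  refine l2_le_of_bil_le fun g => ?_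
  obtain ⟨i1, e1⟩ := integral_rpowIntegrand_bil hs (Sm a u) g
  obtain ⟨i2, e2⟩ := integral_rpowIntegrand_bil hs u (Sm a g)
  -- Multiplication by `a` is symmetric, so the terms with `t⁻¹` in the two integrals coincide and
  -- cancel; only commutators with resolvents remain.
  have e : (I : ℂ) * bil (Fm (wt 1 s) (Sm a u) - Sm a (Fm (wt 1 s) u)) g =
      ∫ t in Set.Ioi (0 : ℝ), ((t ^ (s / 2) : ℝ) : ℂ) *
        bil (Sm a (Fm (resSymb t) u) - Fm (resSymb t) (Sm a u)) g := by
    rw [bil_sub, mul_sub, bil_Sm a _ g, hI, ← e1, ← e2, ← integral_sub i1 i2]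
    refine setIntegral_congr_fun measurableSet_Ioi fun t _ => ?_
    simp only [bil_sub, bil_Sm]
    ring
  have hle : ‖(I : ℂ) * bil (Fm (wt 1 s) (Sm a u) - Sm a (Fm (wt 1 s) u)) g‖ ≤ B * (K * l2 g) := by
    rw [e, ← integral_mul_const]
    refine norm_integral_le_of_norm_le
      ((integrableOn_rpow_mul_rpow hs.1 hq).mul_const _) ?_
    filter_upwards [ae_restrict_mem measurableSet_Ioi] with t ht
    have ht' : (0 : ℝ) < t := ht
    rw [norm_mul, Complex.norm_real, Real.norm_of_nonneg (by positivity)]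
    calc _ ≤ t ^ (s / 2) * (K * (1 + t) ^ (-q) * l2 g) := by
          gcongr
          exact (norm_bil_le _ _).trans
            (mul_le_mul_of_nonneg_right (hdec t ht') (l2_nonneg _))
      _ = _ := by ring
  rw [norm_mul, Complex.norm_real, Real.norm_of_nonneg hIpos.le] at hle
  have h3 : ‖bil (Fm (wt 1 s) (Sm a u) - Sm a (Fm (wt 1 s) u)) g‖ ≤ I⁻¹ * (B * (K * l2 g)) := by
    rw [inv_mul_eq_div, le_div_iff₀ hIpos, mul_comm]; exact hle
  refine h3.trans ?_
  have : 0 ≤ K * l2 g := mul_nonneg hK (l2_nonneg _)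
  calc _ ≤ I⁻¹ * ((B + 1) * (K * l2 g)) := by gcongr; linarith
    _ = _ := by ring

/-! ### Commutation of weights and Bessel potentials -/

theorem norm_wt_neg_two (ε : ℝ) (x : Plane) : ‖wt ε (-2) x‖ = (1 + (ε * ‖x‖) ^ 2)⁻¹ := by
  rw [norm_wt, show (-2 / 2 : ℝ) = -1 by norm_num, Real.rpow_neg_one]

theorem norm_coord (j : Fin 2) (x : Plane) : ‖coord j x‖ = |x j| := by
  rw [coord, Complex.norm_real, Real.norm_eq_abs]

theorem fderiv_coord (j : Fin 2) (x : Plane) : fderiv ℝ (coord j) x (ei j) = 1 := by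
  have h : HasFDerivAt (coord j) (Complex.ofRealCLM.comp (EuclideanSpace.proj j : Plane →L[ℝ] ℝ)) x :=
    (Complex.ofRealCLM.comp (EuclideanSpace.proj j : Plane →L[ℝ] ℝ)).hasFDerivAt
  rw [h.fderiv]
  simp

theorem wt_four (ε : ℝ) (x : Plane) : wt ε (-4) x = wt ε (-2) x * wt ε (-2) x := by
  have := congrFun (wt_mul_wt ε (-2) (-2)) x
  rw [Pi.mul_apply] at this
  rw [this]; norm_num

/-- The weight `(1 + |εx|²)^{r/2}` varies slowly if `ε` is small. -/
def slowWt (ε r : ℝ) (hε : 0 < ε) (hε1 : ε ≤ 1) : SlowWeight (3 * |r| * ε) where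
  ρ := wt ε r
  b j x := tpi⁻¹ * (r * ε ^ 2) * (coord j x * wt ε (-2) x)
  c j x := tpi⁻¹ * (tpi⁻¹ * (r * ε ^ 2)) *
    (wt ε (-2) x - 2 * ε ^ 2 * (coord j x * coord j x * wt ε (-4) x))
  ρ_temperate := by fun_prop
  b_temperate j := by fun_prop
  c_temperate j := by fun_prop
  -- `ε|x_j| ≤ 1 + (ε|x|)²` already gives `|r| ε`. The factor 3 comes from `c`, which is bounded by
  -- `3|r|ε²`, and `ε ≤ 1`.
  norm_b_le j x := by
    have h1 : ‖(tpi⁻¹ : ℂ)‖ ≤ 1 := by rw [norm_inv]; exact inv_le_one_of_one_le₀ one_le_norm_tpi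
    have h2 : ε ^ 2 * (|x j| * (1 + (ε * ‖x‖) ^ 2)⁻¹) ≤ ε := by
      rw [← div_eq_mul_inv, ← mul_div_assoc, div_le_iff₀ (one_add_sq_pos ε x)]
      have := abs_coord_le x j
      have h3 : ε * |x j| ≤ 1 + (ε * ‖x‖) ^ 2 := by
        have : ε * |x j| ≤ ε * ‖x‖ := by gcongr
        nlinarith [sq_nonneg (ε * ‖x‖ - 1)]
      nlinarith
    rw [norm_mul, norm_mul, norm_mul, norm_mul, norm_wt_neg_two, norm_coord, norm_pow,
      Complex.norm_real, Complex.norm_real, Real.norm_eq_abs, Real.norm_of_nonneg hε.le]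
    calc ‖(tpi⁻¹ : ℂ)‖ * (|r| * ε ^ 2) * (|x j| * (1 + (ε * ‖x‖) ^ 2)⁻¹)
        ≤ 1 * (|r| * ε ^ 2) * (|x j| * (1 + (ε * ‖x‖) ^ 2)⁻¹) := by gcongr
      _ = |r| * (ε ^ 2 * (|x j| * (1 + (ε * ‖x‖) ^ 2)⁻¹)) := by ring
      _ ≤ |r| * ε := by gcongr
      _ ≤ _ := by nlinarith [abs_nonneg r, mul_nonneg (abs_nonneg r) hε.le]
  norm_c_le j x := by
    have h1 : ‖(tpi⁻¹ : ℂ)‖ ≤ 1 := by rw [norm_inv]; exact inv_le_one_of_one_le₀ one_le_norm_tpi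
    have h0 : 0 < 1 + (ε * ‖x‖) ^ 2 := one_add_sq_pos ε x
    have hm : ‖wt ε (-2) x‖ ≤ 1 := by
      rw [norm_wt_neg_two]
      exact inv_le_one_of_one_le₀ (by nlinarith [sq_nonneg (ε * ‖x‖)])
    have h2 : ‖(2 * (ε : ℂ) ^ 2 * (coord j x * coord j x * wt ε (-4) x))‖ ≤ 2 := by
      rw [wt_four]
      simp only [norm_mul, norm_wt_neg_two, norm_coord, norm_pow, Complex.norm_ofNat,
        Complex.norm_real, Real.norm_of_nonneg hε.le]
      have h3 : ε * |x j| ≤ ε * ‖x‖ := by gcongr; exact abs_coord_le x j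
      have h4 : (ε * |x j|) ^ 2 ≤ 1 + (ε * ‖x‖) ^ 2 := by nlinarith [mul_nonneg hε.le (abs_nonneg (x j))]
      have h5 : (1 + (ε * ‖x‖) ^ 2)⁻¹ ≤ 1 := inv_le_one_of_one_le₀ (by nlinarith [sq_nonneg (ε * ‖x‖)])
      calc 2 * ε ^ 2 * (|x j| * |x j| * ((1 + (ε * ‖x‖) ^ 2)⁻¹ * (1 + (ε * ‖x‖) ^ 2)⁻¹))
          = 2 * (((ε * |x j|) ^ 2 * (1 + (ε * ‖x‖) ^ 2)⁻¹) * (1 + (ε * ‖x‖) ^ 2)⁻¹) := by ring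
        _ ≤ 2 * (((1 + (ε * ‖x‖) ^ 2) * (1 + (ε * ‖x‖) ^ 2)⁻¹) * 1) := by gcongr
        _ = 2 := by rw [mul_inv_cancel₀ h0.ne']; norm_num
    have h6 : ‖wt ε (-2) x - 2 * (ε : ℂ) ^ 2 * (coord j x * coord j x * wt ε (-4) x)‖ ≤ 3 :=
      (norm_sub_le _ _).trans (by linarith)
    rw [norm_mul, norm_mul, norm_mul, norm_mul, norm_pow,
      Complex.norm_real, Complex.norm_real, Real.norm_eq_abs, Real.norm_of_nonneg hε.le]
    calc _ ≤ 1 * (1 * (|r| * ε ^ 2)) * 3 := by gcongr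
      _ ≤ _ := by nlinarith [abs_nonneg r, mul_nonneg (abs_nonneg r) hε.le,
                    mul_nonneg (mul_nonneg (abs_nonneg r) hε.le) (sub_nonneg.2 hε1)]
  fderiv_ρ j x := by
    rw [hasFDerivAt_wt]
    have := congrFun (wt_mul_wt ε (-2) r) x
    rw [Pi.mul_apply] at this
    have h2 : wt ε (r - 2) x = wt ε (-2) x * wt ε r x := by rw [this]; congr 1; ring
    rw [h2]
    field_simp [tpi_ne_zero]
  fderiv_b j x := by
    have hc := (hasTemperateGrowth_coord j).1.differentiable (by simp) x
    have hw := (hasTemperateGrowth_wt ε (-2)).1.differentiable (by simp) x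
    rw [fderiv_const_mul (hc.fun_mul hw), fderiv_fun_mul hc hw]
    simp only [smul_apply, add_apply, fderiv_coord, hasFDerivAt_wt, smul_eq_mul]
    rw [show (-2 - 2 : ℝ) = -4 by norm_num]
    have := tpi_ne_zero
    field_simp
    push_cast
    ring

/-- `kap` is continuous and vanishes at zero. -/
theorem exists_eps (r M : ℝ) (hM : 0 < M) :
    ∃ ε : ℝ, 0 < ε ∧ ε ≤ 1 ∧ SlowWeight.kap (3 * |r| * ε) ≤ M := by
  have h : Tendsto (fun ε : ℝ => SlowWeight.kap (3 * |r| * ε)) (𝓝[>] 0) (𝓝 0) := by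
    have : Continuous (fun ε : ℝ => SlowWeight.kap (3 * |r| * ε)) := by
      unfold SlowWeight.kap; fun_prop
    have h0 := (this.tendsto 0).mono_left (nhdsWithin_le_nhds (s := Set.Ioi 0))
    simpa [SlowWeight.kap] using h0
  have h1 := h.eventually (Iic_mem_nhds hM)
  have h2 : ∀ᶠ ε : ℝ in 𝓝[>] 0, ε ≤ 1 :=
    (nhdsWithin_le_nhds (s := Set.Ioi 0)) (Iic_mem_nhds one_pos)
  obtain ⟨ε, hε⟩ := (h1.and (h2.and self_mem_nhdsWithin)).exists
  exact ⟨ε, hε.2.2, hε.2.1, hε.1⟩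

theorem sqrt_inv_mul_inv {t : ℝ} (ht : 0 < t) :
    (Real.sqrt (1 + t))⁻¹ * (1 + t)⁻¹ = (1 + t) ^ (-(3 / 2) : ℝ) := by
  have h : (0 : ℝ) < 1 + t := by linarith
  rw [Real.sqrt_eq_rpow, ← Real.rpow_neg h.le, ← Real.rpow_neg_one, ← Real.rpow_add h]
  norm_num

/-- The case `0 < s < 1` of the commutation theorem. -/
theorem commute_of_mem_Ioo {s : ℝ} (hs : s ∈ Set.Ioo (0 : ℝ) 1) (r : ℝ) :
    ∃ C : ℝ, 0 < C ∧ ∀ u : 𝓢(Plane, ℂ),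
      l2 (Fm (wt 1 s) (Sm (wt 1 r) u)) ≤ C * l2 (Sm (wt 1 r) (Fm (wt 1 s) u)) ∧
      l2 (Sm (wt 1 r) (Fm (wt 1 s) u)) ≤ C * l2 (Fm (wt 1 s) (Sm (wt 1 r) u)) := by
  have hs2 : s / 2 ∈ Set.Ioo (0 : ℝ) 1 := ⟨by linarith [hs.1], by linarith [hs.2]⟩
  -- The available decay `3/2` exceeds `s/2 + 1` exactly because `s < 1`.
  obtain ⟨C₀, hC₀, hcomm⟩ := exists_l2_commutator_le (q := 3 / 2) hs2 (by linarith [hs.2])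
  -- The bound `1/2` permits the absorption in the resolvent estimate; `1/(4 C₀)` makes the
  -- commutator with `D_s` at most half of the norm of `ρ u`.
  obtain ⟨ε, hε, hε1, hk⟩ := exists_eps r (min (1 / 2) (1 / (4 * C₀))) (by positivity)
  have hk1 := hk.trans (min_le_left _ _)
  have hk2 := hk.trans (min_le_right _ _)
  let w := slowWt ε r hε hε1
  let w' := slowWt 1 r one_pos le_rfl
  have hwρ : w.ρ = wt ε r := rfl
  have hwρ' : w'.ρ = wt 1 r := rfl
  obtain ⟨c₁, hc₁, hle₁⟩ := exists_wt_le one_pos hε r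
  obtain ⟨c₂, hc₂, hle₂⟩ := exists_wt_le hε one_pos r
  have cmp₁ : ∀ u, l2 (Sm (wt 1 r) u) ≤ c₁ * l2 (Sm (wt ε r) u) := fun u =>
    l2_Sm_le_l2_Sm (by fun_prop) (by fun_prop) hc₁.le hle₁ u
  have cmp₂ : ∀ u, l2 (Sm (wt ε r) u) ≤ c₂ * l2 (Sm (wt 1 r) u) := fun u =>
    l2_Sm_le_l2_Sm (by fun_prop) (by fun_prop) hc₂.le hle₂ u
  have kn := w.kap_nonneg
  have kn' := w'.kap_nonneg
  set k := SlowWeight.kap (3 * |r| * ε)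
  set k' := SlowWeight.kap (3 * |r| * 1)
  -- For the slow weight, `‖ρu‖ ≤ ‖D_s ρu‖ ≤ ‖ρ D_s u‖ + ½‖ρu‖`. The result involves only weighted
  -- `L²` norms, so it passes to the weight of scale one in `low`.
  have stepA : ∀ u, l2 (Sm (wt ε r) u) ≤ 2 * l2 (Sm (wt ε r) (Fm (wt 1 s) u)) := by
    intro u
    have h := hcomm (wt ε r) u (k * 2 * l2 (Sm (wt ε r) u))
      (by have := l2_nonneg (Sm (wt ε r) u); positivity) (fun t ht => by
        refine (w.l2_commutator_resolvent_le ht.le u).trans ?_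
        refine (mul_le_mul_of_nonneg_left (w.l2_ρ_resolvent_le hk1 ht.le u)
          (by positivity)).trans (le_of_eq ?_)
        rw [← sqrt_inv_mul_inv ht, hwρ]; ring)
    have h2 : C₀ * (k * 2 * l2 (Sm (wt ε r) u)) ≤ 1 / 2 * l2 (Sm (wt ε r) u) := by
      have : C₀ * (k * 2) ≤ 1 / 2 := by
        rw [le_div_iff₀ (by positivity)] at hk2; nlinarith
      rw [← mul_assoc]
      exact mul_le_mul_of_nonneg_right this (l2_nonneg _)
    have h3 : l2 (Fm (wt 1 s) (Sm (wt ε r) u)) ≤ l2 (Sm (wt ε r) (Fm (wt 1 s) u)) +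
        l2 (Fm (wt 1 s) (Sm (wt ε r) u) - Sm (wt ε r) (Fm (wt 1 s) u)) := by
      refine le_trans (le_of_eq ?_) (l2_add_le _ _)
      congr 1; abel
    have h4 := l2_le_l2_Fm_wt hs.1.le (Sm (wt ε r) u)
    linarith
  set D := c₁ * (2 * c₂)
  have hD : 0 < D := by positivity
  have low : ∀ u, l2 (Sm (wt 1 r) u) ≤ D * l2 (Sm (wt 1 r) (Fm (wt 1 s) u)) := by
    intro u
    calc _ ≤ c₁ * (2 * (c₂ * l2 (Sm (wt 1 r) (Fm (wt 1 s) u)))) :=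
          (cmp₁ u).trans (by gcongr; exact (stepA u).trans (by gcongr; exact cmp₂ _))
      _ = _ := by simp only [D]; ring
  -- At scale one the commutator is bounded by `‖ρu‖` without being small; the decay of `ρ R u` is
  -- borrowed from scale `ε`. The norm `‖ρu‖` is in turn bounded by `‖ρ D_s u‖` through `low`, and
  -- by `‖D_s ρu‖` because `s ≥ 0`.
  have stepB : ∀ u, l2 (Fm (wt 1 s) (Sm (wt 1 r) u) - Sm (wt 1 r) (Fm (wt 1 s) u)) ≤
      C₀ * (k' * D) * l2 (Sm (wt 1 r) u) := by
    intro u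
    have h := hcomm (wt 1 r) u (k' * D * l2 (Sm (wt 1 r) u))
      (by have := l2_nonneg (Sm (wt 1 r) u); positivity) (fun t ht => by
        refine (w'.l2_commutator_resolvent_le ht.le u).trans ?_
        have e : l2 (Sm (wt 1 r) (Fm (resSymb t) u)) ≤
            c₁ * (2 * (1 + t)⁻¹ * (c₂ * l2 (Sm (wt 1 r) u))) :=
          (cmp₁ _).trans (by
            gcongr
            exact (w.l2_ρ_resolvent_le hk1 ht.le u).trans (by gcongr; exact cmp₂ _))
        refine (mul_le_mul_of_nonneg_left e (by positivity)).trans (le_of_eq ?_)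
        rw [← sqrt_inv_mul_inv ht]
        simp only [D]
        ring)
    linarith
  set B := C₀ * (k' * D)
  have hB : 0 ≤ B := by positivity
  refine ⟨1 + B * D + B, by positivity, fun u => ⟨?_, ?_⟩⟩
  · have h3 : l2 (Fm (wt 1 s) (Sm (wt 1 r) u)) ≤ l2 (Sm (wt 1 r) (Fm (wt 1 s) u)) +
        l2 (Fm (wt 1 s) (Sm (wt 1 r) u) - Sm (wt 1 r) (Fm (wt 1 s) u)) := by
      refine le_trans (le_of_eq ?_) (l2_add_le _ _)
      congr 1; abel
    have h4 := stepB u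
    have h5 := mul_le_mul_of_nonneg_left (low u) hB
    have h6 := mul_nonneg hB (l2_nonneg (Sm (wt 1 r) (Fm (wt 1 s) u)))
    nlinarith
  · have h3 : l2 (Sm (wt 1 r) (Fm (wt 1 s) u)) ≤ l2 (Fm (wt 1 s) (Sm (wt 1 r) u)) +
        l2 (Fm (wt 1 s) (Sm (wt 1 r) u) - Sm (wt 1 r) (Fm (wt 1 s) u)) := by
      refine le_trans (le_of_eq ?_) (l2_sub_le _ _)
      congr 1; abel
    have h4 := stepB u
    have h5 := mul_le_mul_of_nonneg_left (l2_le_l2_Fm_wt hs.1.le (Sm (wt 1 r) u)) hB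
    have h6 := mul_nonneg (mul_nonneg hB hD.le) (l2_nonneg (Fm (wt 1 s) (Sm (wt 1 r) u)))
    nlinarith

/-- Comparable slow weights give comparable `H¹` norms. -/
theorem exists_h1_le {K K' : ℝ} (w : SlowWeight K) (w' : SlowWeight K') {C : ℝ} (hC : 0 ≤ C)
    (h : ∀ x, ‖w.ρ x‖ ≤ C * ‖w'.ρ x‖) :
    ∃ M : ℝ, 0 < M ∧ ∀ u, h1 (Sm w.ρ u) ≤ M * h1 (Sm w'.ρ u) := by
  have hK := w.K_nonneg
  have hK' := w'.K_nonneg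
  have cmp : ∀ u, l2 (Sm w.ρ u) ≤ C * l2 (Sm w'.ρ u) := fun u =>
    l2_Sm_le_l2_Sm w.ρ_temperate w'.ρ_temperate hC h u
  refine ⟨C + 2 * (C * (1 + K') + K * C) + 1, by positivity, fun u => ?_⟩
  have h0 : l2 (Sm w'.ρ u) ≤ h1 (Sm w'.ρ u) := l2_le_l2_Fm_wt zero_le_one _
  set H := h1 (Sm w'.ρ u)
  have hH : 0 ≤ H := h1_nonneg _
  have h2 : l2 (Sm w.ρ u) ≤ C * H := (cmp u).trans (by gcongr)
  have hj : ∀ j, l2 (Fm (coord j) (Sm w.ρ u)) ≤ (C * (1 + K') + K * C) * H := by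
    intro j
    rw [w.coord_ρ]
    have e1 : l2 (Sm w'.ρ (Fm (coord j) u)) ≤ H + K' * H := by
      have e : Sm w'.ρ (Fm (coord j) u) = Fm (coord j) (Sm w'.ρ u) - Sm (w'.b j) (Sm w'.ρ u) := by
        rw [w'.coord_ρ]; abel
      rw [e]
      refine (l2_sub_le _ _).trans (add_le_add (l2_coord_le_h1 j _) ((w'.l2_b_le j _).trans ?_))
      gcongr
    have e2 := (cmp (Fm (coord j) u)).trans (mul_le_mul_of_nonneg_left e1 hC)
    have e3 := (w.l2_b_le j (Sm w.ρ u)).trans (mul_le_mul_of_nonneg_left h2 hK)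
    refine (l2_add_le _ _).trans ((add_le_add e2 e3).trans (le_of_eq (by ring)))
  refine (h1_le _).trans ((add_le_add h2 (Finset.sum_le_sum fun j _ => hj j)).trans ?_)
  simp only [Finset.sum_const, Finset.card_univ, Fintype.card_fin, nsmul_eq_mul]
  push_cast
  nlinarith

/-- The case `s = 1` of the commutation theorem. -/
theorem commute_one (r : ℝ) :
    ∃ C : ℝ, 0 < C ∧ ∀ u : 𝓢(Plane, ℂ),
      l2 (Fm (wt 1 1) (Sm (wt 1 r) u)) ≤ C * l2 (Sm (wt 1 r) (Fm (wt 1 1) u)) ∧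
      l2 (Sm (wt 1 r) (Fm (wt 1 1) u)) ≤ C * l2 (Fm (wt 1 1) (Sm (wt 1 r) u)) := by
  have hs2 : (1 : ℝ) / 2 ∈ Set.Ioo (0 : ℝ) 1 := ⟨by norm_num, by norm_num⟩
  -- For `s = 1` a decay faster than `3/2` is required.
  obtain ⟨C₀, hC₀, hcomm⟩ := exists_l2_commutator_le (q := 2) hs2 (by norm_num)
  obtain ⟨ε, hε, hε1, hk⟩ := exists_eps r (min (1 / 2) (1 / (4 * C₀))) (by positivity)
  have hk1 := hk.trans (min_le_left _ _)
  have hk2 := hk.trans (min_le_right _ _)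
  let w := slowWt ε r hε hε1
  let w' := slowWt 1 r one_pos le_rfl
  have hwρ : w.ρ = wt ε r := rfl
  obtain ⟨c₁, hc₁, hle₁⟩ := exists_wt_le one_pos hε r
  obtain ⟨c₂, hc₂, hle₂⟩ := exists_wt_le hε one_pos r
  have cmp₁ : ∀ u, l2 (Sm (wt 1 r) u) ≤ c₁ * l2 (Sm (wt ε r) u) := fun u =>
    l2_Sm_le_l2_Sm (by fun_prop) (by fun_prop) hc₁.le hle₁ u
  have cmp₂ : ∀ u, l2 (Sm (wt ε r) u) ≤ c₂ * l2 (Sm (wt 1 r) u) := fun u =>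
    l2_Sm_le_l2_Sm (by fun_prop) (by fun_prop) hc₂.le hle₂ u
  -- By Leibniz' rule weights of different scales are comparable inside the `H¹` norm, so the whole
  -- estimate can be proved for the slow weight and then transferred.
  obtain ⟨m₁, hm₁, hh₁⟩ := exists_h1_le w' w hc₁.le hle₁
  obtain ⟨m₂, hm₂, hh₂⟩ := exists_h1_le w w' hc₂.le hle₂
  have kn := w.kap_nonneg
  set k := SlowWeight.kap (3 * |r| * ε)
  have step : ∀ u, l2 (Fm (wt 1 1) (Sm (wt ε r) u) - Sm (wt ε r) (Fm (wt 1 1) u)) ≤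
      1 / 2 * h1 (Sm (wt ε r) u) := by
    intro u
    have h := hcomm (wt ε r) u (2 * k * h1 (Sm (wt ε r) u))
      (by have := h1_nonneg (Sm (wt ε r) u); positivity) (fun t ht => by
        refine (w.l2_commutator_resolvent_le_h1 hk1 ht.le u).trans (le_of_eq ?_)
        rw [hwρ, Real.rpow_neg (by linarith), Real.rpow_two, inv_pow]; ring)
    refine h.trans ?_
    have : C₀ * (2 * k) ≤ 1 / 2 := by
      rw [le_div_iff₀ (by positivity)] at hk2; nlinarith
    rw [← mul_assoc]
    exact mul_le_mul_of_nonneg_right this (h1_nonneg _)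
  have up : ∀ u, h1 (Sm (wt ε r) u) ≤ 2 * l2 (Sm (wt ε r) (Fm (wt 1 1) u)) := by
    intro u
    have h3 : h1 (Sm (wt ε r) u) ≤ l2 (Sm (wt ε r) (Fm (wt 1 1) u)) +
        l2 (Fm (wt 1 1) (Sm (wt ε r) u) - Sm (wt ε r) (Fm (wt 1 1) u)) := by
      refine le_trans (le_of_eq ?_) (l2_add_le _ _)
      rw [h1]; congr 1; abel
    linarith [step u]
  have down : ∀ u, l2 (Sm (wt ε r) (Fm (wt 1 1) u)) ≤ 2 * h1 (Sm (wt ε r) u) := by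
    intro u
    have h3 : l2 (Sm (wt ε r) (Fm (wt 1 1) u)) ≤ h1 (Sm (wt ε r) u) +
        l2 (Fm (wt 1 1) (Sm (wt ε r) u) - Sm (wt ε r) (Fm (wt 1 1) u)) := by
      refine le_trans (le_of_eq ?_) (l2_sub_le _ _)
      congr 1; abel
    linarith [step u, h1_nonneg (Sm (wt ε r) u)]
  refine ⟨m₁ * (2 * c₂) + c₁ * (2 * m₂), by positivity, fun u => ⟨?_, ?_⟩⟩
  · calc h1 (Sm (wt 1 r) u) ≤ m₁ * (2 * (c₂ * l2 (Sm (wt 1 r) (Fm (wt 1 1) u)))) :=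
          (hh₁ u).trans (by gcongr; exact (up u).trans (by gcongr; exact cmp₂ _))
      _ ≤ _ := by
          have : 0 ≤ c₁ * (2 * m₂) * l2 (Sm (wt 1 r) (Fm (wt 1 1) u)) :=
            mul_nonneg (by positivity) (l2_nonneg _)
          nlinarith
  · calc _ ≤ c₁ * (2 * (m₂ * h1 (Sm (wt 1 r) u))) :=
          (cmp₁ _).trans (by gcongr; exact (down u).trans (by gcongr; exact hh₂ u))
      _ ≤ (m₁ * (2 * c₂) + c₁ * (2 * m₂)) * h1 (Sm (wt 1 r) u) := by
          have : 0 ≤ m₁ * (2 * c₂) * h1 (Sm (wt 1 r) u) :=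
            mul_nonneg (by positivity) (h1_nonneg _)
          nlinarith

theorem Fm_wt_cancel (s : ℝ) (u : 𝓢(Plane, ℂ)) : Fm (wt 1 s) (Fm (wt 1 (-s)) u) = u := by
  rw [SchwartzMap.fourierMultiplierCLM_fourierMultiplierCLM_apply (by fun_prop) (by fun_prop),
    wt_mul_wt, add_neg_cancel, wt_zero]
  simp

theorem Sm_wt_cancel (ε s : ℝ) (u : 𝓢(Plane, ℂ)) : Sm (wt ε s) (Sm (wt ε (-s)) u) = u := by
  rw [SchwartzMap.smulLeftCLM_smulLeftCLM_apply (by fun_prop) (by fun_prop),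
    wt_mul_wt, add_neg_cancel, wt_zero]
  simp

theorem Fm_wt_cancel' (s : ℝ) (u : 𝓢(Plane, ℂ)) : Fm (wt 1 (-s)) (Fm (wt 1 s) u) = u := by
  simpa using Fm_wt_cancel (-s) u

theorem Sm_wt_cancel' (ε s : ℝ) (u : 𝓢(Plane, ℂ)) : Sm (wt ε (-s)) (Sm (wt ε s) u) = u := by
  simpa using Sm_wt_cancel ε (-s) u

theorem bil_Fm_wt (s : ℝ) (u v : 𝓢(Plane, ℂ)) : bil (Fm (wt 1 s) u) v = bil u (Fm (wt 1 s) v) :=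
  bil_Fm (by fun_prop) (wt_neg_arg 1 s) u v

/-- The norms of `D_s M_r u` and `M_r D_s u` are equivalent, where `M_r` is the multiplication by
`(1 + |x|²)^{r/2}` and `D_s = (1 + |D|²)^{s/2}`, `-1 ≤ s ≤ 1`. -/
theorem commute_schwartz {s : ℝ} (hs : s ∈ Set.Icc (-1 : ℝ) 1) (r : ℝ) :
    ∃ C : ℝ, 0 < C ∧ ∀ u : 𝓢(Plane, ℂ),
      l2 (Fm (wt 1 s) (Sm (wt 1 r) u)) ≤ C * l2 (Sm (wt 1 r) (Fm (wt 1 s) u)) ∧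
      l2 (Sm (wt 1 r) (Fm (wt 1 s) u)) ≤ C * l2 (Fm (wt 1 s) (Sm (wt 1 r) u)) := by
  have pos : ∀ s ∈ Set.Icc (0 : ℝ) 1, ∀ r : ℝ, ∃ C : ℝ, 0 < C ∧ ∀ u : 𝓢(Plane, ℂ),
      l2 (Fm (wt 1 s) (Sm (wt 1 r) u)) ≤ C * l2 (Sm (wt 1 r) (Fm (wt 1 s) u)) ∧
      l2 (Sm (wt 1 r) (Fm (wt 1 s) u)) ≤ C * l2 (Fm (wt 1 s) (Sm (wt 1 r) u)) := by
    intro s hs r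
    rcases hs.1.eq_or_lt with h0 | h0
    · refine ⟨1, one_pos, fun u => ?_⟩
      rw [← h0, wt_zero]
      simp
    · rcases hs.2.eq_or_lt with h1' | h1'
      · rw [h1']; exact commute_one r
      · exact commute_of_mem_Ioo ⟨h0, h1'⟩ r
  rcases le_total 0 s with h0 | h0
  · exact pos s ⟨h0, hs.2⟩ r
  -- Negative `s` by duality: the transpose of `D_s M_r` is `M_r D_s`, and inserting inverse pairs
  -- turns each estimate into the one for `(-s, -r)` with the roles of the two orders exchanged.
  obtain ⟨C, hC, hb⟩ := pos (-s) ⟨by linarith, by linarith [hs.1]⟩ (-r)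
  refine ⟨C, hC, fun u => ⟨?_, ?_⟩⟩
  · refine l2_le_of_bil_le fun g => ?_
    have e : bil (Fm (wt 1 s) (Sm (wt 1 r) u)) g =
        bil (Sm (wt 1 r) (Fm (wt 1 s) u))
          (Sm (wt 1 (-r)) (Fm (wt 1 (-s)) (Sm (wt 1 r) (Fm (wt 1 s) g)))) := by
      rw [← bil_Sm, Sm_wt_cancel', ← bil_Fm_wt, Fm_wt_cancel', bil_Fm_wt, bil_Sm]
    rw [e, mul_comm C, mul_assoc]
    refine (norm_bil_le _ _).trans (mul_le_mul_of_nonneg_left ?_ (l2_nonneg _))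
    refine ((hb _).2).trans (le_of_eq ?_)
    rw [Sm_wt_cancel', Fm_wt_cancel']
  · refine l2_le_of_bil_le fun g => ?_
    have e : bil (Sm (wt 1 r) (Fm (wt 1 s) u)) g =
        bil (Fm (wt 1 s) (Sm (wt 1 r) u))
          (Fm (wt 1 (-s)) (Sm (wt 1 (-r)) (Fm (wt 1 s) (Sm (wt 1 r) g)))) := by
      rw [← bil_Fm_wt, Fm_wt_cancel', ← bil_Sm, Sm_wt_cancel', bil_Sm, bil_Fm_wt]
    rw [e, mul_comm C, mul_assoc]
    refine (norm_bil_le _ _).trans (mul_le_mul_of_nonneg_left ?_ (l2_nonneg _))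
    refine ((hb _).1).trans (le_of_eq ?_)
    rw [Fm_wt_cancel', Sm_wt_cancel']

/-- The space `L²` after `D_s M_r`, or after `M_r D_s`. -/
theorem commute_dnorm {s : ℝ} (hs : s ∈ Set.Icc (-1 : ℝ) 1) (r : ℝ) :
    ∃ C : ℝ, 0 < C ∧ ∀ T : 𝓢'(Plane, ℂ),
      dnorm (FmD (wt 1 s) (SmD (wt 1 r) T)) ≤
        ENNReal.ofReal C * dnorm (SmD (wt 1 r) (FmD (wt 1 s) T)) ∧
      dnorm (SmD (wt 1 r) (FmD (wt 1 s) T)) ≤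
        ENNReal.ofReal C * dnorm (FmD (wt 1 s) (SmD (wt 1 r) T)) := by
  -- The operators are moved onto the test function, which again replaces `(s, r)` by `(-s, -r)`.
  obtain ⟨C, hC, hb⟩ := commute_schwartz (s := -s) ⟨by linarith [hs.2], by linarith [hs.1]⟩ (-r)
  have hF : ∀ (T : 𝓢'(Plane, ℂ)) v, FmD (wt 1 s) T v = T (Fm (wt 1 s) v) := fun T v =>
    FmD_apply (by fun_prop) (wt_neg_arg 1 s) T v
  refine ⟨C, hC, fun T => ⟨dnorm_le fun v => ?_, dnorm_le fun v => ?_⟩⟩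
  · have e : FmD (wt 1 s) (SmD (wt 1 r) T) v = SmD (wt 1 r) (FmD (wt 1 s) T)
        (Sm (wt 1 (-r)) (Fm (wt 1 (-s)) (Sm (wt 1 r) (Fm (wt 1 s) v)))) := by
      rw [hF, SmD_apply, SmD_apply, hF, Sm_wt_cancel, Fm_wt_cancel]
    rw [e, mul_comm (ENNReal.ofReal C), mul_assoc, ← ENNReal.ofReal_mul hC.le]
    refine (enorm_le_dnorm _ _).trans ?_
    gcongr
    refine ((hb _).2).trans (le_of_eq ?_)
    rw [Sm_wt_cancel', Fm_wt_cancel']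
  · have e : SmD (wt 1 r) (FmD (wt 1 s) T) v = FmD (wt 1 s) (SmD (wt 1 r) T)
        (Fm (wt 1 (-s)) (Sm (wt 1 (-r)) (Fm (wt 1 s) (Sm (wt 1 r) v)))) := by
      rw [hF, SmD_apply, SmD_apply, hF, Fm_wt_cancel, Sm_wt_cancel]
    rw [e, mul_comm (ENNReal.ofReal C), mul_assoc, ← ENNReal.ofReal_mul hC.le]
    refine (enorm_le_dnorm _ _).trans ?_
    gcongr
    refine ((hb _).1).trans (le_of_eq ?_)
    rw [Fm_wt_cancel', Sm_wt_cancel']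

/-! ### Distributions that are functions -/

/-- A smooth bump function as a Schwartz function. -/
def schwartzBump {c : Plane} (b : ContDiffBump c) : 𝓢(Plane, ℂ) :=
  (b.hasCompactSupport.comp_left (g := fun t : ℝ => (t : ℂ)) Complex.ofReal_zero).toSchwartzMap
    (Complex.ofRealCLM.contDiff.comp b.contDiff)

theorem schwartzBump_apply {c : Plane} (b : ContDiffBump c) (x : Plane) :
    schwartzBump b x = ((b x : ℝ) : ℂ) := rfl

theorem locallyIntegrable_of_forall_integrable_mul {f : Plane → ℂ}
    (h : ∀ v : 𝓢(Plane, ℂ), Integrable (fun x => f x * v x)) : LocallyIntegrable f := by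
  intro x
  let b : ContDiffBump x := ⟨1, 2, by norm_num, by norm_num⟩
  refine ⟨Metric.closedBall x 1, Metric.closedBall_mem_nhds x one_pos, ?_⟩
  refine ((h (schwartzBump b)).integrableOn (s := Metric.closedBall x 1)).congr_fun (fun y hy => ?_)
    measurableSet_closedBall
  simp [schwartzBump_apply, b.one_of_mem_closedBall hy]

theorem Represents.locallyIntegrable {T : 𝓢'(Plane, ℂ)} {f : Plane → ℂ} (h : Represents T f) :
    LocallyIntegrable f :=
  locallyIntegrable_of_forall_integrable_mul fun v => (h v).1

/-- The Schwartz function of a smooth function with compact support. -/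
def ofCompact {g : Plane → ℝ} (hc : HasCompactSupport g)
    (hg : ContDiff ℝ ((⊤ : ℕ∞) : WithTop ℕ∞) g) : 𝓢(Plane, ℂ) :=
  (hc.comp_left (g := fun t : ℝ => (t : ℂ)) Complex.ofReal_zero).toSchwartzMap
    (Complex.ofRealCLM.contDiff.comp hg)

theorem ofCompact_apply {g : Plane → ℝ} (hc : HasCompactSupport g)
    (hg : ContDiff ℝ ((⊤ : ℕ∞) : WithTop ℕ∞) g) (x : Plane) :
    ofCompact hc hg x = ((g x : ℝ) : ℂ) := rfl

theorem hasCompactSupport_ofCompact {g : Plane → ℝ} (hc : HasCompactSupport g)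
    (hg : ContDiff ℝ ((⊤ : ℕ∞) : WithTop ℕ∞) g) : HasCompactSupport (ofCompact hc hg) :=
  hc.comp_left (g := fun t : ℝ => (t : ℂ)) Complex.ofReal_zero

theorem ae_eq_of_forall_integral_eq {f g : Plane → ℂ} (hf : LocallyIntegrable f)
    (hg : LocallyIntegrable g) (h : ∀ v : 𝓢(Plane, ℂ), HasCompactSupport v →
      ∫ x, f x * v x = ∫ x, g x * v x) : f =ᵐ[volume] g := by
  refine ae_eq_of_integral_contDiff_smul_eq hf hg fun φ hφ hc => ?_
  have := h (ofCompact hc hφ) (hasCompactSupport_ofCompact hc hφ)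
  simpa [ofCompact_apply, mul_comm] using this

theorem Represents.ae_eq {T : 𝓢'(Plane, ℂ)} {f g : Plane → ℂ} (hf : Represents T f)
    (hg : Represents T g) : f =ᵐ[volume] g :=
  ae_eq_of_forall_integral_eq hf.locallyIntegrable hg.locallyIntegrable fun v _ => by
    rw [← (hf v).2, ← (hg v).2]

theorem Represents.congr {T : 𝓢'(Plane, ℂ)} {f g : Plane → ℂ} (hf : Represents T f)
    (h : f =ᵐ[volume] g) : Represents T g := by
  intro v
  have h' : (fun x => f x * v x) =ᵐ[volume] fun x => g x * v x := by
    filter_upwards [h] with x hx; rw [hx]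
  exact ⟨(hf v).1.congr h', by rw [(hf v).2, integral_congr_ae h']⟩

theorem Represents.dist_eq {T S : 𝓢'(Plane, ℂ)} {f : Plane → ℂ} (hT : Represents T f)
    (hS : Represents S f) : T = S := by
  ext v; rw [(hT v).2, (hS v).2]

theorem Represents.SmD {T : 𝓢'(Plane, ℂ)} {f g : Plane → ℂ} (hg : g.HasTemperateGrowth)
    (hf : Represents T f) : Represents (SmD g T) (fun x => g x * f x) := by
  intro v
  have h : (fun x => f x * (Sm g v) x) = fun x => g x * f x * v x := by
    ext x
    rw [SchwartzMap.smulLeftCLM_apply_apply hg, smul_eq_mul]; ring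
  rw [← h]
  exact hf (Sm g v)

theorem Represents.add {T S : 𝓢'(Plane, ℂ)} {f g : Plane → ℂ} (hT : Represents T f)
    (hS : Represents S g) : Represents (T + S) (fun x => f x + g x) := by
  intro v
  simp only [add_mul]
  exact ⟨(hT v).1.add (hS v).1, by
    rw [integral_add (hT v).1 (hS v).1, ← (hT v).2, ← (hS v).2]; rfl⟩

theorem represents_coe (u : 𝓢(Plane, ℂ)) : Represents (u : 𝓢'(Plane, ℂ)) u := by
  intro v
  refine ⟨integrable_mul u v, ?_⟩
  simp [mul_comm]

theorem exists_represents_of_memLp {f : Plane → ℂ} (hf : MemLp f 2) :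
    ∃ T : 𝓢'(Plane, ℂ), Represents T f := by
  refine ⟨Lp.toTemperedDistribution (hf.toLp f), fun v => ?_⟩
  have h : Integrable (fun x => f x * v x) := hf.integrable_mul (v.memLp 2 volume)
  refine ⟨h, ?_⟩
  rw [Lp.toTemperedDistribution_apply]
  refine integral_congr_ae ?_
  filter_upwards [hf.coeFn_toLp] with x hx
  rw [hx, smul_eq_mul, mul_comm]

/-- A bounded functional on Schwartz functions is an `L²` function. -/
theorem exists_represents_of_dnorm_lt_top {T : 𝓢'(Plane, ℂ)} (h : dnorm T < ∞) :
    ∃ f : Plane → ℂ, MemLp f 2 ∧ Represents T f ∧ eLpNorm f 2 ≤ dnorm T := by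
  set C := (dnorm T).toReal
  have hC : 0 ≤ C := ENNReal.toReal_nonneg
  have hb : ∀ v, ‖T v‖ ≤ C * l2 v := fun v => by
    have := enorm_le_dnorm T v
    rw [← ENNReal.ofReal_toReal h.ne, ← ENNReal.ofReal_mul hC, ← ofReal_norm] at this
    exact (ENNReal.ofReal_le_ofReal_iff (mul_nonneg hC (l2_nonneg _))).1 this
  -- `T` is bounded for the `L²` norm and extends by density. Riesz' vector enters through its
  -- complex conjugate, the inner product being antilinear in the first argument.
  let e : 𝓢(Plane, ℂ) →ₗ[ℂ] Lp ℂ 2 (volume : Measure Plane) :=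
    (SchwartzMap.toLpCLM ℂ ℂ 2 (volume : Measure Plane)).toLinearMap
  let t : 𝓢(Plane, ℂ) →ₗ[ℂ] ℂ := T.toLinearMap
  have hdense : DenseRange e :=
    SchwartzMap.denseRange_toLpCLM (E := Plane) (F := ℂ) (p := 2) (by simp)
  have hnorm : ∀ v, ‖t v‖ ≤ C * ‖e v‖ := hb
  let Λ := t.extendOfNorm e
  have hΛ : ∀ v, Λ (e v) = t v := LinearMap.extendOfNorm_eq hdense ⟨C, hnorm⟩
  have hΛn : ‖Λ‖ ≤ C := LinearMap.opNorm_extendOfNorm_le hdense hC hnorm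
  let y := (InnerProductSpace.toDual ℂ (Lp ℂ 2 (volume : Measure Plane))).symm Λ
  have hy : ‖y‖ ≤ C := by simpa [y] using hΛn
  have hym : MemLp (y : Plane → ℂ) 2 := Lp.memLp y
  have hcm : MemLp (fun x => star (y x)) 2 := hym.star
  refine ⟨fun x => star (y x), hcm, fun v => ⟨hcm.integrable_mul (v.memLp 2 volume), ?_⟩, ?_⟩
  · have e1 : T v = inner ℂ y (e v) := by
      rw [InnerProductSpace.toDual_symm_apply, hΛ]; rfl
    rw [e1, L2.inner_def]
    refine integral_congr_ae ?_
    filter_upwards [v.coeFn_toLp 2 volume] with x hx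
    change inner ℂ (y x) ((v.toLp 2 volume : Plane → ℂ) x) = _
    rw [hx, RCLike.inner_apply, mul_comm]
    rfl
  · have : eLpNorm (fun x => star (y x)) 2 = eLpNorm y 2 (volume : Measure Plane) := by
      refine eLpNorm_congr_norm_ae (Eventually.of_forall fun x => ?_)
      simp
    rw [this, ← ENNReal.ofReal_toReal h.ne, ← ENNReal.ofReal_toReal (Lp.eLpNorm_ne_top y),
      ← Lp.norm_def]
    exact ENNReal.ofReal_le_ofReal hy

/-- Hölder's inequality in one direction. In the other, a finite `dnorm` produces a Riesz
representative, which agrees with `f` almost everywhere. -/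
theorem dnorm_eq_eLpNorm {T : 𝓢'(Plane, ℂ)} {f : Plane → ℂ} (h : Represents T f) :
    dnorm T = eLpNorm f 2 := by
  have hm : AEStronglyMeasurable f := h.locallyIntegrable.aestronglyMeasurable
  refine le_antisymm (dnorm_le fun v => ?_) ?_
  · rw [(h v).2, enorm_l2]
    refine (enorm_integral_le_lintegral_enorm _).trans ?_
    have := eLpNorm_smul_le_mul_eLpNorm (p := 2) (q := 2) (r := 1)
      (v.continuous.aestronglyMeasurable) hm
    rw [eLpNorm_one_eq_lintegral_enorm] at this
    exact this
  · by_cases hT : dnorm T = ∞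
    · rw [hT]; exact le_top
    obtain ⟨g, _, hg, hle⟩ := exists_represents_of_dnorm_lt_top (lt_top_iff_ne_top.2 hT)
    rw [eLpNorm_congr_ae (h.ae_eq hg)]
    exact hle

theorem eLpNorm_two_eq {f : Plane → ℂ} : eLpNorm f 2 = (∫⁻ x, ‖f x‖ₑ ^ 2) ^ (1 / 2 : ℝ) := by
  rw [eLpNorm_eq_lintegral_rpow_enorm_toReal (by simp) (by simp)]
  simp

theorem eLpNorm_two_sq {f : Plane → ℂ} : eLpNorm f 2 ^ 2 = ∫⁻ x, ‖f x‖ₑ ^ 2 := by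
  rw [eLpNorm_two_eq, ← ENNReal.rpow_natCast, ← ENNReal.rpow_mul]
  norm_num

theorem SmD_wt_cancel (ε s : ℝ) (T : 𝓢'(Plane, ℂ)) : SmD (wt ε s) (SmD (wt ε (-s)) T) = T := by
  ext v
  rw [SmD_apply, SmD_apply, Sm_wt_cancel']

theorem SmD_wt_cancel' (ε s : ℝ) (T : 𝓢'(Plane, ℂ)) : SmD (wt ε (-s)) (SmD (wt ε s) T) = T := by
  simpa using SmD_wt_cancel ε (-s) T

theorem FmD_wt_apply (s : ℝ) (T : 𝓢'(Plane, ℂ)) (v : 𝓢(Plane, ℂ)) :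
    FmD (wt 1 s) T v = T (Fm (wt 1 s) v) := FmD_apply (by fun_prop) (wt_neg_arg 1 s) T v

theorem FmD_wt_cancel (s : ℝ) (T : 𝓢'(Plane, ℂ)) : FmD (wt 1 s) (FmD (wt 1 (-s)) T) = T := by
  ext v
  rw [FmD_wt_apply, FmD_wt_apply, Fm_wt_cancel']

theorem FmD_wt_cancel' (s : ℝ) (T : 𝓢'(Plane, ℂ)) : FmD (wt 1 (-s)) (FmD (wt 1 s) T) = T := by
  simpa using FmD_wt_cancel (-s) T

theorem wt_mul_neg (ε s : ℝ) (x : Plane) : wt ε (-s) x * wt ε s x = 1 := by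
  have := congrFun (wt_mul_wt ε (-s) s) x
  simpa [wt_zero] using this

/-- If `(1 + |εx|²)^{s/2} T` is in `L²`, then `T` is a function. -/
theorem exists_represents_of_dnorm_SmD_lt_top {ε s : ℝ} {T : 𝓢'(Plane, ℂ)}
    (h : dnorm (SmD (wt ε s) T) < ∞) : ∃ f, Represents T f := by
  obtain ⟨g, _, hg, _⟩ := exists_represents_of_dnorm_lt_top h
  refine ⟨fun x => wt ε (-s) x * g x, ?_⟩
  have := hg.SmD (hasTemperateGrowth_wt ε (-s))
  rwa [SmD_wt_cancel'] at this

theorem exists_represents_of_wt {ε s : ℝ} {f : Plane → ℂ}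
    (hf : MemLp (fun x => wt ε s x * f x) 2) : ∃ T : 𝓢'(Plane, ℂ), Represents T f := by
  obtain ⟨T, hT⟩ := exists_represents_of_memLp hf
  refine ⟨SmD (wt ε (-s)) T, ?_⟩
  have := hT.SmD (hasTemperateGrowth_wt ε (-s))
  refine this.congr (Eventually.of_forall fun x => ?_)
  simp only [← mul_assoc, wt_mul_neg, one_mul]

theorem enorm_wt_sq (ε s : ℝ) (x : Plane) :
    ‖wt ε s x‖ₑ ^ 2 = ENNReal.ofReal ((1 + (ε * ‖x‖) ^ 2) ^ s) := by
  rw [← ofReal_norm, norm_wt, ← ENNReal.ofReal_pow (by positivity), ← Real.rpow_natCast,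
    ← Real.rpow_mul (by positivity)]
  norm_num

/-- The Sobolev norm is the `L²` norm of `D_s M_r T`. -/
theorem sobolevNorm_eq (s r : ℝ) (T : 𝓢'(Plane, ℂ)) :
    sobolevNorm s r T = dnorm (SmD (wt (2 * Real.pi) s) (𝓕 (SmD (wt 1 r) T))) := by
  have hw : (fun x : Plane => (((1 + ‖x‖ ^ 2) ^ (r / 2) : ℝ) : ℂ)) = wt 1 r := by
    ext x; simp [wt]
  have hint : ∀ g : Plane → ℂ,
      (∫⁻ ξ, ENNReal.ofReal ((1 + (2 * Real.pi * ‖ξ‖) ^ 2) ^ s) * ‖g ξ‖ₑ ^ 2) ^ (1 / 2 : ℝ) =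
      eLpNorm (fun ξ => wt (2 * Real.pi) s ξ * g ξ) 2 := by
    intro g
    rw [eLpNorm_two_eq]
    congr 2 with ξ
    rw [enorm_mul, mul_pow ‖wt _ _ _‖ₑ, enorm_wt_sq]
  rw [sobolevNorm, hw]
  set U := 𝓕 (SmD (wt 1 r) T)
  refine le_antisymm ?_ ?_
  · by_cases h : dnorm (SmD (wt (2 * Real.pi) s) U) = ∞
    · rw [h]; exact le_top
    obtain ⟨f, hf⟩ := exists_represents_of_dnorm_SmD_lt_top (lt_top_iff_ne_top.2 h)
    refine (iInf₂_le f hf).trans (le_of_eq ?_)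
    rw [hint, dnorm_eq_eLpNorm (hf.SmD (hasTemperateGrowth_wt _ _))]
  · refine le_iInf₂ fun g hg => ?_
    rw [hint, dnorm_eq_eLpNorm (hg.SmD (hasTemperateGrowth_wt _ _))]

theorem dnorm_SmD_wt_le {ε δ : ℝ} (hε : 0 < ε) (hδ : 0 < δ) (s : ℝ) :
    ∃ C : ℝ, 0 < C ∧ ∀ T : 𝓢'(Plane, ℂ),
      dnorm (SmD (wt ε s) T) ≤ ENNReal.ofReal C * dnorm (SmD (wt δ s) T) := by
  obtain ⟨C, hC, hle⟩ := exists_wt_le hε hδ s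
  refine ⟨C, hC, fun T => ?_⟩
  have h := dnorm_SmD_le (g := wt ε s * wt δ (-s)) (h := wt δ s) (by fun_prop) (by fun_prop) hC.le
    (fun x => ?_) T
  · have e : wt ε s * wt δ (-s) * wt δ s = wt ε s := by
      rw [mul_assoc, wt_mul_wt, neg_add_cancel, wt_zero]; ext x; simp
    rwa [e] at h
  · rw [Pi.mul_apply, norm_mul]
    have h1 : ‖wt δ (-s) x‖ * ‖wt δ s x‖ = 1 := by rw [← norm_mul, wt_mul_neg]; simp
    calc ‖wt ε s x‖ * ‖wt δ (-s) x‖ ≤ C * ‖wt δ s x‖ * ‖wt δ (-s) x‖ := by gcongr; exact hle x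
      _ = C * (‖wt δ (-s) x‖ * ‖wt δ s x‖) := by ring
      _ = C := by rw [h1, mul_one]

theorem dnorm_FmD (g : Plane → ℂ) (T : 𝓢'(Plane, ℂ)) : dnorm (FmD g T) = dnorm (SmD g (𝓕 T)) := by
  rw [TemperedDistribution.fourierMultiplierCLM_apply, dnorm_fourierInv]

/-- The two sides differ by the frequency variable, `2πξ` or `ξ`, hence by comparable weights; the
constant does not depend on `r`. -/
theorem exists_sobolevNorm_equiv (s : ℝ) : ∃ C : ℝ, 0 < C ∧ ∀ (r : ℝ) (T : 𝓢'(Plane, ℂ)),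
    sobolevNorm s r T ≤ ENNReal.ofReal C * dnorm (FmD (wt 1 s) (SmD (wt 1 r) T)) ∧
    dnorm (FmD (wt 1 s) (SmD (wt 1 r) T)) ≤ ENNReal.ofReal C * sobolevNorm s r T := by
  obtain ⟨C₁, h₁, e₁⟩ := dnorm_SmD_wt_le (ε := 2 * Real.pi) (δ := 1) (by positivity) one_pos s
  obtain ⟨C₂, h₂, e₂⟩ := dnorm_SmD_wt_le (ε := 1) (δ := 2 * Real.pi) one_pos (by positivity) s
  refine ⟨C₁ + C₂, by positivity, fun r T => ⟨?_, ?_⟩⟩ <;> rw [sobolevNorm_eq, dnorm_FmD]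
  · refine (e₁ _).trans ?_
    gcongr
    linarith
  · refine (e₂ _).trans ?_
    gcongr
    linarith

/-! ### The norm on the surface -/

theorem coe_Sm {g : Plane → ℂ} (hg : g.HasTemperateGrowth) (v : 𝓢(Plane, ℂ)) :
    SmD g (v : 𝓢'(Plane, ℂ)) = (Sm g v : 𝓢(Plane, ℂ)) := by
  ext w
  rw [SmD_apply, SchwartzMap.coe_apply, SchwartzMap.coe_apply]
  refine integral_congr_ae (Eventually.of_forall fun x => ?_)
  simp only [SchwartzMap.smulLeftCLM_apply_apply hg, smul_eq_mul]
  ring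

theorem coe_Fm {g : Plane → ℂ} (hg : g.HasTemperateGrowth) (v : 𝓢(Plane, ℂ)) :
    FmD g (v : 𝓢'(Plane, ℂ)) = (Fm g v : 𝓢(Plane, ℂ)) :=
  TemperedDistribution.fourierMultiplierCLM_toTemperedDistributionCLM_eq hg v

theorem conjTest_Sm {g : Plane → ℂ} (hg : g.HasTemperateGrowth) (hr : ∀ x, star (g x) = g x)
    (v : 𝓢(Plane, ℂ)) : conjTest (Sm g v) = Sm g (conjTest v) := by
  ext x
  simp only [conjTest_apply, SchwartzMap.smulLeftCLM_apply_apply hg, smul_eq_mul, star_mul', hr]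

theorem fourier_conjTest (v : 𝓢(Plane, ℂ)) : 𝓕 (conjTest v) = conjTest (𝓕⁻ v) := by
  ext x
  rw [conjTest_apply, SchwartzMap.fourier_coe, SchwartzMap.fourierInv_coe,
    Real.fourier_eq, Real.fourierInv_eq]
  change _ = (starRingEnd ℂ) _
  rw [← integral_conj]
  refine integral_congr_ae (Eventually.of_forall fun y => ?_)
  simp only [conjTest_apply, Circle.smul_def, smul_eq_mul, map_mul]
  rw [Real.fourierChar_apply, Real.fourierChar_apply, ← Complex.exp_conj]
  simp [Complex.conj_ofNat]

theorem fourierInv_conjTest (v : 𝓢(Plane, ℂ)) : 𝓕⁻ (conjTest v) = conjTest (𝓕 v) := by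
  have h := fourier_conjTest (𝓕 v)
  rw [FourierTransform.fourierInv_fourier_eq] at h
  rw [← h, FourierTransform.fourierInv_fourier_eq]

theorem conjTest_Fm {g : Plane → ℂ} (hg : g.HasTemperateGrowth) (heven : ∀ x, g (-x) = g x)
    (hr : ∀ x, star (g x) = g x) (v : 𝓢(Plane, ℂ)) : conjTest (Fm g v) = Fm g (conjTest v) := by
  rw [← fourier_Sm_fourierInv hg heven v, SchwartzMap.fourierMultiplierCLM_apply, fourier_conjTest,
    ← conjTest_Sm hg hr, fourierInv_conjTest]

theorem star_wt (ε r : ℝ) (x : Plane) : star (wt ε r x) = wt ε r x := by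
  simp [wt]

theorem conjTest_Fm_wt (s : ℝ) (v : 𝓢(Plane, ℂ)) :
    conjTest (Fm (wt 1 s) v) = Fm (wt 1 s) (conjTest v) :=
  conjTest_Fm (by fun_prop) (wt_neg_arg 1 s) (star_wt 1 s) v

theorem conjTest_Sm_wt (s : ℝ) (v : 𝓢(Plane, ℂ)) :
    conjTest (Sm (wt 1 s) v) = Sm (wt 1 s) (conjTest v) :=
  conjTest_Sm (by fun_prop) (star_wt 1 s) v

theorem dnorm_coe_wt (s r : ℝ) (v : 𝓢(Plane, ℂ)) :
    dnorm (FmD (wt 1 s) (SmD (wt 1 r) (v : 𝓢'(Plane, ℂ)))) =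
      ENNReal.ofReal (l2 (Fm (wt 1 s) (Sm (wt 1 r) v))) := by
  rw [coe_Sm (by fun_prop), coe_Fm (by fun_prop), dnorm_coe]

theorem le_mul_of_div_le {a b c : ℝ≥0∞} (hb : b ≠ ∞) (h0 : b = 0 → a = 0) (h : a / b ≤ c) :
    a ≤ c * b := by
  by_cases hb0 : b = 0
  · simp [h0 hb0]
  · exact (ENNReal.div_le_iff hb0 hb).1 h

/-- The dual norm of `H^{-s}_{-r}`, taken over Schwartz functions, is the norm of `H^s_r`. -/
theorem exists_dual_equiv (s r : ℝ) {N : 𝓢(Plane, ℂ) → ℝ≥0∞} {A : ℝ}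
    (h₁ : ∀ v, N v ≤ ENNReal.ofReal A * ENNReal.ofReal (l2 (Fm (wt 1 (-s)) (Sm (wt 1 (-r)) v))))
    (h₂ : ∀ v, ENNReal.ofReal (l2 (Fm (wt 1 (-s)) (Sm (wt 1 (-r)) v))) ≤ ENNReal.ofReal A * N v)
    (T : 𝓢'(Plane, ℂ)) :
    (⨆ v, ‖T (conjTest v)‖ₑ / N v) ≤
        ENNReal.ofReal A * dnorm (FmD (wt 1 s) (SmD (wt 1 r) T)) ∧
      dnorm (FmD (wt 1 s) (SmD (wt 1 r) T)) ≤
        ENNReal.ofReal A * ⨆ v, ‖T (conjTest v)‖ₑ / N v := by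
  have hap : ∀ w, FmD (wt 1 s) (SmD (wt 1 r) T) w = T (Sm (wt 1 r) (Fm (wt 1 s) w)) := fun w => by
    rw [FmD_wt_apply, SmD_apply]
  constructor
  · refine iSup_le fun v => ENNReal.div_le_of_le_mul ?_
    have e : T (conjTest v) = FmD (wt 1 s) (SmD (wt 1 r) T)
        (conjTest (Fm (wt 1 (-s)) (Sm (wt 1 (-r)) v))) := by
      rw [hap, conjTest_Fm_wt, conjTest_Sm_wt, Fm_wt_cancel, Sm_wt_cancel]
    rw [e, mul_comm (ENNReal.ofReal A), mul_assoc]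
    refine (enorm_le_dnorm _ _).trans ?_
    rw [l2_conjTest]
    gcongr
    exact h₂ v
  · refine dnorm_le fun w => ?_
    rw [hap]
    set v := conjTest (Sm (wt 1 r) (Fm (wt 1 s) w)) with hv
    have hw : l2 (Fm (wt 1 (-s)) (Sm (wt 1 (-r)) v)) = l2 w := by
      rw [hv, ← conjTest_Sm_wt, ← conjTest_Fm_wt, l2_conjTest, Sm_wt_cancel', Fm_wt_cancel']
    have hN := h₁ v
    have hN2 := h₂ v
    rw [hw] at hN hN2
    have hd : ‖T (conjTest v)‖ₑ / N v ≤ ⨆ v, ‖T (conjTest v)‖ₑ / N v :=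
      le_iSup (fun v => ‖T (conjTest v)‖ₑ / N v) v
    have h := le_mul_of_div_le (ne_top_of_le_ne_top (by finiteness) hN) (fun h0 => ?_) hd
    · rw [hv, conjTest_conjTest] at h
      refine h.trans ?_
      rw [mul_comm (ENNReal.ofReal A), mul_assoc]
      gcongr
    · rw [h0, mul_zero, nonpos_iff_eq_zero, ENNReal.ofReal_eq_zero] at hN2
      have : w = 0 := l2_eq_zero (le_antisymm hN2 (l2_nonneg w))
      rw [hv, conjTest_conjTest, this]
      simp

variable {Λ : Matrix (Fin 2) (Fin 2) ℝ}

/-- The surface has left no trace: for `s ≥ 0` its norm is the planar one by definition, and for `s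
< 0` it is a dual norm over Schwartz functions, evaluated by `exists_dual_equiv`. -/
theorem exists_surfaceNorm_equiv (S : PeriodicDiffeo Λ) (s r : ℝ) : ∃ C : ℝ, 0 < C ∧
    ∀ T : 𝓢'(Plane, ℂ),
    S.surfaceNorm s r T ≤ ENNReal.ofReal C * dnorm (FmD (wt 1 s) (SmD (wt 1 r) T)) ∧
    dnorm (FmD (wt 1 s) (SmD (wt 1 r) T)) ≤ ENNReal.ofReal C * S.surfaceNorm s r T := by
  by_cases hs : 0 ≤ s
  · obtain ⟨C, hC, h⟩ := exists_sobolevNorm_equiv s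
    refine ⟨C, hC, fun T => ?_⟩
    simp only [PeriodicDiffeo.surfaceNorm, if_pos hs]
    exact h r T
  · obtain ⟨C, hC, h⟩ := exists_sobolevNorm_equiv (-s)
    refine ⟨C, hC, fun T => ?_⟩
    simp only [PeriodicDiffeo.surfaceNorm, if_neg hs]
    refine exists_dual_equiv s r (N := fun v => sobolevNorm (-s) (-r) (v : 𝓢'(Plane, ℂ)))
      (fun v => ?_) (fun v => ?_) T
    · rw [← dnorm_coe_wt]; exact (h (-r) _).1
    · rw [← dnorm_coe_wt]; exact (h (-r) _).2

/-- The `L²` norm is the norm of order zero on the surface. -/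
theorem surfaceNorm_zero_zero (S : PeriodicDiffeo Λ) (T : 𝓢'(Plane, ℂ)) :
    S.surfaceNorm 0 0 T = dnorm T := by
  simp only [PeriodicDiffeo.surfaceNorm, le_refl, if_true]
  rw [sobolevNorm_eq, wt_zero, wt_zero]
  simp [dnorm_fourier]

theorem PeriodicDiffeo.point_injective (S : PeriodicDiffeo Λ) : Function.Injective S.point := by
  intro a b h
  have h1 : S.ζ (embed a) = S.ζ (embed b) := congrArg Subtype.val h
  have h2 := S.ζ.injective h1
  ext i
  have h3 : ∀ k : Fin 3, embed a k = embed b k := fun k => by rw [h2]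
  fin_cases i
  · exact h3 0
  · exact h3 1

/-- Elements of `H^s_r` are functions if `s ≥ 0`, so that the space is described by its norm. -/
theorem mem_sobolev_iff (S : PeriodicDiffeo Λ) (s r : ℝ) (T : 𝓢'(Plane, ℂ)) :
    T ∈ S.sobolev s r ↔ S.surfaceNorm s r T < ∞ := by
  refine ⟨fun h => h.2, fun h => ⟨fun hs => ?_, h⟩⟩
  obtain ⟨C, hC, hN⟩ := exists_surfaceNorm_equiv S s r
  have h1 : dnorm (FmD (wt 1 s) (SmD (wt 1 r) T)) < ∞ :=
    ((hN T).2).trans_lt (ENNReal.mul_lt_top ENNReal.ofReal_lt_top h)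
  -- For `s ≥ 0` the operator `D_{-s}` contracts `L²`, so `M_r T` itself is in `L²` and `T` is a
  -- function.
  have h2 : dnorm (SmD (wt 1 r) T) < ∞ := by
    refine lt_of_le_of_lt (dnorm_le fun v => ?_) h1
    have e : SmD (wt 1 r) T v = FmD (wt 1 s) (SmD (wt 1 r) T) (Fm (wt 1 (-s)) v) := by
      rw [FmD_wt_apply, Fm_wt_cancel]
    rw [e]
    refine (enorm_le_dnorm _ _).trans ?_
    gcongr
    have := l2_le_l2_Fm_wt hs (Fm (wt 1 (-s)) v)
    rwa [Fm_wt_cancel] at this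
  obtain ⟨f, hf⟩ := exists_represents_of_dnorm_SmD_lt_top h2
  -- Injectivity of the parametrization lets a function on the plane be read on the surface.
  refine ⟨fun x => f (Function.invFun S.point x), ?_⟩
  have : (fun y => S.liftFactor s y * f (Function.invFun S.point (S.point y))) = f := by
    ext y
    rw [Function.leftInverse_invFun S.point_injective y]
    simp [PeriodicDiffeo.liftFactor, hs]
  rw [PeriodicDiffeo.IsLift, this]
  exact hf

/-! ### Lattices -/

theorem mulPt_add (A : Matrix (Fin 2) (Fin 2) ℝ) (μ ν : Fin 2 → ℝ) :
    mulPt A (μ + ν) = mulPt A μ + mulPt A ν := by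
  rw [mulPt, Matrix.mulVec_add]
  rfl

theorem latt_add (A : Matrix (Fin 2) (Fin 2) ℝ) (j k : Idx) :
    latt A (j + k) = latt A j + latt A k := by
  simp only [latt, ← mulPt_add]
  congr 1
  ext i
  simp

theorem latt_zero (A : Matrix (Fin 2) (Fin 2) ℝ) : latt A 0 = 0 := by
  have h := latt_add A 0 0
  simpa using h

theorem latt_neg (A : Matrix (Fin 2) (Fin 2) ℝ) (j : Idx) : latt A (-j) = -latt A j := by
  have h := latt_add A j (-j)
  rw [add_neg_cancel, latt_zero] at h
  exact eq_neg_of_add_eq_zero_right h.symm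

theorem latt_sub (A : Matrix (Fin 2) (Fin 2) ℝ) (j k : Idx) :
    latt A (j - k) = latt A j - latt A k := by
  rw [sub_eq_add_neg, latt_add, latt_neg, sub_eq_add_neg]

/-- `μ ↦ A μ` as a linear equivalence. -/
def mulPtEquiv {A : Matrix (Fin 2) (Fin 2) ℝ} (hA : IsUnit A.det) : (Fin 2 → ℝ) ≃L[ℝ] Plane :=
  ((A.toLinearEquiv' (A.invertibleOfIsUnitDet hA)).trans
    (WithLp.linearEquiv 2 ℝ (Fin 2 → ℝ)).symm).toContinuousLinearEquiv

theorem mulPtEquiv_apply {A : Matrix (Fin 2) (Fin 2) ℝ} (hA : IsUnit A.det) (μ : Fin 2 → ℝ) :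
    mulPtEquiv hA μ = mulPt A μ := rfl

theorem continuous_mulPt (A : Matrix (Fin 2) (Fin 2) ℝ) : Continuous (mulPt A) := by
  unfold mulPt
  fun_prop

theorem map_mulPt {A : Matrix (Fin 2) (Fin 2) ℝ} (hA : IsUnit A.det) :
    Measure.map (mulPt A) volume = ENNReal.ofReal |A.det⁻¹| • (volume : Measure Plane) := by
  have h := Real.map_matrix_volume_pi_eq_smul_volume_pi hA.ne_zero
  have e : mulPt A = WithLp.toLp 2 ∘ (Matrix.toLin' A) := rfl
  rw [e, ← Measure.map_map (by fun_prop) (LinearMap.continuous_of_finiteDimensional _).measurable,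
    h, Measure.map_smul, (PiLp.volume_preserving_toLp (Fin 2)).map_eq]

/-- The half-open unit cube centred at the origin. -/
def unitCube : Set (Fin 2 → ℝ) := {μ | ∀ i, μ i ∈ Set.Ioc (-1 / 2 : ℝ) (-1 / 2 + 1)}

theorem cell_eq (A : Matrix (Fin 2) (Fin 2) ℝ) : cell A = mulPt A '' unitCube := by
  ext x
  simp only [cell, unitCube, Set.mem_ofPred_eq, Set.mem_image, Set.mem_Ioc]
  norm_num
  constructor <;> rintro ⟨μ, h, rfl⟩ <;> exact ⟨μ, h, rfl⟩

theorem measurableSet_unitCube : MeasurableSet unitCube := by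
  have h : unitCube = Set.univ.pi fun _ : Fin 2 => Set.Ioc (-1 / 2 : ℝ) (-1 / 2 + 1) := by
    ext; simp [unitCube]
  rw [h]
  exact MeasurableSet.univ_pi fun _ => measurableSet_Ioc

theorem cell_eq_preimage {A : Matrix (Fin 2) (Fin 2) ℝ} (hA : IsUnit A.det) :
    cell A = (mulPtEquiv hA).symm ⁻¹' unitCube := by
  rw [cell_eq, ← ContinuousLinearEquiv.image_eq_preimage_symm]
  rfl

theorem measurableSet_cell {A : Matrix (Fin 2) (Fin 2) ℝ} (hA : IsUnit A.det) :
    MeasurableSet (cell A) := by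
  rw [cell_eq_preimage hA]
  exact (mulPtEquiv hA).symm.continuous.measurable measurableSet_unitCube

theorem mem_cell_iff {A : Matrix (Fin 2) (Fin 2) ℝ} (hA : IsUnit A.det) (μ : Fin 2 → ℝ) :
    mulPt A μ ∈ cell A ↔ μ ∈ unitCube := by
  rw [cell_eq_preimage hA, Set.mem_preimage, ← mulPtEquiv_apply hA,
    ContinuousLinearEquiv.symm_apply_apply]

theorem volume_cell_lt_top {A : Matrix (Fin 2) (Fin 2) ℝ} : volume (cell A) < ∞ := by
  have hb : unitCube ⊆ Set.Icc (fun _ => -1 / 2) (fun _ => -1 / 2 + 1) := fun μ h =>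
    ⟨fun i => (h i).1.le, fun i => (h i).2⟩
  have : IsCompact (mulPt A '' Set.Icc (fun _ => -1 / 2) (fun _ => -1 / 2 + 1)) :=
    isCompact_Icc.image (continuous_mulPt A)
  rw [cell_eq]
  exact (measure_mono (Set.image_mono hb)).trans_lt this.measure_lt_top

theorem isBounded_cell (A : Matrix (Fin 2) (Fin 2) ℝ) : Bornology.IsBounded (cell A) := by
  have hb : unitCube ⊆ Set.Icc (fun _ => -1 / 2) (fun _ => -1 / 2 + 1) := fun μ h =>
    ⟨fun i => (h i).1.le, fun i => (h i).2⟩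
  have : IsCompact (mulPt A '' Set.Icc (fun _ => -1 / 2) (fun _ => -1 / 2 + 1)) :=
    isCompact_Icc.image (continuous_mulPt A)
  rw [cell_eq]
  exact this.isBounded.subset (Set.image_mono hb)

/-- The translates of a cell by the lattice tile the plane. -/
theorem existsUnique_sub_latt_mem_cell {A : Matrix (Fin 2) (Fin 2) ℝ} (hA : IsUnit A.det)
    (x : Plane) : ∃! m : Idx, x - latt A m ∈ cell A := by
  obtain ⟨μ, rfl⟩ := (mulPtEquiv hA).surjective x
  rw [mulPtEquiv_apply]
  have key : ∀ m : Idx, mulPt A μ - latt A m ∈ cell A ↔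
      ∀ i, μ i + (-m i) • (1 : ℝ) ∈ Set.Ioc (-1 / 2 : ℝ) (-1 / 2 + 1) := by
    intro m
    have : mulPt A μ - latt A m = mulPt A (fun i => μ i + (-m i) • (1 : ℝ)) := by
      rw [sub_eq_iff_eq_add, latt, ← mulPt_add]
      congr 1
      ext i
      simp
    rw [this, mem_cell_iff hA]
    rfl
  simp only [key]
  choose n hn hu using fun i => existsUnique_add_zsmul_mem_Ioc (one_pos (α := ℝ)) (μ i) (-1 / 2)
  refine ⟨fun i => -n i, fun i => ?_, fun m hm => ?_⟩
  · simpa using hn i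
  · ext i
    have := hu i (-m i) (hm i)
    simp [← this]

theorem iUnion_cell {A : Matrix (Fin 2) (Fin 2) ℝ} (hA : IsUnit A.det) :
    ⋃ m : Idx, (fun x => x - latt A m) ⁻¹' cell A = Set.univ :=
  Set.eq_univ_of_forall fun x => Set.mem_iUnion.2 (existsUnique_sub_latt_mem_cell hA x).exists

theorem pairwise_disjoint_cell {A : Matrix (Fin 2) (Fin 2) ℝ} (hA : IsUnit A.det) :
    Pairwise (Function.onFun Disjoint fun m : Idx => (fun x => x - latt A m) ⁻¹' cell A) := by
  intro m n hmn
  refine Set.disjoint_left.2 fun x hm hn => hmn ?_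
  exact (existsUnique_sub_latt_mem_cell hA x).unique hm hn

theorem measurableSet_preimage_cell {A : Matrix (Fin 2) (Fin 2) ℝ} (hA : IsUnit A.det) (m : Idx) :
    MeasurableSet ((fun x => x - latt A m) ⁻¹' cell A) :=
  (measurable_id.sub_const _) (measurableSet_cell hA)

theorem preimage_sub_image (s : Set Plane) (a : Plane) :
    (fun x => x + a) ⁻¹' ((fun x => x - a) ⁻¹' s) = s := by
  ext x; simp

theorem lintegral_eq_tsum_cell {A : Matrix (Fin 2) (Fin 2) ℝ} (hA : IsUnit A.det)
    (f : Plane → ℝ≥0∞) :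
    ∫⁻ x, f x = ∑' m : Idx, ∫⁻ x in cell A, f (x + latt A m) := by
  rw [← setLIntegral_univ, ← iUnion_cell hA, lintegral_iUnion (measurableSet_preimage_cell hA)
    (pairwise_disjoint_cell hA)]
  refine tsum_congr fun m => ?_
  have := (measurePreserving_add_right (volume : Measure Plane)
    (latt A m)).setLIntegral_comp_preimage_emb (measurableEmbedding_addRight _) f
      ((fun x => x - latt A m) ⁻¹' cell A)
  rw [← this, preimage_sub_image]

theorem hasSum_integral_cell {A : Matrix (Fin 2) (Fin 2) ℝ} (hA : IsUnit A.det)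
    {E : Type*} [NormedAddCommGroup E] [NormedSpace ℝ E] {f : Plane → E} (hf : Integrable f) :
    HasSum (fun m : Idx => ∫ x in cell A, f (x + latt A m)) (∫ x, f x) := by
  have h := hasSum_integral_iUnion (μ := volume) (f := f) (measurableSet_preimage_cell hA)
    (pairwise_disjoint_cell hA) hf.integrableOn
  rw [iUnion_cell hA, setIntegral_univ] at h
  refine h.congr_fun fun m => ?_
  have := (measurePreserving_add_right (volume : Measure Plane)
    (latt A m)).setIntegral_preimage_emb (measurableEmbedding_addRight _) f
      ((fun x => x - latt A m) ⁻¹' cell A)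
  rw [← this, preimage_sub_image]

theorem lintegral_tsum_cell {A : Matrix (Fin 2) (Fin 2) ℝ} (hA : IsUnit A.det)
    {f : Plane → ℝ≥0∞} (hf : AEMeasurable f) :
    ∫⁻ x in cell A, ∑' m : Idx, f (x + latt A m) = ∫⁻ x, f x := by
  rw [lintegral_eq_tsum_cell hA, lintegral_tsum fun m => ?_]
  exact (hf.comp_quasiMeasurePreserving
    (measurePreserving_add_right volume (latt A m)).quasiMeasurePreserving).restrict

theorem integral_tsum_cell {A : Matrix (Fin 2) (Fin 2) ℝ} (hA : IsUnit A.det)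
    {f : Plane → ℂ} (hf : Integrable f) :
    ∫ x in cell A, ∑' m : Idx, f (x + latt A m) = ∫ x, f x := by
  rw [integral_tsum (fun m => (hf.comp_add_right _).aestronglyMeasurable.restrict) ?_]
  · exact (hasSum_integral_cell hA hf).tsum_eq
  · rw [← lintegral_eq_tsum_cell hA (fun x => ‖f x‖ₑ)]
    exact hf.2.ne

theorem exists_norm_le_latt {A : Matrix (Fin 2) (Fin 2) ℝ} (hA : IsUnit A.det) :
    ∃ c : ℝ, 0 < c ∧ ∀ j : Idx, ‖j‖ ≤ c * ‖latt A j‖ := by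
  refine ⟨‖((mulPtEquiv hA).symm : Plane →L[ℝ] (Fin 2 → ℝ))‖ + 1, by positivity, fun j => ?_⟩
  have h := ((mulPtEquiv hA).symm : Plane →L[ℝ] (Fin 2 → ℝ)).le_opNorm (latt A j)
  have e : ((mulPtEquiv hA).symm : Plane →L[ℝ] (Fin 2 → ℝ)) (latt A j) = fun i => (j i : ℝ) := by
    have : latt A j = mulPtEquiv hA (fun i => (j i : ℝ)) := rfl
    rw [this]
    exact (mulPtEquiv hA).symm_apply_apply _
  rw [e] at h
  have h2 : ‖j‖ ≤ ‖fun i => (j i : ℝ)‖ := by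
    refine (pi_norm_le_iff_of_nonneg (norm_nonneg _)).2 fun i => ?_
    have := norm_le_pi_norm (fun i => (j i : ℝ)) i
    rwa [← Int.norm_cast_real]
  nlinarith [norm_nonneg (latt A j)]

/-- Comparison with the Eisenstein series: the exponent 3 exceeds the dimension 2. The lattice sums
of Schwartz functions below converge by this. -/
theorem summable_latt {A : Matrix (Fin 2) (Fin 2) ℝ} (hA : IsUnit A.det) :
    Summable fun j : Idx => ((1 + ‖latt A j‖) ^ 3)⁻¹ := by
  obtain ⟨c, hc, h⟩ := exists_norm_le_latt hA
  have hs := (EisensteinSeries.summable_one_div_norm_rpow (k := 3) (by norm_num)).mul_left (c ^ 3)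
  refine Summable.of_norm_bounded_eventually hs ?_
  -- The comparison divides by `‖j‖`, so the origin is left out.
  filter_upwards [(Set.finite_singleton (0 : Idx)).compl_mem_cofinite] with j hj
  have hj0 : 0 < ‖j‖ := norm_pos_iff.2 hj
  have h1 := h j
  rw [Real.norm_of_nonneg (by positivity), Real.rpow_neg hj0.le]
  norm_cast
  rw [← div_eq_mul_inv, le_div_iff₀ (by positivity), inv_mul_le_iff₀ (by positivity), mul_comm,
    ← mul_pow]
  gcongr
  nlinarith

/-! ### Phases -/

theorem phase_add_left (a b x : Plane) : phase (a + b) x = phase a x * phase b x := by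
  simp [phase, inner_add_left, mul_add, Complex.exp_add]

theorem phase_add_right (a x y : Plane) : phase a (x + y) = phase a x * phase a y := by
  simp [phase, inner_add_right, mul_add, Complex.exp_add]

theorem phase_zero_right (x : Plane) : phase x 0 = 1 := by simp [phase]

theorem phase_neg_right (a x : Plane) : phase a (-x) = phase (-a) x := by simp [phase]

theorem norm_phase (a x : Plane) : ‖phase a x‖ = 1 := by
  rw [phase, mul_comm, Complex.norm_exp_ofReal_mul_I]

theorem star_phase (a x : Plane) : star (phase a x) = phase (-a) x := by
  change (starRingEnd ℂ) _ = _
  rw [phase, ← Complex.exp_conj]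
  simp [phase]

theorem continuous_phase (x : Plane) : Continuous fun a : Plane => phase a x := by
  unfold phase
  fun_prop

theorem det_dualMat (Λ : Matrix (Fin 2) (Fin 2) ℝ) : (dualMat Λ).det = (2 * Real.pi) ^ 2 * Λ.det⁻¹ := by
  rw [dualMat, Matrix.det_smul, Fintype.card_fin, Matrix.det_nonsing_inv, Matrix.det_transpose,
    Ring.inverse_eq_inv']

theorem isUnit_det_dualMat (hΛ : IsUnit Λ.det) : IsUnit (dualMat Λ).det := by
  rw [det_dualMat Λ]
  have := hΛ.ne_zero
  exact IsUnit.mk0 _ (by positivity)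

theorem inner_dual (hΛ : IsUnit Λ.det) (μ ν : Fin 2 → ℝ) :
    inner ℝ (mulPt (dualMat Λ) μ) (mulPt Λ ν) = 2 * Real.pi * ∑ i, μ i * ν i := by
  have h : inner ℝ (mulPt (dualMat Λ) μ) (mulPt Λ ν) =
      (Matrix.mulVec (dualMat Λ) μ) ⬝ᵥ (Matrix.mulVec Λ ν) := by
    simp [mulPt, PiLp.inner_apply, dotProduct, mul_comm]
  rw [h, Matrix.dotProduct_mulVec, ← Matrix.mulVec_transpose, dualMat, Matrix.smul_mulVec,
    Matrix.mulVec_smul, Matrix.mulVec_mulVec, Matrix.mul_nonsing_inv _ (by simpa using hΛ),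
    Matrix.one_mulVec, smul_dotProduct]
  rfl

theorem phase_latt_latt (hΛ : IsUnit Λ.det) (m j : Idx) :
    phase (latt (dualMat Λ) m) (latt Λ j) = 1 := by
  rw [phase, latt, latt, inner_dual hΛ]
  have h : (Complex.I * ((2 * Real.pi * ∑ i, (m i : ℝ) * (j i : ℝ) : ℝ) : ℂ)) =
      ((∑ i, m i * j i : ℤ) : ℂ) * (2 * Real.pi * Complex.I) := by
    push_cast; ring
  rw [h, Complex.exp_int_mul_two_pi_mul_I]

theorem phase_add_latt (hΛ : IsUnit Λ.det) (a : Plane) (m j : Idx) :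
    phase (a + latt (dualMat Λ) m) (latt Λ j) = phase a (latt Λ j) := by
  rw [phase_add_left, phase_latt_latt hΛ, mul_one]

theorem blochConst_ne_zero (hΛ : IsUnit Λ.det) : blochConst Λ ≠ 0 := by
  have := hΛ.ne_zero
  have h : 0 < Real.sqrt |Λ.det| / (2 * Real.pi) :=
    div_pos (Real.sqrt_pos.2 (abs_pos.2 this)) (by positivity)
  exact Complex.ofReal_ne_zero.2 h.ne'

/-- The square is the reciprocal of the area of `W*`; hence `blochConst` normalizes the phases on
the dual cell. -/
theorem blochConst_sq (Λ : Matrix (Fin 2) (Fin 2) ℝ) :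
    blochConst Λ ^ 2 = ((|(dualMat Λ).det⁻¹| : ℝ) : ℂ) := by
  rw [blochConst, ← Complex.ofReal_pow, div_pow, Real.sq_sqrt (abs_nonneg _), det_dualMat Λ,
    mul_inv, inv_inv, abs_mul, abs_of_pos (by positivity : (0 : ℝ) < ((2 * Real.pi) ^ 2)⁻¹)]
  congr 1
  field_simp

theorem star_blochConst (Λ : Matrix (Fin 2) (Fin 2) ℝ) : star (blochConst Λ) = blochConst Λ := by
  simp [blochConst]

theorem iteratedDeriv_cexp_I (n : ℕ) : iteratedDeriv n (fun t : ℝ => Complex.exp (Complex.I * t)) =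
    fun t : ℝ => Complex.I ^ n * Complex.exp (Complex.I * t) := by
  induction n with
  | zero => simp
  | succ n ih =>
    rw [iteratedDeriv_succ, ih]
    ext t
    have h : HasDerivAt (fun t : ℝ => Complex.I * (t : ℂ)) Complex.I t := by
      simpa using (Complex.ofRealCLM.hasDerivAt (x := t)).const_mul Complex.I
    rw [((h.cexp).const_mul (Complex.I ^ n)).deriv]
    ring

theorem hasTemperateGrowth_cexp_I :
    (fun t : ℝ => Complex.exp (Complex.I * t)).HasTemperateGrowth := by
  refine ⟨(contDiff_const.mul Complex.ofRealCLM.contDiff).cexp, fun n => ⟨0, 1, fun t => ?_⟩⟩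
  rw [norm_iteratedFDeriv_eq_norm_iteratedDeriv, iteratedDeriv_cexp_I, norm_mul, norm_pow,
    Complex.norm_I, mul_comm Complex.I, Complex.norm_exp_ofReal_mul_I]
  simp

/-- The map `a ↦ exp(i a·x)` is of temperate growth. -/
@[fun_prop]
theorem hasTemperateGrowth_phase (x : Plane) :
    (fun a : Plane => phase a x).HasTemperateGrowth :=
  hasTemperateGrowth_cexp_I.comp (Function.hasTemperateGrowth_inner_left x)

/-! ### Series of Schwartz functions -/

/-- Absolute convergence in every seminorm allows termwise differentiation, and the tails of these
series bound the seminorms of the remainder. -/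
theorem exists_hasSum_schwartz {ι : Type*} (f : ι → 𝓢(Plane, ℂ))
    (h : ∀ k n, Summable fun i => SchwartzMap.seminorm ℂ k n (f i)) : ∃ F, HasSum f F := by
  have hb : ∀ k n i x, ‖x‖ ^ k * ‖iteratedFDeriv ℝ n (f i) x‖ ≤ SchwartzMap.seminorm ℂ k n (f i) :=
    fun k n i x => SchwartzMap.le_seminorm ℂ k n (f i) x
  have hb0 : ∀ n i x, ‖iteratedFDeriv ℝ n (f i) x‖ ≤ SchwartzMap.seminorm ℂ 0 n (f i) :=
    fun n i x => SchwartzMap.norm_iteratedFDeriv_le_seminorm ℂ (f i) n x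
  have hD : ∀ (n : ℕ) x, iteratedFDeriv ℝ n (fun y => ∑' i, f i y) x =
      ∑' i, iteratedFDeriv ℝ n (f i) x := fun n x =>
    iteratedFDeriv_tsum_apply (N := ⊤) (fun i => (f i).smooth ⊤) (fun n _ => h 0 n)
      (fun n i x _ => hb0 n i x) le_top x
  have hsum : ∀ n x, Summable fun i => iteratedFDeriv ℝ n (f i) x := fun n x =>
    Summable.of_norm_bounded (h 0 n) (fun i => hb0 n i x)
  have tail : ∀ (s : Finset ι) k n x, ‖x‖ ^ k * ‖∑' i : {i // i ∉ s}, iteratedFDeriv ℝ n (f i) x‖ ≤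
      ∑' i : {i // i ∉ s}, SchwartzMap.seminorm ℂ k n (f i) := by
    intro s k n x
    have h1 : Summable fun i : {i // i ∉ s} => ‖x‖ ^ k * ‖iteratedFDeriv ℝ n (f i) x‖ :=
      Summable.of_nonneg_of_le (fun i => by positivity) (fun i => hb k n i x)
        ((h k n).subtype _)
    have h2 : Summable fun i : {i // i ∉ s} => ‖iteratedFDeriv ℝ n (f i) x‖ :=
      Summable.of_nonneg_of_le (fun i => by positivity) (fun i => hb0 n i x)
        ((h 0 n).subtype _)
    calc _ ≤ ‖x‖ ^ k * ∑' i : {i // i ∉ s}, ‖iteratedFDeriv ℝ n (f i) x‖ := by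
          gcongr; exact norm_tsum_le_tsum_norm h2
      _ = ∑' i : {i // i ∉ s}, ‖x‖ ^ k * ‖iteratedFDeriv ℝ n (f i) x‖ := tsum_mul_left.symm
      _ ≤ _ := h1.tsum_le_tsum (fun i => hb k n i x) ((h k n).subtype _)
  have decay : ∀ k n x, ‖x‖ ^ k * ‖iteratedFDeriv ℝ n (fun y => ∑' i, f i y) x‖ ≤
      ∑' i, SchwartzMap.seminorm ℂ k n (f i) := by
    intro k n x
    have h1 : Summable fun i => ‖x‖ ^ k * ‖iteratedFDeriv ℝ n (f i) x‖ :=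
      Summable.of_nonneg_of_le (fun i => by positivity) (fun i => hb k n i x) (h k n)
    rw [hD]
    calc _ ≤ ‖x‖ ^ k * ∑' i, ‖iteratedFDeriv ℝ n (f i) x‖ := by
          gcongr; exact norm_tsum_le_tsum_norm (Summable.of_nonneg_of_le (fun i => by positivity)
            (fun i => hb0 n i x) (h 0 n))
      _ = ∑' i, ‖x‖ ^ k * ‖iteratedFDeriv ℝ n (f i) x‖ := tsum_mul_left.symm
      _ ≤ _ := h1.tsum_le_tsum (fun i => hb k n i x) (h k n)
  let F : 𝓢(Plane, ℂ) :=
    { toFun := fun y => ∑' i, f i y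
      smooth' := contDiff_tsum (N := ⊤) (fun i => (f i).smooth ⊤) (fun n _ => h 0 n)
        (fun n i x _ => hb0 n i x)
      decay' := fun k n => ⟨_, decay k n⟩ }
  refine ⟨F, ?_⟩
  rw [HasSum, SummationFilter.unconditional_filter,
    (schwartz_withSeminorms ℂ Plane ℂ).tendsto_nhds]
  rintro ⟨k, n⟩ ε hε
  have ht := tendsto_tsum_compl_atTop_zero (fun i => SchwartzMap.seminorm ℂ k n (f i))
  filter_upwards [ht.eventually (gt_mem_nhds hε)] with s hs
  refine lt_of_le_of_lt ?_ hs
  rw [SchwartzMap.schwartzSeminormFamily_apply]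
  refine SchwartzMap.seminorm_le_bound ℂ k n _ (tsum_nonneg fun i => apply_nonneg _ _) fun x => ?_
  refine le_trans (le_of_eq ?_) (tail s k n x)
  congr 1
  rw [← norm_neg]
  congr 1
  have e : ((∑ i ∈ s, f i - F : 𝓢(Plane, ℂ)) : Plane → ℂ) =
      (fun y => ∑ i ∈ s, f i y) - (F : Plane → ℂ) := by
    ext y
    rw [sub_apply, sum_apply]
    rfl
  rw [e, iteratedFDeriv_sub_apply (ContDiffAt.sum fun i _ => ((f i).smooth n).contDiffAt)
    ((F.smooth n).contDiffAt),
    show iteratedFDeriv ℝ n F x = _ from hD n x, iteratedFDeriv_sum (fun i _ => (f i).smooth n),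
    ← (hsum n x).sum_add_tsum_subtype_compl s]
  simp

/-! ### Seminorm estimates for translates and products -/

/-- The seminorms that define the topology of the Schwartz space, in increasing order. -/
def pn (m : ℕ) : Seminorm ℂ 𝓢(Plane, ℂ) :=
  (Finset.Iic (m, m)).sup (schwartzSeminormFamily ℂ Plane ℂ)

theorem seminorm_le_pn {k n m : ℕ} (hk : k ≤ m) (hn : n ≤ m) (v : 𝓢(Plane, ℂ)) :
    SchwartzMap.seminorm ℂ k n v ≤ pn m v :=
  (Finset.le_sup (f := schwartzSeminormFamily ℂ Plane ℂ) (b := (k, n))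
    (Finset.mem_Iic.2 (Prod.mk_le_mk.2 ⟨hk, hn⟩)) : _) v

theorem pn_le {m : ℕ} {v : 𝓢(Plane, ℂ)} {B : ℝ} (hB : 0 ≤ B)
    (h : ∀ k ≤ m, ∀ n ≤ m, SchwartzMap.seminorm ℂ k n v ≤ B) : pn m v ≤ B := by
  refine Seminorm.finset_sup_apply_le hB fun i hi => ?_
  have := Finset.mem_Iic.1 hi
  exact h i.1 this.1 i.2 this.2

theorem pn_mono {m n : ℕ} (h : m ≤ n) (v : 𝓢(Plane, ℂ)) : pn m v ≤ pn n v :=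
  pn_le (apply_nonneg _ _) fun _ hk _ hl => seminorm_le_pn (hk.trans h) (hl.trans h) v

theorem sup_le_pn (s : Finset (ℕ × ℕ)) : ∃ m, ∀ v,
    s.sup (schwartzSeminormFamily ℂ Plane ℂ) v ≤ pn m v := by
  refine ⟨s.sup fun p => max p.1 p.2, fun v => Seminorm.finset_sup_apply_le (apply_nonneg _ _)
    fun i hi => seminorm_le_pn ?_ ?_ v⟩
  · exact (le_max_left _ _).trans (Finset.le_sup (f := fun p : ℕ × ℕ => max p.1 p.2) hi)
  · exact (le_max_right _ _).trans (Finset.le_sup (f := fun p : ℕ × ℕ => max p.1 p.2) hi)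

theorem one_add_pow_mul_le_pn (m : ℕ) (v : 𝓢(Plane, ℂ)) (x : Plane) {n : ℕ} (hn : n ≤ m) :
    (1 + ‖x‖) ^ m * ‖iteratedFDeriv ℝ n v x‖ ≤ 2 ^ m * pn m v :=
  SchwartzMap.one_add_le_sup_seminorm_apply (𝕜 := ℂ) (m := (m, m)) le_rfl hn v x

theorem one_add_pow_mul_norm_le_pn (m : ℕ) (v : 𝓢(Plane, ℂ)) (x : Plane) :
    (1 + ‖x‖) ^ m * ‖v x‖ ≤ 2 ^ m * pn m v := by
  simpa using one_add_pow_mul_le_pn m v x (Nat.zero_le m)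

theorem exists_norm_le_pn (T : 𝓢'(Plane, ℂ)) : ∃ (m : ℕ) (C : ℝ), 0 < C ∧
    ∀ v, ‖T v‖ ≤ C * pn m v := by
  have hT : Continuous fun v => T v := T.continuous
  obtain ⟨s, C, hC, h⟩ := Seminorm.bound_of_continuous (schwartz_withSeminorms ℂ Plane ℂ)
    ((normSeminorm ℂ ℂ).comp T.toLinearMap) (continuous_norm.comp hT)
  obtain ⟨m, hm⟩ := sup_le_pn s
  refine ⟨m, C, NNReal.coe_pos.2 (pos_iff_ne_zero.2 hC), fun v => (h v).trans ?_⟩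
  change (C : ℝ) * _ ≤ _
  gcongr
  exact hm v

theorem transl_apply (a : Plane) (v : 𝓢(Plane, ℂ)) (x : Plane) : transl a v x = v (x - a) := rfl

theorem transl_transl (a b : Plane) (v : 𝓢(Plane, ℂ)) : transl a (transl b v) = transl (a + b) v := by
  ext x
  simp only [transl_apply]
  congr 1
  abel

theorem transl_zero (v : 𝓢(Plane, ℂ)) : transl 0 v = v := by
  ext x
  simp [transl_apply]

theorem iteratedFDeriv_transl (n : ℕ) (a : Plane) (v : 𝓢(Plane, ℂ)) (x : Plane) :
    iteratedFDeriv ℝ n (transl a v) x = iteratedFDeriv ℝ n v (x - a) :=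
  iteratedFDeriv_comp_sub n a x

theorem one_add_norm_le (x a : Plane) : 1 + ‖x‖ ≤ (1 + ‖a‖) * (1 + ‖x - a‖) := by
  have : ‖x‖ ≤ ‖x - a‖ + ‖a‖ := by simpa using norm_add_le (x - a) a
  nlinarith [norm_nonneg a, norm_nonneg (x - a)]

/-- From `1 + |x| ≤ (1 + |a|)(1 + |x - a|)`. A translation costs only a power of `|a|`, which
rapidly decaying coefficients compensate. -/
theorem pn_transl_le (m : ℕ) (a : Plane) (v : 𝓢(Plane, ℂ)) :
    pn m (transl a v) ≤ 2 ^ m * (1 + ‖a‖) ^ m * pn m v := by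
  refine pn_le (by positivity) fun k hk n hn => ?_
  refine SchwartzMap.seminorm_le_bound ℂ k n _ (by positivity) fun x => ?_
  rw [iteratedFDeriv_transl]
  have h1 : ‖x‖ ^ k ≤ (1 + ‖a‖) ^ m * (1 + ‖x - a‖) ^ m := by
    calc ‖x‖ ^ k ≤ (1 + ‖x‖) ^ k := by gcongr; linarith
      _ ≤ (1 + ‖x‖) ^ m := pow_le_pow_right₀ (by linarith [norm_nonneg x]) hk
      _ ≤ ((1 + ‖a‖) * (1 + ‖x - a‖)) ^ m := by gcongr; exact one_add_norm_le x a
      _ = _ := mul_pow _ _ _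
  calc _ ≤ (1 + ‖a‖) ^ m * (1 + ‖x - a‖) ^ m * ‖iteratedFDeriv ℝ n v (x - a)‖ := by gcongr
    _ = (1 + ‖a‖) ^ m * ((1 + ‖x - a‖) ^ m * ‖iteratedFDeriv ℝ n v (x - a)‖) := by ring
    _ ≤ (1 + ‖a‖) ^ m * (2 ^ m * pn m v) :=
        mul_le_mul_of_nonneg_left (one_add_pow_mul_le_pn m v _ hn) (by positivity)
    _ = _ := by ring

/-- A product of a Schwartz function and a translate decays rapidly in the translation. -/
theorem exists_seminorm_mul_transl_le (u v : 𝓢(Plane, ℂ)) (k n : ℕ) : ∃ C : ℝ, ∀ a : Plane,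
    SchwartzMap.seminorm ℂ k n (Sm u (transl a v)) ≤ C * ((1 + ‖a‖) ^ 3)⁻¹ := by
  set m := k + n + 3
  set B := ∑ i ∈ Finset.range (n + 1), (n.choose i : ℝ) * (2 ^ m * pn m u) * (2 ^ m * pn m v)
  refine ⟨B, fun a => ?_⟩
  have hB : 0 ≤ B := Finset.sum_nonneg fun i _ => by positivity
  refine SchwartzMap.seminorm_le_bound ℂ k n _ (by positivity) fun x => ?_
  have e : ((Sm u (transl a v) : 𝓢(Plane, ℂ)) : Plane → ℂ) = fun x => u x * transl a v x := by
    ext y; rw [SchwartzMap.smulLeftCLM_apply_apply u.hasTemperateGrowth]; rfl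
  rw [e, ← div_eq_mul_inv, le_div_iff₀ (by positivity)]
  have h1 : (1 + ‖a‖) ^ 3 ≤ (1 + ‖x‖) ^ 3 * (1 + ‖x - a‖) ^ 3 := by
    rw [← mul_pow]
    gcongr
    have := one_add_norm_le a x
    rwa [← norm_neg (a - x), neg_sub] at this
  have hx1 : 1 ≤ 1 + ‖x‖ := by linarith [norm_nonneg x]
  have hy1 : 1 ≤ 1 + ‖x - a‖ := by linarith [norm_nonneg (x - a)]
  have h2 : ‖x‖ ^ k * (1 + ‖a‖) ^ 3 ≤ (1 + ‖x‖) ^ m * (1 + ‖x - a‖) ^ m := by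
    calc ‖x‖ ^ k * (1 + ‖a‖) ^ 3 ≤ (1 + ‖x‖) ^ k * ((1 + ‖x‖) ^ 3 * (1 + ‖x - a‖) ^ 3) := by
          gcongr; linarith
      _ = (1 + ‖x‖) ^ (k + 3) * (1 + ‖x - a‖) ^ 3 := by ring
      _ ≤ _ := by
          refine mul_le_mul (pow_le_pow_right₀ hx1 ?_) (pow_le_pow_right₀ hy1 ?_) (by positivity)
            (by positivity) <;> omega
  have h3 := norm_iteratedFDeriv_mul_le (𝕜 := ℝ) (u.smooth ⊤) ((transl a v).smooth ⊤) x
    (n := n) (by exact_mod_cast le_top)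
  calc _ = ‖x‖ ^ k * (1 + ‖a‖) ^ 3 * ‖iteratedFDeriv ℝ n (fun x => u x * transl a v x) x‖ := by ring
    _ ≤ (1 + ‖x‖) ^ m * (1 + ‖x - a‖) ^ m * ∑ i ∈ Finset.range (n + 1),
        (n.choose i : ℝ) * ‖iteratedFDeriv ℝ i u x‖ * ‖iteratedFDeriv ℝ (n - i) (transl a v) x‖ := by
        gcongr
    _ = ∑ i ∈ Finset.range (n + 1), (n.choose i : ℝ) * ((1 + ‖x‖) ^ m * ‖iteratedFDeriv ℝ i u x‖) *
        ((1 + ‖x - a‖) ^ m * ‖iteratedFDeriv ℝ (n - i) v (x - a)‖) := by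
        rw [Finset.mul_sum]
        refine Finset.sum_congr rfl fun i _ => ?_
        rw [iteratedFDeriv_transl]
        ring
    _ ≤ B := by
        refine Finset.sum_le_sum fun i hi => ?_
        have hi' := Finset.mem_range.1 hi
        have hu := one_add_pow_mul_le_pn m u x (n := i) (by omega)
        have hv := one_add_pow_mul_le_pn m v (x - a) (n := n - i) (by omega)
        exact mul_le_mul (mul_le_mul_of_nonneg_left hu (by positivity)) hv (by positivity)
          (by positivity)

/-! ### Poisson summation -/

/-- The Fourier coefficients `∫ η(α) exp(-i α·Λj) dα` of the periodization of `η`. -/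
def coef (Λ : Matrix (Fin 2) (Fin 2) ℝ) (η : 𝓢(Plane, ℂ)) (j : Idx) : ℂ :=
  ∫ α, η α * phase (-α) (latt Λ j)

/-- The periodization `∑_m η(α + Λ*m)`. -/
def perSum (Λ : Matrix (Fin 2) (Fin 2) ℝ) (η : 𝓢(Plane, ℂ)) (α : Plane) : ℂ :=
  ∑' m : Idx, η (α + latt (dualMat Λ) m)

theorem coef_eq_fourier (η : 𝓢(Plane, ℂ)) (j : Idx) :
    coef Λ η j = 𝓕 η ((2 * Real.pi)⁻¹ • latt Λ j) := by
  rw [coef, SchwartzMap.fourier_coe, Real.fourier_eq]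
  refine integral_congr_ae (Eventually.of_forall fun α => ?_)
  simp only [Circle.smul_def, smul_eq_mul, Real.fourierChar_apply, phase, inner_smul_right,
    inner_neg_left]
  rw [mul_comm]
  congr 2
  push_cast
  field_simp

theorem norm_coef_le (m : ℕ) (η : 𝓢(Plane, ℂ)) (j : Idx) :
    (1 + ‖latt Λ j‖) ^ m * ‖coef Λ η j‖ ≤ (2 * Real.pi) ^ m * (2 ^ m * pn m (𝓕 η)) := by
  rw [coef_eq_fourier]
  set x := (2 * Real.pi)⁻¹ • latt Λ j
  have hx : 1 + ‖latt Λ j‖ ≤ 2 * Real.pi * (1 + ‖x‖) := by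
    simp only [x, norm_smul, norm_inv, norm_mul, Real.norm_ofNat, Real.norm_of_nonneg Real.pi_pos.le]
    have : 2 * Real.pi * ((2 * Real.pi)⁻¹ * ‖latt Λ j‖) = ‖latt Λ j‖ := by field_simp
    nlinarith [Real.pi_gt_three]
  calc _ ≤ (2 * Real.pi * (1 + ‖x‖)) ^ m * ‖𝓕 η x‖ := by gcongr
    _ = (2 * Real.pi) ^ m * ((1 + ‖x‖) ^ m * ‖𝓕 η x‖) := by rw [mul_pow, mul_assoc]
    _ ≤ _ := mul_le_mul_of_nonneg_left (one_add_pow_mul_norm_le_pn m _ x) (by positivity)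

theorem norm_coef_mul_pow_le (m : ℕ) (η : 𝓢(Plane, ℂ)) (j : Idx) :
    ‖coef Λ η j‖ * (1 + ‖latt Λ j‖) ^ m ≤
      (2 * Real.pi) ^ (m + 3) * (2 ^ (m + 3) * pn (m + 3) (𝓕 η)) * ((1 + ‖latt Λ j‖) ^ 3)⁻¹ := by
  rw [← div_eq_mul_inv, le_div_iff₀ (by positivity)]
  refine le_trans (le_of_eq ?_) (norm_coef_le (Λ := Λ) (m + 3) η j)
  ring

theorem summable_coef_mul_pow (hΛ : IsUnit Λ.det) (m : ℕ) (η : 𝓢(Plane, ℂ)) :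
    Summable fun j : Idx => ‖coef Λ η j‖ * (1 + ‖latt Λ j‖) ^ m :=
  Summable.of_nonneg_of_le (fun j => by positivity) (norm_coef_mul_pow_le m η)
    ((summable_latt hΛ).mul_left _)

theorem summable_norm_coef (hΛ : IsUnit Λ.det) (η : 𝓢(Plane, ℂ)) :
    Summable fun j : Idx => ‖coef Λ η j‖ := by
  simpa using summable_coef_mul_pow hΛ 0 η

theorem norm_add_latt_le (A : Matrix (Fin 2) (Fin 2) ℝ) (v : 𝓢(Plane, ℂ)) (x : Plane) (m : Idx) :
    ‖v (x + latt A m)‖ ≤ 8 * pn 3 v * (1 + ‖x‖) ^ 3 * ((1 + ‖latt A m‖) ^ 3)⁻¹ := by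
  rw [← div_eq_mul_inv, le_div_iff₀ (by positivity)]
  have h1 : 1 + ‖latt A m‖ ≤ (1 + ‖x‖) * (1 + ‖x + latt A m‖) := by
    have := one_add_norm_le (latt A m) (-x)
    rwa [norm_neg, sub_neg_eq_add, add_comm (latt A m)] at this
  have h2 := one_add_pow_mul_norm_le_pn 3 v (x + latt A m)
  calc _ ≤ ‖v (x + latt A m)‖ * ((1 + ‖x‖) * (1 + ‖x + latt A m‖)) ^ 3 := by gcongr
    _ = (1 + ‖x‖) ^ 3 * ((1 + ‖x + latt A m‖) ^ 3 * ‖v (x + latt A m)‖) := by ring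
    _ ≤ (1 + ‖x‖) ^ 3 * (2 ^ 3 * pn 3 v) := mul_le_mul_of_nonneg_left h2 (by positivity)
    _ = _ := by ring

theorem summable_norm_add_latt {A : Matrix (Fin 2) (Fin 2) ℝ} (hA : IsUnit A.det)
    (v : 𝓢(Plane, ℂ)) (x : Plane) : Summable fun m : Idx => ‖v (x + latt A m)‖ :=
  Summable.of_nonneg_of_le (fun j => by positivity) (norm_add_latt_le A v x)
    ((summable_latt hA).mul_left _)

/-- Lattice sums of a Schwartz function with bounded continuous coefficients are continuous. -/
theorem continuous_tsum_latt {A : Matrix (Fin 2) (Fin 2) ℝ} (hA : IsUnit A.det)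
    {X : Type*} [TopologicalSpace X] (v : 𝓢(Plane, ℂ)) {g : X → Plane} (hg : Continuous g)
    {c : Idx → X → ℂ} (hc : ∀ m, Continuous (c m)) (hc1 : ∀ m x, ‖c m x‖ ≤ 1) :
    Continuous fun x => ∑' m : Idx, v (g x + latt A m) * c m x := by
  refine continuous_iff_continuousAt.2 fun x₀ => ?_
  set U := {x | ‖g x‖ < ‖g x₀‖ + 1}
  have hU : IsOpen U := isOpen_lt (by fun_prop) continuous_const
  have h0 : x₀ ∈ U := by simp [U]
  refine ContinuousOn.continuousAt (s := U) ?_ (hU.mem_nhds h0)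
  refine continuousOn_tsum (u := fun m => 8 * pn 3 v * (1 + (‖g x₀‖ + 1)) ^ 3 *
    ((1 + ‖latt A m‖) ^ 3)⁻¹) (fun m => ?_) ((summable_latt hA).mul_left _) fun m x hx => ?_
  · have := hc m
    have := v.continuous
    fun_prop
  · rw [norm_mul]
    have h1 : ‖g x‖ < ‖g x₀‖ + 1 := hx
    calc _ ≤ ‖v (g x + latt A m)‖ * 1 := by gcongr; exact hc1 m x
      _ ≤ 8 * pn 3 v * (1 + ‖g x‖) ^ 3 * ((1 + ‖latt A m‖) ^ 3)⁻¹ := by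
          rw [mul_one]; exact norm_add_latt_le A v _ m
      _ ≤ _ := by gcongr

theorem continuous_perSum (hΛ : IsUnit Λ.det) (η : 𝓢(Plane, ℂ)) : Continuous (perSum Λ η) := by
  have := continuous_tsum_latt (isUnit_det_dualMat hΛ) η (g := fun x => x) continuous_id
    (c := fun _ _ => 1) (fun _ => continuous_const) (by simp)
  have e : perSum Λ η = fun x => ∑' m : Idx, η (x + latt (dualMat Λ) m) := rfl
  rw [e]
  simpa using this

theorem perSum_add_latt (η : 𝓢(Plane, ℂ)) (α : Plane) (k : Idx) :
    perSum Λ η (α + latt (dualMat Λ) k) = perSum Λ η α := by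
  rw [perSum, perSum, ← (Equiv.addLeft k).tsum_eq fun m => η (α + latt (dualMat Λ) m)]
  simp only [Equiv.coe_addLeft, latt_add, add_assoc]

/-! ### Fourier series on the torus -/

theorem measurableEmbedding_mulPt {A : Matrix (Fin 2) (Fin 2) ℝ} (hA : IsUnit A.det) :
    MeasurableEmbedding (mulPt A) :=
  (mulPtEquiv hA).toHomeomorph.measurableEmbedding

theorem setIntegral_unitCube {A : Matrix (Fin 2) (Fin 2) ℝ} (hA : IsUnit A.det) (f : Plane → ℂ) :
    ∫ μ in unitCube, f (mulPt A μ) = ((|A.det⁻¹| : ℝ) : ℂ) * ∫ x in cell A, f x := by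
  have h := (measurableEmbedding_mulPt hA).setIntegral_map (μ := volume) f (cell A)
  have e : mulPt A ⁻¹' cell A = unitCube := by
    ext μ; exact mem_cell_iff hA μ
  rw [e] at h
  rw [← h, map_mulPt hA, Measure.restrict_smul, integral_smul_measure,
    ENNReal.toReal_ofReal (abs_nonneg _), Complex.real_smul]

/-- The projection of the plane onto the torus. -/
def toTorus (μ : Fin 2 → ℝ) : UnitAddTorus (Fin 2) := fun i => (μ i : UnitAddCircle)

theorem isOpenQuotientMap_toTorus : IsOpenQuotientMap toTorus :=
  IsOpenQuotientMap.piMap fun _ => QuotientAddGroup.isOpenQuotientMap_mk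

theorem toTorus_eq_iff (μ ν : Fin 2 → ℝ) :
    toTorus μ = toTorus ν ↔ ∃ m : Idx, μ = ν + fun i => (m i : ℝ) := by
  constructor
  · intro h
    have h1 : ∀ i, ∃ m : ℤ, μ i = ν i + m := fun i => by
      have h2 : (μ i : UnitAddCircle) = (ν i : UnitAddCircle) := congrFun h i
      rw [eq_comm, QuotientAddGroup.eq, AddSubgroup.mem_zmultiples_iff] at h2
      obtain ⟨k, hk⟩ := h2
      exact ⟨k, by simp at hk; linarith⟩
    choose m hm using h1
    exact ⟨m, funext hm⟩
  · rintro ⟨m, rfl⟩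
    ext i
    change ((ν i + (m i : ℝ) : ℝ) : UnitAddCircle) = (ν i : UnitAddCircle)
    rw [QuotientAddGroup.eq, AddSubgroup.mem_zmultiples_iff]
    exact ⟨-m i, by simp⟩

theorem mFourier_toTorus (hΛ : IsUnit Λ.det) (n : Idx) (μ : Fin 2 → ℝ) :
    UnitAddTorus.mFourier n (toTorus μ) = phase (mulPt (dualMat Λ) μ) (latt Λ n) := by
  rw [phase, latt, inner_dual hΛ]
  change ∏ i, fourier (n i) ((μ i : ℝ) : UnitAddCircle) = _
  simp only [fourier_coe_apply, ← Complex.exp_sum]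
  congr 1
  simp
  ring

/-- The periodization is a continuous function on the torus whose Fourier coefficients are summable,
so that its Fourier series converges to it at every point. -/
theorem poisson (hΛ : IsUnit Λ.det) (η : 𝓢(Plane, ℂ)) (α : Plane) :
    HasSum (fun j : Idx => blochConst Λ ^ 2 * coef Λ η j * phase α (latt Λ j)) (perSum Λ η α) := by
  have hA := isUnit_det_dualMat hΛ
  let f : C(Fin 2 → ℝ, ℂ) := ⟨fun μ => perSum Λ η (mulPt (dualMat Λ) μ),
    (continuous_perSum hΛ η).comp (continuous_mulPt _)⟩
  let q : C(Fin 2 → ℝ, UnitAddTorus (Fin 2)) := ⟨toTorus, isOpenQuotientMap_toTorus.continuous⟩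
  have hq : IsQuotientMap q := isOpenQuotientMap_toTorus.isQuotientMap
  have hfq : Function.FactorsThrough f q := fun a b hab => by
    obtain ⟨m, rfl⟩ := (toTorus_eq_iff a b).1 hab
    change perSum Λ η (mulPt _ _) = perSum Λ η (mulPt _ _)
    rw [mulPt_add]
    exact perSum_add_latt η _ m
  let g : C(UnitAddTorus (Fin 2), ℂ) := hq.lift f hfq
  have hg : ∀ μ, g (toTorus μ) = perSum Λ η (mulPt (dualMat Λ) μ) := fun μ =>
    congrFun (congrArg DFunLike.coe (hq.lift_comp f hfq)) μ
  -- The phases are periodic, so the integral of the periodization over the cell unfolds to an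
  -- integral over the plane.
  have hc : ∀ n, UnitAddTorus.mFourierCoeff g n = blochConst Λ ^ 2 * coef Λ η n := by
    intro n
    rw [UnitAddTorus.mFourierCoeff_eq_integral g n (fun _ => -1 / 2)]
    change ∫ x in unitCube, UnitAddTorus.mFourier (-n) (toTorus x) • g (toTorus x) = _
    simp only [mFourier_toTorus hΛ, hg, smul_eq_mul]
    rw [setIntegral_unitCube hA fun x => phase x (latt Λ (-n)) * perSum Λ η x, blochConst_sq]
    congr 1
    have hi : Integrable fun α => η α * phase (-α) (latt Λ n) := by
      have hm : Measurable fun α : Plane => phase (-α) (latt Λ n) :=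
        ((continuous_phase _).comp continuous_neg).measurable
      exact (η.integrable (μ := volume)).mul_bdd (c := 1) hm.aestronglyMeasurable
        (Eventually.of_forall fun x => (norm_phase _ _).le)
    rw [coef, ← integral_tsum_cell hA hi]
    congr 1
    ext x
    rw [perSum, ← tsum_mul_left]
    refine tsum_congr fun m => ?_
    rw [latt_neg, phase_neg_right, neg_add, phase_add_left, ← latt_neg, phase_latt_latt hΛ]
    ring
  have hs : Summable (UnitAddTorus.mFourierCoeff g) := by
    have : UnitAddTorus.mFourierCoeff g = fun n => blochConst Λ ^ 2 * coef Λ η n := funext hc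
    rw [this]
    exact (summable_norm_coef hΛ η).of_norm.mul_left _
  obtain ⟨μ, rfl⟩ := (mulPtEquiv hA).surjective α
  have h := UnitAddTorus.hasSum_mFourier_series_apply_of_summable hs (toTorus μ)
  simp only [hc, mFourier_toTorus hΛ, hg, smul_eq_mul] at h
  exact h

/-! ### The Bloch transform of tempered distributions -/

theorem pn_smul (m : ℕ) (c : ℂ) (v : 𝓢(Plane, ℂ)) : pn m (c • v) = ‖c‖ * pn m v :=
  map_smul_eq_mul (pn m) c v

/-- The scale `t` allows two uses: `t = 1` for `blochTest`, and `t = (2π)⁻¹` for sums of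
modulations, which are translations on the Fourier side. -/
theorem exists_hasSum_transl (A : Matrix (Fin 2) (Fin 2) ℝ) (t : ℝ) {c : Idx → ℂ}
    (hc : ∀ m : ℕ, Summable fun j => ‖c j‖ * (1 + ‖latt A j‖) ^ m) (v : 𝓢(Plane, ℂ)) :
    ∃ F, HasSum (fun j => c j • transl (t • latt A j) v) F := by
  refine exists_hasSum_schwartz _ fun k n => ?_
  set m := k + n
  refine Summable.of_nonneg_of_le (fun j => apply_nonneg _ _) (fun j => ?_)
    ((hc m).mul_left (2 ^ m * (1 + |t|) ^ m * pn m v))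
  calc _ ≤ pn m (c j • transl (t • latt A j) v) := seminorm_le_pn (by omega) (by omega) _
    _ ≤ ‖c j‖ * (2 ^ m * (1 + ‖t • latt A j‖) ^ m * pn m v) := by
        rw [pn_smul]; gcongr; exact pn_transl_le m _ v
    _ ≤ ‖c j‖ * (2 ^ m * ((1 + |t|) * (1 + ‖latt A j‖)) ^ m * pn m v) := by
        gcongr
        rw [norm_smul, Real.norm_eq_abs]
        nlinarith [norm_nonneg (latt A j), abs_nonneg t]
    _ = _ := by rw [mul_pow]; ring

/-- The test function `|det Λ|^{1/2}/(2π) ∑_j (∫ η(α) exp(-i α·Λj) dα) v(x - Λj)`. -/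
def blochTest (Λ : Matrix (Fin 2) (Fin 2) ℝ) (η v : 𝓢(Plane, ℂ)) : 𝓢(Plane, ℂ) :=
  ∑' j : Idx, (blochConst Λ * coef Λ η j) • transl (latt Λ j) v

theorem hasSum_blochTest (hΛ : IsUnit Λ.det) (η v : 𝓢(Plane, ℂ)) :
    HasSum (fun j : Idx => (blochConst Λ * coef Λ η j) • transl (latt Λ j) v)
      (blochTest Λ η v) := by
  obtain ⟨F, hF⟩ := exists_hasSum_transl Λ 1 (c := fun j => blochConst Λ * coef Λ η j)
    (fun m => by
      simp only [norm_mul, mul_assoc]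
      exact (summable_coef_mul_pow hΛ m η).mul_left _) v
  simp only [one_smul] at hF
  exact hF.summable.hasSum

theorem _root_.HasSum.schwartz_apply {ι : Type*} {f : ι → 𝓢(Plane, ℂ)} {F : 𝓢(Plane, ℂ)} (h : HasSum f F)
    (x : Plane) : HasSum (fun i => f i x) (F x) :=
  h.map (TemperedDistribution.delta x) (TemperedDistribution.delta x).continuous

theorem _root_.HasSum.dist_apply {ι : Type*} {f : ι → 𝓢(Plane, ℂ)} {F : 𝓢(Plane, ℂ)} (h : HasSum f F)
    (T : 𝓢'(Plane, ℂ)) : HasSum (fun i => T (f i)) (T F) :=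
  h.map T T.continuous

theorem _root_.HasSum.dist₂_apply {ι : Type*} {f : ι → 𝓢(Plane, ℂ)} {F : 𝓢(Plane, ℂ)} (h : HasSum f F)
    (ψ : Dist₂) (v : 𝓢(Plane, ℂ)) : HasSum (fun i => ψ (f i) v) (ψ F v) :=
  (h.map ψ ψ.continuous).map (PointwiseConvergenceCLM.evalCLM (RingHom.id ℂ) ℂ v)
    (PointwiseConvergenceCLM.evalCLM (RingHom.id ℂ) ℂ v).continuous

theorem integrable_mul_phase (η : 𝓢(Plane, ℂ)) (x : Plane) :
    Integrable fun α => η α * phase (-α) x := by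
  have hm : Measurable fun α : Plane => phase (-α) x :=
    ((continuous_phase _).comp continuous_neg).measurable
  exact (η.integrable (μ := volume)).mul_bdd (c := 1) hm.aestronglyMeasurable
    (Eventually.of_forall fun x => (norm_phase _ _).le)

theorem coef_add (η η' : 𝓢(Plane, ℂ)) (j : Idx) :
    coef Λ (η + η') j = coef Λ η j + coef Λ η' j := by
  rw [coef, coef, coef, ← integral_add (integrable_mul_phase _ _) (integrable_mul_phase _ _)]
  simp [add_mul]

theorem coef_smul (c : ℂ) (η : 𝓢(Plane, ℂ)) (j : Idx) :
    coef Λ (c • η) j = c * coef Λ η j := by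
  rw [coef, coef, ← integral_const_mul]
  simp [mul_assoc]

theorem transl_add (a : Plane) (u v : 𝓢(Plane, ℂ)) : transl a (u + v) = transl a u + transl a v :=
  map_add _ _ _

theorem transl_smul (a : Plane) (c : ℂ) (v : 𝓢(Plane, ℂ)) : transl a (c • v) = c • transl a v :=
  map_smul _ _ _

theorem blochTest_add_left (hΛ : IsUnit Λ.det) (η η' v : 𝓢(Plane, ℂ)) :
    blochTest Λ (η + η') v = blochTest Λ η v + blochTest Λ η' v := by
  refine (hasSum_blochTest hΛ _ v).unique ?_
  refine ((hasSum_blochTest hΛ η v).add (hasSum_blochTest hΛ η' v)).congr_fun fun j => ?_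
  rw [coef_add, mul_add, add_smul]

theorem blochTest_smul_left (hΛ : IsUnit Λ.det) (c : ℂ) (η v : 𝓢(Plane, ℂ)) :
    blochTest Λ (c • η) v = c • blochTest Λ η v := by
  refine (hasSum_blochTest hΛ _ v).unique ?_
  refine ((hasSum_blochTest hΛ η v).const_smul c).congr_fun fun j => ?_
  rw [coef_smul, smul_smul]
  congr 1
  ring

theorem blochTest_add_right (hΛ : IsUnit Λ.det) (η v v' : 𝓢(Plane, ℂ)) :
    blochTest Λ η (v + v') = blochTest Λ η v + blochTest Λ η v' := by
  refine (hasSum_blochTest hΛ _ _).unique ?_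
  refine ((hasSum_blochTest hΛ η v).add (hasSum_blochTest hΛ η v')).congr_fun fun j => ?_
  rw [transl_add, smul_add]

theorem blochTest_smul_right (hΛ : IsUnit Λ.det) (c : ℂ) (η v : 𝓢(Plane, ℂ)) :
    blochTest Λ η (c • v) = c • blochTest Λ η v := by
  refine (hasSum_blochTest hΛ _ _).unique ?_
  refine ((hasSum_blochTest hΛ η v).const_smul c).congr_fun fun j => ?_
  rw [transl_smul, smul_smul, smul_smul]
  congr 1
  ring

theorem continuous_pn (m : ℕ) : Continuous (pn m) := by
  have h : ∀ s : Finset (ℕ × ℕ), Continuous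
      (s.sup (schwartzSeminormFamily ℂ Plane ℂ) : Seminorm ℂ 𝓢(Plane, ℂ)) := by
    intro s
    induction s using Finset.induction_on with
    | empty => simpa using continuous_zero
    | insert a s _ ih =>
      rw [Finset.sup_insert]
      exact ((schwartz_withSeminorms ℂ Plane ℂ).continuous_seminorm a).sup ih
  exact h _

theorem exists_pn_clm_le (Ψ : 𝓢(Plane, ℂ) →L[ℂ] 𝓢(Plane, ℂ)) (m : ℕ) :
    ∃ (n : ℕ) (C : ℝ), 0 < C ∧ ∀ v, pn m (Ψ v) ≤ C * pn n v := by
  obtain ⟨s, C, hC, h⟩ := Seminorm.bound_of_continuous (schwartz_withSeminorms ℂ Plane ℂ)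
    ((pn m).comp Ψ.toLinearMap) ((continuous_pn m).comp Ψ.continuous)
  obtain ⟨n, hn⟩ := sup_le_pn s
  refine ⟨n, C, NNReal.coe_pos.2 (pos_iff_ne_zero.2 hC), fun v => (h v).trans ?_⟩
  change (C : ℝ) * _ ≤ _
  gcongr
  exact hn v

/-- `T` of a translate grows polynomially in `Λj`, and `coef` decays faster than any power. The
estimate has to be joint in `η` and `v` to define a distribution in two variables. -/
theorem exists_norm_blochTest_le (hΛ : IsUnit Λ.det) (T : 𝓢'(Plane, ℂ)) :
    ∃ (m : ℕ) (C : ℝ), 0 ≤ C ∧ ∀ η v, ‖T (blochTest Λ η v)‖ ≤ C * pn m η * pn m v := by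
  obtain ⟨m, C, hC, hT⟩ := exists_norm_le_pn T
  obtain ⟨n, D, hD, hF⟩ := exists_pn_clm_le (FourierTransform.fourierCLM ℂ 𝓢(Plane, ℂ)) (m + 3)
  set K := ∑' j : Idx, ((1 + ‖latt Λ j‖) ^ 3)⁻¹
  have hK : 0 ≤ K := tsum_nonneg fun j => by positivity
  set B := ‖blochConst Λ‖ * C * 2 ^ m * ((2 * Real.pi) ^ (m + 3) * (2 ^ (m + 3) * D)) * K
  refine ⟨max m n, B, by positivity, fun η v => ?_⟩
  have h1 := (hasSum_blochTest hΛ η v).dist_apply T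
  have h2 : HasSum (fun j : Idx => ‖blochConst Λ‖ * C * 2 ^ m * ((2 * Real.pi) ^ (m + 3) *
      (2 ^ (m + 3) * (D * pn n η))) * pn m v * ((1 + ‖latt Λ j‖) ^ 3)⁻¹) (B * pn n η * pn m v) := by
    have e : B * pn n η * pn m v = ‖blochConst Λ‖ * C * 2 ^ m * ((2 * Real.pi) ^ (m + 3) *
      (2 ^ (m + 3) * (D * pn n η))) * pn m v * K := by simp only [B]; ring
    rw [e]
    exact (summable_latt hΛ).hasSum.mul_left _
  have h3 : ‖T (blochTest Λ η v)‖ ≤ B * pn n η * pn m v := by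
    refine h1.norm_le_of_bounded h2 fun j => ?_
    rw [map_smul, norm_smul, norm_mul]
    have e1 : ‖T (transl (latt Λ j) v)‖ ≤ C * (2 ^ m * (1 + ‖latt Λ j‖) ^ m * pn m v) :=
      (hT _).trans (by gcongr; exact pn_transl_le m _ v)
    have e2 := norm_coef_mul_pow_le (Λ := Λ) m η j
    have e3 : pn (m + 3) (𝓕 η) ≤ D * pn n η := hF η
    calc _ ≤ ‖blochConst Λ‖ * ‖coef Λ η j‖ * (C * (2 ^ m * (1 + ‖latt Λ j‖) ^ m * pn m v)) := by
          gcongr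
      _ = ‖blochConst Λ‖ * C * 2 ^ m * (‖coef Λ η j‖ * (1 + ‖latt Λ j‖) ^ m) * pn m v := by ring
      _ ≤ ‖blochConst Λ‖ * C * 2 ^ m * ((2 * Real.pi) ^ (m + 3) * (2 ^ (m + 3) * (D * pn n η)) *
            ((1 + ‖latt Λ j‖) ^ 3)⁻¹) * pn m v := by
          refine mul_le_mul_of_nonneg_right (mul_le_mul_of_nonneg_left (e2.trans ?_)
            (by positivity)) (by positivity)
          gcongr
      _ = _ := by ring
  refine h3.trans ?_
  gcongr
  · exact pn_mono (le_max_right _ _) η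
  · exact pn_mono (le_max_left _ _) v

/-- A separately linear map that is bounded by Schwartz seminorms is a distribution in two
variables. -/
theorem exists_dist₂ (B : 𝓢(Plane, ℂ) →ₗ[ℂ] 𝓢(Plane, ℂ) →ₗ[ℂ] ℂ)
    (h : ∃ (m : ℕ) (C : ℝ), 0 ≤ C ∧ ∀ η v, ‖B η v‖ ≤ C * pn m η * pn m v) :
    ∃ ψ : Dist₂, ∀ η v, ψ η v = B η v := by
  obtain ⟨m, C, hC, hB⟩ := h
  have hv : ∀ η, ∃ T : 𝓢'(Plane, ℂ), ∀ v, T v = B η v := fun η =>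
    ⟨ContinuousLinearMap.toPointwiseConvergenceCLM ℂ (RingHom.id ℂ) _ _
      (SchwartzMap.mkCLMtoNormedSpace (σ := RingHom.id ℂ) (fun v => B η v) (fun _ _ => map_add _ _ _)
        (fun _ _ => map_smul _ _ _) ⟨Finset.Iic (m, m), C * pn m η, by positivity, hB η⟩),
      fun v => rfl⟩
  choose T hT using hv
  let ψ₀ : 𝓢(Plane, ℂ) →ₗ[ℂ] 𝓢'(Plane, ℂ) :=
    { toFun := T
      map_add' := fun a b => by ext v; change T (a + b) v = T a v + T b v; simp [hT]
      map_smul' := fun c a => by ext v; change T (c • a) v = c • T a v; simp [hT] }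
  -- Distributions carry the topology of pointwise convergence, so continuity is checked for each
  -- fixed `v`.
  have hc : Continuous ψ₀ := by
    refine PointwiseConvergenceCLM.continuous_of_continuous_eval fun v => ?_
    have : Continuous (SchwartzMap.mkCLMtoNormedSpace (σ := RingHom.id ℂ) (fun η => B η v)
        (fun a b => by simp) (fun c a => by simp)
        ⟨Finset.Iic (m, m), C * pn m v, by positivity, fun η => by
          refine (hB η v).trans (le_of_eq ?_)
          change _ = C * pn m v * pn m η
          ring⟩) := ContinuousLinearMap.continuous _
    refine this.congr fun η => ?_
    exact (hT η v).symm
  exact ⟨ContinuousLinearMap.toPointwiseConvergenceCLM ℂ (RingHom.id ℂ) _ _ ⟨ψ₀, hc⟩,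
    fun η v => hT η v⟩

theorem exists_blochJ (hΛ : IsUnit Λ.det) (T : 𝓢'(Plane, ℂ)) :
    ∃ ψ : Dist₂, ∀ η v, ψ η v = T (blochTest Λ η v) :=
  exists_dist₂
    { toFun := fun η =>
        { toFun := fun v => T (blochTest Λ η v)
          map_add' := fun a b => by rw [blochTest_add_right hΛ, map_add]
          map_smul' := fun c a => by rw [blochTest_smul_right hΛ, map_smul]; rfl }
      map_add' := fun a b => by
        ext v; exact (congrArg T (blochTest_add_left hΛ a b v)).trans (map_add _ _ _)
      map_smul' := fun c a => by
        ext v; exact (congrArg T (blochTest_smul_left hΛ c a v)).trans (map_smul _ _ _) }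
    (exists_norm_blochTest_le hΛ T)

/-- The Bloch transform of tempered distributions. -/
def blochJ (hΛ : IsUnit Λ.det) : 𝓢'(Plane, ℂ) →ₗ[ℂ] Dist₂ where
  toFun T := (exists_blochJ hΛ T).choose
  map_add' S T := by
    ext η v
    change (exists_blochJ hΛ (S + T)).choose η v =
      (exists_blochJ hΛ S).choose η v + (exists_blochJ hΛ T).choose η v
    simp only [(exists_blochJ hΛ _).choose_spec]
    rfl
  map_smul' c T := by
    ext η v
    change (exists_blochJ hΛ (c • T)).choose η v = c • (exists_blochJ hΛ T).choose η v
    simp only [(exists_blochJ hΛ _).choose_spec]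
    rfl

theorem blochJ_apply (hΛ : IsUnit Λ.det) (T : 𝓢'(Plane, ℂ)) (η v : 𝓢(Plane, ℂ)) :
    blochJ hΛ T η v = T (blochTest Λ η v) :=
  (exists_blochJ hΛ T).choose_spec η v

theorem isBlochTransform_blochJ (hΛ : IsUnit Λ.det) (S : PeriodicDiffeo Λ) (T : 𝓢'(Plane, ℂ)) :
    S.IsBlochTransform T (blochJ hΛ T) := by
  intro η v
  rw [blochJ_apply]
  refine ((hasSum_blochTest hΛ η v).dist_apply T).congr_fun fun j => ?_
  rw [map_smul, smul_eq_mul, mul_assoc]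
  rfl

/-! ### Inversion of the Bloch transform -/

/-- The product with the phase `exp(i α·Λj)`. -/
abbrev modul (Λ : Matrix (Fin 2) (Fin 2) ℝ) (j : Idx) (η : 𝓢(Plane, ℂ)) : 𝓢(Plane, ℂ) :=
  SchwartzMap.smulLeftCLM ℂ (fun α : Plane => phase α (latt Λ j)) η

theorem modul_apply (j : Idx) (η : 𝓢(Plane, ℂ)) (α : Plane) :
    modul Λ j η α = phase α (latt Λ j) * η α :=
  SchwartzMap.smulLeftCLM_apply_apply (hasTemperateGrowth_phase _) η α

theorem coef_transl (hΛ : IsUnit Λ.det) (m : Idx) (η : 𝓢(Plane, ℂ)) (j : Idx) :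
    coef Λ (transl (latt (dualMat Λ) m) η) j = coef Λ η j := by
  rw [coef, coef, ← integral_add_right_eq_self _ (latt (dualMat Λ) m)]
  refine integral_congr_ae (Eventually.of_forall fun α => ?_)
  simp only [transl_apply, add_sub_cancel_right]
  rw [neg_add, ← latt_neg, phase_add_latt hΛ]

theorem coef_modul (k : Idx) (η : 𝓢(Plane, ℂ)) (j : Idx) :
    coef Λ (modul Λ k η) j = coef Λ η (j - k) := by
  refine integral_congr_ae (Eventually.of_forall fun α => ?_)
  simp only [modul_apply]
  rw [latt_sub, sub_eq_add_neg, phase_add_right, phase_neg_right, neg_neg]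
  ring

theorem blochTest_transl (hΛ : IsUnit Λ.det) (m : Idx) (η v : 𝓢(Plane, ℂ)) :
    blochTest Λ (transl (latt (dualMat Λ) m) η) v = blochTest Λ η v := by
  simp only [blochTest, coef_transl hΛ]

/-- Shifting the summation index by `k` turns a translation in `x` into a phase in `α`; this is the
quasiperiodicity of the transform. -/
theorem blochTest_transl_right (hΛ : IsUnit Λ.det) (k : Idx) (η v : 𝓢(Plane, ℂ)) :
    blochTest Λ η (transl (latt Λ k) v) = blochTest Λ (modul Λ k η) v := by
  refine (hasSum_blochTest hΛ _ _).unique ?_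
  have h := (Equiv.addRight k).hasSum_iff.2 (hasSum_blochTest hΛ (modul Λ k η) v)
  refine h.congr_fun fun j => ?_
  simp only [Function.comp, Equiv.coe_addRight, coef_modul, add_sub_cancel_right, transl_transl,
    latt_add]

theorem isQuasiperiodic_blochJ (hΛ : IsUnit Λ.det) (T : 𝓢'(Plane, ℂ)) :
    IsQuasiperiodic Λ (blochJ hΛ T) := by
  constructor
  · intro m η v
    rw [blochJ_apply, blochJ_apply, blochTest_transl hΛ]
  · intro j η v
    rw [blochJ_apply, blochJ_apply, blochTest_transl_right hΛ]

/-- The translates of `η` by the dual lattice sum up to one. -/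
def IsPartition (Λ : Matrix (Fin 2) (Fin 2) ℝ) (η : 𝓢(Plane, ℂ)) : Prop :=
  ∀ α : Plane, HasSum (fun m : Idx => η (α + latt (dualMat Λ) m)) 1

theorem mFourierCoeff_one (n : Idx) :
    UnitAddTorus.mFourierCoeff (fun _ : UnitAddTorus (Fin 2) => (1 : ℂ)) n =
      if n = 0 then 1 else 0 := by
  have h := (orthonormal_iff_ite.1 (UnitAddTorus.orthonormal_mFourier (d := Fin 2))) 0 (-n)
  rw [UnitAddTorus.mFourierLp, UnitAddTorus.mFourierLp, ContinuousMap.inner_toLp] at h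
  simp only [UnitAddTorus.mFourier_zero, ContinuousMap.one_apply,
    map_one, mul_one] at h
  simp only [UnitAddTorus.mFourierCoeff, smul_eq_mul, mul_one]
  rw [h]
  simp [eq_comm]

theorem setIntegral_phase (hΛ : IsUnit Λ.det) (j : Idx) :
    blochConst Λ ^ 2 * ∫ α in cell (dualMat Λ), phase (-α) (latt Λ j) = if j = 0 then 1 else 0 := by
  have hA := isUnit_det_dualMat hΛ
  rw [blochConst_sq, ← setIntegral_unitCube hA fun α => phase (-α) (latt Λ j)]
  have h := UnitAddTorus.mFourierCoeff_eq_integral (fun _ : UnitAddTorus (Fin 2) => (1 : ℂ)) j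
    (fun _ => -1 / 2)
  rw [mFourierCoeff_one] at h
  simp only [smul_eq_mul, mul_one] at h
  rw [h]
  refine integral_congr_ae (Eventually.of_forall fun μ => ?_)
  change _ = UnitAddTorus.mFourier (-j) (toTorus μ)
  rw [mFourier_toTorus hΛ, latt_neg, phase_neg_right]

theorem IsPartition.coef_eq (hΛ : IsUnit Λ.det) {η : 𝓢(Plane, ℂ)} (h : IsPartition Λ η) (j : Idx) :
    blochConst Λ ^ 2 * coef Λ η j = if j = 0 then 1 else 0 := by
  rw [← setIntegral_phase hΛ j, coef, ← integral_tsum_cell (isUnit_det_dualMat hΛ)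
    (integrable_mul_phase η _)]
  congr 2
  ext α
  have : ∀ m, η (α + latt (dualMat Λ) m) * phase (-(α + latt (dualMat Λ) m)) (latt Λ j) =
      η (α + latt (dualMat Λ) m) * phase (-α) (latt Λ j) := fun m => by
    rw [neg_add, ← latt_neg, phase_add_latt hΛ]
  simp only [this, tsum_mul_right, (h α).tsum_eq, one_mul]

/-- A partition of unity has the Fourier coefficients of the constant one, so only the term `j = 0`
survives. -/
theorem IsPartition.blochTest_eq (hΛ : IsUnit Λ.det) {η : 𝓢(Plane, ℂ)} (h : IsPartition Λ η)
    (v : 𝓢(Plane, ℂ)) : blochConst Λ • blochTest Λ η v = v := by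
  have h1 := (hasSum_blochTest hΛ η v).const_smul (blochConst Λ)
  refine h1.unique ?_
  have h2 : (fun j : Idx => blochConst Λ • (blochConst Λ * coef Λ η j) • transl (latt Λ j) v) =
      fun j => if j = 0 then v else 0 := by
    ext1 j
    rw [smul_smul, ← mul_assoc, ← sq, h.coef_eq hΛ]
    split_ifs with hj
    · rw [hj, latt_zero, transl_zero, one_smul]
    · rw [zero_smul]
  rw [h2]
  exact hasSum_ite_eq 0 v

/-- The inversion formula for distributions. -/
theorem inversion (hΛ : IsUnit Λ.det) {η : 𝓢(Plane, ℂ)} (h : IsPartition Λ η)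
    (T : 𝓢'(Plane, ℂ)) (j : Idx) (v : 𝓢(Plane, ℂ)) :
    T (transl (latt Λ j) v) = blochConst Λ * blochJ hΛ T (modul Λ j η) v := by
  rw [blochJ_apply, ← blochTest_transl_right hΛ, ← smul_eq_mul, ← map_smul, h.blochTest_eq hΛ]

/-- By Poisson summation it is enough that the Fourier transform of `η` be a suitable multiple of a
bump which equals one at the origin and vanishes at the other points of the rescaled lattice. -/
theorem exists_isPartition (hΛ : IsUnit Λ.det) : ∃ η, IsPartition Λ η := by
  obtain ⟨c, hc, hle⟩ := exists_norm_le_latt hΛ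
  -- Nonzero points of the lattice scaled by `(2π)⁻¹` have norm at least `R`, since `‖j‖ ≥ 1` there.
  let R := (2 * Real.pi)⁻¹ * c⁻¹
  have hR : 0 < R := by positivity
  let b : ContDiffBump (0 : Plane) := ⟨R / 2, R, by positivity, by linarith⟩
  refine ⟨(blochConst Λ ^ 2)⁻¹ • 𝓕⁻ (schwartzBump b), fun α => ?_⟩
  set η := (blochConst Λ ^ 2)⁻¹ • 𝓕⁻ (schwartzBump b) with hη
  have hC := blochConst_ne_zero hΛ
  have hcoef : ∀ j, blochConst Λ ^ 2 * coef Λ η j = if j = 0 then 1 else 0 := by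
    intro j
    rw [hη, coef_smul, mul_inv_cancel_left₀ (pow_ne_zero 2 hC), coef_eq_fourier,
      FourierTransform.fourier_fourierInv_eq, schwartzBump_apply]
    split_ifs with hj
    · rw [hj, latt_zero, smul_zero, b.one_of_mem_closedBall (by simp [b.rIn_pos.le])]
      simp
    · rw [b.zero_of_le_dist, Complex.ofReal_zero]
      change R ≤ _
      rw [dist_zero_right, norm_smul, Real.norm_of_nonneg (by positivity)]
      simp only [R]
      gcongr
      have h1 : 1 ≤ ‖j‖ := by
        obtain ⟨i, hi⟩ := Function.ne_iff.1 hj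
        refine le_trans ?_ (norm_le_pi_norm j i)
        rw [Int.norm_eq_abs]
        exact_mod_cast Int.one_le_abs hi
      rw [inv_le_iff_one_le_mul₀ hc, mul_comm]
      exact h1.trans (hle j)
  have h1 := poisson hΛ η α
  simp only [hcoef] at h1
  have h2 : perSum Λ η α = 1 := by
    refine h1.unique ?_
    have h3 : (fun j : Idx => (if j = 0 then (1 : ℂ) else 0) * phase α (latt Λ j)) =
        fun j => if j = 0 then 1 else 0 := by
      ext1 j
      split_ifs with hj
      · rw [hj, latt_zero, phase_zero_right, one_mul]
      · rw [zero_mul]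
    rw [h3]
    exact hasSum_ite_eq 0 1
  rw [← h2]
  exact (summable_norm_add_latt (isUnit_det_dualMat hΛ) η α).of_norm.hasSum

/-- A fixed test function whose translates by the dual lattice sum up to one. -/
def eta (hΛ : IsUnit Λ.det) : 𝓢(Plane, ℂ) := (exists_isPartition hΛ).choose

theorem isPartition_eta (hΛ : IsUnit Λ.det) : IsPartition Λ (eta hΛ) :=
  (exists_isPartition hΛ).choose_spec

/-- The inverse of the Bloch transform. -/
def blochInv (hΛ : IsUnit Λ.det) (ψ : Dist₂) : 𝓢'(Plane, ℂ) := blochConst Λ • ψ (eta hΛ)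

theorem blochInv_blochJ (hΛ : IsUnit Λ.det) (T : 𝓢'(Plane, ℂ)) : blochInv hΛ (blochJ hΛ T) = T := by
  ext v
  change blochConst Λ • blochJ hΛ T (eta hΛ) v = T v
  rw [blochJ_apply, ← map_smul, (isPartition_eta hΛ).blochTest_eq hΛ]

theorem phase_smul_eq_fourierInv (a : Plane) (η : 𝓢(Plane, ℂ)) :
    SchwartzMap.smulLeftCLM ℂ (fun α : Plane => phase α a) η =
      𝓕⁻ (transl ((2 * Real.pi)⁻¹ • a) (𝓕 η)) := by
  rw [← FourierTransform.fourierInv_fourier_eq (F := 𝓢(Plane, ℂ))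
    (SchwartzMap.smulLeftCLM ℂ _ η)]
  congr 1
  ext ξ
  rw [transl_apply, SchwartzMap.fourier_coe, SchwartzMap.fourier_coe, Real.fourier_eq,
    Real.fourier_eq]
  refine integral_congr_ae (Eventually.of_forall fun α => ?_)
  simp only [SchwartzMap.smulLeftCLM_apply_apply (hasTemperateGrowth_phase a)]
  simp only [Circle.smul_def, smul_eq_mul, Real.fourierChar_apply, phase, inner_smul_right,
    inner_sub_right]
  rw [← mul_assoc, ← Complex.exp_add]
  congr 2
  push_cast
  field_simp
  ring

theorem exists_hasSum_modul (hΛ : IsUnit Λ.det) (η η' : 𝓢(Plane, ℂ)) :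
    ∃ E, HasSum (fun j : Idx => (blochConst Λ ^ 2 * coef Λ η j) • modul Λ j η') E := by
  obtain ⟨F, hF⟩ := exists_hasSum_transl Λ ((2 * Real.pi)⁻¹)
    (c := fun j => blochConst Λ ^ 2 * coef Λ η j) (fun m => by
      simp only [norm_mul, mul_assoc]
      exact (summable_coef_mul_pow hΛ m η).mul_left _) (𝓕 η')
  refine ⟨𝓕⁻ F, ?_⟩
  have h := hF.map (FourierTransform.fourierInvCLM ℂ 𝓢(Plane, ℂ))
    (FourierTransform.fourierInvCLM ℂ 𝓢(Plane, ℂ)).continuous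
  refine h.congr_fun fun j => ?_
  simp only [Function.comp, map_smul]
  rw [modul, phase_smul_eq_fourierInv]
  rfl

theorem exists_hasSum_mul_transl {A : Matrix (Fin 2) (Fin 2) ℝ} (hA : IsUnit A.det)
    (u v : 𝓢(Plane, ℂ)) : ∃ E, HasSum (fun m : Idx => Sm u (transl (latt A m) v)) E := by
  refine exists_hasSum_schwartz _ fun k n => ?_
  obtain ⟨C, hC⟩ := exists_seminorm_mul_transl_le u v k n
  exact Summable.of_nonneg_of_le (fun j => apply_nonneg _ _) (fun j => hC _)
    ((summable_latt hA).mul_left _)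

theorem Sm_coe_apply (u v : 𝓢(Plane, ℂ)) (x : Plane) : Sm u v x = u x * v x :=
  SchwartzMap.smulLeftCLM_apply_apply u.hasTemperateGrowth v x

/-- Write `Pη` for the periodization of `η` and `e` for the fixed partition of unity.
Quasiperiodicity and Poisson summation turn the left side into `ψ(Pη · e, v)`; periodicity of `ψ`
moves the translations from `η` to `e`; and `η · Pe = η`. -/
theorem blochJ_blochInv (hΛ : IsUnit Λ.det) {ψ : Dist₂} (hψ : IsQuasiperiodic Λ ψ) :
    blochJ hΛ (blochInv hΛ ψ) = ψ := by
  have hA := isUnit_det_dualMat hΛ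
  ext η v
  rw [blochJ_apply]
  obtain ⟨E, hE⟩ := exists_hasSum_modul hΛ η (eta hΛ)
  obtain ⟨E', hE'⟩ := exists_hasSum_mul_transl hA (eta hΛ) η
  obtain ⟨E'', hE''⟩ := exists_hasSum_mul_transl hA η (eta hΛ)
  -- The product `Pη · e` as a series of modulations and as a series of translates.
  have e1 : E = E' := by
    ext α
    have h1 := hE.schwartz_apply α
    have h2 := (Equiv.neg Idx).hasSum_iff.2 (hE'.schwartz_apply α)
    have h3 := (poisson hΛ η α).mul_right (eta hΛ α)
    have h4 := ((summable_norm_add_latt hA η α).of_norm.hasSum).mul_left (eta hΛ α)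
    have h5 : E α = perSum Λ η α * eta hΛ α := by
      refine h1.unique (h3.congr_fun fun j => ?_)
      rw [smul_apply, modul_apply, smul_eq_mul]
      ring
    have h6 : E' α = eta hΛ α * perSum Λ η α := by
      refine h2.unique (h4.congr_fun fun m => ?_)
      simp only [Function.comp, Equiv.neg_apply, Sm_coe_apply, transl_apply, latt_neg,
        sub_neg_eq_add]
    rw [h5, h6, mul_comm]
  have e2 : E'' = η := by
    ext α
    have h1 := (Equiv.neg Idx).hasSum_iff.2 (hE''.schwartz_apply α)
    have h2 := (isPartition_eta hΛ α).mul_left (η α)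
    rw [mul_one] at h2
    refine h1.unique (h2.congr_fun fun m => ?_)
    simp only [Function.comp, Equiv.neg_apply, Sm_coe_apply, transl_apply, latt_neg,
      sub_neg_eq_add]
  -- Termwise, a dual lattice translation of the whole product is invisible to `ψ` and carries the
  -- shift over to the other factor.
  have e3 : ψ E' v = ψ E'' v := by
    have h1 := hE'.dist₂_apply ψ v
    have h2 := (Equiv.neg Idx).hasSum_iff.2 (hE''.dist₂_apply ψ v)
    refine h1.unique (h2.congr_fun fun m => ?_)
    simp only [Function.comp, Equiv.neg_apply]
    rw [← hψ.1 m (Sm η (transl (latt (dualMat Λ) (-m)) (eta hΛ)))]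
    congr 2
    ext α
    simp only [transl_apply, Sm_coe_apply, latt_neg, sub_neg_eq_add, sub_add_cancel]
    ring
  have h1 := (hasSum_blochTest hΛ η v).dist_apply (blochInv hΛ ψ)
  have h2 := hE.dist₂_apply ψ v
  -- Quasiperiodicity replaces the translates of `v` by phases multiplying `eta`.
  have e4 : blochInv hΛ ψ (blochTest Λ η v) = ψ E v := by
    refine h1.unique (h2.congr_fun fun j => ?_)
    rw [map_smul, map_smul]
    change (blochConst Λ * coef Λ η j) • blochConst Λ • ψ (eta hΛ) (transl (latt Λ j) v) =
      (blochConst Λ ^ 2 * coef Λ η j) • ψ (modul Λ j (eta hΛ)) v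
    rw [hψ.2, smul_smul]
    congr 1
    ring
  rw [e4, e1, e3, e2]

/-! ### A partition of unity with small supports -/

/-- A smooth function on the line with support in `[-1, 1]`, the integer translates of which sum
up to one. -/
def hat (t : ℝ) : ℝ := Real.smoothTransition (t + 1) - Real.smoothTransition t

theorem contDiff_hat : ContDiff ℝ ((⊤ : ℕ∞) : WithTop ℕ∞) hat :=
  (Real.smoothTransition.contDiff.comp (contDiff_id.add contDiff_const)).sub
    Real.smoothTransition.contDiff

theorem hat_eq_zero {t : ℝ} (h : 1 ≤ |t|) : hat t = 0 := by
  rcases le_abs.1 h with h | h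
  · rw [hat, Real.smoothTransition.one_of_one_le (by linarith),
      Real.smoothTransition.one_of_one_le h, sub_self]
  · rw [hat, Real.smoothTransition.zero_of_nonpos (by linarith),
      Real.smoothTransition.zero_of_nonpos (by linarith), sub_self]

/-- Only two translates can be nonzero at `t`, and in their sum the values of the transition
function at the fractional part of `t` cancel. -/
theorem hasSum_hat (t : ℝ) : HasSum (fun m : ℤ => hat (t + m)) 1 := by
  have h0 := Int.floor_le t
  have h1 := Int.lt_floor_add_one t
  have hne : -⌊t⌋ ≠ -⌊t⌋ - 1 := by omega
  have hs : ∀ m ∉ ({-⌊t⌋, -⌊t⌋ - 1} : Finset ℤ), hat (t + m) = 0 := by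
    intro m hm
    simp only [Finset.mem_insert, Finset.mem_singleton, not_or] at hm
    refine hat_eq_zero (le_abs.2 ?_)
    rcases lt_or_gt_of_ne hm.1 with h | h
    · right
      have : m ≤ -⌊t⌋ - 2 := by omega
      have : (m : ℝ) ≤ -⌊t⌋ - 2 := by exact_mod_cast this
      linarith
    · left
      have : -⌊t⌋ + 1 ≤ m := by omega
      have : (-⌊t⌋ + 1 : ℝ) ≤ m := by exact_mod_cast this
      linarith
  have h := hasSum_sum_of_ne_finset_zero (L := .unconditional ℤ) hs
  rw [Finset.sum_pair hne] at h
  convert h using 1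
  push_cast
  rw [hat, hat, Real.smoothTransition.one_of_one_le (by linarith : 1 ≤ t + -(⌊t⌋ : ℝ) + 1),
    Real.smoothTransition.zero_of_nonpos (by linarith : t + (-(⌊t⌋ : ℝ) - 1) ≤ 0)]
  have : t + (-(⌊t⌋ : ℝ) - 1) + 1 = t + -⌊t⌋ := by ring
  rw [this]
  ring

/-- The product of two functions `hat`, scaled to size `ε`. -/
def hat₂ (ε : ℝ) (x : Plane) : ℝ := hat (ε⁻¹ * x 0) * hat (ε⁻¹ * x 1)

theorem contDiff_hat₂ (ε : ℝ) : ContDiff ℝ ((⊤ : ℕ∞) : WithTop ℕ∞) (hat₂ ε) := by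
  have h : ∀ i : Fin 2, ContDiff ℝ ((⊤ : ℕ∞) : WithTop ℕ∞) fun x : Plane => hat (ε⁻¹ * x i) :=
    fun i => contDiff_hat.comp (contDiff_const.mul (by fun_prop))
  exact (h 0).mul (h 1)

theorem hat₂_eq_zero {ε : ℝ} (hε : 0 < ε) {x : Plane} (h : 2 * ε ≤ ‖x‖) : hat₂ ε x = 0 := by
  by_contra hne
  have h0 : ∀ i : Fin 2, |x i| < ε := by
    intro i
    by_contra hi
    push Not at hi
    have : hat (ε⁻¹ * x i) = 0 := hat_eq_zero (by
      rw [abs_mul, abs_of_pos (inv_pos.2 hε), inv_mul_eq_div, le_div_iff₀ hε, one_mul]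
      exact hi)
    apply hne
    fin_cases i <;> simp_all [hat₂]
  have h1 := norm_sq_eq x
  have h2 := sq_lt_sq' (by linarith [abs_lt.1 (h0 0)]) (abs_lt.1 (h0 0)).2
  have h3 := sq_lt_sq' (by linarith [abs_lt.1 (h0 1)]) (abs_lt.1 (h0 1)).2
  nlinarith

theorem hasCompactSupport_hat₂ {ε : ℝ} (hε : 0 < ε) : HasCompactSupport (hat₂ ε) :=
  HasCompactSupport.intro (isCompact_closedBall (0 : Plane) (2 * ε)) fun x hx =>
    hat₂_eq_zero hε (by simpa using le_of_lt (not_le.1 fun h => hx (by simpa using h)))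

/-- The matrix of the lattice `ε ℤ²`. -/
def fineMat (ε : ℝ) : Matrix (Fin 2) (Fin 2) ℝ := ε • 1

theorem isUnit_det_fineMat {ε : ℝ} (hε : 0 < ε) : IsUnit (fineMat ε).det := by
  simp [fineMat, hε.ne']

theorem latt_fineMat (ε : ℝ) (m : Idx) (i : Fin 2) : latt (fineMat ε) m i = ε * m i := by
  simp [latt, mulPt, fineMat, Matrix.smul_mulVec]

theorem hasSum_hat_mul (t u : ℝ) :
    HasSum (fun p : ℤ × ℤ => hat (t + p.1) * hat (u + p.2)) 1 := by
  have s0 : Summable fun m : ℤ => ‖hat (t + m)‖ := (hasSum_hat t).summable.norm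
  have s1 : Summable fun m : ℤ => ‖hat (u + m)‖ := (hasSum_hat u).summable.norm
  have hs := summable_mul_of_summable_norm s0 s1
  have h := tsum_mul_tsum_of_summable_norm s0 s1
  rw [(hasSum_hat t).tsum_eq, (hasSum_hat u).tsum_eq, one_mul] at h
  rw [h]
  exact hs.hasSum

theorem hat₂_sub {ε : ℝ} (hε : 0 < ε) (x : Plane) (m : Idx) :
    hat₂ ε (x - latt (fineMat ε) m) =
      hat (ε⁻¹ * x 0 + ((-m 0 : ℤ) : ℝ)) * hat (ε⁻¹ * x 1 + ((-m 1 : ℤ) : ℝ)) := by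
  have h2 : ∀ i : Fin 2, ε⁻¹ * (x - latt (fineMat ε) m) i = ε⁻¹ * x i + ((-m i : ℤ) : ℝ) := by
    intro i
    rw [PiLp.sub_apply, latt_fineMat, mul_sub, inv_mul_cancel_left₀ hε.ne']
    push_cast
    ring
  rw [hat₂, h2, h2]

theorem hasSum_hat₂ {ε : ℝ} (hε : 0 < ε) (x : Plane) :
    HasSum (fun m : Idx => hat₂ ε (x - latt (fineMat ε) m)) 1 := by
  simp only [hat₂_sub hε]
  exact (Equiv.hasSum_iff ((Equiv.neg Idx).trans (finTwoArrowEquiv ℤ))).2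
    (hasSum_hat_mul (ε⁻¹ * x 0) (ε⁻¹ * x 1))

/-- The factor `v` makes the partition of unity converge in the Schwartz topology, so that tempered
distributions may be applied term by term. -/
theorem exists_small_partition {ε : ℝ} (hε : 0 < ε) (v : 𝓢(Plane, ℂ)) :
    HasSum (fun m : Idx => Sm v (transl (latt (fineMat ε) m)
      (ofCompact (hasCompactSupport_hat₂ hε) (contDiff_hat₂ ε)))) v := by
  obtain ⟨E, hE⟩ := exists_hasSum_mul_transl (isUnit_det_fineMat hε) v
    (ofCompact (hasCompactSupport_hat₂ hε) (contDiff_hat₂ ε))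
  convert hE
  ext x
  have h1 := hE.schwartz_apply x
  have h2 := (Complex.hasSum_ofReal.2 (hasSum_hat₂ hε x)).mul_left (v x)
  rw [Complex.ofReal_one, mul_one] at h2
  exact h2.unique (h1.congr_fun fun m => by rw [Sm_coe_apply, transl_apply, ofCompact_apply])

theorem tsupport_small {ε : ℝ} (hε : 0 < ε) (v : 𝓢(Plane, ℂ)) (a : Plane) :
    tsupport (Sm v (transl a (ofCompact (hasCompactSupport_hat₂ hε) (contDiff_hat₂ ε)))) ⊆
      Metric.closedBall a (2 * ε) := by
  refine closure_minimal (fun x hx => ?_) Metric.isClosed_closedBall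
  by_contra h
  apply hx
  rw [Metric.mem_closedBall, dist_eq_norm, not_le] at h
  rw [Sm_coe_apply, transl_apply, ofCompact_apply, hat₂_eq_zero hε h.le]
  simp

/-- A tempered distribution that vanishes on functions with small supports is zero. -/
theorem dist_ext_of_small {T S : 𝓢'(Plane, ℂ)} {ρ : ℝ} (hρ : 0 < ρ)
    (h : ∀ (a : Plane) (w : 𝓢(Plane, ℂ)), tsupport w ⊆ Metric.ball a ρ → T w = S w) : T = S := by
  ext v
  have hs := exists_small_partition (ε := ρ / 4) (by positivity) v
  refine (hs.dist_apply T).unique ((hs.dist_apply S).congr_fun fun m => ?_)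
  refine h (latt (fineMat (ρ / 4)) m) _ ((tsupport_small (by positivity) v _).trans ?_)
  exact Metric.closedBall_subset_ball (by linarith)

theorem hasCompactSupport_of_small {a : Plane} {ρ : ℝ} {w : 𝓢(Plane, ℂ)}
    (h : tsupport w ⊆ Metric.ball a ρ) : HasCompactSupport w :=
  (isCompact_closedBall a ρ).of_isClosed_subset (isClosed_tsupport _)
    (h.trans Metric.ball_subset_closedBall)

theorem ae_eq_of_small {f g : Plane → ℂ} (hf : LocallyIntegrable f) (hg : LocallyIntegrable g)
    {ρ : ℝ} (hρ : 0 < ρ) (h : ∀ (a : Plane) (w : 𝓢(Plane, ℂ)), tsupport w ⊆ Metric.ball a ρ →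
      ∫ x, f x * w x = ∫ x, g x * w x) : f =ᵐ[volume] g := by
  rw [Filter.EventuallyEq, ae_iff]
  refine measure_null_of_locally_null _ fun a _ => ?_
  have hU : IsOpen (Metric.ball a ρ) := Metric.isOpen_ball
  have key : ∀ᵐ x, x ∈ Metric.ball a ρ → (f - g) x = 0 := by
    refine hU.ae_eq_zero_of_integral_contDiff_smul_eq_zero ((hf.sub hg).locallyIntegrableOn _)
      fun φ hφ hc hs => ?_
    have h1 := h a (ofCompact hc hφ) ((closure_mono ?_).trans hs)
    · have i1 : ∀ u : Plane → ℂ, LocallyIntegrable u → Integrable fun x => u x * (φ x : ℂ) := by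
        intro u hu
        have := hu.integrable_smul_left_of_hasCompactSupport hφ.continuous hc
        refine this.congr (Eventually.of_forall fun x => ?_)
        simp [mul_comm]
      simp only [ofCompact_apply] at h1
      calc ∫ x, φ x • (f - g) x = ∫ x, (f x * (φ x : ℂ) - g x * (φ x : ℂ)) := by
            congr 1; ext x; simp [mul_sub, mul_comm]
        _ = 0 := by rw [integral_sub (i1 f hf) (i1 g hg), h1, sub_self]
    · intro x hx hx'
      apply hx
      simp [ofCompact_apply, hx']
  refine ⟨_, inter_mem_nhdsWithin _ (Metric.ball_mem_nhds a hρ), ?_⟩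
  rw [ae_iff] at key
  refine measure_mono_null (fun x hx => ?_) key
  intro h'
  exact hx.1 (sub_eq_zero.1 (h' hx.2))

/-! ### The Fourier transform in the normalization of the lattice -/

theorem two_pi_ne_zero : (2 * Real.pi : ℝ) ≠ 0 := by positivity

/-- The dilation `v ↦ v(2π ·)`. -/
def dil : 𝓢(Plane, ℂ) →L[ℂ] 𝓢(Plane, ℂ) :=
  SchwartzMap.compCLMOfContinuousLinearEquiv ℂ
    (LinearEquiv.smulOfNeZero ℝ Plane _ two_pi_ne_zero).toContinuousLinearEquiv

/-- The dilation `v ↦ v((2π)⁻¹ ·)`. -/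
def dilInv : 𝓢(Plane, ℂ) →L[ℂ] 𝓢(Plane, ℂ) :=
  SchwartzMap.compCLMOfContinuousLinearEquiv ℂ
    (LinearEquiv.smulOfNeZero ℝ Plane _ (inv_ne_zero two_pi_ne_zero)).toContinuousLinearEquiv

theorem dil_apply (v : 𝓢(Plane, ℂ)) (x : Plane) : dil v x = v ((2 * Real.pi) • x) := rfl

theorem dilInv_apply (v : 𝓢(Plane, ℂ)) (x : Plane) : dilInv v x = v ((2 * Real.pi)⁻¹ • x) := rfl

theorem dil_dilInv (v : 𝓢(Plane, ℂ)) : dil (dilInv v) = v := by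
  ext x
  rw [dil_apply, dilInv_apply, inv_smul_smul₀ two_pi_ne_zero]

theorem dilInv_dil (v : 𝓢(Plane, ℂ)) : dilInv (dil v) = v := by
  ext x
  rw [dilInv_apply, dil_apply, smul_inv_smul₀ two_pi_ne_zero]

/-- The transform `α ↦ ∫ exp(i α·x) v(x) dx`. -/
def uft : 𝓢(Plane, ℂ) →L[ℂ] 𝓢(Plane, ℂ) :=
  dilInv.comp (FourierTransform.fourierInvCLM ℂ 𝓢(Plane, ℂ))

/-- The inverse of `uft`. -/
def uftInv : 𝓢(Plane, ℂ) →L[ℂ] 𝓢(Plane, ℂ) :=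
  (FourierTransform.fourierCLM ℂ 𝓢(Plane, ℂ)).comp dil

theorem uft_uftInv (v : 𝓢(Plane, ℂ)) : uft (uftInv v) = v := by
  change dilInv (𝓕⁻ (𝓕 (dil v))) = v
  rw [FourierTransform.fourierInv_fourier_eq, dilInv_dil]

theorem uftInv_uft (v : 𝓢(Plane, ℂ)) : uftInv (uft v) = v := by
  change 𝓕 (dil (dilInv (𝓕⁻ v))) = v
  rw [dil_dilInv, FourierTransform.fourier_fourierInv_eq]

theorem uft_apply (v : 𝓢(Plane, ℂ)) (α : Plane) : uft v α = ∫ x, phase α x * v x := by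
  change (𝓕⁻ v) ((2 * Real.pi)⁻¹ • α) = _
  rw [SchwartzMap.fourierInv_coe, Real.fourierInv_eq]
  refine integral_congr_ae (Eventually.of_forall fun x => ?_)
  simp only [Circle.smul_def, smul_eq_mul, Real.fourierChar_apply, phase, inner_smul_right]
  congr 2
  rw [real_inner_comm]
  push_cast
  field_simp

theorem uft_transl (a : Plane) (v : 𝓢(Plane, ℂ)) (α : Plane) :
    uft (transl a v) α = phase α a * uft v α := by
  rw [uft_apply, uft_apply, ← integral_const_mul, ← integral_add_right_eq_self _ a]
  refine integral_congr_ae (Eventually.of_forall fun x => ?_)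
  simp only [transl_apply, add_sub_cancel_right, phase_add_right]
  ring

/-- Translates become phases, and the resulting Fourier series is summed by Poisson's formula. So on
the Fourier side the transform only sees multiplication by periodic functions. -/
theorem uft_blochTest (hΛ : IsUnit Λ.det) (η v : 𝓢(Plane, ℂ)) (α : Plane) :
    uft (blochTest Λ η v) α = (blochConst Λ)⁻¹ * (perSum Λ η α * uft v α) := by
  have h1 := ((hasSum_blochTest hΛ η v).map uft uft.continuous).schwartz_apply α
  have h2 := ((poisson hΛ η α).mul_right (uft v α)).mul_left (blochConst Λ)⁻¹
  refine h1.unique (h2.congr_fun fun j => ?_)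
  simp only [Function.comp, map_smul, smul_apply, uft_transl, smul_eq_mul]
  have := blochConst_ne_zero hΛ
  field_simp

/-- The Fourier transform of tempered distributions with respect to `uft`. -/
def Fh (T : 𝓢'(Plane, ℂ)) : 𝓢'(Plane, ℂ) :=
  (2 * Real.pi : ℂ) • PointwiseConvergenceCLM.precomp ℂ uftInv T

theorem Fh_apply (T : 𝓢'(Plane, ℂ)) (w : 𝓢(Plane, ℂ)) :
    Fh T w = 2 * Real.pi * T (uftInv w) := rfl

theorem Fh_apply' (T : 𝓢'(Plane, ℂ)) (w : 𝓢(Plane, ℂ)) :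
    Fh T w = 2 * Real.pi * 𝓕 T (dil w) := rfl

theorem apply_eq_Fh (T : 𝓢'(Plane, ℂ)) (v : 𝓢(Plane, ℂ)) :
    T v = (2 * Real.pi : ℂ)⁻¹ * Fh T (uft v) := by
  have : (Real.pi : ℂ) ≠ 0 := by exact_mod_cast Real.pi_ne_zero
  rw [Fh_apply, uftInv_uft]
  field_simp

/-- The factor `2π` in `Fh` is chosen so that, with the prefactor `|det Λ|^{-1/2}` of the Fourier
expansion, the coefficients are translates of `Fh T` without any further constant. -/
theorem sqrt_det_inv (Λ : Matrix (Fin 2) (Fin 2) ℝ) :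
    (2 * Real.pi : ℂ)⁻¹ * (blochConst Λ)⁻¹ = ((Real.sqrt |Λ.det| : ℝ) : ℂ)⁻¹ := by
  have h : (Real.pi : ℂ) ≠ 0 := by exact_mod_cast Real.pi_ne_zero
  rw [blochConst]
  push_cast
  rw [inv_div]
  field_simp

theorem blochJ_eq_Fh (hΛ : IsUnit Λ.det) (T : 𝓢'(Plane, ℂ)) (η v : 𝓢(Plane, ℂ)) :
    blochJ hΛ T η v = (2 * Real.pi : ℂ)⁻¹ * Fh T (uft (blochTest Λ η v)) := by
  rw [blochJ_apply, ← apply_eq_Fh]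

/-- Exchanges the non-smooth power of `1 + |x|` for a weight that may multiply Schwartz functions.
-/
theorem one_add_norm_pow_le (x : Plane) : (1 + ‖x‖) ^ 3 ≤ 4 * ‖wt 1 4 x‖ := by
  rw [norm_wt]
  norm_num
  nlinarith [norm_nonneg x, sq_nonneg (‖x‖ - 1), sq_nonneg (‖x‖ ^ 2 - 1), sq_nonneg (‖x‖ ^ 2 - ‖x‖),
    pow_nonneg (norm_nonneg x) 3]

theorem locallyIntegrable_comp_add_right {G : Plane → ℂ} (hG : LocallyIntegrable G) (a : Plane) :
    LocallyIntegrable fun x => G (x + a) := by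
  have h := locallyIntegrable_map_homeomorph (Homeomorph.addRight a) (f := G)
    (μ := (volume : Measure Plane))
  have e : Measure.map (Homeomorph.addRight a) (volume : Measure Plane) = volume :=
    (measurePreserving_add_right volume a).map_eq
  rw [e] at h
  exact h.1 hG

/-- The Fourier coefficients of a Bloch transform are the translates of the Fourier transform. -/
theorem isFourierExpansion_blochJ (hΛ : IsUnit Λ.det) {T : 𝓢'(Plane, ℂ)} {G : Plane → ℂ}
    (hG : Represents (Fh T) G) :
    IsFourierExpansion Λ (blochJ hΛ T) fun j α => G (α + latt (dualMat Λ) j) := by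
  have hA := isUnit_det_dualMat hΛ
  refine ⟨fun j => locallyIntegrable_comp_add_right hG.locallyIntegrable _, fun η v => ?_⟩
  simp only [← uft_apply]
  set K := ((Real.sqrt |Λ.det| : ℝ) : ℂ)⁻¹
  let F : Idx → Plane → ℂ := fun j α => G α * uft v α * η (α - latt (dualMat Λ) j)
  -- The representative is tested against `(1 + |α|²)²` times the transform of `v`. The extra power
  -- pays for estimating `η(α - Λ*j)` by a summable power of `1 + |Λ*j|`, uniformly up to growth in
  -- `α`.
  have hGv : Integrable fun α => G α * (Sm (wt 1 4) (uft v)) α := (hG _).1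
  have hGu : Integrable fun α => G α * uft v α := (hG _).1
  have hF : ∀ j, Integrable (F j) := fun j =>
    hGu.mul_bdd (c := 8 * pn 3 η) (by
      have : Continuous fun α => η (α - latt (dualMat Λ) j) := η.continuous.comp (by fun_prop)
      exact this.aestronglyMeasurable) (Eventually.of_forall fun α => by
        have h := one_add_pow_mul_norm_le_pn 3 η (α - latt (dualMat Λ) j)
        have h1 : 1 ≤ (1 + ‖α - latt (dualMat Λ) j‖) ^ 3 := one_le_pow₀ (by simp)
        nlinarith [norm_nonneg (η (α - latt (dualMat Λ) j))])
  have hbound : ∀ j, ∫ α, ‖F j α‖ ≤ (8 * pn 3 η * 4 * ∫ α, ‖G α * (Sm (wt 1 4) (uft v)) α‖) *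
      ((1 + ‖latt (dualMat Λ) (-j)‖) ^ 3)⁻¹ := by
    intro j
    calc ∫ α, ‖F j α‖ ≤ ∫ α, (8 * pn 3 η * 4 * ((1 + ‖latt (dualMat Λ) (-j)‖) ^ 3)⁻¹) *
          ‖G α * (Sm (wt 1 4) (uft v)) α‖ := by
          refine integral_mono (hF j).norm (hGv.norm.const_mul _) fun α => ?_
          have h1 := norm_add_latt_le (dualMat Λ) η α (-j)
          have h2 := one_add_norm_pow_le α
          simp only [F, norm_mul, SchwartzMap.smulLeftCLM_apply_apply (hasTemperateGrowth_wt 1 4),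
            smul_eq_mul]
          rw [sub_eq_add_neg, ← latt_neg]
          have h3 : 0 ≤ ((1 + ‖latt (dualMat Λ) (-j)‖) ^ 3)⁻¹ := by positivity
          have h4 : (0 : ℝ) ≤ pn 3 η := apply_nonneg _ _
          calc _ ≤ ‖G α‖ * ‖uft v α‖ * (8 * pn 3 η * (4 * ‖wt 1 4 α‖) *
                ((1 + ‖latt (dualMat Λ) (-j)‖) ^ 3)⁻¹) := by
                gcongr
                exact h1.trans (by gcongr)
            _ = _ := by ring
      _ = _ := by rw [integral_const_mul]; ring
  have hs : Summable fun j => ∫ α, ‖F j α‖ := by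
    refine Summable.of_nonneg_of_le (fun j => integral_nonneg fun α => norm_nonneg _) hbound ?_
    exact ((Equiv.neg Idx).summable_iff.2 (summable_latt hA)).mul_left _
  have h1 := (hasSum_integral_of_summable_integral_norm hF hs).mul_left K
  have e : blochJ hΛ T η v = K * ∫ α, ∑' j, F j α := by
    rw [blochJ_eq_Fh, (hG _).2]
    simp only [K]
    rw [← sqrt_det_inv, mul_assoc, ← integral_const_mul (blochConst Λ)⁻¹]
    congr 2
    ext α
    rw [uft_blochTest hΛ, tsum_mul_left, perSum, ← (Equiv.neg Idx).tsum_eq]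
    simp only [Equiv.neg_apply, latt_neg, ← sub_eq_add_neg]
    ring
  rw [e]
  refine h1.congr_fun fun j => ?_
  rw [← integral_add_right_eq_self (F j) (latt (dualMat Λ) j)]
  congr 2
  ext α
  simp only [F, add_sub_cancel_right]
  rw [add_comm (latt (dualMat Λ) j) α]
  ring

/-- Nonzero points of a lattice are bounded away from zero. -/
theorem exists_latt_gap {A : Matrix (Fin 2) (Fin 2) ℝ} (hA : IsUnit A.det) :
    ∃ ρ : ℝ, 0 < ρ ∧ ∀ j : Idx, ‖latt A j‖ < 3 * ρ → j = 0 := by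
  obtain ⟨c, hc, h⟩ := exists_norm_le_latt hA
  refine ⟨(3 * c)⁻¹, by positivity, fun j hj => ?_⟩
  by_contra hne
  have h1 : 1 ≤ ‖j‖ := by
    obtain ⟨i, hi⟩ := Function.ne_iff.1 hne
    refine le_trans ?_ (norm_le_pi_norm j i)
    rw [Int.norm_eq_abs]
    exact_mod_cast Int.one_le_abs hi
  have h2 : 3 * (3 * c)⁻¹ = c⁻¹ := by field_simp
  rw [h2, lt_inv_comm₀ (lt_of_le_of_ne (norm_nonneg _) ?_) hc] at hj
  · have := h j
    have h3 : 0 < ‖latt A j‖ := by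
      by_contra h0
      have : ‖latt A j‖ = 0 := le_antisymm (not_lt.1 h0) (norm_nonneg _)
      simp_all
    have h4 : c * ‖latt A j‖ < ‖latt A j‖⁻¹ * ‖latt A j‖ := by gcongr
    rw [inv_mul_cancel₀ h3.ne'] at h4
    linarith
  · intro h0
    have := h j
    rw [← h0, mul_zero] at this
    linarith

/-- If the Bloch transform has Fourier coefficients `c_j`, then the Fourier transform is locally
the function `c_j(· - Λ*j)`. -/
theorem Fh_apply_of_isFourierExpansion (hΛ : IsUnit Λ.det) {T : 𝓢'(Plane, ℂ)}
    {c : Idx → Plane → ℂ} (hc : IsFourierExpansion Λ (blochJ hΛ T) c) {ρ : ℝ} (hρ : 0 < ρ)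
    (hgap : ∀ j : Idx, ‖latt (dualMat Λ) j‖ < 3 * ρ → j = 0) (j : Idx) (a : Plane)
    (w : 𝓢(Plane, ℂ)) (hw : tsupport w ⊆ Metric.ball a ρ) :
    Fh T w = ∫ α, c j α * w (α + latt (dualMat Λ) j) := by
  -- `b` is one on the ball of radius `ρ` and vanishes outside radius `2ρ`; by the gap `3ρ` it meets
  -- no other lattice translate of `w`.
  let b : ContDiffBump a := ⟨ρ, 2 * ρ, hρ, by linarith⟩
  have hw0 : ∀ x, ρ ≤ ‖x - a‖ → w x = 0 := fun x hx =>
    image_eq_zero_of_notMem_tsupport fun h => by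
      have := hw h
      rw [Metric.mem_ball, dist_eq_norm] at this
      linarith
  have hb0 : ∀ x, 2 * ρ ≤ ‖x - a‖ → schwartzBump b x = 0 := fun x hx => by
    rw [schwartzBump_apply, b.zero_of_le_dist (by rw [dist_eq_norm]; exact hx), Complex.ofReal_zero]
  have hb1 : ∀ x, ‖x - a‖ ≤ ρ → schwartzBump b x = 1 := fun x hx => by
    rw [schwartzBump_apply, b.one_of_mem_closedBall (by
      rw [Metric.mem_closedBall, dist_eq_norm]; exact hx), Complex.ofReal_one]
  have key : ∀ x (k : Idx), k ≠ 0 → w (x + latt (dualMat Λ) k) * schwartzBump b x = 0 := by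
    intro x k hk
    by_contra hne
    have h1 : ‖x + latt (dualMat Λ) k - a‖ < ρ := by
      by_contra h
      rw [hw0 _ (not_lt.1 h), zero_mul] at hne
      exact hne rfl
    have h2 : ‖x - a‖ < 2 * ρ := by
      by_contra h
      rw [hb0 _ (not_lt.1 h), mul_zero] at hne
      exact hne rfl
    refine hk (hgap k ?_)
    have e : latt (dualMat Λ) k = (x + latt (dualMat Λ) k - a) - (x - a) := by abel
    rw [e]
    exact (norm_sub_le _ _).trans_lt (by linarith)
  have key0 : ∀ x, w x * schwartzBump b x = w x := by
    intro x
    by_cases h : ‖x - a‖ ≤ ρ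
    · rw [hb1 x h, mul_one]
    · rw [hw0 x (not_le.1 h).le, zero_mul]
  set η := transl (-latt (dualMat Λ) j) w with hη
  have hηx : ∀ x, η x = w (x + latt (dualMat Λ) j) := fun x => by
    rw [hη, transl_apply, sub_neg_eq_add]
  set v := uftInv (schwartzBump b)
  have hv : uft v = schwartzBump b := uft_uftInv _
  -- The transform of `v` is `b`, and in the periodization of `η` only the translate that equals `w`
  -- meets `b`.
  have e1 : uft (blochTest Λ η v) = (blochConst Λ)⁻¹ • w := by
    ext x
    rw [uft_blochTest hΛ, hv, smul_apply, smul_eq_mul]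
    congr 1
    rw [perSum, ← tsum_mul_right, tsum_eq_single (-j), hηx, latt_neg, neg_add_cancel_right, key0]
    intro m hm
    rw [hηx, add_assoc, ← latt_add]
    exact key x _ fun h => hm (eq_neg_of_add_eq_zero_left h)
  have e2 : blochJ hΛ T η v = ((Real.sqrt |Λ.det| : ℝ) : ℂ)⁻¹ * Fh T w := by
    rw [blochJ_eq_Fh, e1, map_smul, smul_eq_mul, ← mul_assoc, sqrt_det_inv]
  have h1 := hc.2 η v
  simp only [← uft_apply, hv] at h1
  -- In the Fourier expansion too, every coefficient but the `j`-th is tested against zero.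
  have e3 := h1.unique (hasSum_single j fun k hk => by
    have : ∀ α, c k α * η α * schwartzBump b (latt (dualMat Λ) k + α) = 0 := by
      intro α
      rw [hηx, mul_assoc]
      have h2 := key (latt (dualMat Λ) k + α) (j - k) (sub_ne_zero.2 hk.symm)
      rw [latt_sub] at h2
      have e : latt (dualMat Λ) k + α + (latt (dualMat Λ) j - latt (dualMat Λ) k) =
        α + latt (dualMat Λ) j := by abel
      rw [e] at h2
      rw [h2, mul_zero]
    simp only [this, integral_zero, mul_zero])
  rw [e2] at e3
  have hK : ((Real.sqrt |Λ.det| : ℝ) : ℂ)⁻¹ ≠ 0 := by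
    have := Real.sqrt_pos.2 (abs_pos.2 hΛ.ne_zero)
    exact inv_ne_zero (Complex.ofReal_ne_zero.2 this.ne')
  rw [mul_left_cancel₀ hK e3]
  congr 1
  ext α
  rw [mul_assoc, hηx, add_comm (latt (dualMat Λ) j) α, key0]

/-! ### Integer regularity in the quasiperiodicity -/

/-- The derivative `∂^γ` of a tempered distribution. -/
def pdD (γ : ℕ × ℕ) (U : 𝓢'(Plane, ℂ)) : 𝓢'(Plane, ℂ) :=
  (fun V : 𝓢'(Plane, ℂ) => ∂_{ei 0} V)^[γ.1] ((fun V : 𝓢'(Plane, ℂ) => ∂_{ei 1} V)^[γ.2] U)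

theorem iterate_lineDeriv_apply (m : Plane) (n : ℕ) (U : 𝓢'(Plane, ℂ)) (v : 𝓢(Plane, ℂ)) :
    ((fun V : 𝓢'(Plane, ℂ) => ∂_{m} V)^[n] U) v =
      (-1) ^ n * U ((fun f : 𝓢(Plane, ℂ) => ∂_{m} f)^[n] v) := by
  induction n generalizing U with
  | zero => simp
  | succ n ih =>
    rw [Function.iterate_succ_apply, ih, Function.iterate_succ_apply',
      TemperedDistribution.lineDerivOp_apply_apply, map_neg, pow_succ]
    ring

theorem lineDeriv_comm (i j : Fin 2) (u : 𝓢(Plane, ℂ)) :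
    ∂_{ei i} (∂_{ei j} u) = ∂_{ei j} (∂_{ei i} u) := by
  rw [lineDeriv_eq_Fm, lineDeriv_eq_Fm, lineDeriv_eq_Fm, lineDeriv_eq_Fm, map_smul, map_smul,
    Fm_comm (hasTemperateGrowth_coord i) (hasTemperateGrowth_coord j)]

theorem pdD_apply (γ : ℕ × ℕ) (U : 𝓢'(Plane, ℂ)) (v : 𝓢(Plane, ℂ)) :
    pdD γ U v = (-1) ^ (γ.1 + γ.2) * U (partialDeriv γ v) := by
  have hc : Function.Commute (fun f : 𝓢(Plane, ℂ) => ∂_{ei 0} f)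
      (fun f : 𝓢(Plane, ℂ) => ∂_{ei 1} f) := fun u => lineDeriv_comm 0 1 u
  rw [pdD, iterate_lineDeriv_apply, iterate_lineDeriv_apply, pow_add, mul_assoc]
  congr 3
  exact ((hc.iterate_iterate γ.1 γ.2).eq v).symm

theorem lineDeriv_transl (m a : Plane) (u : 𝓢(Plane, ℂ)) :
    ∂_{m} (transl a u) = transl a (∂_{m} u) := by
  ext x
  rw [SchwartzMap.lineDerivOp_apply_eq_fderiv, transl_apply, SchwartzMap.lineDerivOp_apply_eq_fderiv]
  have : (transl a u : Plane → ℂ) = fun y => u (y - a) := funext fun y => transl_apply a u y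
  rw [this, fderiv_comp_sub]

theorem partialDeriv_transl (γ : ℕ × ℕ) (a : Plane) (u : 𝓢(Plane, ℂ)) :
    partialDeriv γ (transl a u) = transl a (partialDeriv γ u) := by
  have hc : ∀ m : Plane, Function.Commute (fun f : 𝓢(Plane, ℂ) => ∂_{m} f) (transl a) :=
    fun m u => lineDeriv_transl m a u
  rw [partialDeriv, partialDeriv, ((hc (ei 1)).iterate_left γ.2).eq,
    ((hc (ei 0)).iterate_left γ.1).eq]

theorem tsupport_partialDeriv_subset (γ : ℕ × ℕ) (u : 𝓢(Plane, ℂ)) :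
    tsupport (partialDeriv γ u) ⊆ tsupport u := by
  have h : ∀ (m : Plane) (n : ℕ) (u : 𝓢(Plane, ℂ)),
      tsupport ((fun f : 𝓢(Plane, ℂ) => ∂_{m} f)^[n] u : 𝓢(Plane, ℂ)) ⊆ tsupport u := by
    intro m n
    induction n with
    | zero => intro u; simp
    | succ n ih =>
      intro u
      rw [Function.iterate_succ_apply]
      exact (ih _).trans (SchwartzMap.tsupport_lineDerivOp_subset m u)
  exact (h _ _ _).trans (h _ _ _)

theorem rpow_le_of_le_mul {a b B : ℝ} (ha : 0 < a) (hb : 0 < b) (hB : 1 ≤ B) (hab : a ≤ B * b)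
    (hba : b ≤ B * a) (s : ℝ) : a ^ s ≤ B ^ |s| * b ^ s := by
  have hB0 : 0 < B := by linarith
  rcases le_or_gt 0 s with hs | hs
  · rw [abs_of_nonneg hs, ← Real.mul_rpow hB0.le hb.le]
    exact Real.rpow_le_rpow ha.le hab hs
  · rw [abs_of_neg hs, Real.rpow_neg hB0.le, ← Real.inv_rpow hB0.le,
      ← Real.mul_rpow (by positivity) hb.le]
    refine Real.rpow_le_rpow_of_nonpos (by positivity) ?_ hs.le
    rw [inv_mul_le_iff₀ hB0]
    exact hba

/-- The cell is bounded, so `|α + A j|` and `|j|` are comparable up to additive constants. That the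
constant is exactly one for `s = 0` is recorded for the isometry. -/
theorem exists_idxWeight_equiv {A : Matrix (Fin 2) (Fin 2) ℝ} (hA : IsUnit A.det) (s : ℝ) :
    ∃ C : ℝ, 0 < C ∧ (s = 0 → C = 1) ∧ ∀ (j : Idx), ∀ α ∈ cell A,
      idxWeight s j ≤ ENNReal.ofReal C * ‖wt 1 s (α + latt A j)‖ₑ ^ 2 ∧
      ‖wt 1 s (α + latt A j)‖ₑ ^ 2 ≤ ENNReal.ofReal C * idxWeight s j := by
  obtain ⟨c, hc, hlow⟩ := exists_norm_le_latt hA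
  obtain ⟨R, hR⟩ := (isBounded_cell A).exists_norm_le
  set M := ‖(mulPtEquiv hA : (Fin 2 → ℝ) →L[ℝ] Plane)‖
  have hM : 0 ≤ M := norm_nonneg _
  have hup : ∀ j : Idx, ‖latt A j‖ ≤ M * ‖j‖ := fun j => by
    have h := (mulPtEquiv hA : (Fin 2 → ℝ) →L[ℝ] Plane).le_opNorm (fun i => (j i : ℝ))
    have e : ‖(fun i => (j i : ℝ))‖ = ‖j‖ := by
      simp only [Pi.norm_def]
      congr 1
    rw [e] at h
    exact h
  have hR0 : 0 ≤ R := (norm_nonneg _).trans (hR (mulPt A 0) ((mem_cell_iff hA 0).2 (by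
    intro i; norm_num)))
  set B := 1 + 4 * c ^ 2 * (1 + R ^ 2) + 2 * R ^ 2 + 2 * M ^ 2 with hBdef
  have hB : 1 ≤ B := by have : 0 ≤ 4 * c ^ 2 * (1 + R ^ 2) + 2 * R ^ 2 + 2 * M ^ 2 := by positivity
                        linarith
  have hj : ∀ j : Idx, ‖j‖ ^ 2 ≤ (j 0 : ℝ) ^ 2 + (j 1 : ℝ) ^ 2 ∧
      (j 0 : ℝ) ^ 2 + (j 1 : ℝ) ^ 2 ≤ 2 * ‖j‖ ^ 2 := by
    intro j
    have h0 : |(j 0 : ℝ)| ≤ ‖j‖ := norm_le_pi_norm j 0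
    have h1 : |(j 1 : ℝ)| ≤ ‖j‖ := norm_le_pi_norm j 1
    constructor
    · have h2 : ‖j‖ ≤ Real.sqrt ((j 0 : ℝ) ^ 2 + (j 1 : ℝ) ^ 2) := by
        refine (pi_norm_le_iff_of_nonneg (Real.sqrt_nonneg _)).2 fun i => ?_
        rw [Int.norm_eq_abs]
        refine Real.abs_le_sqrt ?_
        fin_cases i <;> simp <;> positivity
      calc ‖j‖ ^ 2 ≤ _ := pow_le_pow_left₀ (norm_nonneg _) h2 2
        _ = _ := Real.sq_sqrt (by positivity)
    · have h0' := pow_le_pow_left₀ (abs_nonneg _) h0 2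
      have h1' := pow_le_pow_left₀ (abs_nonneg _) h1 2
      rw [sq_abs] at h0' h1'
      linarith
  have key : ∀ (j : Idx), ∀ α ∈ cell A,
      1 + ((j 0 : ℝ) ^ 2 + (j 1 : ℝ) ^ 2) ≤ B * (1 + (1 * ‖α + latt A j‖) ^ 2) ∧
      1 + (1 * ‖α + latt A j‖) ^ 2 ≤ B * (1 + ((j 0 : ℝ) ^ 2 + (j 1 : ℝ) ^ 2)) := by
    intro j α hα
    obtain ⟨hj1, hj2⟩ := hj j
    have hα' := hR α hα
    set q := (j 0 : ℝ) ^ 2 + (j 1 : ℝ) ^ 2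
    set y := ‖α + latt A j‖
    have h1 : ‖latt A j‖ ≤ y + R := by
      have e : latt A j = (α + latt A j) - α := by abel
      rw [e]
      exact (norm_sub_le _ _).trans (by linarith)
    have h2 : y ≤ R + M * ‖j‖ := (norm_add_le _ _).trans (by linarith [hup j])
    have hy : 0 ≤ y := norm_nonneg _
    have h3 : ‖j‖ ^ 2 ≤ c ^ 2 * (2 * y ^ 2 + 2 * R ^ 2) := by
      have h4 : ‖j‖ ≤ c * (y + R) := (hlow j).trans (by gcongr)
      calc ‖j‖ ^ 2 ≤ (c * (y + R)) ^ 2 := pow_le_pow_left₀ (norm_nonneg _) h4 2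
        _ = c ^ 2 * (y + R) ^ 2 := by ring
        _ ≤ _ := by gcongr; nlinarith [sq_nonneg (y - R)]
    have h5 : y ^ 2 ≤ 2 * R ^ 2 + 2 * M ^ 2 * ‖j‖ ^ 2 := by
      calc y ^ 2 ≤ (R + M * ‖j‖) ^ 2 := pow_le_pow_left₀ hy h2 2
        _ ≤ _ := by nlinarith [sq_nonneg (R - M * ‖j‖)]
    have hq : 0 ≤ q := by positivity
    constructor
    · have : (0:ℝ) ≤ c ^ 2 * R ^ 2 * y ^ 2 := by positivity
      have : (0:ℝ) ≤ R ^ 2 * y ^ 2 := by positivity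
      have : (0:ℝ) ≤ M ^ 2 * y ^ 2 := by positivity
      nlinarith [sq_nonneg c, sq_nonneg R, sq_nonneg M]
    · have h6 : M ^ 2 * ‖j‖ ^ 2 ≤ M ^ 2 * q := by gcongr
      have : (0:ℝ) ≤ c ^ 2 * (1 + R ^ 2) * (1 + q) := by positivity
      have : (0:ℝ) ≤ R ^ 2 * q := by positivity
      nlinarith [sq_nonneg c, sq_nonneg R, sq_nonneg M]
  refine ⟨B ^ |s|, by positivity, by rintro rfl; simp, fun j α hα => ?_⟩
  obtain ⟨k1, k2⟩ := key j α hα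
  have p1 : 0 < 1 + ((j 0 : ℝ) ^ 2 + (j 1 : ℝ) ^ 2) := by positivity
  have p2 := one_add_sq_pos 1 (α + latt A j)
  rw [enorm_wt_sq, idxWeight, ← ENNReal.ofReal_mul (by positivity),
    ← ENNReal.ofReal_mul (by positivity)]
  exact ⟨ENNReal.ofReal_le_ofReal (rpow_le_of_le_mul p1 p2 hB k1 k2 s),
    ENNReal.ofReal_le_ofReal (rpow_le_of_le_mul p2 p1 hB k2 k1 s)⟩

theorem zero_mem_multiIdx (l : ℕ) : (0, 0) ∈ multiIdx l := by simp [multiIdx]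

theorem pdD_zero (U : 𝓢'(Plane, ℂ)) : pdD (0, 0) U = U := rfl

/-- A translate of a representative of `∂^γ U` is a weak derivative of the translate of `U`. -/
theorem isWeakDeriv_of_represents {U : 𝓢'(Plane, ℂ)} {γ : ℕ × ℕ} {G D : Plane → ℂ}
    (hG : Represents U G) (hD : Represents (pdD γ U) D) (a : Plane) :
    IsWeakDeriv γ (fun α => G (α + a)) (fun α => D (α + a)) := by
  refine ⟨locallyIntegrable_comp_add_right hD.locallyIntegrable a, fun η _ => ?_⟩
  have h1 : ∀ (F : Plane → ℂ) (u : 𝓢(Plane, ℂ)),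
      ∫ α, F (α + a) * u α = ∫ β, F β * transl a u β := by
    intro F u
    rw [← integral_add_right_eq_self (fun β => F β * transl a u β) a]
    simp [transl_apply]
  rw [h1, h1, ← (hD _).2, pdD_apply, partialDeriv_transl, ← (hG _).2, ← mul_assoc, ← mul_pow]
  simp

theorem IsWeakDeriv.ae_eq {γ : ℕ × ℕ} {c c' d d' : Plane → ℂ} (h : IsWeakDeriv γ c d)
    (h' : IsWeakDeriv γ c' d') (hc : c =ᵐ[volume] c') : d =ᵐ[volume] d' := by
  refine ae_eq_of_forall_integral_eq h.1 h'.1 fun v hv => ?_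
  have e : ∫ α, c α * partialDeriv γ v α = ∫ α, c' α * partialDeriv γ v α :=
    integral_congr_ae (hc.mono fun x hx => by simp only [hx])
  rw [h.2 v hv, h'.2 v hv] at e
  exact mul_left_cancel₀ (pow_ne_zero _ (by norm_num)) e

theorem IsWeakDeriv.comp_add {γ : ℕ × ℕ} {c d : Plane → ℂ} (h : IsWeakDeriv γ c d) (a : Plane) :
    IsWeakDeriv γ (fun α => c (α + a)) (fun α => d (α + a)) := by
  refine ⟨locallyIntegrable_comp_add_right h.1 a, fun η hη => ?_⟩
  have h1 : ∀ (F : Plane → ℂ) (u : 𝓢(Plane, ℂ)),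
      ∫ α, F (α + a) * u α = ∫ β, F β * transl a u β := by
    intro F u
    rw [← integral_add_right_eq_self (fun β => F β * transl a u β) a]
    simp [transl_apply]
  have hs : HasCompactSupport (transl a η) := by
    have : (transl a η : Plane → ℂ) = η ∘ (Homeomorph.subRight a) :=
      funext fun y => transl_apply a η y
    rw [this]
    exact hη.comp_homeomorph _
  rw [h1, h1, ← h.2 _ hs, partialDeriv_transl]

/-- The Fourier transform of `T` and its derivatives as functions, read off the Fourier
coefficients of the Bloch transform. -/
theorem represents_of_isFourierExpansion (hΛ : IsUnit Λ.det) {T : 𝓢'(Plane, ℂ)}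
    {c : Idx → Plane → ℂ} (hc : IsFourierExpansion Λ (blochJ hΛ T) c) {γ : ℕ × ℕ}
    {d : Idx → Plane → ℂ} (hd : ∀ j, IsWeakDeriv γ (c j) (d j)) :
    (∀ j, d j =ᵐ[volume] fun α => d 0 (α + latt (dualMat Λ) j)) ∧
    ∀ s : ℝ, MemLp (fun α => wt 1 s α * d 0 α) 2 → Represents (pdD γ (Fh T)) (d 0) := by
  obtain ⟨ρ, hρ, hgap⟩ := exists_latt_gap (isUnit_det_dualMat hΛ)
  have hF := Fh_apply_of_isFourierExpansion hΛ hc hρ hgap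
  have hF0 : ∀ (a : Plane) (w : 𝓢(Plane, ℂ)), tsupport w ⊆ Metric.ball a ρ →
      Fh T w = ∫ α, c 0 α * w α := fun a w hw => by
    rw [hF 0 a w hw]
    simp [latt_zero]
  -- Both functions give the distribution `Fh T` on small balls shifted by `Λ*j`.
  have hcj : ∀ j, c j =ᵐ[volume] fun α => c 0 (α + latt (dualMat Λ) j) := by
    intro j
    refine ae_eq_of_small (hc.1 j) (locallyIntegrable_comp_add_right (hc.1 0) _) hρ fun a w hw => ?_
    set b := latt (dualMat Λ) j
    have hw' : tsupport (transl b w) ⊆ Metric.ball (a + b) ρ := by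
      have : (transl b w : Plane → ℂ) = w ∘ (Homeomorph.subRight b) :=
        funext fun y => transl_apply b w y
      rw [this, tsupport_comp_eq_preimage]
      intro x hx
      have := hw hx
      rw [Metric.mem_ball, dist_eq_norm] at this ⊢
      simp only [Homeomorph.coe_subRight] at this
      convert this using 2
      abel
    have h1 := hF j (a + b) (transl b w) hw'
    rw [hF0 _ _ hw'] at h1
    simp only [transl_apply, b, add_sub_cancel_right] at h1
    rw [← h1, ← integral_add_right_eq_self (fun α => c 0 α * w (α - b)) b]
    simp only [add_sub_cancel_right, b]
  refine ⟨fun j => (hd j).ae_eq ((hd 0).comp_add _) (hcj j), fun s hs => ?_⟩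
  -- The weighted `L²` bound makes `d 0` a tempered distribution; it agrees with the derivative of
  -- `Fh T` on functions of small support, hence everywhere.
  obtain ⟨V, hV⟩ := exists_represents_of_wt hs
  have : V = pdD γ (Fh T) := by
    refine dist_ext_of_small hρ fun a w hw => ?_
    rw [(hV w).2, pdD_apply, hF0 a _ ((tsupport_partialDeriv_subset γ w).trans hw),
      (hd 0).2 w (hasCompactSupport_of_small hw), ← mul_assoc, ← mul_pow]
    simp
  rwa [← this]

theorem dnorm_SmD_wt_sq (hΛ : IsUnit Λ.det) (s : ℝ) {V : 𝓢'(Plane, ℂ)} {G : Plane → ℂ}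
    (h : Represents V G) : dnorm (SmD (wt 1 s) V) ^ 2 =
      ∑' j : Idx, ∫⁻ α in cell (dualMat Λ), ‖wt 1 s (α + latt (dualMat Λ) j)‖ₑ ^ 2 *
        ‖G (α + latt (dualMat Λ) j)‖ₑ ^ 2 := by
  rw [dnorm_eq_eLpNorm (h.SmD (hasTemperateGrowth_wt 1 s)), eLpNorm_two_sq,
    lintegral_eq_tsum_cell (isUnit_det_dualMat hΛ)]
  simp only [enorm_mul, mul_pow]

theorem idxWeight_ne_top (s : ℝ) (j : Idx) : idxWeight s j ≠ ∞ := ENNReal.ofReal_ne_top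

/-- The norm of integer order in terms of the Fourier transform. -/
theorem exists_intNorm_equiv_pdD (hΛ : IsUnit Λ.det) (s : ℝ) : ∃ C : ℝ, 0 < C ∧ (s = 0 → C = 1) ∧
    ∀ (l : ℕ) (T : 𝓢'(Plane, ℂ)),
      intNorm Λ s l (blochJ hΛ T) ^ 2 ≤ ENNReal.ofReal C *
        ∑ γ ∈ multiIdx l, dnorm (SmD (wt 1 s) (pdD γ (Fh T))) ^ 2 ∧
      ∑ γ ∈ multiIdx l, dnorm (SmD (wt 1 s) (pdD γ (Fh T))) ^ 2 ≤
        ENNReal.ofReal C * intNorm Λ s l (blochJ hΛ T) ^ 2 := by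
  have hA := isUnit_det_dualMat hΛ
  obtain ⟨C, hC, hC1, hcomp⟩ := exists_idxWeight_equiv hA s
  have hmc := measurableSet_cell hA
  have sq_half : ∀ x : ℝ≥0∞, (x ^ (1 / 2 : ℝ)) ^ 2 = x := fun x => by
    rw [← ENNReal.rpow_natCast, ← ENNReal.rpow_mul]
    norm_num
  refine ⟨C, hC, hC1, fun l T => ⟨?_, ?_⟩⟩
  · by_cases hfin : ∃ γ ∈ multiIdx l, dnorm (SmD (wt 1 s) (pdD γ (Fh T))) = ∞
    · obtain ⟨γ, hγ, h⟩ := hfin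
      have : ∑ γ ∈ multiIdx l, dnorm (SmD (wt 1 s) (pdD γ (Fh T))) ^ 2 = ∞ :=
        ENNReal.sum_eq_top.2 ⟨γ, hγ, by rw [h]; rfl⟩
      rw [this, ENNReal.mul_top (by simpa using hC)]
      exact le_top
    push Not at hfin
    have hrep : ∀ γ, ∃ G, γ ∈ multiIdx l → Represents (pdD γ (Fh T)) G := fun γ => by
      by_cases hγ : γ ∈ multiIdx l
      · obtain ⟨G, hG⟩ := exists_represents_of_dnorm_SmD_lt_top (lt_top_iff_ne_top.2 (hfin γ hγ))
        exact ⟨G, fun _ => hG⟩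
      · exact ⟨0, fun h => absurd h hγ⟩
    choose G hG using hrep
    have hG0 : Represents (Fh T) (G (0, 0)) := hG _ (zero_mem_multiIdx l)
    have hle : intNorm Λ s l (blochJ hΛ T) ≤ _ :=
      iInf_le_of_le (fun j α => G (0, 0) (α + latt (dualMat Λ) j)) <|
      iInf_le_of_le (fun γ j α => G γ (α + latt (dualMat Λ) j)) <|
      iInf_le _ ⟨isFourierExpansion_blochJ hΛ hG0, fun γ hγ j =>
        isWeakDeriv_of_represents hG0 (hG γ hγ) _⟩
    calc _ ≤ _ := pow_le_pow_left' hle 2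
      _ = _ := sq_half _
      _ ≤ _ := by
        rw [Finset.mul_sum]
        refine Finset.sum_le_sum fun γ hγ => ?_
        rw [dnorm_SmD_wt_sq hΛ s (hG γ hγ), ← ENNReal.tsum_mul_left]
        refine ENNReal.tsum_le_tsum fun j => ?_
        rw [← lintegral_const_mul' _ _ ENNReal.ofReal_ne_top,
          ← lintegral_const_mul' _ _ (idxWeight_ne_top s j)]
        refine setLIntegral_mono' hmc fun α hα => ?_
        rw [← mul_assoc]
        exact mul_le_mul_left (hcomp j α hα).1 _
  · have hC0 : ENNReal.ofReal C ≠ 0 := by simpa using hC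
    rw [← ENNReal.div_le_iff' hC0 ENNReal.ofReal_ne_top]
    set X := ∑ γ ∈ multiIdx l, dnorm (SmD (wt 1 s) (pdD γ (Fh T))) ^ 2
    suffices h : (X / ENNReal.ofReal C) ^ (1 / 2 : ℝ) ≤ intNorm Λ s l (blochJ hΛ T) by
      rw [← sq_half (X / ENNReal.ofReal C)]
      exact pow_le_pow_left' h 2
    refine le_iInf fun c => le_iInf fun d => le_iInf fun ⟨hc, hd⟩ => ?_
    refine ENNReal.rpow_le_rpow ?_ (by norm_num)
    rw [ENNReal.div_le_iff' hC0 ENNReal.ofReal_ne_top, Finset.mul_sum]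
    refine Finset.sum_le_sum fun γ hγ => ?_
    -- Whatever coefficients compete in the infimum, they are almost everywhere translates of one
    -- function, so the sum over `j` is an integral over the plane.
    obtain ⟨hae, hrep⟩ := represents_of_isFourierExpansion hΛ hc (hd γ hγ)
    have hval : ∑' j : Idx, ∫⁻ α in cell (dualMat Λ), ‖wt 1 s (α + latt (dualMat Λ) j)‖ₑ ^ 2 *
        ‖d γ 0 (α + latt (dualMat Λ) j)‖ₑ ^ 2 ≤ ENNReal.ofReal C * ∑' j : Idx,
        idxWeight s j * ∫⁻ α in cell (dualMat Λ), ‖d γ j α‖ₑ ^ 2 := by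
      rw [← ENNReal.tsum_mul_left]
      refine ENNReal.tsum_le_tsum fun j => ?_
      have e : ∫⁻ α in cell (dualMat Λ), ‖d γ j α‖ₑ ^ 2 =
          ∫⁻ α in cell (dualMat Λ), ‖d γ 0 (α + latt (dualMat Λ) j)‖ₑ ^ 2 :=
        lintegral_congr_ae (ae_restrict_of_ae ((hae j).mono fun α hα => by simp only [hα]))
      rw [e, ← mul_assoc, ← lintegral_const_mul' _ _
        (ENNReal.mul_ne_top ENNReal.ofReal_ne_top (idxWeight_ne_top s j))]
      refine setLIntegral_mono' hmc fun α hα => ?_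
      exact mul_le_mul_left (hcomp j α hα).2 _
    by_cases hfin : ∑' j : Idx, idxWeight s j * ∫⁻ α in cell (dualMat Λ), ‖d γ j α‖ₑ ^ 2 = ∞
    · rw [hfin, ENNReal.mul_top hC0]
      exact le_top
    have hmem : MemLp (fun α => wt 1 s α * d γ 0 α) 2 := by
      refine ⟨?_, ?_⟩
      · exact (Continuous.aestronglyMeasurable (hasTemperateGrowth_wt 1 s).1.continuous).mul
          (hd γ hγ 0).1.aestronglyMeasurable
      · have h2 : eLpNorm (fun α => wt 1 s α * d γ 0 α) 2 ^ 2 < ∞ := by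
          rw [eLpNorm_two_sq, lintegral_eq_tsum_cell hA]
          simp only [enorm_mul, mul_pow]
          exact hval.trans_lt (ENNReal.mul_lt_top ENNReal.ofReal_lt_top (lt_top_iff_ne_top.2 hfin))
        by_contra h
        rw [not_lt, top_le_iff] at h
        rw [h] at h2
        simp at h2
    rw [dnorm_SmD_wt_sq hΛ s (hrep s hmem)]
    exact hval

/-! ### Moments and weights -/

theorem Sm_coord_fourierInv (j : Fin 2) (f : 𝓢(Plane, ℂ)) :
    Sm (coord j) (𝓕⁻ f) = -𝓕⁻ (Fm (coord j) f) := by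
  have h1 := SchwartzMap.fourierInv_lineDerivOp_eq f (ei j)
  rw [lineDeriv_eq_Fm, FourierTransform.fourierInv_smul] at h1
  rw [← SchwartzMap.smulLeftCLM_ofReal ℂ (by fun_prop)] at h1
  have h2 : tpi • Sm (coord j) (𝓕⁻ f) = -(tpi • 𝓕⁻ (Fm (coord j) f)) := by
    rw [h1, coord_eq_inner, neg_smul, neg_neg]
    rfl
  rw [← smul_neg] at h2
  exact smul_right_injective _ tpi_ne_zero h2

/-- Commutation of a coordinate with a Fourier multiplier. -/
theorem Sm_coord_Fm {a a' : Plane → ℂ} (ha : a.HasTemperateGrowth) (ha' : a'.HasTemperateGrowth)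
    (j : Fin 2) (h : ∀ x, fderiv ℝ a x (ei j) = tpi * a' x) (u : 𝓢(Plane, ℂ)) :
    Sm (coord j) (Fm a u) = Fm a (Sm (coord j) u) - Fm a' u := by
  have e : Sm (coord j) u = -𝓕⁻ (Fm (coord j) (𝓕 u)) := by
    rw [← Sm_coord_fourierInv, FourierTransform.fourierInv_fourier_eq]
  have e1 : ∀ (g : Plane → ℂ) w, Fm g w = 𝓕⁻ (Sm g (𝓕 w)) := fun g w =>
    SchwartzMap.fourierMultiplierCLM_apply g w
  rw [e1 a u, Sm_coord_fourierInv, Fm_coord_Sm ha ha' j h, e, map_neg, e1 a, e1 a',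
    FourierTransform.fourier_fourierInv_eq, FourierTransform.fourierInv_add]
  abel

theorem norm_coord_mul_wt_neg_two_le (j : Fin 2) (x : Plane) : ‖coord j x * wt 1 (-2) x‖ ≤ 1 := by
  rw [norm_mul, norm_coord, norm_wt_neg_two, one_mul, mul_inv_le_iff₀ (by positivity)]
  have := abs_coord_le x j
  nlinarith [sq_nonneg (‖x‖ - 1), norm_nonneg x]

/-- Boundedness of `x_j (1 + |x|²)^{-1/2}` on `H^s`: the coordinate passes `D_s` up to a multiplier
of lower order, and then the commutation theorem exchanges `D_s` with the weights. -/
theorem exists_l2_Fm_coord_le {s : ℝ} (hs : s ∈ Set.Icc (-1 : ℝ) 1) (j : Fin 2) :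
    ∃ C : ℝ, 0 < C ∧ ∀ u, l2 (Fm (wt 1 s) (Sm (coord j) (Sm (wt 1 (-1)) u))) ≤
      C * l2 (Fm (wt 1 s) u) := by
  obtain ⟨C₁, hC₁, h₁⟩ := commute_schwartz hs 1
  obtain ⟨C₂, hC₂, h₂⟩ := commute_schwartz hs (-1)
  refine ⟨C₁ + C₂, by positivity, fun u => ?_⟩
  set w := Sm (wt 1 (-1)) u with hw
  -- The derivative of the symbol of `D_s`, divided by `2πi`. Because `|s| ≤ 1` it is dominated by
  -- that symbol itself.
  set a' : Plane → ℂ := fun x => tpi⁻¹ * (s * 1 ^ 2 * coord j x * wt 1 (s - 2) x) with ha'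
  have hta : a'.HasTemperateGrowth := by
    have := hasTemperateGrowth_coord j
    have := hasTemperateGrowth_wt 1 (s - 2)
    fun_prop
  have e := Sm_coord_Fm (hasTemperateGrowth_wt 1 s) hta j (fun x => by
    rw [hasFDerivAt_wt, ha']
    field_simp [tpi_ne_zero]
    simp) w
  have e' : Fm (wt 1 s) (Sm (coord j) w) = Sm (coord j) (Fm (wt 1 s) w) + Fm a' w := by
    rw [e, sub_add_cancel]
  have b1 : l2 (Sm (coord j) (Fm (wt 1 s) w)) ≤ C₁ * l2 (Fm (wt 1 s) u) := by
    have k1 := l2_Sm_le_l2_Sm (C := 1) (hasTemperateGrowth_coord j) (hasTemperateGrowth_wt 1 1)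
      zero_le_one (fun x => by
        rw [one_mul, norm_coord, norm_wt]
        refine (abs_coord_le x j).trans ?_
        rw [one_mul, ← Real.sqrt_eq_rpow]
        exact Real.le_sqrt_of_sq_le (by linarith)) (Fm (wt 1 s) w)
    rw [one_mul] at k1
    refine k1.trans ((h₁ w).2.trans ?_)
    rw [hw, Sm_wt_cancel]
  have b0 : l2 (Fm (wt 1 s) w) ≤ C₂ * l2 (Fm (wt 1 s) u) := by
    refine (h₂ u).1.trans ?_
    gcongr
    refine (l2_Sm_le (C := 1) (hasTemperateGrowth_wt 1 (-1)) (fun x => ?_) _).trans (by rw [one_mul])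
    rw [norm_wt]
    exact Real.rpow_le_one_of_one_le_of_nonpos (by nlinarith [sq_nonneg (1 * ‖x‖)]) (by norm_num)
  have b2 : l2 (Fm a' w) ≤ C₂ * l2 (Fm (wt 1 s) u) := by
    refine le_trans ?_ b0
    have k := l2_Fm_le_l2_Fm (C := 1) hta (hasTemperateGrowth_wt 1 s) zero_le_one (fun x => ?_) w
    · rwa [one_mul] at k
    · have : a' x = (tpi⁻¹ * s) * (coord j x * wt 1 (-2) x) * wt 1 s x := by
        have k : wt 1 (s - 2) x = wt 1 (-2) x * wt 1 s x := by
          rw [sub_eq_neg_add, ← wt_mul_wt]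
          rfl
        rw [ha']
        simp only [k]
        ring
      rw [this, norm_mul]
      refine mul_le_mul_of_nonneg_right ?_ (norm_nonneg _)
      rw [norm_mul, norm_mul, norm_inv]
      have k1 : ‖tpi‖⁻¹ ≤ 1 := inv_le_one_of_one_le₀ one_le_norm_tpi
      have k2 : ‖(s : ℂ)‖ ≤ 1 := by
        rw [Complex.norm_real]
        exact abs_le.2 ⟨hs.1, hs.2⟩
      have k3 := norm_coord_mul_wt_neg_two_le j x
      exact mul_le_one₀ (mul_le_one₀ k1 (norm_nonneg _) k2) (norm_nonneg _) k3
  rw [e']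
  calc _ ≤ _ := l2_add_le _ _
    _ ≤ _ := by rw [add_mul]; exact add_le_add b1 b2

/-- Bounds of Schwartz multipliers carry over to distributions by duality. -/
theorem dnorm_FmD_SmD_le {s C : ℝ} (hC : 0 ≤ C) {Φ : 𝓢(Plane, ℂ) → 𝓢(Plane, ℂ)}
    (h : ∀ u, l2 (Fm (wt 1 (-s)) (Φ u)) ≤ C * l2 (Fm (wt 1 (-s)) u)) {T T' : 𝓢'(Plane, ℂ)}
    (hT : ∀ v, T' v = T (Φ v)) :
    dnorm (FmD (wt 1 s) T') ≤ ENNReal.ofReal C * dnorm (FmD (wt 1 s) T) := by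
  refine dnorm_le fun v => ?_
  have e : FmD (wt 1 s) T' v = FmD (wt 1 s) T (Fm (wt 1 (-s)) (Φ (Fm (wt 1 s) v))) := by
    rw [FmD_wt_apply, FmD_wt_apply, hT, Fm_wt_cancel]
  rw [e]
  refine (enorm_le_dnorm _ _).trans ?_
  rw [mul_comm (ENNReal.ofReal C), mul_assoc, ← ENNReal.ofReal_mul hC]
  gcongr
  refine (h _).trans ?_
  rw [Fm_wt_cancel']

theorem SmD_comm {g h : Plane → ℂ} (hg : g.HasTemperateGrowth) (hh : h.HasTemperateGrowth)
    (T : 𝓢'(Plane, ℂ)) : SmD g (SmD h T) = SmD h (SmD g T) := by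
  ext v
  simp only [SmD_apply, Sm_comm hg hh]

theorem SmD_wt_wt (ε r r' : ℝ) (T : 𝓢'(Plane, ℂ)) :
    SmD (wt ε r) (SmD (wt ε r') T) = SmD (wt ε (r + r')) T := by
  ext v
  rw [SmD_apply, SmD_apply, SmD_apply, SchwartzMap.smulLeftCLM_smulLeftCLM_apply (by fun_prop)
    (by fun_prop), wt_mul_wt, add_comm]

theorem exists_dnorm_coord_le {s : ℝ} (hs : s ∈ Set.Icc (-1 : ℝ) 1) (j : Fin 2) :
    ∃ C : ℝ, 0 < C ∧ ∀ T, dnorm (FmD (wt 1 s) (SmD (coord j) (SmD (wt 1 (-1)) T))) ≤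
      ENNReal.ofReal C * dnorm (FmD (wt 1 s) T) := by
  obtain ⟨C, hC, h⟩ := exists_l2_Fm_coord_le (s := -s) ⟨by linarith [hs.2], by linarith [hs.1]⟩ j
  refine ⟨C, hC, fun T => dnorm_FmD_SmD_le hC.le h fun v => ?_⟩
  rw [SmD_apply, SmD_apply, Sm_comm (hasTemperateGrowth_wt _ _) (hasTemperateGrowth_coord j)]

theorem exists_dnorm_wt_neg_one_le {s : ℝ} (hs : s ∈ Set.Icc (-1 : ℝ) 1) :
    ∃ C : ℝ, 0 < C ∧ ∀ T, dnorm (FmD (wt 1 s) (SmD (wt 1 (-1)) T)) ≤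
      ENNReal.ofReal C * dnorm (FmD (wt 1 s) T) := by
  obtain ⟨C, hC, h⟩ := commute_dnorm hs (-1)
  refine ⟨C, hC, fun T => (h T).1.trans ?_⟩
  gcongr
  have k := dnorm_SmD_le (g := wt 1 (-1)) (h := wt 1 0) (C := 1) (by fun_prop) (by fun_prop)
    zero_le_one (fun x => by
      rw [norm_wt]
      exact Real.rpow_le_one_of_one_le_of_nonpos (by nlinarith [sq_nonneg (1 * ‖x‖)])
        (by norm_num)) (FmD (wt 1 s) T)
  rw [wt_mul_wt, ENNReal.ofReal_one, one_mul, add_zero] at k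
  refine k.trans (le_of_eq ?_)
  congr 1
  ext v
  rw [SmD_apply, wt_zero]
  congr 1
  ext x
  rw [SchwartzMap.smulLeftCLM_apply_apply (by fun_prop), one_smul]

/-- `⟨x⟩² = 1 + x₁² + x₂²`. -/
theorem SmD_wt_two (T : 𝓢'(Plane, ℂ)) :
    SmD (wt 1 2) T = T + ∑ j, SmD (coord j) (SmD (coord j) T) := by
  ext v
  rw [add_apply, sum_apply, SmD_apply]
  simp only [SmD_apply]
  rw [← map_sum, ← map_add]
  congr 1
  ext x
  have h0 := hasTemperateGrowth_coord 0
  have h1 := hasTemperateGrowth_coord 1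
  rw [add_apply, Fin.sum_univ_two, add_apply]
  rw [SchwartzMap.smulLeftCLM_apply_apply (by fun_prop), SchwartzMap.smulLeftCLM_apply_apply h0,
    SchwartzMap.smulLeftCLM_apply_apply h0, SchwartzMap.smulLeftCLM_apply_apply h1,
    SchwartzMap.smulLeftCLM_apply_apply h1, wt_one_two, norm_sq_eq]
  simp only [coord, smul_eq_mul]
  push_cast
  ring

/-- One more power of the weight amounts to one more moment. -/
theorem exists_dnorm_wt_succ_equiv {s : ℝ} (hs : s ∈ Set.Icc (-1 : ℝ) 1) (r : ℝ) :
    ∃ C : ℝ, 0 < C ∧ ∀ T,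
      dnorm (FmD (wt 1 s) (SmD (wt 1 r) T)) ≤
        ENNReal.ofReal C * dnorm (FmD (wt 1 s) (SmD (wt 1 (r + 1)) T)) ∧
      (∀ j, dnorm (FmD (wt 1 s) (SmD (wt 1 r) (SmD (coord j) T))) ≤
        ENNReal.ofReal C * dnorm (FmD (wt 1 s) (SmD (wt 1 (r + 1)) T))) ∧
      dnorm (FmD (wt 1 s) (SmD (wt 1 (r + 1)) T)) ≤ ENNReal.ofReal C *
        (dnorm (FmD (wt 1 s) (SmD (wt 1 r) T)) +
          ∑ j, dnorm (FmD (wt 1 s) (SmD (wt 1 r) (SmD (coord j) T)))) := by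
  obtain ⟨C₀, hC₀, h₀⟩ := exists_dnorm_wt_neg_one_le hs
  choose C hC h using exists_dnorm_coord_le hs
  set B := C₀ + ∑ j, C j
  have hCj : ∀ j, C j ≤ B := fun j => by
    have := Finset.single_le_sum (f := C) (fun i _ => (hC i).le) (Finset.mem_univ j)
    linarith
  have hB0 : C₀ ≤ B := by
    have := Finset.sum_nonneg (s := Finset.univ) (f := C) (fun i _ => (hC i).le)
    linarith
  have e0 : ∀ T, SmD (wt 1 r) T = SmD (wt 1 (-1)) (SmD (wt 1 (r + 1)) T) := fun T => by
    rw [SmD_wt_wt, neg_add_cancel_comm_assoc]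
  have ej : ∀ j T, SmD (wt 1 r) (SmD (coord j) T) =
      SmD (coord j) (SmD (wt 1 (-1)) (SmD (wt 1 (r + 1)) T)) := fun j T => by
    rw [SmD_comm (by fun_prop) (hasTemperateGrowth_coord j), ← e0]
  refine ⟨B, hC₀.trans_le hB0, fun T => ⟨?_, fun j => ?_, ?_⟩⟩
  · rw [e0]
    refine (h₀ _).trans ?_
    gcongr
  · rw [ej]
    refine (h j _).trans ?_
    gcongr
    exact hCj j
  -- From `⟨x⟩² = 1 + ∑ x_j²`, with `⟨x⟩ = (1 + |x|²)^{1/2}`: `⟨x⟩^{r+1} = ⟨x⟩⁻¹ ⟨x⟩^r + ∑ x_j ⟨x⟩⁻¹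
  -- ⟨x⟩^r x_j`, where `⟨x⟩⁻¹` and `x_j ⟨x⟩⁻¹` are bounded on `H^s`.
  · have e : SmD (wt 1 (r + 1)) T = SmD (wt 1 (-1)) (SmD (wt 1 r) T) +
        ∑ j, SmD (coord j) (SmD (wt 1 (-1)) (SmD (wt 1 r) (SmD (coord j) T))) := by
      have k : SmD (wt 1 (r + 1)) T = SmD (wt 1 2) (SmD (wt 1 (-1)) (SmD (wt 1 r) T)) := by
        rw [SmD_wt_wt, SmD_wt_wt]
        congr 3
        ring
      rw [k, SmD_wt_two]
      congr 1
      refine Finset.sum_congr rfl fun j _ => ?_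
      rw [SmD_comm (by fun_prop : (wt 1 r).HasTemperateGrowth) (hasTemperateGrowth_coord j),
        SmD_comm (by fun_prop : (wt 1 (-1)).HasTemperateGrowth) (hasTemperateGrowth_coord j)]
    rw [e, map_add, map_sum, mul_add, Finset.mul_sum]
    refine (dnorm_add_le _ _).trans (add_le_add ((h₀ _).trans ?_)
      ((dnorm_sum_le _ _).trans (Finset.sum_le_sum fun j _ => (h j _).trans ?_)))
    · gcongr
    · gcongr
      exact hCj j

/-! ### Equivalence of norms -/

/-- `f ≤ C g` for some constant `C`. -/
def Dom {X : Type*} (f g : X → ℝ≥0∞) : Prop := ∃ C : ℝ, 0 < C ∧ ∀ x, f x ≤ ENNReal.ofReal C * g x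

namespace Dom

variable {X : Type*} {f g h : X → ℝ≥0∞}

theorem of_le (h : ∀ x, f x ≤ g x) : Dom f g := ⟨1, one_pos, fun x => by simpa using h x⟩

theorem refl (f : X → ℝ≥0∞) : Dom f f := of_le fun _ => le_rfl

theorem trans (h₁ : Dom f g) (h₂ : Dom g h) : Dom f h := by
  obtain ⟨C, hC, h⟩ := h₁
  obtain ⟨D, hD, h'⟩ := h₂
  refine ⟨C * D, by positivity, fun x => (h x).trans ?_⟩
  rw [ENNReal.ofReal_mul hC.le, mul_assoc]
  gcongr
  exact h' x

theorem add {f' : X → ℝ≥0∞} (h₁ : Dom f g) (h₂ : Dom f' g) : Dom (fun x => f x + f' x) g := by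
  obtain ⟨C, hC, h⟩ := h₁
  obtain ⟨D, hD, h'⟩ := h₂
  refine ⟨C + D, by positivity, fun x => ?_⟩
  rw [ENNReal.ofReal_add hC.le hD.le, add_mul]
  exact add_le_add (h x) (h' x)

theorem zero : Dom (fun _ => 0) g := ⟨1, one_pos, fun _ => zero_le⟩

theorem sum {ι : Type*} {s : Finset ι} {f : ι → X → ℝ≥0∞} (h : ∀ i ∈ s, Dom (f i) g) :
    Dom (fun x => ∑ i ∈ s, f i x) g := by
  classical
  induction s using Finset.induction_on with
  | empty => simpa using zero
  | insert i s hi ih =>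
    have := (h i (Finset.mem_insert_self i s)).add
      (ih fun k hk => h k (Finset.mem_insert_of_mem hk))
    simpa only [Finset.sum_insert hi] using this

theorem single {ι : Type*} {s : Finset ι} {i : ι} (hi : i ∈ s) (f : ι → X → ℝ≥0∞) :
    Dom (f i) fun x => ∑ i ∈ s, f i x :=
  of_le fun x => Finset.single_le_sum (f := fun i => f i x) (fun _ _ => zero_le) hi

theorem sq (h : Dom f g) : Dom (fun x => f x ^ 2) (fun x => g x ^ 2) := by
  obtain ⟨C, hC, h⟩ := h
  refine ⟨C ^ 2, by positivity, fun x => ?_⟩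
  rw [ENNReal.ofReal_pow hC.le, ← mul_pow]
  exact pow_le_pow_left' (h x) 2

theorem of_sq (h : Dom (fun x => f x ^ 2) (fun x => g x ^ 2)) : Dom f g := by
  obtain ⟨C, hC, h⟩ := h
  refine ⟨Real.sqrt C, Real.sqrt_pos.2 hC, fun x => ?_⟩
  have := h x
  rw [← Real.sq_sqrt hC.le, ENNReal.ofReal_pow (Real.sqrt_nonneg _), ← mul_pow] at this
  exact (ENNReal.pow_right_strictMono two_ne_zero).le_iff_le.1 this

theorem comp {Y : Type*} (h : Dom f g) (φ : Y → X) : Dom (fun y => f (φ y)) fun y => g (φ y) := by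
  obtain ⟨C, hC, h⟩ := h
  exact ⟨C, hC, fun y => h (φ y)⟩

theorem lt_top (h : Dom f g) {x : X} (hx : g x < ∞) : f x < ∞ := by
  obtain ⟨C, hC, h⟩ := h
  exact (h x).trans_lt (ENNReal.mul_lt_top ENNReal.ofReal_lt_top hx)

end Dom

/-- Equivalence of norms. -/
def NEquiv {X : Type*} (f g : X → ℝ≥0∞) : Prop := Dom f g ∧ Dom g f

namespace NEquiv

variable {X : Type*} {f g h : X → ℝ≥0∞}

theorem of_exists (h : ∃ C : ℝ, 0 < C ∧ ∀ x, f x ≤ ENNReal.ofReal C * g x ∧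
    g x ≤ ENNReal.ofReal C * f x) : NEquiv f g := by
  obtain ⟨C, hC, h⟩ := h
  exact ⟨⟨C, hC, fun x => (h x).1⟩, ⟨C, hC, fun x => (h x).2⟩⟩

theorem exists_le (h : NEquiv f g) : ∃ C : ℝ, 0 < C ∧ ∀ x, f x ≤ ENNReal.ofReal C * g x ∧
    g x ≤ ENNReal.ofReal C * f x := by
  obtain ⟨⟨C, hC, h⟩, ⟨D, hD, h'⟩⟩ := h
  refine ⟨C + D, by positivity, fun x => ⟨(h x).trans ?_, (h' x).trans ?_⟩⟩ <;> gcongr <;> linarith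

theorem symm (h : NEquiv f g) : NEquiv g f := ⟨h.2, h.1⟩

theorem trans (h₁ : NEquiv f g) (h₂ : NEquiv g h) : NEquiv f h :=
  ⟨h₁.1.trans h₂.1, h₂.2.trans h₁.2⟩

theorem comp {Y : Type*} (h : NEquiv f g) (φ : Y → X) :
    NEquiv (fun y => f (φ y)) fun y => g (φ y) := ⟨h.1.comp φ, h.2.comp φ⟩

theorem lt_top_iff (h : NEquiv f g) (x : X) : f x < ∞ ↔ g x < ∞ := ⟨h.2.lt_top, h.1.lt_top⟩

end NEquiv

/-! ### Derivatives of the Fourier transform -/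

/-- The moment `x^γ T`. -/
def moment (γ : ℕ × ℕ) (T : 𝓢'(Plane, ℂ)) : 𝓢'(Plane, ℂ) :=
  (SmD (coord 0))^[γ.1] ((SmD (coord 1))^[γ.2] T)

theorem moment_coord_zero (γ : ℕ × ℕ) (T : 𝓢'(Plane, ℂ)) :
    moment γ (SmD (coord 0) T) = moment (γ.1 + 1, γ.2) T := by
  have hc : Function.Commute (SmD (coord 0)) (SmD (coord 1)) := fun T =>
    SmD_comm (hasTemperateGrowth_coord 0) (hasTemperateGrowth_coord 1) T
  rw [moment, moment, Function.iterate_succ_apply, (hc.iterate_right γ.2).eq]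

theorem mem_multiIdx {l : ℕ} {γ : ℕ × ℕ} : γ ∈ multiIdx l ↔ γ.1 + γ.2 ≤ l := by
  simp only [multiIdx, Finset.mem_filter, Finset.mem_product, Finset.mem_range]
  omega

/-- Induction on `l`: one power of the weight is traded for the first moments, and a moment of order
`l + 1` of `T` is a moment of order `l` of some `x_j T`. -/
theorem dom_moment {s : ℝ} (hs : s ∈ Set.Icc (-1 : ℝ) 1) (l : ℕ) :
    (∀ γ ∈ multiIdx l, Dom (fun T => dnorm (FmD (wt 1 s) (moment γ T)))
      (fun T => dnorm (FmD (wt 1 s) (SmD (wt 1 l) T)))) ∧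
    Dom (fun T => dnorm (FmD (wt 1 s) (SmD (wt 1 l) T)))
      (fun T => ∑ γ ∈ multiIdx l, dnorm (FmD (wt 1 s) (moment γ T))) := by
  induction l with
  | zero =>
    have e : ∀ T, SmD (wt 1 ((0 : ℕ) : ℝ)) T = T := fun T => by
      have := SmD_wt_cancel 1 0 T
      rwa [SmD_wt_wt, neg_zero, add_zero, ← Nat.cast_zero] at this
    simp only [e]
    refine ⟨fun γ hγ => ?_, Dom.single (zero_mem_multiIdx 0)
      fun γ T => dnorm (FmD (wt 1 s) (moment γ T))⟩
    · have : γ = (0, 0) := by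
        rw [mem_multiIdx] at hγ
        ext <;> simp <;> omega
      rw [this]
      exact Dom.refl _
  | succ l ih =>
    obtain ⟨C, hC, h⟩ := exists_dnorm_wt_succ_equiv hs l
    have d0 : Dom (fun T => dnorm (FmD (wt 1 s) (SmD (wt 1 l) T)))
      (fun T => dnorm (FmD (wt 1 s) (SmD (wt 1 ((l + 1 : ℕ) : ℝ)) T))) :=
      ⟨C, hC, fun T => by simpa using (h T).1⟩
    have dj : ∀ j, Dom (fun T => dnorm (FmD (wt 1 s) (SmD (wt 1 l) (SmD (coord j) T))))
      (fun T => dnorm (FmD (wt 1 s) (SmD (wt 1 ((l + 1 : ℕ) : ℝ)) T))) := fun j =>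
      ⟨C, hC, fun T => by simpa using (h T).2.1 j⟩
    have hsum : ∀ γ ∈ multiIdx (l + 1), Dom (fun T => dnorm (FmD (wt 1 s) (moment γ T)))
        (fun T => ∑ γ ∈ multiIdx (l + 1), dnorm (FmD (wt 1 s) (moment γ T))) := fun γ hγ =>
      Dom.single hγ fun γ T => dnorm (FmD (wt 1 s) (moment γ T))
    refine ⟨fun γ hγ => ?_, Dom.trans ⟨C, hC, fun T => by
      simpa only [Nat.cast_add, Nat.cast_one] using (h T).2.2⟩ (Dom.add ?_ ?_)⟩
    · obtain ⟨a, b⟩ := γ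
      rw [mem_multiIdx] at hγ
      rcases Nat.eq_zero_or_pos a with rfl | ha
      · rcases Nat.eq_zero_or_pos b with rfl | hb
        · exact (ih.1 (0, 0) (zero_mem_multiIdx l)).trans d0
        · obtain ⟨b, rfl⟩ := Nat.exists_eq_succ_of_ne_zero hb.ne'
          have := ((ih.1 (0, b) (mem_multiIdx.2 (by simp at hγ ⊢; omega))).comp
            (SmD (coord 1))).trans (dj 1)
          exact this
      · obtain ⟨a, rfl⟩ := Nat.exists_eq_succ_of_ne_zero ha.ne'
        have := ((ih.1 (a, b) (mem_multiIdx.2 (by simp at hγ ⊢; omega))).comp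
            (SmD (coord 0))).trans (dj 0)
        simpa only [moment_coord_zero] using this
    · refine ih.2.trans (Dom.sum fun γ hγ => hsum γ ?_)
      rw [mem_multiIdx] at hγ ⊢
      omega
    · refine Dom.sum fun j _ => (ih.2.comp (SmD (coord j))).trans (Dom.sum fun γ hγ => ?_)
      rw [mem_multiIdx] at hγ
      fin_cases j
      · have := hsum (γ.1 + 1, γ.2) (mem_multiIdx.2 (by simp; omega))
        simp only [← moment_coord_zero] at this
        exact this
      · exact hsum (γ.1, γ.2 + 1) (mem_multiIdx.2 (by simp; omega))

theorem lineDeriv_dil (m : Plane) (w : 𝓢(Plane, ℂ)) :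
    ∂_{m} (dil w) = (2 * Real.pi : ℂ) • dil (∂_{m} w) := by
  rw [dil, SchwartzMap.lineDerivOp_compCLMOfContinuousLinearEquiv]
  ext x
  rw [smul_apply]
  change (∂_{(2 * Real.pi) • m} w) _ = _ • (∂_{m} w) _
  rw [LineDeriv.lineDerivOp_left_smul, smul_apply]
  simp only [Complex.real_smul, smul_eq_mul]
  push_cast
  rfl

theorem lineDeriv_Fh (j : Fin 2) (T : 𝓢'(Plane, ℂ)) :
    ∂_{ei j} (Fh T) = (-Complex.I) • Fh (SmD (coord j) T) := by
  have h2 : (2 * Real.pi : ℂ) ≠ 0 := by exact_mod_cast two_pi_ne_zero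
  have hF := TemperedDistribution.lineDerivOp_fourier_eq T (ei j)
  rw [← coord_eq_inner] at hF
  ext w
  rw [TemperedDistribution.lineDerivOp_apply_apply, smul_apply, Fh_apply', Fh_apply']
  have h3 := congrArg (fun U : 𝓢'(Plane, ℂ) => U (dil w)) hF
  simp only [TemperedDistribution.lineDerivOp_apply_apply, lineDeriv_dil,
    FourierTransform.fourier_smul, smul_apply, map_neg, map_smul, smul_eq_mul] at h3 ⊢
  linear_combination h3

theorem pdD_Fh (γ : ℕ × ℕ) (T : 𝓢'(Plane, ℂ)) :
    pdD γ (Fh T) = (-Complex.I) ^ (γ.1 + γ.2) • Fh (moment γ T) := by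
  have h : ∀ (j : Fin 2) (n : ℕ) (c : ℂ) (T : 𝓢'(Plane, ℂ)),
      (fun V : 𝓢'(Plane, ℂ) => ∂_{ei j} V)^[n] (c • Fh T) =
        ((-Complex.I) ^ n * c) • Fh ((SmD (coord j))^[n] T) := by
    intro j n
    induction n with
    | zero => intro c T; simp
    | succ n ih =>
      intro c T
      rw [Function.iterate_succ_apply, Function.iterate_succ_apply,
        LineDeriv.lineDerivOp_smul, lineDeriv_Fh, smul_smul, ih, pow_succ]
      congr 1
      ring
  have h1 := h 1 γ.2 1 T
  rw [one_smul, mul_one] at h1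
  rw [pdD, h1, h, pow_add]
  rfl

theorem dnorm_smul_of_norm_eq_one {c : ℂ} (hc : ‖c‖ = 1) (T : 𝓢'(Plane, ℂ)) :
    dnorm (c • T) = dnorm T := by
  have hc0 : c ≠ 0 := fun h => by simp [h] at hc
  have e : ‖c‖ₑ = 1 := by rw [← ofReal_norm, hc, ENNReal.ofReal_one]
  have e' : ‖c⁻¹‖ₑ = 1 := by rw [← ofReal_norm, norm_inv, hc, inv_one, ENNReal.ofReal_one]
  refine le_antisymm ((dnorm_smul_le c T).trans (by rw [e, one_mul])) ?_
  have := dnorm_smul_le c⁻¹ (c • T)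
  rwa [smul_smul, inv_mul_cancel₀ hc0, one_smul, e', one_mul] at this

theorem l2_dil (w : 𝓢(Plane, ℂ)) : 2 * Real.pi * l2 (dil w) = l2 w := by
  have h : (2 * Real.pi * l2 (dil w)) ^ 2 = l2 w ^ 2 := by
    rw [mul_pow, l2_sq, l2_sq]
    simp only [dil_apply]
    rw [Measure.integral_comp_smul volume (fun x => ‖w x‖ ^ 2) (2 * Real.pi)]
    simp only [finrank_euclideanSpace, Fintype.card_fin, smul_eq_mul]
    rw [abs_of_pos (by positivity), ← mul_assoc, mul_inv_cancel₀ (by positivity), one_mul]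
  exact (pow_left_inj₀ (mul_nonneg (by positivity) (l2_nonneg _)) (l2_nonneg _) two_ne_zero).1 h

theorem dil_Sm_wt (s : ℝ) (w : 𝓢(Plane, ℂ)) :
    dil (Sm (wt 1 s) w) = Sm (wt (2 * Real.pi) s) (dil w) := by
  ext x
  rw [dil_apply, SchwartzMap.smulLeftCLM_apply_apply (by fun_prop),
    SchwartzMap.smulLeftCLM_apply_apply (by fun_prop), dil_apply]
  congr 1
  simp only [wt, norm_smul, Real.norm_eq_abs, one_mul, abs_of_pos (show 0 < 2 * Real.pi by positivity)]

/-- The Jacobian of the dilation in the plane makes `2π dil` isometric on `L²`, which is the factor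
in `Fh`; hence equality and not merely equivalence. -/
theorem dnorm_SmD_Fh (s : ℝ) (T : 𝓢'(Plane, ℂ)) :
    dnorm (SmD (wt 1 s) (Fh T)) = dnorm (SmD (wt (2 * Real.pi) s) (𝓕 T)) := by
  have h2 : (2 * Real.pi : ℂ) ≠ 0 := by exact_mod_cast two_pi_ne_zero
  have e : ‖(2 * Real.pi : ℂ)‖ = 2 * Real.pi := by
    rw [← Complex.ofReal_ofNat, ← Complex.ofReal_mul, Complex.norm_real, Real.norm_of_nonneg]
    positivity
  have key : ∀ w, SmD (wt 1 s) (Fh T) w =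
      2 * Real.pi * SmD (wt (2 * Real.pi) s) (𝓕 T) (dil w) := fun w => by
    rw [SmD_apply, Fh_apply', dil_Sm_wt, SmD_apply]
  refine le_antisymm (dnorm_le fun w => ?_) (dnorm_le fun w => ?_)
  · rw [key, enorm_mul, ← ofReal_norm (2 * Real.pi : ℂ), e, ← l2_dil w,
      ENNReal.ofReal_mul (p := 2 * Real.pi) (by positivity), mul_left_comm]
    gcongr
    exact enorm_le_dnorm _ _
  · have k := key (dilInv w)
    rw [dil_dilInv] at k
    have k2 : SmD (wt (2 * Real.pi) s) (𝓕 T) w =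
        (2 * Real.pi : ℂ)⁻¹ * SmD (wt 1 s) (Fh T) (dilInv w) := by
      rw [k]
      field_simp
    have k3 : l2 w = (2 * Real.pi)⁻¹ * l2 (dilInv w) := by
      rw [← l2_dil (dilInv w), dil_dilInv, inv_mul_cancel_left₀ two_pi_ne_zero]
    rw [k2, enorm_mul, ← ofReal_norm (2 * Real.pi : ℂ)⁻¹, norm_inv, e, k3,
      ENNReal.ofReal_mul (by positivity), mul_left_comm]
    gcongr
    exact enorm_le_dnorm _ _

theorem nequiv_dnorm_Fh (s : ℝ) :
    NEquiv (fun T => dnorm (SmD (wt 1 s) (Fh T))) (fun T => dnorm (FmD (wt 1 s) T)) := by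
  simp only [dnorm_SmD_Fh, dnorm_FmD]
  exact ⟨Dom.comp (dnorm_SmD_wt_le (by positivity) one_pos s) _,
    Dom.comp (dnorm_SmD_wt_le one_pos (by positivity) s) _⟩

theorem nequiv_commute {s : ℝ} (hs : s ∈ Set.Icc (-1 : ℝ) 1) (r : ℝ) :
    NEquiv (fun T => dnorm (FmD (wt 1 s) (SmD (wt 1 r) T)))
      (fun T => dnorm (SmD (wt 1 r) (FmD (wt 1 s) T))) := NEquiv.of_exists (commute_dnorm hs r)

/-- The norm of integer order in terms of the weighted Sobolev norm. -/
theorem nequiv_intNorm (hΛ : IsUnit Λ.det) {s : ℝ} (hs : s ∈ Set.Icc (-1 : ℝ) 1) (l : ℕ) :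
    NEquiv (fun T => intNorm Λ s l (blochJ hΛ T))
      (fun T => dnorm (FmD (wt 1 s) (SmD (wt 1 l) T))) := by
  obtain ⟨C, hC, -, h⟩ := exists_intNorm_equiv_pdD hΛ s
  obtain ⟨h1, h2⟩ := dom_moment hs l
  have e : ∀ γ T, dnorm (SmD (wt 1 s) (pdD γ (Fh T))) = dnorm (SmD (wt 1 s) (Fh (moment γ T))) := by
    intro γ T
    rw [pdD_Fh, map_smul, dnorm_smul_of_norm_eq_one (by simp)]
  simp only [e] at h
  obtain ⟨k1, k2⟩ := nequiv_dnorm_Fh s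
  constructor
  · refine Dom.of_sq (Dom.trans ⟨C, hC, fun T => (h l T).1⟩ (Dom.sum fun γ hγ => ?_))
    exact ((k1.comp (moment γ)).trans (h1 γ hγ)).sq
  · refine h2.trans (Dom.sum fun γ hγ => (k2.comp (moment γ)).trans (Dom.of_sq ?_))
    exact (Dom.single hγ fun γ T => dnorm (SmD (wt 1 s) (Fh (moment γ T))) ^ 2).trans
      ⟨C, hC, fun T => (h l T).2⟩

/-- For `s = 0` the constant in `exists_intNorm_equiv_pdD` is one, and the only multi-index is zero.
-/
theorem intNorm_zero_zero (hΛ : IsUnit Λ.det) (T : 𝓢'(Plane, ℂ)) :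
    intNorm Λ 0 0 (blochJ hΛ T) = dnorm T := by
  obtain ⟨C, hC, hC1, h⟩ := exists_intNorm_equiv_pdD hΛ 0
  rw [hC1 rfl] at h
  have e : multiIdx 0 = {(0, 0)} := by
    ext γ
    rw [mem_multiIdx, Finset.mem_singleton, Prod.ext_iff]
    simp
  have hw : ∀ ε (T : 𝓢'(Plane, ℂ)), SmD (wt ε 0) T = T := fun ε T => by
    have := SmD_wt_cancel ε 0 T
    rwa [SmD_wt_wt, neg_zero, add_zero] at this
  have h0 := h 0 T
  rw [e, Finset.sum_singleton, pdD_zero, ENNReal.ofReal_one, one_mul, one_mul, dnorm_SmD_Fh, hw,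
    dnorm_fourier] at h0
  exact le_antisymm ((ENNReal.pow_le_pow_left_iff two_ne_zero).1 h0.1)
    ((ENNReal.pow_le_pow_left_iff two_ne_zero).1 h0.2)

/-! ### Fractional regularity in the quasiperiodicity -/

theorem lintegral_Ioi_comp_mul {a : ℝ} (ha : 0 < a) {h : ℝ → ℝ≥0∞} (hh : Measurable h) :
    ∫⁻ u in Set.Ioi (0 : ℝ), h u = ENNReal.ofReal a * ∫⁻ t in Set.Ioi (0 : ℝ), h (a * t) := by
  have e := Real.smul_map_volume_mul_left ha.ne'
  have hp : (fun t : ℝ => a * t) ⁻¹' Set.Ioi 0 = Set.Ioi 0 := by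
    ext t
    simp [ha]
  calc ∫⁻ u in Set.Ioi (0 : ℝ), h u
      = ∫⁻ u in Set.Ioi (0 : ℝ), h u ∂(ENNReal.ofReal |a| • Measure.map (fun x => a * x) volume) := by
        rw [e]
    _ = _ := by
        rw [Measure.restrict_smul, lintegral_smul_measure, Measure.restrict_map (by fun_prop)
          measurableSet_Ioi, lintegral_map hh (by fun_prop), abs_of_pos ha, smul_eq_mul, hp]

/-- The constant of the K-method. -/
def kConst (θ : ℝ) : ℝ≥0∞ :=
  ∫⁻ t in Set.Ioi (0 : ℝ), ENNReal.ofReal (t ^ (-2 * θ - 1)) * ENNReal.ofReal (t ^ 2 / (1 + t ^ 2))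

/-- Near zero the integrand is at most `t^{1-2θ}`, integrable since `θ < 1`; near infinity at most
`t^{-2θ-1}`, integrable since `θ > 0`. -/
theorem kConst_lt_top {θ : ℝ} (h0 : 0 < θ) (h1 : θ < 1) : kConst θ < ∞ := by
  have e : Set.Ioi (0 : ℝ) = Set.Ioc 0 1 ∪ Set.Ioi 1 := (Set.Ioc_union_Ioi_eq_Ioi zero_le_one).symm
  rw [kConst, e]
  refine (lintegral_union_le _ _ _).trans_lt (ENNReal.add_lt_top.2 ⟨?_, ?_⟩)
  · have hi : IntegrableOn (fun t : ℝ => t ^ (1 - 2 * θ)) (Set.Ioc 0 1) :=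
      (intervalIntegrable_iff_integrableOn_Ioc_of_le zero_le_one).1
        (intervalIntegral.intervalIntegrable_rpow' (by linarith))
    refine lt_of_le_of_lt ?_ hi.lintegral_lt_top
    refine setLIntegral_mono' measurableSet_Ioc fun t ht => ?_
    rw [← ENNReal.ofReal_mul (Real.rpow_nonneg ht.1.le _)]
    refine ENNReal.ofReal_le_ofReal ?_
    have e2 : t ^ (1 - 2 * θ) = t ^ (-2 * θ - 1) * t ^ 2 := by
      rw [← Real.rpow_natCast, ← Real.rpow_add ht.1]
      congr 1
      push_cast
      ring
    rw [e2]
    refine mul_le_mul_of_nonneg_left (div_le_self (by positivity) (by nlinarith [sq_nonneg t]))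
      (Real.rpow_nonneg ht.1.le _)
  · have hi : IntegrableOn (fun t : ℝ => t ^ (-2 * θ - 1)) (Set.Ioi 1) :=
      integrableOn_Ioi_rpow_of_lt (by linarith) one_pos
    refine lt_of_le_of_lt ?_ hi.lintegral_lt_top
    refine setLIntegral_mono' measurableSet_Ioi fun t ht => ?_
    refine mul_le_of_le_one_right zero_le ?_
    rw [ENNReal.ofReal_le_one, div_le_one (by positivity)]
    linarith

theorem kConst_pos (θ : ℝ) : 0 < kConst θ := by
  have hm : Measurable fun t : ℝ =>
      ENNReal.ofReal (t ^ (-2 * θ - 1)) * ENNReal.ofReal (t ^ 2 / (1 + t ^ 2)) := by fun_prop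
  rw [kConst, setLIntegral_pos_iff hm]
  have : Set.Ioi (0 : ℝ) ⊆ (Function.support fun t : ℝ =>
      ENNReal.ofReal (t ^ (-2 * θ - 1)) * ENNReal.ofReal (t ^ 2 / (1 + t ^ 2))) ∩ Set.Ioi 0 := by
    intro t ht
    refine ⟨?_, ht⟩
    have ht' : 0 < t := ht
    rw [Function.mem_support]
    refine mul_ne_zero ?_ ?_ <;> rw [ne_eq, ENNReal.ofReal_eq_zero, not_le] <;> positivity
  refine lt_of_lt_of_le ?_ (measure_mono this)
  simp

/-- The substitution `u = √A t` extracts the power `A^θ`. It is the source of the intermediate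
weight. -/
theorem lintegral_kernel {θ A : ℝ} (hA : 0 < A) :
    ∫⁻ t in Set.Ioi (0 : ℝ), ENNReal.ofReal (t ^ (-2 * θ - 1)) *
      ENNReal.ofReal (t ^ 2 * A / (1 + t ^ 2 * A)) = kConst θ * ENNReal.ofReal (A ^ θ) := by
  have ha : 0 < Real.sqrt A := Real.sqrt_pos.2 hA
  have hsq : Real.sqrt A ^ 2 = A := Real.sq_sqrt hA.le
  have hm : Measurable fun t : ℝ =>
      ENNReal.ofReal (t ^ (-2 * θ - 1)) * ENNReal.ofReal (t ^ 2 / (1 + t ^ 2)) := by fun_prop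
  rw [kConst, lintegral_Ioi_comp_mul ha hm]
  have e : ∀ t ∈ Set.Ioi (0 : ℝ), ENNReal.ofReal ((Real.sqrt A * t) ^ (-2 * θ - 1)) *
      ENNReal.ofReal ((Real.sqrt A * t) ^ 2 / (1 + (Real.sqrt A * t) ^ 2)) =
      ENNReal.ofReal (Real.sqrt A ^ (-2 * θ - 1)) * (ENNReal.ofReal (t ^ (-2 * θ - 1)) *
      ENNReal.ofReal (t ^ 2 * A / (1 + t ^ 2 * A))) := by
    intro t ht
    have ht' : 0 < t := ht
    rw [Real.mul_rpow ha.le ht'.le, ENNReal.ofReal_mul (by positivity), mul_pow, hsq, mul_assoc,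
      mul_comm A]
  rw [setLIntegral_congr_fun measurableSet_Ioi e, lintegral_const_mul' _ _ ENNReal.ofReal_ne_top,
    ← mul_assoc, ← ENNReal.ofReal_mul ha.le, mul_right_comm, ← ENNReal.ofReal_mul (by positivity)]
  have : Real.sqrt A * Real.sqrt A ^ (-2 * θ - 1) * A ^ θ = 1 := by
    have e1 : A ^ θ = Real.sqrt A ^ (2 * θ) := by
      rw [Real.rpow_mul ha.le]
      norm_cast
      rw [hsq]
    have e2 : Real.sqrt A * Real.sqrt A ^ (-2 * θ - 1) = Real.sqrt A ^ (-2 * θ) := by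
      nth_rewrite 1 [← Real.rpow_one (Real.sqrt A)]
      rw [← Real.rpow_add ha]
      congr 1
      ring
    rw [e1, e2, ← Real.rpow_add ha]
    simp
  rw [this, ENNReal.ofReal_one, one_mul]

/-- Integration of the K-functional of weighted `L²` spaces. -/
theorem lintegral_kFunctional (θ l : ℝ) {f : Plane → ℂ} (hf : AEStronglyMeasurable f) :
    ∫⁻ t in Set.Ioi (0 : ℝ), ENNReal.ofReal (t ^ (-2 * θ - 1)) *
      ∫⁻ x, ENNReal.ofReal (t ^ 2 * (1 + (1 * ‖x‖) ^ 2) / (1 + t ^ 2 * (1 + (1 * ‖x‖) ^ 2))) *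
        ‖wt 1 l x * f x‖ₑ ^ 2 =
    kConst θ * ∫⁻ x, ‖wt 1 (l + θ) x * f x‖ₑ ^ 2 := by
  have hwf : AEMeasurable fun x => ‖wt 1 l x * f x‖ₑ ^ 2 := by
    have hw : AEStronglyMeasurable (wt 1 l) volume :=
      (hasTemperateGrowth_wt 1 l).1.continuous.aestronglyMeasurable
    exact ((hw.mul hf).enorm).pow_const 2
  have hk : Measurable fun p : ℝ × Plane => ENNReal.ofReal (p.1 ^ (-2 * θ - 1)) *
      ENNReal.ofReal (p.1 ^ 2 * (1 + (1 * ‖p.2‖) ^ 2) / (1 + p.1 ^ 2 * (1 + (1 * ‖p.2‖) ^ 2))) := by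
    fun_prop
  simp_rw [← lintegral_const_mul' _ _ ENNReal.ofReal_ne_top, ← mul_assoc]
  rw [lintegral_lintegral_swap]
  · rw [← lintegral_const_mul'' _ ?_]
    · refine lintegral_congr fun x => ?_
      have hx := one_add_sq_pos 1 x
      rw [lintegral_mul_const _ (by fun_prop), lintegral_kernel hx, enorm_mul, enorm_mul,
        mul_pow ‖_‖ₑ, mul_pow ‖_‖ₑ, enorm_wt_sq, enorm_wt_sq, Real.rpow_add hx, ENNReal.ofReal_mul (by positivity)]
      ring
    · have hw : AEStronglyMeasurable (wt 1 (l + θ)) volume :=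
        (hasTemperateGrowth_wt 1 (l + θ)).1.continuous.aestronglyMeasurable
      exact ((hw.mul hf).enorm).pow_const 2
  · exact hk.aemeasurable.mul (hwf.comp_quasiMeasurePreserving Measure.quasiMeasurePreserving_snd)

/-- The square of the K-functional of weighted `L²` spaces. -/
def kInt (l t : ℝ) (f : Plane → ℂ) : ℝ≥0∞ :=
  ∫⁻ x, ENNReal.ofReal (t ^ 2 * (1 + (1 * ‖x‖) ^ 2) / (1 + t ^ 2 * (1 + (1 * ‖x‖) ^ 2))) *
    ‖wt 1 l x * f x‖ₑ ^ 2

theorem dnorm_SmD_sq {V : 𝓢'(Plane, ℂ)} {f : Plane → ℂ} (h : Represents V f) (r : ℝ) :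
    dnorm (SmD (wt 1 r) V) ^ 2 = ∫⁻ x, ‖wt 1 r x * f x‖ₑ ^ 2 := by
  rw [dnorm_eq_eLpNorm (h.SmD (hasTemperateGrowth_wt 1 r)), eLpNorm_two_sq]

theorem aemeasurable_wt_mul {f : Plane → ℂ} (hf : AEStronglyMeasurable f) (r : ℝ) :
    AEMeasurable fun x => ‖wt 1 r x * f x‖ₑ ^ 2 := by
  have hw : AEStronglyMeasurable (wt 1 r) volume :=
    (hasTemperateGrowth_wt 1 r).1.continuous.aestronglyMeasurable
  exact ((hw.mul hf).enorm).pow_const 2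

theorem enorm_wt_add_one_sq (l : ℝ) (x : Plane) :
    ‖wt 1 (l + 1) x‖ₑ ^ 2 = ENNReal.ofReal (1 + (1 * ‖x‖) ^ 2) * ‖wt 1 l x‖ₑ ^ 2 := by
  rw [enorm_wt_sq, enorm_wt_sq, ← ENNReal.ofReal_mul (one_add_sq_pos 1 x).le,
    Real.rpow_add (one_add_sq_pos 1 x), Real.rpow_one, mul_comm]

/-- With `τ = t²(1 + |x|²)`, pointwise `τ/(1+τ) |a + b|² ≤ |a|² + τ |b|²`. The quadratic
K-functional is used because this minimum is explicit. -/
theorem kInt_le {V₀ V₁ : 𝓢'(Plane, ℂ)} {f : Plane → ℂ} (h : Represents (V₀ + V₁) f) (l : ℝ) {t : ℝ}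
    (ht : 0 < t) : kInt l t f ≤
      dnorm (SmD (wt 1 l) V₀) ^ 2 + ENNReal.ofReal (t ^ 2) * dnorm (SmD (wt 1 (l + 1)) V₁) ^ 2 := by
  have ht2 : ENNReal.ofReal (t ^ 2) ≠ 0 := by
    rw [ne_eq, ENNReal.ofReal_eq_zero, not_le]
    positivity
  by_cases h0 : dnorm (SmD (wt 1 l) V₀) = ∞
  · simp [h0]
  by_cases h1 : dnorm (SmD (wt 1 (l + 1)) V₁) = ∞
  · simp [h1, ENNReal.mul_top ht2]
  obtain ⟨f₀, hf₀⟩ := exists_represents_of_dnorm_SmD_lt_top (lt_top_iff_ne_top.2 h0)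
  obtain ⟨f₁, hf₁⟩ := exists_represents_of_dnorm_SmD_lt_top (lt_top_iff_ne_top.2 h1)
  have hae := h.ae_eq (hf₀.add hf₁)
  rw [dnorm_SmD_sq hf₀, dnorm_SmD_sq hf₁, ← lintegral_const_mul' _ _ ENNReal.ofReal_ne_top,
    ← lintegral_add_left' (aemeasurable_wt_mul hf₀.locallyIntegrable.aestronglyMeasurable l), kInt]
  refine lintegral_mono_ae (hae.mono fun x hx => ?_)
  have hA := one_add_sq_pos 1 x
  set A := 1 + (1 * ‖x‖) ^ 2
  have key : ENNReal.ofReal (t ^ 2 * A / (1 + t ^ 2 * A)) * ‖f₀ x + f₁ x‖ₑ ^ 2 ≤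
      ‖f₀ x‖ₑ ^ 2 + ENNReal.ofReal (t ^ 2 * A) * ‖f₁ x‖ₑ ^ 2 := by
    simp only [← ofReal_norm]
    rw [← ENNReal.ofReal_pow (norm_nonneg _), ← ENNReal.ofReal_pow (norm_nonneg _),
      ← ENNReal.ofReal_pow (norm_nonneg _), ← ENNReal.ofReal_mul (by positivity),
      ← ENNReal.ofReal_mul (by positivity), ← ENNReal.ofReal_add (by positivity) (by positivity)]
    refine ENNReal.ofReal_le_ofReal ?_
    have hτ : 0 < t ^ 2 * A := by positivity
    set τ := t ^ 2 * A
    have h2 : ‖f₀ x + f₁ x‖ ^ 2 ≤ (‖f₀ x‖ + ‖f₁ x‖) ^ 2 :=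
      pow_le_pow_left₀ (norm_nonneg _) (norm_add_le _ _) 2
    rw [div_mul_eq_mul_div, div_le_iff₀ (by positivity)]
    nlinarith [sq_nonneg (‖f₀ x‖ - τ * ‖f₁ x‖)]
  rw [hx, enorm_mul, enorm_mul, enorm_mul, mul_pow, mul_pow, mul_pow, enorm_wt_add_one_sq]
  calc _ = ‖wt 1 l x‖ₑ ^ 2 * (ENNReal.ofReal (t ^ 2 * A / (1 + t ^ 2 * A)) *
        ‖f₀ x + f₁ x‖ₑ ^ 2) := by ring
    _ ≤ ‖wt 1 l x‖ₑ ^ 2 * _ := mul_le_mul_right key _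
    _ = _ := by rw [ENNReal.ofReal_mul (by positivity)]; ring

/-- The multiplier of the optimal decomposition. -/
def kMult (t : ℝ) (x : Plane) : ℂ := ((1 + t ^ 2 * (1 + (1 * ‖x‖) ^ 2) : ℝ) : ℂ)⁻¹

theorem hasTemperateGrowth_kMult (t : ℝ) : (kMult t).HasTemperateGrowth := by
  have e : kMult t = fun x =>
      ((1 + t ^ 2 : ℝ) : ℂ)⁻¹ * wt (t / Real.sqrt (1 + t ^ 2)) (-2) x := by
    ext x
    have h1 : (0 : ℝ) < 1 + t ^ 2 := by positivity
    rw [kMult, wt, neg_div, div_self (by norm_num : (2 : ℝ) ≠ 0), Real.rpow_neg_one,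
      ← Complex.ofReal_inv, ← Complex.ofReal_inv, ← Complex.ofReal_mul, ← mul_inv]
    congr 2
    rw [one_mul, mul_pow (t / _), div_pow, Real.sq_sqrt h1.le]
    field_simp
    ring
  rw [e]
  have := hasTemperateGrowth_wt (t / Real.sqrt (1 + t ^ 2)) (-2)
  fun_prop

/-- Equality in the pointwise inequality, attained by giving the fraction `1/(1+τ)` of the function
to the second summand. -/
theorem exists_decomp {V : 𝓢'(Plane, ℂ)} {f : Plane → ℂ} (h : Represents V f) (l t : ℝ) :
    ∃ V₀ V₁ : 𝓢'(Plane, ℂ), V₀ + V₁ = V ∧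
      dnorm (SmD (wt 1 l) V₀) ^ 2 + ENNReal.ofReal (t ^ 2) * dnorm (SmD (wt 1 (l + 1)) V₁) ^ 2 =
        kInt l t f := by
  have hk := hasTemperateGrowth_kMult t
  have h1 := h.SmD hk
  have hk0 : (fun x => 1 - kMult t x).HasTemperateGrowth := by fun_prop
  have h0 := h.SmD hk0
  have hf := h.locallyIntegrable.aestronglyMeasurable
  refine ⟨SmD (fun x => 1 - kMult t x) V, SmD (kMult t) V, (h0.add h1).dist_eq
    (h.congr (Eventually.of_forall fun x => by ring)), ?_⟩
  rw [dnorm_SmD_sq h0, dnorm_SmD_sq h1, ← lintegral_const_mul' _ _ ENNReal.ofReal_ne_top,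
    ← lintegral_add_left' (aemeasurable_wt_mul h0.locallyIntegrable.aestronglyMeasurable l), kInt]
  refine lintegral_congr fun x => ?_
  have hA := one_add_sq_pos 1 x
  have hk1 : ‖kMult t x‖ₑ = ENNReal.ofReal (1 + t ^ 2 * (1 + (1 * ‖x‖) ^ 2))⁻¹ := by
    rw [← ofReal_norm, kMult, ← Complex.ofReal_inv, Complex.norm_real, Real.norm_of_nonneg]
    positivity
  have hk2 : ‖1 - kMult t x‖ₑ = ENNReal.ofReal (t ^ 2 * (1 + (1 * ‖x‖) ^ 2) /
      (1 + t ^ 2 * (1 + (1 * ‖x‖) ^ 2))) := by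
    rw [← ofReal_norm, kMult, ← Complex.ofReal_inv, ← Complex.ofReal_one, ← Complex.ofReal_sub,
      Complex.norm_real]
    have : 1 - (1 + t ^ 2 * (1 + (1 * ‖x‖) ^ 2))⁻¹ = t ^ 2 * (1 + (1 * ‖x‖) ^ 2) /
      (1 + t ^ 2 * (1 + (1 * ‖x‖) ^ 2)) := by field_simp; ring
    rw [this, Real.norm_of_nonneg (by positivity)]
  rw [enorm_mul, enorm_mul, enorm_mul, enorm_mul, enorm_mul, hk1, hk2]
  simp only [mul_pow ‖_‖ₑ, mul_pow (ENNReal.ofReal _)]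
  rw [enorm_wt_add_one_sq]
  set A := 1 + (1 * ‖x‖) ^ 2
  have e : ENNReal.ofReal (t ^ 2 * A / (1 + t ^ 2 * A)) ^ 2 +
      ENNReal.ofReal (t ^ 2) * (ENNReal.ofReal A * ENNReal.ofReal (1 + t ^ 2 * A)⁻¹ ^ 2) =
      ENNReal.ofReal (t ^ 2 * A / (1 + t ^ 2 * A)) := by
    rw [← ENNReal.ofReal_pow (by positivity), ← ENNReal.ofReal_pow (by positivity),
      ← ENNReal.ofReal_mul (by positivity), ← ENNReal.ofReal_mul (by positivity),
      ← ENNReal.ofReal_add (by positivity) (by positivity)]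
    congr 1
    field_simp
    ring
  calc _ = (ENNReal.ofReal (t ^ 2 * A / (1 + t ^ 2 * A)) ^ 2 +
      ENNReal.ofReal (t ^ 2) * (ENNReal.ofReal A * ENNReal.ofReal (1 + t ^ 2 * A)⁻¹ ^ 2)) *
        (‖wt 1 l x‖ₑ ^ 2 * ‖f x‖ₑ ^ 2) := by ring
    _ = _ := by rw [e]

/-- The weighted Sobolev norm with the weight outside. -/
def wnorm (s r : ℝ) (T : 𝓢'(Plane, ℂ)) : ℝ≥0∞ := dnorm (SmD (wt 1 r) (FmD (wt 1 s) T))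

theorem nequiv_intNorm_wnorm (hΛ : IsUnit Λ.det) {s : ℝ} (hs : s ∈ Set.Icc (-1 : ℝ) 1) (l : ℕ) :
    NEquiv (fun T => intNorm Λ s l (blochJ hΛ T)) (wnorm s l) :=
  (nequiv_intNorm hΛ hs l).trans (nequiv_commute hs l)

theorem blochJ_injective (hΛ : IsUnit Λ.det) : Function.Injective (blochJ hΛ) :=
  Function.LeftInverse.injective (blochInv_blochJ hΛ)

/-- The K-functional in terms of weighted `L²` norms. -/
theorem exists_kFunctionalSq_equiv (hΛ : IsUnit Λ.det) {s : ℝ} (hs : s ∈ Set.Icc (-1 : ℝ) 1)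
    (l : ℕ) : ∃ A : ℝ, 0 < A ∧ ∀ (T : 𝓢'(Plane, ℂ)) (t : ℝ), 0 < t →
      (kFunctionalSq Λ s l t (blochJ hΛ T) < ∞ → ∃ f, Represents (FmD (wt 1 s) T) f) ∧
      ∀ f, Represents (FmD (wt 1 s) T) f →
        kFunctionalSq Λ s l t (blochJ hΛ T) ≤ ENNReal.ofReal A * kInt l t f ∧
        kInt l t f ≤ ENNReal.ofReal A * kFunctionalSq Λ s l t (blochJ hΛ T) := by
  obtain ⟨⟨C₀, hC₀, h₀⟩, ⟨D₀, hD₀, k₀⟩⟩ := (nequiv_intNorm_wnorm hΛ hs l)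
  obtain ⟨⟨C₁, hC₁, h₁⟩, ⟨D₁, hD₁, k₁⟩⟩ := (nequiv_intNorm_wnorm hΛ hs (l + 1))
  -- A single constant for all the norm comparisons, independent of `t`, so that it survives the
  -- integration in `t`.
  set A := (C₀ + C₁ + D₀ + D₁) ^ 2 with hAdef
  have hA : 0 < A := by positivity
  have sqle : ∀ {B : ℝ} {a b : ℝ≥0∞}, 0 < B → B ≤ C₀ + C₁ + D₀ + D₁ → a ≤ ENNReal.ofReal B * b →
      a ^ 2 ≤ ENNReal.ofReal A * b ^ 2 := fun {B a b} hB hle h => by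
    rw [hAdef, ENNReal.ofReal_pow (by positivity), ← mul_pow]
    refine pow_le_pow_left' (h.trans ?_) 2
    gcongr
  have hfun : ∀ (T₀ T₁ : 𝓢'(Plane, ℂ)) (t : ℝ),
      (wnorm s l T₀ ^ 2 + ENNReal.ofReal (t ^ 2) * wnorm s (l + 1) T₁ ^ 2) ≤
      ENNReal.ofReal A * (intNorm Λ s l (blochJ hΛ T₀) ^ 2 +
        ENNReal.ofReal (t ^ 2) * intNorm Λ s (l + 1) (blochJ hΛ T₁) ^ 2) := by
    intro T₀ T₁ t
    rw [mul_add, mul_left_comm]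
    refine add_le_add (sqle hD₀ (by linarith) (k₀ T₀)) (mul_le_mul_right ?_ _)
    have := sqle hD₁ (by linarith) (k₁ T₁)
    push_cast at this
    exact this
  -- Since the transform is a bijection onto the quasiperiodic distributions, splittings of the
  -- transform are the transforms of splittings of `T`.
  have hdec : ∀ (T : 𝓢'(Plane, ℂ)) (ψ₀ ψ₁ : Dist₂), IsQuasiperiodic Λ ψ₀ ∧ IsQuasiperiodic Λ ψ₁ ∧
      ψ₀ + ψ₁ = blochJ hΛ T → ∃ T₀ T₁, T₀ + T₁ = T ∧ ψ₀ = blochJ hΛ T₀ ∧ ψ₁ = blochJ hΛ T₁ := by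
    rintro T ψ₀ ψ₁ ⟨q₀, q₁, e⟩
    refine ⟨blochInv hΛ ψ₀, blochInv hΛ ψ₁, blochJ_injective hΛ ?_, (blochJ_blochInv hΛ q₀).symm,
      (blochJ_blochInv hΛ q₁).symm⟩
    rw [map_add, blochJ_blochInv hΛ q₀, blochJ_blochInv hΛ q₁, e]
  refine ⟨A, hA, fun T t ht => ⟨fun hfin => ?_, fun f hf => ⟨?_, ?_⟩⟩⟩
  · simp only [kFunctionalSq, iInf_lt_iff] at hfin
    obtain ⟨ψ₀, ψ₁, hq, hlt⟩ := hfin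
    obtain ⟨T₀, T₁, e, rfl, rfl⟩ := hdec T ψ₀ ψ₁ hq
    have hlt' := (hfun T₀ T₁ t).trans_lt (ENNReal.mul_lt_top ENNReal.ofReal_lt_top hlt)
    have ht2 : ENNReal.ofReal (t ^ 2) ≠ 0 := by
      rw [ne_eq, ENNReal.ofReal_eq_zero, not_le]
      positivity
    obtain ⟨a, b⟩ := ENNReal.add_lt_top.1 hlt'
    have a' : wnorm s l T₀ < ∞ := by
      by_contra h
      rw [not_lt, top_le_iff] at h
      rw [h] at a
      simp at a
    have b' : wnorm s (l + 1) T₁ < ∞ := by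
      by_contra h
      rw [not_lt, top_le_iff] at h
      rw [h] at b
      simp [ENNReal.mul_top ht2] at b
    obtain ⟨f₀, hf₀⟩ := exists_represents_of_dnorm_SmD_lt_top a'
    obtain ⟨f₁, hf₁⟩ := exists_represents_of_dnorm_SmD_lt_top b'
    exact ⟨_, by rw [← e, map_add]; exact hf₀.add hf₁⟩
  · obtain ⟨V₀, V₁, e, hV⟩ := exists_decomp hf l t
    rw [← hV]
    have hadd : blochJ hΛ (FmD (wt 1 (-s)) V₀) + blochJ hΛ (FmD (wt 1 (-s)) V₁) = blochJ hΛ T := by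
      rw [← map_add, ← map_add, e, FmD_wt_cancel']
    refine iInf_le_of_le (blochJ hΛ (FmD (wt 1 (-s)) V₀)) <|
      iInf_le_of_le (blochJ hΛ (FmD (wt 1 (-s)) V₁)) <| iInf_le_of_le
      ⟨isQuasiperiodic_blochJ hΛ _, isQuasiperiodic_blochJ hΛ _, hadd⟩ ?_
    rw [mul_add, mul_left_comm]
    refine add_le_add (sqle hC₀ (by linarith) ?_) (mul_le_mul_right (sqle hC₁ (by linarith) ?_) _)
    · simpa only [wnorm, FmD_wt_cancel] using h₀ (FmD (wt 1 (-s)) V₀)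
    · have := h₁ (FmD (wt 1 (-s)) V₁)
      simp only [wnorm, FmD_wt_cancel] at this
      push_cast at this
      exact this
  · rw [← ENNReal.div_le_iff' (by simpa using hA) ENNReal.ofReal_ne_top]
    refine le_iInf fun ψ₀ => le_iInf fun ψ₁ => le_iInf fun hq => ?_
    obtain ⟨T₀, T₁, e, rfl, rfl⟩ := hdec T ψ₀ ψ₁ hq
    rw [ENNReal.div_le_iff' (by simpa using hA) ENNReal.ofReal_ne_top]
    refine le_trans ?_ (hfun T₀ T₁ t)
    rw [← e, map_add] at hf
    exact kInt_le hf l ht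

theorem interpNorm_sq (s : ℝ) (l : ℕ) (θ : ℝ) (ψ : Dist₂) :
    interpNorm Λ s l θ ψ ^ 2 = ∫⁻ t in Set.Ioi (0 : ℝ),
      ENNReal.ofReal (t ^ (-2 * θ - 1)) * kFunctionalSq Λ s l t ψ := by
  rw [interpNorm, ← ENNReal.rpow_natCast, ← ENNReal.rpow_mul]
  norm_num

/-- The K-functional is equivalent to the pointwise expression `kInt`, whose integral in `t` is the
weighted norm of order `l + θ`. -/
theorem nequiv_interpNorm (hΛ : IsUnit Λ.det) {s : ℝ} (hs : s ∈ Set.Icc (-1 : ℝ) 1) (l : ℕ)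
    {θ : ℝ} (h0 : 0 < θ) (h1 : θ < 1) :
    NEquiv (fun T => interpNorm Λ s l θ (blochJ hΛ T)) (wnorm s (l + θ)) := by
  obtain ⟨A, hA, hK⟩ := exists_kFunctionalSq_equiv hΛ hs l
  have hc : 0 < (kConst θ).toReal := ENNReal.toReal_pos (kConst_pos θ).ne' (kConst_lt_top h0 h1).ne
  have hc' : ENNReal.ofReal (kConst θ).toReal = kConst θ :=
    ENNReal.ofReal_toReal (kConst_lt_top h0 h1).ne
  have hint : ∀ (T : 𝓢'(Plane, ℂ)) f, Represents (FmD (wt 1 s) T) f →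
      ∫⁻ t in Set.Ioi (0 : ℝ), ENNReal.ofReal (t ^ (-2 * θ - 1)) * kInt l t f =
        kConst θ * wnorm s (l + θ) T ^ 2 := fun T f hf => by
    rw [wnorm, dnorm_SmD_sq hf]
    exact lintegral_kFunctional θ l hf.locallyIntegrable.aestronglyMeasurable
  constructor
  · refine Dom.of_sq ⟨A * (kConst θ).toReal, by positivity, fun T => ?_⟩
    rw [ENNReal.ofReal_mul hA.le, hc', mul_assoc]
    beta_reduce
    by_cases hfin : wnorm s (l + θ) T = ∞
    · rw [hfin]
      simp [ENNReal.mul_top, (kConst_pos θ).ne', hA]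
    obtain ⟨f, hf⟩ := exists_represents_of_dnorm_SmD_lt_top (lt_top_iff_ne_top.2 hfin)
    rw [interpNorm_sq, ← hint T f hf, ← lintegral_const_mul' _ _ ENNReal.ofReal_ne_top]
    refine setLIntegral_mono' measurableSet_Ioi fun t ht => ?_
    rw [mul_left_comm]
    exact mul_le_mul_right (((hK T t ht).2 f hf).1) _
  · refine Dom.of_sq ⟨A * ((kConst θ).toReal)⁻¹, by positivity, fun T => ?_⟩
    rw [mul_comm A, ENNReal.ofReal_mul (by positivity), ENNReal.ofReal_inv_of_pos hc, hc', mul_assoc]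
    beta_reduce
    by_cases hfin : interpNorm Λ s l θ (blochJ hΛ T) = ∞
    · rw [hfin]
      simp [ENNReal.mul_top, (kConst_lt_top h0 h1).ne, hA]
    -- A finite interpolation norm needs a finite K-functional at some `t`; this already makes `D_s
    -- T` a function.
    have hex : ∃ t : ℝ, 0 < t ∧ kFunctionalSq Λ s l t (blochJ hΛ T) < ∞ := by
      by_contra hne
      push Not at hne
      have e : interpNorm Λ s l θ (blochJ hΛ T) ^ 2 = ∞ := by
        rw [interpNorm_sq, setLIntegral_congr_fun (g := fun _ => ∞) measurableSet_Ioi]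
        · simp
        · intro t ht
          have ht' : 0 < t := ht
          simp only [top_le_iff.1 (hne t ht)]
          refine ENNReal.mul_top ?_
          rw [ne_eq, ENNReal.ofReal_eq_zero, not_le]
          positivity
      exact ENNReal.pow_ne_top hfin e
    obtain ⟨t, ht, htf⟩ := hex
    obtain ⟨f, hf⟩ := (hK T t ht).1 htf
    have h2 : kConst θ * wnorm s (l + θ) T ^ 2 ≤
        ENNReal.ofReal A * interpNorm Λ s l θ (blochJ hΛ T) ^ 2 := by
      rw [← hint T f hf, interpNorm_sq, ← lintegral_const_mul' _ _ ENNReal.ofReal_ne_top]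
      refine setLIntegral_mono' measurableSet_Ioi fun t ht => ?_
      rw [mul_left_comm]
      exact mul_le_mul_right (((hK T t ht).2 f hf).2) _
    rw [← ENNReal.div_eq_inv_mul, ENNReal.le_div_iff_mul_le (Or.inl (kConst_pos θ).ne')
      (Or.inl (kConst_lt_top h0 h1).ne), mul_comm]
    exact h2

theorem nequiv_posNorm (hΛ : IsUnit Λ.det) {s r : ℝ} (hs : s ∈ Set.Icc (-1 : ℝ) 1) (hr : 0 ≤ r) :
    NEquiv (fun T => posNorm Λ s r (blochJ hΛ T)) (wnorm s r) := by
  by_cases h : Int.fract r = 0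
  · simp only [posNorm, if_pos h]
    have e : ((⌊r⌋₊ : ℕ) : ℝ) = r := by
      rw [natCast_floor_eq_intCast_floor hr]
      have := Int.self_sub_floor r
      linarith
    have := nequiv_intNorm_wnorm hΛ hs ⌊r⌋₊
    rwa [e] at this
  · simp only [posNorm, if_neg h]
    have := nequiv_interpNorm hΛ hs ⌊r⌋₊ (lt_of_le_of_ne (Int.fract_nonneg r) (Ne.symm h))
      (Int.fract_lt_one r)
    rwa [natCast_floor_eq_intCast_floor hr, Int.floor_add_fract] at this

/-! ### Bloch transforms of integrable functions -/

theorem integrable_tsum {X ι : Type*} [MeasurableSpace X] {μ : Measure X} [Countable ι]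
    {f : ι → X → ℂ} (hf : ∀ i, AEStronglyMeasurable (f i) μ)
    (h : ∑' i, ∫⁻ x, ‖f i x‖ₑ ∂μ ≠ ∞) : Integrable (fun x => ∑' i, f i x) μ := by
  have hm : ∀ i, AEMeasurable (fun x => ‖f i x‖ₑ) μ := fun i => (hf i).enorm
  refine ⟨(AEMeasurable.tsum fun i => (hf i).aemeasurable).aestronglyMeasurable, ?_⟩
  refine lt_of_le_of_lt (lintegral_mono_ae ?_) (lt_top_iff_ne_top.2 (lintegral_tsum hm ▸ h))
  exact Eventually.of_forall fun x => enorm_tsum_le_tsum_enorm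

/-- The sum is periodic, so a bound on the bounded cell is a bound everywhere. -/
theorem exists_tsum_enorm_le {A : Matrix (Fin 2) (Fin 2) ℝ} (hA : IsUnit A.det)
    (v : 𝓢(Plane, ℂ)) : ∃ B : ℝ≥0∞, B < ∞ ∧ ∀ x, ∑' j : Idx, ‖v (x + latt A j)‖ₑ ≤ B := by
  obtain ⟨R, hR⟩ := (isBounded_cell A).exists_norm_le
  have hper : ∀ (x : Plane) (m : Idx),
      ∑' j : Idx, ‖v (x + latt A m + latt A j)‖ₑ = ∑' j : Idx, ‖v (x + latt A j)‖ₑ := by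
    intro x m
    rw [← (Equiv.addLeft m).tsum_eq fun j => ‖v (x + latt A j)‖ₑ]
    refine tsum_congr fun j => ?_
    rw [Equiv.coe_addLeft, latt_add, add_assoc]
  set K := 8 * pn 3 v * (1 + R) ^ 3
  have hp : (0 : ℝ) ≤ pn 3 v := apply_nonneg _ _
  refine ⟨∑' j : Idx, ENNReal.ofReal (K * ((1 + ‖latt A j‖) ^ 3)⁻¹), ?_, fun x => ?_⟩
  · have hR0 : 0 ≤ R := (norm_nonneg _).trans (hR (mulPt A 0) ((mem_cell_iff hA 0).2 (by
      intro i; norm_num)))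
    have hs : Summable fun j : Idx => K * ((1 + ‖latt A j‖) ^ 3)⁻¹ := (summable_latt hA).mul_left _
    rw [← ENNReal.ofReal_tsum_of_nonneg (fun j => by positivity) hs]
    exact ENNReal.ofReal_lt_top
  · obtain ⟨m, hm, -⟩ := existsUnique_sub_latt_mem_cell hA x
    have e : x = x - latt A m + latt A m := by abel
    rw [e, hper]
    refine ENNReal.tsum_le_tsum fun j => ?_
    rw [← ofReal_norm]
    refine ENNReal.ofReal_le_ofReal ((norm_add_latt_le A v _ j).trans ?_)
    have := hR _ hm
    simp only [K]
    gcongr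

/-- The series `∑_j g(x + Λj) exp(-i α·Λj)`. -/
def blochSeries (Λ : Matrix (Fin 2) (Fin 2) ℝ) (g : Plane → ℂ) (α x : Plane) : ℂ :=
  ∑' j : Idx, g (x + latt Λ j) * phase (-α) (latt Λ j)

/-- The Bloch transform of an integrable function is given by its series. -/
theorem represents₂_blochJ (hΛ : IsUnit Λ.det) {T : 𝓢'(Plane, ℂ)} {g : Plane → ℂ}
    (hg : Integrable g) (hT : Represents T g) :
    Represents₂ (blochJ hΛ T) fun α x => blochConst Λ * blochSeries Λ g α x := by
  intro η v
  obtain ⟨B, hB, hle⟩ := exists_tsum_enorm_le hΛ v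
  let F : Idx → Plane × Plane → ℂ := fun j p => blochConst Λ *
    ((η p.1 * phase (-p.1) (latt Λ j)) * (g (p.2 + latt Λ j) * v p.2))
  have hgv : ∀ j, Integrable fun x => g (x + latt Λ j) * v x := by
    intro j
    have h := ((hT (transl (latt Λ j) v)).1).comp_add_right (latt Λ j)
    simpa [transl_apply] using h
  have hF : ∀ j, Integrable (F j) := fun j =>
    ((integrable_mul_phase η (latt Λ j)).mul_prod (hgv j)).const_mul _
  have hFn : ∀ j, ∫⁻ p, ‖F j p‖ₑ = ‖blochConst Λ‖ₑ * ((∫⁻ α, ‖η α‖ₑ) *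
      ∫⁻ x, ‖g x‖ₑ * ‖v (x - latt Λ j)‖ₑ) := by
    intro j
    simp only [F, enorm_mul]
    have hη : AEMeasurable fun α => ‖η α‖ₑ * ‖phase (-α) (latt Λ j)‖ₑ := by
      simpa only [enorm_mul] using (integrable_mul_phase η (latt Λ j)).1.enorm
    have hgv' : AEMeasurable fun x => ‖g (x + latt Λ j)‖ₑ * ‖v x‖ₑ := by
      simpa only [enorm_mul] using (hgv j).1.enorm
    rw [lintegral_const_mul' _ _ enorm_ne_top, Measure.volume_eq_prod, lintegral_prod_mul hη hgv']
    congr 2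
    · refine lintegral_congr fun α => ?_
      rw [← ofReal_norm (phase _ _), norm_phase, ENNReal.ofReal_one, mul_one]
    · rw [← lintegral_add_right_eq_self (fun x => ‖g x‖ₑ * ‖v (x - latt Λ j)‖ₑ) (latt Λ j)]
      simp
  -- Summing over `j` first leaves the integral of `|g|` against a bounded lattice sum of `|v|`.
  have hsum : ∑' j, ∫⁻ p, ‖F j p‖ₑ ≠ ∞ := by
    simp only [hFn]
    have hm : ∀ j, AEMeasurable fun x => ‖g x‖ₑ * ‖v (x - latt Λ j)‖ₑ := fun j => by
      have : Continuous fun x => v (x - latt Λ j) := v.continuous.comp (by fun_prop)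
      exact hg.1.enorm.mul this.enorm.aemeasurable
    rw [ENNReal.tsum_mul_left, ENNReal.tsum_mul_left, ← lintegral_tsum hm]
    refine ENNReal.mul_ne_top enorm_ne_top (ENNReal.mul_ne_top ?_ ?_)
    · exact (η.integrable (μ := volume)).2.ne
    · refine ne_top_of_le_ne_top (b := ∫⁻ x, ‖g x‖ₑ * B) ?_ (lintegral_mono fun x => ?_)
      · rw [lintegral_mul_const' _ _ hB.ne]
        exact ENNReal.mul_ne_top hg.2.ne hB.ne
      · rw [ENNReal.tsum_mul_left]
        refine mul_le_mul_right ?_ _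
        rw [← (Equiv.neg Idx).tsum_eq]
        simpa only [Equiv.neg_apply, latt_neg, sub_neg_eq_add] using hle x
  have e : ∀ p : Plane × Plane, (blochConst Λ * blochSeries Λ g p.1 p.2) * (η p.1 * v p.2) =
      ∑' j, F j p := by
    intro p
    rw [blochSeries, ← tsum_mul_left, ← tsum_mul_right]
    refine tsum_congr fun j => ?_
    simp only [F]
    ring
  simp only [e]
  refine ⟨integrable_tsum (fun j => (hF j).1) hsum, ?_⟩
  rw [integral_tsum (fun j => (hF j).1) hsum, blochJ_apply]
  have h1 := (hasSum_blochTest hΛ η v).dist_apply T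
  rw [← h1.tsum_eq]
  refine tsum_congr fun j => ?_
  simp only [F]
  rw [integral_const_mul, Measure.volume_eq_prod,
    integral_prod_mul (fun α => η α * phase (-α) (latt Λ j)) (fun x => g (x + latt Λ j) * v x),
    map_smul, smul_eq_mul, (hT _).2, mul_assoc, coef]
  congr 2
  rw [← integral_add_right_eq_self (fun x => g x * transl (latt Λ j) v x) (latt Λ j)]
  simp [transl_apply]

theorem Represents₂.dist_eq {V W : Dist₂} {f : Plane → Plane → ℂ} (hV : Represents₂ V f)
    (hW : Represents₂ W f) : V = W := by
  ext η v
  rw [(hV η v).2, (hW η v).2]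

theorem Represents₂.add {V W : Dist₂} {f g : Plane → Plane → ℂ} (hV : Represents₂ V f)
    (hW : Represents₂ W g) : Represents₂ (V + W) fun α x => f α x + g α x := by
  intro η v
  simp only [add_mul]
  exact ⟨(hV η v).1.add (hW η v).1, by
    rw [integral_add (hV η v).1 (hW η v).1, ← (hV η v).2, ← (hW η v).2]; rfl⟩

/-! ### Periodizations -/

/-- The test function on the plane that corresponds to the periodization of `η(α) v(x)`. -/
def unfold (Λ : Matrix (Fin 2) (Fin 2) ℝ) (p : 𝓢(Plane, ℂ) × 𝓢(Plane, ℂ)) : 𝓢(Plane, ℂ) :=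
  conjTest (blochTest Λ (conjTest p.1) (conjTest p.2))

theorem star_coef_conjTest (η : 𝓢(Plane, ℂ)) (j : Idx) :
    star (coef Λ (conjTest η) j) = coef Λ η (-j) := by
  rw [coef, coef, ← starRingEnd_apply, ← integral_conj]
  refine integral_congr_ae (Eventually.of_forall fun α => ?_)
  simp only [conjTest_apply, map_mul, starRingEnd_apply, star_star, star_phase, neg_neg, latt_neg,
    phase_neg_right]

theorem hasSum_unfold (hΛ : IsUnit Λ.det) (η v : 𝓢(Plane, ℂ)) (x : Plane) :
    HasSum (fun k : Idx => blochConst Λ * coef Λ η (-k) * v (x - latt Λ k))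
      (unfold Λ (η, v) x) := by
  have h := ((hasSum_blochTest hΛ (conjTest η) (conjTest v)).schwartz_apply x).star
  rw [unfold, conjTest_apply]
  refine h.congr_fun fun k => ?_
  rw [smul_apply, transl_apply, conjTest_apply, smul_eq_mul, star_mul', star_mul', star_star,
    star_blochConst, star_coef_conjTest]

/-- `unfold` is a convolution over the lattice, so its series is a Cauchy product. The two factors
are the Poisson series of the periodization of `η` and the series of `v`. -/
theorem blochSeries_unfold (hΛ : IsUnit Λ.det) (η v : 𝓢(Plane, ℂ)) (α x : Plane) :
    blochConst Λ * blochSeries Λ (unfold Λ (η, v)) α x =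
      perSum Λ η α * blochSeries Λ v α x := by
  have hC := blochConst_ne_zero hΛ
  let a : Idx → ℂ := fun k => blochConst Λ * coef Λ η (-k) * phase (-α) (latt Λ k)
  let b : Idx → ℂ := fun m => v (x + latt Λ m) * phase (-α) (latt Λ m)
  have ha : Summable fun k => ‖a k‖ := by
    simp only [a, norm_mul, norm_phase, mul_one]
    exact ((Equiv.neg Idx).summable_iff.2 (summable_norm_coef hΛ η)).mul_left _
  have hb : Summable fun m => ‖b m‖ := by
    simp only [b, norm_mul, norm_phase, mul_one]
    exact summable_norm_add_latt hΛ v x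
  have hab : Summable fun p : Idx × Idx => a p.1 * b p.2 :=
    summable_mul_of_summable_norm ha hb
  let e : Idx × Idx ≃ Idx × Idx :=
    ⟨fun p => (p.2, p.1 - p.2), fun p => (p.1 + p.2, p.1), fun p => by simp, fun p => by simp⟩
  have h1 : (∑' k, a k) * ∑' m, b m = ∑' j, ∑' k, a k * b (j - k) := by
    rw [tsum_mul_tsum_of_summable_norm ha hb, ← e.tsum_eq]
    exact (e.summable_iff.2 hab).tsum_prod
  have h2 : ∑' k, a k = (blochConst Λ)⁻¹ * perSum Λ η α := by
    have := ((Equiv.neg Idx).hasSum_iff.2 (poisson hΛ η α)).mul_left (blochConst Λ)⁻¹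
    rw [← this.tsum_eq]
    refine tsum_congr fun k => ?_
    simp only [a, Function.comp, Equiv.neg_apply, latt_neg, phase_neg_right]
    field_simp
  have h3 : ∀ j, ∑' k, a k * b (j - k) =
      unfold Λ (η, v) (x + latt Λ j) * phase (-α) (latt Λ j) := by
    intro j
    rw [← (hasSum_unfold hΛ η v (x + latt Λ j)).tsum_eq, ← tsum_mul_right]
    refine tsum_congr fun k => ?_
    have e1 : phase (-α) (latt Λ j) = phase (-α) (latt Λ k) * phase (-α) (latt Λ (j - k)) := by
      rw [← phase_add_right, ← latt_add]
      simp
    simp only [a, b]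
    rw [e1, latt_sub, add_sub_assoc]
    ring
  simp only [h3, h2] at h1
  rw [blochSeries, ← h1, blochSeries]
  field_simp
  rfl

/-- So the test functions in the negative order norm are Bloch transforms of Schwartz functions;
this converts that norm into one over the plane. -/
theorem represents₂_unfold (hΛ : IsUnit Λ.det) (L : TestSum) :
    Represents₂ (blochJ hΛ (((L.map (unfold Λ)).sum : 𝓢(Plane, ℂ)) : 𝓢'(Plane, ℂ)))
      (periodization Λ L) := by
  induction L with
  | nil =>
    intro η v
    simp [periodization]
  | cons p L ih =>
    have h1 := represents₂_blochJ hΛ ((unfold Λ p).integrable) (represents_coe (unfold Λ p))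
    rw [List.map_cons, List.sum_cons]
    have e : ((unfold Λ p + (L.map (unfold Λ)).sum : 𝓢(Plane, ℂ)) : 𝓢'(Plane, ℂ)) =
      (unfold Λ p : 𝓢'(Plane, ℂ)) + (((L.map (unfold Λ)).sum : 𝓢(Plane, ℂ)) : 𝓢'(Plane, ℂ)) :=
      map_add _ _ _
    rw [e, map_add]
    have h2 := h1.add ih
    simp only [blochSeries_unfold hΛ p.1 p.2] at h2
    exact h2

theorem pairTest_blochJ (hΛ : IsUnit Λ.det) (T : 𝓢'(Plane, ℂ)) (L : TestSum) :
    pairTest (blochJ hΛ T) L = T (conjTest (L.map (unfold Λ)).sum) := by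
  induction L with
  | nil => simp [pairTest, conjTest]
  | cons p L ih =>
    have e : conjTest (unfold Λ p + (L.map (unfold Λ)).sum) =
      conjTest (unfold Λ p) + conjTest (L.map (unfold Λ)).sum := map_add _ _ _
    rw [List.map_cons, List.sum_cons, e, map_add, ← ih, unfold, conjTest_conjTest, ← blochJ_apply hΛ]
    simp [pairTest]

/-- Every test function on the plane comes from a periodization. -/
theorem exists_unfold_eq (hΛ : IsUnit Λ.det) (v : 𝓢(Plane, ℂ)) :
    ∃ p : 𝓢(Plane, ℂ) × 𝓢(Plane, ℂ), unfold Λ p = v := by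
  refine ⟨(conjTest (eta hΛ), blochConst Λ • v), ?_⟩
  have e : conjTest (blochConst Λ • v) = blochConst Λ • conjTest v := by
    ext x
    simp only [conjTest_apply, smul_apply, smul_eq_mul, star_mul', star_blochConst]
  rw [unfold, conjTest_conjTest, e, blochTest_smul_right hΛ, (isPartition_eta hΛ).blochTest_eq hΛ,
    conjTest_conjTest]

/-! ### The isomorphism -/

/-- The supremum over periodizations becomes one over Schwartz functions, because unfolding reaches
all of them. -/
theorem cellNorm_of_neg (hΛ : IsUnit Λ.det) {s r : ℝ} (hr : r < 0) (T : 𝓢'(Plane, ℂ)) :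
    cellNorm Λ s r (blochJ hΛ T) = ⨆ v : 𝓢(Plane, ℂ),
      ‖T (conjTest v)‖ₑ / posNorm Λ (-s) (-r) (blochJ hΛ (v : 𝓢'(Plane, ℂ))) := by
  rw [cellNorm, if_neg (not_le.2 hr)]
  refine le_antisymm (iSup_le fun L => iSup_le fun V => iSup_le fun hV => ?_) (iSup_le fun v => ?_)
  · rw [hV.dist_eq (represents₂_unfold hΛ L), pairTest_blochJ]
    exact le_iSup (fun v : 𝓢(Plane, ℂ) =>
      ‖T (conjTest v)‖ₑ / posNorm Λ (-s) (-r) (blochJ hΛ (v : 𝓢'(Plane, ℂ)))) _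
  · obtain ⟨p, rfl⟩ := exists_unfold_eq hΛ v
    have h := represents₂_unfold hΛ [p]
    refine le_iSup_of_le [p] (le_iSup_of_le _ (le_iSup_of_le h ?_))
    rw [pairTest_blochJ]
    simp

/-- For `r < 0` both norms are dual to the case `(-s, -r)`, which is available because the range of
`s` is symmetric. -/
theorem nequiv_cellNorm (hΛ : IsUnit Λ.det) {s : ℝ} (hs : s ∈ Set.Icc (-1 : ℝ) 1) (r : ℝ) :
    NEquiv (fun T => cellNorm Λ s r (blochJ hΛ T))
      (fun T => dnorm (FmD (wt 1 s) (SmD (wt 1 r) T))) := by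
  have hs' : -s ∈ Set.Icc (-1 : ℝ) 1 := ⟨by linarith [hs.2], by linarith [hs.1]⟩
  rcases le_or_gt 0 r with hr | hr
  · simp only [cellNorm, if_pos hr]
    exact (nequiv_posNorm hΛ hs hr).trans (nequiv_commute hs r).symm
  · have h := ((nequiv_posNorm hΛ hs' (r := -r) (by linarith)).trans
      (nequiv_commute hs' (-r)).symm).comp fun v : 𝓢(Plane, ℂ) => (v : 𝓢'(Plane, ℂ))
    obtain ⟨A, hA, h⟩ := h.exists_le
    simp only [dnorm_coe_wt] at h
    refine NEquiv.of_exists ⟨A, hA, fun T => ?_⟩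
    rw [cellNorm_of_neg hΛ hr]
    exact exists_dual_equiv s r (fun v => (h v).1) (fun v => (h v).2) T

theorem nequiv_surfaceNorm (hΛ : IsUnit Λ.det) (S : PeriodicDiffeo Λ) {s : ℝ}
    (hs : s ∈ Set.Icc (-1 : ℝ) 1) (r : ℝ) :
    NEquiv (fun T => cellNorm Λ s r (blochJ hΛ T)) (S.surfaceNorm s r) :=
  (nequiv_cellNorm hΛ hs r).trans (NEquiv.of_exists (exists_surfaceNorm_equiv S s r)).symm

theorem bijOn_blochJ (hΛ : IsUnit Λ.det) (S : PeriodicDiffeo Λ) {s : ℝ}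
    (hs : s ∈ Set.Icc (-1 : ℝ) 1) (r : ℝ) :
    Set.BijOn (blochJ hΛ) (S.sobolev s r) (S.blochSobolev s r) := by
  have h := nequiv_surfaceNorm hΛ S hs r
  refine ⟨fun T hT => ⟨isQuasiperiodic_blochJ hΛ T, (h.lt_top_iff T).2
    ((mem_sobolev_iff S s r T).1 hT)⟩, (blochJ_injective hΛ).injOn, fun ψ hψ => ?_⟩
  have e := blochJ_blochInv hΛ hψ.1
  refine ⟨blochInv hΛ ψ, (mem_sobolev_iff S s r _).2 ((h.lt_top_iff _).1 ?_), e⟩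
  rw [e]
  exact hψ.2

theorem cellNorm_zero_zero (hΛ : IsUnit Λ.det) (S : PeriodicDiffeo Λ) (T : 𝓢'(Plane, ℂ)) :
    cellNorm Λ 0 0 (blochJ hΛ T) = S.surfaceNorm 0 0 T := by
  rw [cellNorm, if_pos le_rfl, posNorm, if_pos Int.fract_zero, Nat.floor_zero, intNorm_zero_zero,
    surfaceNorm_zero_zero]

/-! ### The pairings -/

/-- Schwartz functions are dense in the weighted Sobolev spaces. -/
theorem exists_seq_schwartz {s r : ℝ} {G : 𝓢'(Plane, ℂ)}
    (hG : dnorm (FmD (wt 1 (-s)) (SmD (wt 1 (-r)) G)) < ∞) :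
    ∃ u : ℕ → 𝓢(Plane, ℂ),
      CauchySeq (fun n => (u n).toLp 2 (volume : Measure Plane)) ∧
      Tendsto (fun n => dnorm (FmD (wt 1 (-s)) (SmD (wt 1 (-r))
        (G - (Sm (wt 1 r) (Fm (wt 1 s) (u n)) : 𝓢(Plane, ℂ)))))) atTop (𝓝 0) := by
  obtain ⟨f, hf, hrep, -⟩ := exists_represents_of_dnorm_lt_top hG
  have hd := SchwartzMap.denseRange_toLpCLM (E := Plane) (F := ℂ) (p := 2)
    (μ := (volume : Measure Plane)) (by norm_num)
  obtain ⟨x, hx, hlim⟩ := mem_closure_iff_seq_limit.1 (hd.closure_range ▸ Set.mem_univ (hf.toLp f))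
  choose u hu using hx
  have hu' : ∀ n, (u n).toLp 2 (volume : Measure Plane) = x n := hu
  refine ⟨u, ?_, ?_⟩
  · simp only [hu']
    exact hlim.cauchySeq
  · have key : ∀ n, dnorm (FmD (wt 1 (-s)) (SmD (wt 1 (-r))
        (G - (Sm (wt 1 r) (Fm (wt 1 s) (u n)) : 𝓢(Plane, ℂ))))) = ‖hf.toLp f - x n‖ₑ := by
      intro n
      have e : FmD (wt 1 (-s)) (SmD (wt 1 (-r))
          ((Sm (wt 1 r) (Fm (wt 1 s) (u n)) : 𝓢(Plane, ℂ)) : 𝓢'(Plane, ℂ))) =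
          (u n : 𝓢'(Plane, ℂ)) := by
        rw [coe_Sm (by fun_prop), Sm_wt_cancel', coe_Fm (by fun_prop), Fm_wt_cancel']
      rw [map_sub, map_sub, e]
      have h2 : Represents (FmD (wt 1 (-s)) (SmD (wt 1 (-r)) G) - (u n : 𝓢'(Plane, ℂ)))
          (fun y => f y - u n y) := by
        intro v
        have k1 := hrep v
        have k2 := represents_coe (u n) v
        simp only [sub_mul]
        exact ⟨k1.1.sub k2.1, by rw [integral_sub k1.1 k2.1, ← k1.2, ← k2.2]; rfl⟩
      rw [dnorm_eq_eLpNorm h2, ← hu' n, SchwartzMap.toLp, ← MemLp.toLp_sub, Lp.enorm_toLp]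
      rfl
    simp only [key]
    have : Tendsto (fun n => hf.toLp f - x n) atTop (𝓝 0) := by
      simpa using (tendsto_const_nhds (x := hf.toLp f)).sub hlim
    simpa using this.enorm

theorem tendsto_of_dom {X : Type*} {f g : X → ℝ≥0∞} (h : Dom f g) {u : ℕ → X}
    (hu : Tendsto (fun n => g (u n)) atTop (𝓝 0)) : Tendsto (fun n => f (u n)) atTop (𝓝 0) := by
  obtain ⟨C, hC, h⟩ := h
  have h2 : Tendsto (fun n => ENNReal.ofReal C * g (u n)) atTop (𝓝 0) := by
    simpa using ENNReal.Tendsto.const_mul hu (Or.inr ENNReal.ofReal_ne_top)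
  exact tendsto_of_tendsto_of_tendsto_of_le_of_le tendsto_const_nhds h2 (fun _ => zero_le)
    fun n => h (u n)

/-- One sequence of Schwartz functions approximates `G`; its Bloch transforms are periodizations
that approximate the transform of `G`. By `pairTest_blochJ` both pairings run through the same
numbers, which form a Cauchy sequence. -/
theorem exists_pairing (hΛ : IsUnit Λ.det) (S : PeriodicDiffeo Λ) {s : ℝ}
    (hs : s ∈ Set.Icc (-1 : ℝ) 1) (r : ℝ) {T G : 𝓢'(Plane, ℂ)} (hT : T ∈ S.sobolev s r)
    (hG : G ∈ S.sobolev (-s) (-r)) :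
    ∃ z : ℂ, S.IsCellPairing s r (blochJ hΛ T) (blochJ hΛ G) z ∧ S.IsSurfacePairing s r T G z := by
  have hs' : -s ∈ Set.Icc (-1 : ℝ) 1 := ⟨by linarith [hs.2], by linarith [hs.1]⟩
  have hS := NEquiv.of_exists (exists_surfaceNorm_equiv S (-s) (-r))
  have hST := NEquiv.of_exists (exists_surfaceNorm_equiv S s r)
  have hG' := (hS.lt_top_iff G).1 ((mem_sobolev_iff S _ _ G).1 hG)
  have hT' := (hST.lt_top_iff T).1 ((mem_sobolev_iff S _ _ T).1 hT)
  obtain ⟨u, hcau, hlim⟩ := exists_seq_schwartz hG'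
  set v : ℕ → 𝓢(Plane, ℂ) := fun n => Sm (wt 1 r) (Fm (wt 1 s) (u n)) with hv
  set U := FmD (wt 1 s) (SmD (wt 1 r) T) with hU
  have hTv : ∀ n, T (conjTest (v n)) = U (conjTest (u n)) := fun n => by
    rw [hv, hU, FmD_wt_apply, SmD_apply, conjTest_Sm_wt, conjTest_Fm_wt]
  have hlip : ∀ m n, dist (T (conjTest (v m))) (T (conjTest (v n))) ≤
      (dnorm U).toReal * dist ((u m).toLp 2 (volume : Measure Plane)) ((u n).toLp 2 volume) := by
    intro m n
    have e : conjTest (u m) - conjTest (u n) = conjTest (u m - u n) := (map_sub _ _ _).symm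
    rw [hTv, hTv, dist_eq_norm, dist_eq_norm, ← map_sub, e]
    have h1 := enorm_le_dnorm U (conjTest (u m - u n))
    rw [l2_conjTest] at h1
    have h2 := ENNReal.toReal_mono (ENNReal.mul_ne_top hT'.ne ENNReal.ofReal_ne_top) h1
    rw [ENNReal.toReal_mul, ENNReal.toReal_ofReal (l2_nonneg _), toReal_enorm] at h2
    refine h2.trans (le_of_eq ?_)
    congr 1
  have hcz : CauchySeq fun n => T (conjTest (v n)) := by
    have hD : 0 ≤ (dnorm U).toReal := ENNReal.toReal_nonneg
    rw [Metric.cauchySeq_iff] at hcau ⊢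
    intro ε hε
    obtain ⟨N, hN⟩ := hcau (ε / ((dnorm U).toReal + 1)) (by positivity)
    refine ⟨N, fun m hm n hn => (hlip m n).trans_lt ?_⟩
    have h3 := hN m hm n hn
    rw [lt_div_iff₀ (by positivity)] at h3
    have := dist_nonneg (x := (u m).toLp 2 (volume : Measure Plane)) (y := (u n).toLp 2 volume)
    nlinarith
  obtain ⟨z, hz⟩ := cauchySeq_tendsto_of_complete hcz
  choose p hp using fun n => exists_unfold_eq hΛ (v n)
  refine ⟨z, ⟨fun n => [p n], fun n => blochJ hΛ (v n : 𝓢'(Plane, ℂ)), fun n => ?_, ?_, ?_⟩,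
    ⟨v, tendsto_of_dom hS.1 hlim, hz⟩⟩
  · have := represents₂_unfold hΛ [p n]
    simpa [hp] using this
  · simp only [← map_sub]
    exact tendsto_of_dom (nequiv_cellNorm hΛ hs' (-r)).1 hlim
  · simpa [pairTest_blochJ, hp] using hz

/-! ### Functions on the surface -/

namespace PeriodicDiffeo

variable (S : PeriodicDiffeo Λ)

theorem param_add_latt (y : Plane) (j : Idx) :
    S.param (y + latt Λ j) = S.param y + embed (latt Λ j) := by
  rw [param, param, embed_add, S.periodic]

theorem shift_point (j : Idx) (y : Plane) : S.shift j (S.point y) = S.point (y + latt Λ j) :=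
  Subtype.ext (S.param_add_latt y j).symm

theorem density_add_latt (y : Plane) (j : Idx) : S.density (y + latt Λ j) = S.density y := by
  have h : fderiv ℝ S.param (y + latt Λ j) = fderiv ℝ S.param y := by
    rw [← fderiv_comp_add_right]
    have e : (fun x => S.param (x + latt Λ j)) = fun x => S.param x + embed (latt Λ j) :=
      funext fun x => S.param_add_latt x j
    rw [e, fderiv_add_const]
  rw [density, density, h]

theorem liftFactor_add_latt (s : ℝ) (y : Plane) (j : Idx) :
    S.liftFactor s (y + latt Λ j) = S.liftFactor s y := by
  rw [liftFactor, liftFactor, density_add_latt]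

theorem norm_embed (y : Plane) : ‖embed y‖ = ‖y‖ := by
  rw [EuclideanSpace.norm_eq, EuclideanSpace.norm_eq]
  simp [embed, Fin.sum_univ_three, Fin.sum_univ_two]

/-- The parametrization is proper. -/
theorem exists_norm_le (R : ℝ) : ∃ R' : ℝ, ∀ y : Plane, ‖S.param y‖ ≤ R → ‖y‖ ≤ R' := by
  obtain ⟨K, hK⟩ := S.lipschitz_symm
  refine ⟨K * R + ‖S.ζ.symm 0‖, fun y hy => ?_⟩
  have h := hK.dist_le_mul (S.param y) 0
  rw [dist_zero_right, param, Equiv.symm_apply_apply, dist_eq_norm] at h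
  have h2 := norm_sub_norm_le (embed y) (S.ζ.symm 0)
  rw [norm_embed] at h2
  have h3 : (K : ℝ) * ‖S.ζ (embed y)‖ ≤ K * R := by gcongr; exact hy
  linarith

/-- The Bloch transform of a function of bounded support is given by its series. -/
theorem isLift₂_blochFun (hΛ : IsUnit Λ.det) {s : ℝ} {T : 𝓢'(Plane, ℂ)} {φ : S.surface → ℂ}
    (hT : S.IsLift s T φ) (hφ : ∃ R : ℝ, ∀ x : S.surface, R < ‖(x : Space)‖ → φ x = 0) :
    S.IsLift₂ s (blochJ hΛ T) (S.blochFun φ) := by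
  obtain ⟨R, hR⟩ := hφ
  obtain ⟨R', hR'⟩ := S.exists_norm_le R
  set g : Plane → ℂ := fun y => S.liftFactor s y * φ (S.point y) with hg
  -- The parametrization is proper, so bounded support on the surface means bounded support of the
  -- lift.
  have hi : Integrable g := by
    have h1 : IntegrableOn g (Metric.closedBall 0 R') :=
      hT.locallyIntegrable.integrableOn_isCompact (isCompact_closedBall _ _)
    refine (integrableOn_iff_integrable_of_support_subset fun y hy => ?_).1 h1
    rw [mem_closedBall_zero_iff]
    refine hR' y ?_
    by_contra hlt
    have : φ (S.point y) = 0 := hR (S.point y) (not_le.1 hlt)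
    simp [hg, this] at hy
  have h := represents₂_blochJ hΛ hi hT
  intro η v
  have e : ∀ α y, blochConst Λ * blochSeries Λ g α y =
      S.liftFactor s y * S.blochFun φ α (S.point y) := by
    intro α y
    simp only [hg, blochSeries, blochFun, shift_point, liftFactor_add_latt, mul_assoc]
    rw [tsum_mul_left]
    ring
  simp only [e] at h
  exact h η v

theorem horiz_add_embed (x : Space) (y : Plane) : horiz (x + embed y) = horiz x + y := by
  ext i
  fin_cases i <;> simp [horiz, embed]

theorem exists_shift_eq (hΛ : IsUnit Λ.det) (x : S.surface) :
    ∃ x₀ ∈ S.surfaceCell, ∃ j : Idx, S.shift j x₀ = x := by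
  obtain ⟨m, hm, -⟩ := existsUnique_sub_latt_mem_cell hΛ (horiz (x : Space))
  refine ⟨S.shift (-m) x, ?_, m, ?_⟩
  · change horiz ((x : Space) + embed (latt Λ (-m))) ∈ cell Λ
    rwa [horiz_add_embed, latt_neg, ← sub_eq_add_neg]
  · refine Subtype.ext ?_
    change (x : Space) + embed (latt Λ (-m)) + embed (latt Λ m) = x
    rw [add_assoc, ← embed_add, latt_neg, neg_add_cancel]
    have : embed (0 : Plane) = 0 := by
      ext i
      fin_cases i <;> simp [embed]
    rw [this, add_zero]

end PeriodicDiffeo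

/-- Integrals of periodic functions against a partition of unity. -/
theorem IsPartition.integral_mul (hΛ : IsUnit Λ.det) {η : 𝓢(Plane, ℂ)} (h : IsPartition Λ η)
    {f : Plane → ℂ} (hper : ∀ m : Idx, ∀ᵐ α, f (α + latt (dualMat Λ) m) = f α)
    (hi : Integrable fun α => f α * η α) :
    ∫ α, f α * η α = ∫ α in cell (dualMat Λ), f α := by
  rw [← integral_tsum_cell (isUnit_det_dualMat hΛ) hi]
  refine integral_congr_ae (ae_restrict_of_ae ?_)
  filter_upwards [ae_all_iff.2 hper] with α hα
  simp only [hα]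
  rw [tsum_mul_left, (h α).tsum_eq, mul_one]

theorem Represents₂.integrable_swap {ψ : Dist₂} {F : Plane → Plane → ℂ} (h : Represents₂ ψ F)
    (η v : 𝓢(Plane, ℂ)) :
    Integrable (fun p : Plane × Plane => F p.1 p.2 * (η p.1 * v p.2))
      ((volume : Measure Plane).prod volume) := (h η v).1

/-- The inverse Bloch transform of a function. -/
theorem represents_blochInv (hΛ : IsUnit Λ.det) {ψ : Dist₂} {F : Plane → Plane → ℂ}
    (hF : Represents₂ ψ F) (hper : ∀ α m y, F (α + latt (dualMat Λ) m) y = F α y) :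
    Represents (blochInv hΛ ψ) fun y => blochConst Λ * ∫ α in cell (dualMat Λ), F α y := by
  intro v
  have hη := isPartition_eta hΛ
  have h := hF.integrable_swap (eta hΛ) v
  -- The partition of unity reduces the integral over the plane to the dual cell. Where `v y ≠ 0`,
  -- integrability in `α` is obtained by dividing by `v y`.
  have hae : ∀ᵐ y : Plane, ∫ α, F α y * (eta hΛ α * v y) =
      (∫ α in cell (dualMat Λ), F α y) * v y := by
    filter_upwards [h.prod_left_ae] with y hy
    by_cases hv : v y = 0
    · simp [hv]
    · have e : (fun α => F α y * eta hΛ α) = fun α => F α y * (eta hΛ α * v y) * (v y)⁻¹ := by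
        ext α
        field_simp
      rw [← hη.integral_mul hΛ (fun m => Eventually.of_forall fun α => hper α m y)
        (by rw [e]; exact hy.mul_const _), ← integral_mul_const]
      simp only [mul_assoc]
  refine ⟨?_, ?_⟩
  · have h1 := h.integral_prod_right.congr hae
    simpa only [mul_assoc] using h1.const_mul (blochConst Λ)
  · have e1 : blochInv hΛ ψ v = blochConst Λ * ψ (eta hΛ) v := rfl
    rw [e1, (hF _ _).2, Measure.volume_eq_prod, integral_prod_symm _ h, integral_congr_ae hae,
      ← integral_const_mul]
    simp only [mul_assoc]

/-- Every point of the surface is a shift of one over `W`. Quasiperiodicity absorbs the phase, so on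
the whole surface `φ` is a constant times the integral of `f` over `W*`. -/
theorem isLift_blochInv (hΛ : IsUnit Λ.det) (S : PeriodicDiffeo Λ) {s : ℝ} {ψ : Dist₂}
    {f : Plane → S.surface → ℂ} (hf : S.IsLift₂ s ψ f)
    (hper : ∀ (α : Plane) (m : Idx) (x : S.surface), f (α + latt (dualMat Λ) m) x = f α x)
    (hquasi : ∀ (α : Plane) (j : Idx) (x : S.surface),
      f α (S.shift j x) = phase α (latt Λ j) * f α x) {φ : S.surface → ℂ}
    (hφ : ∀ x ∈ S.surfaceCell, ∀ j : Idx, φ (S.shift j x) =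
      blochConst Λ * ∫ α in cell (dualMat Λ), f α x * phase α (latt Λ j)) :
    S.IsLift s (blochInv hΛ ψ) φ := by
  have key : ∀ x, φ x = blochConst Λ * ∫ α in cell (dualMat Λ), f α x := by
    intro x
    obtain ⟨x₀, hx₀, j, rfl⟩ := S.exists_shift_eq hΛ x
    rw [hφ x₀ hx₀ j]
    simp only [hquasi, mul_comm]
  have h := represents_blochInv hΛ hf fun α m y => by rw [hper]
  have e : (fun y => blochConst Λ * ∫ α in cell (dualMat Λ), S.liftFactor s y * f α (S.point y)) =
      fun y => S.liftFactor s y * φ (S.point y) := by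
    ext y
    rw [key, integral_const_mul]
    ring
  rw [e] at h
  exact h

/-! ### Fourier series on the dual cell -/

theorem convex_cell {A : Matrix (Fin 2) (Fin 2) ℝ} (hA : IsUnit A.det) : Convex ℝ (cell A) := by
  have h : Convex ℝ unitCube := by
    have e : unitCube = Set.univ.pi fun _ : Fin 2 => Set.Ioc (-1 / 2 : ℝ) (-1 / 2 + 1) := by
      ext μ
      simp [unitCube]
    rw [e]
    exact convex_pi fun _ _ => convex_Ioc _ _
  rw [cell_eq_preimage hA]
  exact h.is_linear_preimage (mulPtEquiv hA).symm.toLinearEquiv.toLinearMap.isLinear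

theorem perSum_eq_of_support_subset_cell (hΛ : IsUnit Λ.det) {η : 𝓢(Plane, ℂ)}
    (h : ∀ α, α ∉ cell (dualMat Λ) → η α = 0) {α : Plane} (hα : α ∈ cell (dualMat Λ)) :
    perSum Λ η α = η α := by
  have hz := latt_zero (dualMat Λ)
  rw [perSum, tsum_eq_single 0, hz, add_zero]
  intro m hm
  apply h
  intro hmem
  apply hm
  obtain ⟨k, -, hk⟩ := existsUnique_sub_latt_mem_cell (isUnit_det_dualMat hΛ) α
  have h1 := hk 0 (by simpa [hz] using hα)
  have h2 := hk (-m) (by simpa [latt_neg] using hmem)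
  simpa using h2.trans h1.symm

/-- The Fourier coefficients of a function on the dual cell. -/
def cellCoef (Λ : Matrix (Fin 2) (Fin 2) ℝ) (f : Plane → ℂ) (k : Idx) : ℂ :=
  blochConst Λ * ∫ α in cell (dualMat Λ), f α * phase α (latt Λ k)

theorem integrable_mul_phase_right {f : Plane → ℂ} {μ : Measure Plane} (hf : Integrable f μ)
    (x : Plane) : Integrable (fun α => f α * phase α x) μ :=
  hf.mul_of_top_left (memLp_top_of_bound (continuous_phase x).aestronglyMeasurable 1
      (Eventually.of_forall fun α => (norm_phase α x).le))

/-- A smooth function supported inside the cell equals its absolutely convergent Fourier series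
there, so `f` integrates to zero against it. The boundary of the convex cell is a null set. Only
integrability of `f` is assumed, as square integrability is not yet known where this is applied. -/
theorem ae_eq_zero_of_cellCoef (hΛ : IsUnit Λ.det) {f : Plane → ℂ}
    (hf : IntegrableOn f (cell (dualMat Λ))) (h : ∀ k, cellCoef Λ f k = 0) :
    ∀ᵐ α ∂volume.restrict (cell (dualMat Λ)), f α = 0 := by
  have hD := isUnit_det_dualMat hΛ
  have hm := measurableSet_cell hD
  have hint : ∀ᵐ α : Plane, α ∈ interior (cell (dualMat Λ)) → f α = 0 := by
    refine isOpen_interior.ae_eq_zero_of_integral_contDiff_smul_eq_zero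
      ((hf.mono_set interior_subset).locallyIntegrableOn) fun g hg hc hs => ?_
    set η := ofCompact hc hg
    have hη : ∀ α, α ∉ cell (dualMat Λ) → η α = 0 := fun α hα => by
      have : g α = 0 := image_eq_zero_of_notMem_tsupport
        fun hmem => hα (interior_subset (hs hmem))
      rw [ofCompact_apply, this, Complex.ofReal_zero]
    have e1 : ∫ α, g α • f α = ∫ α in cell (dualMat Λ), f α * perSum Λ η α := by
      rw [← setIntegral_eq_integral_of_forall_compl_eq_zero (s := cell (dualMat Λ))]
      · refine setIntegral_congr_fun hm fun α hα => ?_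
        rw [perSum_eq_of_support_subset_cell hΛ hη hα, ofCompact_apply, Complex.real_smul, mul_comm]
      · intro α hα
        have := hη α hα
        rw [ofCompact_apply, Complex.ofReal_eq_zero] at this
        rw [this, zero_smul]
    rw [e1]
    have hsum := hasSum_integral_of_summable_integral_norm (μ := volume.restrict (cell (dualMat Λ)))
      (F := fun (k : Idx) α => (blochConst Λ ^ 2 * coef Λ η k) * (f α * phase α (latt Λ k)))
      (fun k => (integrable_mul_phase_right hf _).const_mul _) (by
        simp only [norm_mul, norm_phase, mul_one]
        simp_rw [integral_const_mul]
        exact ((summable_norm_coef hΛ η).mul_left _).mul_right _)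
    have e2 : ∀ α, f α * perSum Λ η α =
        ∑' k, (blochConst Λ ^ 2 * coef Λ η k) * (f α * phase α (latt Λ k)) := fun α => by
      rw [← (poisson hΛ η α).tsum_eq, ← tsum_mul_left]
      exact tsum_congr fun k => by ring
    simp_rw [e2]
    rw [← hsum.tsum_eq]
    refine (tsum_congr fun k => ?_).trans tsum_zero
    have := h k
    rw [cellCoef, mul_eq_zero, or_iff_right (blochConst_ne_zero hΛ)] at this
    rw [integral_const_mul, this, mul_zero]
  rw [ae_restrict_iff' hm]
  have hfr : ∀ᵐ α : Plane, α ∉ frontier (cell (dualMat Λ)) :=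
    measure_eq_zero_iff_ae_notMem.1 ((convex_cell hD).addHaar_frontier volume)
  filter_upwards [hint, hfr] with α h1 h2 h3
  apply h1
  by_contra h4
  exact h2 ⟨subset_closure h3, h4⟩

/-- The trigonometric system on the dual cell. -/
def trig (Λ : Matrix (Fin 2) (Fin 2) ℝ) (k : Idx) (α : Plane) : ℂ :=
  blochConst Λ * phase (-α) (latt Λ k)

theorem continuous_trig (k : Idx) : Continuous (trig Λ k) :=
  continuous_const.mul ((continuous_phase _).comp continuous_neg)

instance isFiniteMeasure_cell {A : Matrix (Fin 2) (Fin 2) ℝ} :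
    IsFiniteMeasure (volume.restrict (cell A)) :=
  ⟨by rw [Measure.restrict_apply_univ]; exact volume_cell_lt_top⟩

theorem memLp_trig (k : Idx) : MemLp (trig Λ k) 2 (volume.restrict (cell (dualMat Λ))) :=
  MemLp.of_bound (continuous_trig k).aestronglyMeasurable ‖blochConst Λ‖
    (Eventually.of_forall fun α => by rw [trig, norm_mul, norm_phase, mul_one])

theorem inner_trig {f : Plane → ℂ} (hf : MemLp f 2 (volume.restrict (cell (dualMat Λ))))
    (k : Idx) : inner ℂ ((memLp_trig k).toLp) (hf.toLp) = cellCoef Λ f k := by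
  rw [L2.inner_def, cellCoef, ← integral_const_mul]
  refine integral_congr_ae ?_
  filter_upwards [(memLp_trig (Λ := Λ) k).coeFn_toLp, hf.coeFn_toLp] with α h1 h2
  rw [h1, h2, RCLike.inner_apply, trig, map_mul]
  have e1 := star_blochConst Λ
  have e2 := star_phase (-α) (latt Λ k)
  rw [neg_neg] at e2
  rw [← starRingEnd_apply] at e1 e2
  rw [e1, e2]
  ring

theorem cellCoef_trig (hΛ : IsUnit Λ.det) (j k : Idx) :
    cellCoef Λ (trig Λ j) k = if k = j then 1 else 0 := by
  have h := setIntegral_phase hΛ (j - k)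
  rw [cellCoef, ← integral_const_mul]
  rw [← integral_const_mul] at h
  rw [show (fun α => blochConst Λ * (trig Λ j α * phase α (latt Λ k))) =
      fun α => blochConst Λ ^ 2 * phase (-α) (latt Λ (j - k)) from ?_, h]
  · simp only [sub_eq_zero, eq_comm]
  · ext α
    rw [trig, sub_eq_add_neg, latt_add, latt_neg, phase_add_right, phase_neg_right, neg_neg]
    ring

theorem orthonormal_trig (hΛ : IsUnit Λ.det) :
    Orthonormal ℂ fun k => (memLp_trig (Λ := Λ) k).toLp := by
  classical
  rw [orthonormal_iff_ite]
  intro k j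
  rw [inner_trig, cellCoef_trig hΛ]

/-- The trigonometric system as a Hilbert basis. -/
def trigBasis (hΛ : IsUnit Λ.det) :
    HilbertBasis Idx ℂ (Lp ℂ 2 (volume.restrict (cell (dualMat Λ)))) :=
  HilbertBasis.mkOfOrthogonalEqBot (orthonormal_trig hΛ) (by
    rw [Submodule.eq_bot_iff]
    intro x hx
    have hx' := Lp.memLp x
    have h0 : ∀ k, cellCoef Λ x k = 0 := fun k => by
      rw [← inner_trig hx', Lp.toLp_coeFn]
      exact (Submodule.mem_orthogonal _ _).1 hx _ (Submodule.subset_span ⟨k, rfl⟩)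
    have := ae_eq_zero_of_cellCoef hΛ (hx'.integrable one_le_two) h0
    exact Lp.eq_zero_iff_ae_eq_zero.2 this)

theorem inner_trigBasis (hΛ : IsUnit Λ.det) {f : Plane → ℂ}
    (hf : MemLp f 2 (volume.restrict (cell (dualMat Λ)))) (k : Idx) :
    inner ℂ (trigBasis hΛ k) hf.toLp = cellCoef Λ f k := by
  rw [trigBasis, HilbertBasis.coe_mkOfOrthogonalEqBot, inner_trig]

/-- Riesz–Fischer gives an `L²` function with the same coefficients, and uniqueness in `L¹`
identifies it with `f`. -/
theorem memLp_of_cellCoef (hΛ : IsUnit Λ.det) {f : Plane → ℂ}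
    (hf : IntegrableOn f (cell (dualMat Λ)))
    (hs : ∑' k, ‖cellCoef Λ f k‖ₑ ^ 2 < ∞) :
    MemLp f 2 (volume.restrict (cell (dualMat Λ))) := by
  have hs' : Memℓp (cellCoef Λ f) 2 := by
    refine memℓp_gen ?_
    have : Summable fun k => (‖cellCoef Λ f k‖ₑ ^ 2).toReal := ENNReal.summable_toReal hs.ne
    simpa using this
  set g := (trigBasis hΛ).repr.symm ⟨cellCoef Λ f, hs'⟩
  have hg := Lp.memLp g
  have hc : ∀ k, cellCoef Λ g k = cellCoef Λ f k := fun k => by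
    rw [← inner_trigBasis hΛ hg, Lp.toLp_coeFn, ← HilbertBasis.repr_apply_apply,
      LinearIsometryEquiv.apply_symm_apply]
  have hgi := hg.integrable one_le_two
  have h0 := ae_eq_zero_of_cellCoef hΛ (f := fun α => g α - f α) (hgi.sub hf) fun k => by
    have := hc k
    rw [cellCoef, cellCoef] at this
    rw [cellCoef]
    simp_rw [sub_mul]
    rw [integral_sub (integrable_mul_phase_right hgi _) (integrable_mul_phase_right hf _), mul_sub, this,
      sub_self]
  refine hg.ae_eq ?_
  filter_upwards [h0] with α hα
  exact sub_eq_zero.1 hα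

theorem hasSum_cellCoef (hΛ : IsUnit Λ.det) {f h : Plane → ℂ}
    (hf : MemLp f 2 (volume.restrict (cell (dualMat Λ))))
    (hh : MemLp h 2 (volume.restrict (cell (dualMat Λ)))) :
    HasSum (fun k => cellCoef Λ f k * star (cellCoef Λ h k))
      (∫ α in cell (dualMat Λ), f α * star (h α)) := by
  have key := (trigBasis hΛ).hasSum_inner_mul_inner hh.toLp hf.toLp
  have e : inner ℂ hh.toLp hf.toLp = ∫ α in cell (dualMat Λ), f α * star (h α) := by
    rw [L2.inner_def]
    refine integral_congr_ae ?_
    filter_upwards [hf.coeFn_toLp, hh.coeFn_toLp] with α h1 h2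
    rw [h1, h2, RCLike.inner_apply]
    rfl
  rw [← e]
  refine key.congr_fun fun k => ?_
  rw [← inner_conj_symm, inner_trigBasis, inner_trigBasis, mul_comm]
  rfl

theorem tsum_enorm_cellCoef_sq (hΛ : IsUnit Λ.det) {f : Plane → ℂ}
    (hf : MemLp f 2 (volume.restrict (cell (dualMat Λ)))) :
    ∑' k, ‖cellCoef Λ f k‖ₑ ^ 2 = ∫⁻ α in cell (dualMat Λ), ‖f α‖ₑ ^ 2 := by
  have h := hasSum_cellCoef hΛ hf hf
  have e : ∀ z : ℂ, z * star z = ((‖z‖ ^ 2 : ℝ) : ℂ) := fun z => by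
    rw [Complex.ofReal_pow]
    exact Complex.mul_conj' z
  simp_rw [e] at h
  rw [integral_complex_ofReal, Complex.hasSum_ofReal] at h
  have e2 : ∀ z : ℂ, ‖z‖ₑ ^ 2 = ENNReal.ofReal (‖z‖ ^ 2) := fun z => by
    rw [ENNReal.ofReal_pow (norm_nonneg _), ofReal_norm]
  simp_rw [e2]
  rw [← ofReal_integral_eq_lintegral_ofReal hf.norm.integrable_sq
    (Eventually.of_forall fun α => sq_nonneg _), ← h.tsum_eq,
    ENNReal.ofReal_tsum_of_nonneg (fun k => sq_nonneg _) h.summable]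

/-! ### The scalar products with the surface measure -/

theorem exists_eq_one_of_isBounded {s : Set Plane} (hs : Bornology.IsBounded s) :
    ∃ v : 𝓢(Plane, ℂ), ∀ x ∈ s, v x = 1 := by
  obtain ⟨R, hR⟩ := hs.subset_closedBall 0
  let b : ContDiffBump (0 : Plane) := ⟨max R 1, max R 1 + 1, by positivity, by linarith⟩
  refine ⟨schwartzBump b, fun x hx => ?_⟩
  rw [schwartzBump_apply, b.one_of_mem_closedBall, Complex.ofReal_one]
  exact Metric.closedBall_subset_closedBall (le_max_left _ _) (hR hx)

/-- Take a test function in `α` that equals one on the bounded dual cell. -/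
theorem Represents₂.integrable_cell_left (hΛ : IsUnit Λ.det) {ψ : Dist₂} {F : Plane → Plane → ℂ}
    (h : Represents₂ ψ F) (v : 𝓢(Plane, ℂ)) :
    Integrable (fun p : Plane × Plane => F p.1 p.2 * v p.2)
      ((volume.restrict (cell (dualMat Λ))).prod volume) := by
  obtain ⟨η, hη⟩ := exists_eq_one_of_isBounded (isBounded_cell (dualMat Λ))
  have hm := measurableSet_cell (isUnit_det_dualMat hΛ)
  have h1 := (h.integrable_swap η v).integrableOn (s := cell (dualMat Λ) ×ˢ Set.univ)
  rw [IntegrableOn, ← Measure.prod_restrict, Measure.restrict_univ] at h1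
  refine h1.congr ?_
  have h2 : ∀ᵐ p : Plane × Plane ∂(volume.restrict (cell (dualMat Λ))).prod volume,
      p.1 ∈ cell (dualMat Λ) :=
    Measure.quasiMeasurePreserving_fst.ae (ae_restrict_mem hm)
  filter_upwards [h2] with p hp
  rw [hη _ hp, one_mul]

theorem Represents₂.integrable_cell (hΛ : IsUnit Λ.det) {ψ : Dist₂} {F : Plane → Plane → ℂ}
    (h : Represents₂ ψ F) :
    Integrable (fun p : Plane × Plane => F p.1 p.2)
      ((volume.restrict (cell (dualMat Λ))).prod (volume.restrict (cell Λ))) := by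
  obtain ⟨v, hv⟩ := exists_eq_one_of_isBounded (isBounded_cell Λ)
  have h1 := (h.integrable_cell_left hΛ v).integrableOn (s := Set.univ ×ˢ cell Λ)
  rw [IntegrableOn, ← Measure.prod_restrict, Measure.restrict_univ] at h1
  refine h1.congr ?_
  have h2 : ∀ᵐ p : Plane × Plane ∂(volume.restrict (cell (dualMat Λ))).prod
      (volume.restrict (cell Λ)), p.2 ∈ cell Λ :=
    Measure.quasiMeasurePreserving_snd.ae (ae_restrict_mem (measurableSet_cell hΛ))
  filter_upwards [h2] with p hp
  rw [hv _ hp, mul_one]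

theorem Represents₂.represents_partial {ψ : Dist₂} {F : Plane → Plane → ℂ}
    (h : Represents₂ ψ F) (η v : 𝓢(Plane, ℂ)) :
    Integrable (fun α => (∫ y, F α y * v y) * η α) ∧
      ψ η v = ∫ α, (∫ y, F α y * v y) * η α := by
  have e : ∀ α, ∫ y, F α y * (η α * v y) = (∫ y, F α y * v y) * η α := fun α => by
    rw [← integral_mul_const]
    exact integral_congr_ae (Eventually.of_forall fun y => by beta_reduce; ring)
  have h1 := h.integrable_swap η v
  refine ⟨by simpa only [e] using h1.integral_prod_left, ?_⟩
  rw [(h η v).2, Measure.volume_eq_prod, integral_prod _ h1]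
  simp only [e]

/-- Periodicity is known only for the distribution; it reaches the representing function almost
everywhere, after pairing with `v`. -/
theorem Represents₂.ae_periodic_partial {ψ : Dist₂} (hψ : IsQuasiperiodic Λ ψ)
    {F : Plane → Plane → ℂ} (h : Represents₂ ψ F) (v : 𝓢(Plane, ℂ)) (m : Idx) :
    ∀ᵐ α, ∫ y, F (α + latt (dualMat Λ) m) y * v y = ∫ y, F α y * v y := by
  set g : Plane → ℂ := fun α => ∫ y, F α y * v y with hg
  set a := latt (dualMat Λ) m
  have e : ∀ η : 𝓢(Plane, ℂ), (fun α => g (α + a) * η α) =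
      fun α => (fun α => g α * transl a η α) (α + a) := fun η => by
    ext α
    simp only [transl_apply, add_sub_cancel_right]
  have hi : ∀ η : 𝓢(Plane, ℂ), Integrable fun α => g (α + a) * η α := fun η => by
    rw [e]
    exact (h.represents_partial (transl a η) v).1.comp_add_right a
  refine ae_eq_of_forall_integral_eq (locallyIntegrable_of_forall_integrable_mul hi)
    (locallyIntegrable_of_forall_integrable_mul fun η => (h.represents_partial η v).1)
    fun η _ => ?_
  rw [e, integral_add_right_eq_self (fun α => g α * transl a η α) a,
    ← (h.represents_partial (transl a η) v).2, ← (h.represents_partial η v).2, hψ.1]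

/-- The inversion formula, tested against `v`: the periodic function left after integration in `y`
is integrated over `W*` through the partition of unity. -/
theorem cellCoef_blochJ (hΛ : IsUnit Λ.det) {T : 𝓢'(Plane, ℂ)} {a : Plane → ℂ}
    (ha : Represents T a) {F : Plane → Plane → ℂ} (hF : Represents₂ (blochJ hΛ T) F) (k : Idx) :
    ∀ᵐ y, cellCoef Λ (fun α => F α y) k = a (y + latt Λ k) := by
  have hFi : ∀ v : 𝓢(Plane, ℂ), Integrable
      (fun p : Plane × Plane => F p.1 p.2 * v p.2 * phase p.1 (latt Λ k))
      ((volume.restrict (cell (dualMat Λ))).prod volume) := fun v =>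
    (hF.integrable_cell_left hΛ v).mul_of_top_left (memLp_top_of_bound
      ((continuous_phase _).comp continuous_fst).aestronglyMeasurable 1
      (Eventually.of_forall fun p => (norm_phase p.1 _).le))
  have e : ∀ (v : 𝓢(Plane, ℂ)) y, cellCoef Λ (fun α => F α y) k * v y =
      blochConst Λ * ∫ α in cell (dualMat Λ), F α y * v y * phase α (latt Λ k) := fun v y => by
    rw [cellCoef, mul_assoc, ← integral_mul_const]
    congr 1
    exact integral_congr_ae (Eventually.of_forall fun α => by beta_reduce; ring)
  have ea : ∀ v : 𝓢(Plane, ℂ), (fun y => a (y + latt Λ k) * v y) =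
      fun y => (fun y => a y * transl (latt Λ k) v y) (y + latt Λ k) := fun v => by
    ext y
    simp only [transl_apply, add_sub_cancel_right]
  refine ae_eq_of_forall_integral_eq
    (locallyIntegrable_of_forall_integrable_mul fun v => ?_)
    (locallyIntegrable_of_forall_integrable_mul fun v => ?_) fun v _ => ?_
  · simp only [e]
    exact (hFi v).integral_prod_right.const_mul _
  · rw [ea]
    exact (ha _).1.comp_add_right _
  · have hη := isPartition_eta hΛ
    have hp := hF.represents_partial (modul Λ k (eta hΛ)) v
    simp only [modul_apply, ← mul_assoc] at hp
    simp only [e]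
    rw [ea, integral_add_right_eq_self (fun y => a y * transl (latt Λ k) v y) (latt Λ k),
      ← (ha _).2, inversion hΛ hη T k v, hp.2, hη.integral_mul hΛ ?_ hp.1, integral_const_mul,
      ← integral_integral_swap (f := fun α y => F α y * v y * phase α (latt Λ k)) (hFi v)]
    · simp only [integral_mul_const]
    · intro m
      filter_upwards [hF.ae_periodic_partial (isQuasiperiodic_blochJ hΛ T) v m] with α hα
      rw [hα, phase_add_latt hΛ]

/-- The sums of squares of the coefficients integrate over `W` to the squared norm of `a`, so they
are finite for almost every `y`. -/
theorem ae_cell_blochJ (hΛ : IsUnit Λ.det) {T : 𝓢'(Plane, ℂ)} {a : Plane → ℂ}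
    (ha : Represents T a) (ha2 : MemLp a 2) {F : Plane → Plane → ℂ}
    (hF : Represents₂ (blochJ hΛ T) F) :
    ∀ᵐ y ∂volume.restrict (cell Λ),
      MemLp (fun α => F α y) 2 (volume.restrict (cell (dualMat Λ))) ∧
        ∀ k, cellCoef Λ (fun α => F α y) k = a (y + latt Λ k) := by
  have h1 : ∀ᵐ y ∂volume.restrict (cell Λ), ∀ k, cellCoef Λ (fun α => F α y) k = a (y + latt Λ k) :=
    ae_restrict_of_ae (ae_all_iff.2 fun k => cellCoef_blochJ hΛ ha hF k)
  have h2 : ∀ᵐ y ∂volume.restrict (cell Λ), ∑' k, ‖a (y + latt Λ k)‖ₑ ^ 2 < ∞ := by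
    have hm : AEMeasurable fun y => ‖a y‖ₑ ^ 2 := ha2.1.enorm.pow_const 2
    refine ae_lt_top' (AEMeasurable.tsum fun k => ?_) ?_
    · exact (hm.comp_quasiMeasurePreserving
        (measurePreserving_add_right volume (latt Λ k)).quasiMeasurePreserving).restrict
    · rw [lintegral_tsum_cell hΛ hm, ← eLpNorm_two_sq]
      exact (ENNReal.pow_lt_top ha2.2).ne
  filter_upwards [h1, h2, (hF.integrable_cell hΛ).prod_left_ae] with y hy1 hy2 hy3
  exact ⟨memLp_of_cellCoef hΛ hy3 (by simpa only [hy1] using hy2), hy1⟩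

theorem memLp_cell_blochJ (hΛ : IsUnit Λ.det) {T : 𝓢'(Plane, ℂ)} {a : Plane → ℂ}
    (ha : Represents T a) (ha2 : MemLp a 2) {F : Plane → Plane → ℂ}
    (hF : Represents₂ (blochJ hΛ T) F) :
    MemLp (fun p : Plane × Plane => F p.1 p.2) 2
      ((volume.restrict (cell (dualMat Λ))).prod (volume.restrict (cell Λ))) := by
  have hm := (hF.integrable_cell hΛ).aestronglyMeasurable
  refine ⟨hm, ?_⟩
  rw [eLpNorm_lt_top_iff_lintegral_rpow_enorm_lt_top two_ne_zero ENNReal.ofNat_ne_top]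
  simp only [ENNReal.toReal_ofNat, ENNReal.rpow_ofNat]
  rw [lintegral_prod_symm _ (hm.enorm.pow_const 2)]
  have h : ∀ᵐ y ∂volume.restrict (cell Λ), ∫⁻ α in cell (dualMat Λ), ‖F α y‖ₑ ^ 2 =
      ∑' k, ‖a (y + latt Λ k)‖ₑ ^ 2 := by
    filter_upwards [ae_cell_blochJ hΛ ha ha2 hF] with y hy
    rw [← tsum_enorm_cellCoef_sq hΛ hy.1]
    simp only [hy.2]
  rw [lintegral_congr_ae h, lintegral_tsum_cell hΛ (ha2.1.enorm.pow_const 2), ← eLpNorm_two_sq]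
  exact ENNReal.pow_lt_top ha2.2

/-! ### The surface density and Parseval's identity -/

namespace PeriodicDiffeo

variable (S : PeriodicDiffeo Λ)

/-- The norm of the cross product. -/
def crossNorm (p : Space × Space) : ℝ :=
  ‖(WithLp.toLp 2 (crossProduct (WithLp.ofLp p.1) (WithLp.ofLp p.2)) : Space)‖

theorem continuous_crossNorm : Continuous crossNorm := by
  refine continuous_norm.comp ((PiLp.continuous_toLp 2 _).comp ?_)
  refine continuous_pi fun i => ?_
  fin_cases i <;> simp [crossProduct] <;> fun_prop

theorem density_eq_crossNorm : S.density = fun y =>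
    crossNorm (fderiv ℝ S.param y (EuclideanSpace.single 0 1),
      fderiv ℝ S.param y (EuclideanSpace.single 1 1)) := rfl

theorem measurable_density : Measurable S.density := by
  have h0 := measurable_fderiv_apply_const ℝ S.param (EuclideanSpace.single (0 : Fin 2) (1 : ℝ))
  have h1 := measurable_fderiv_apply_const ℝ S.param (EuclideanSpace.single (1 : Fin 2) (1 : ℝ))
  rw [density_eq_crossNorm]
  exact continuous_crossNorm.measurable.comp (h0.prodMk h1)

/-- The Lipschitz constant bounds the derivative at every point: where the parametrization is not
differentiable, `fderiv` is zero. The cross product is bounded on bounded sets. -/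
theorem exists_density_le : ∃ C : ℝ, ∀ y, ‖((S.density y : ℝ) : ℂ)‖ ≤ C := by
  obtain ⟨K, hK⟩ := S.lipschitz
  have hp : LipschitzWith K S.param := LipschitzWith.of_dist_le_mul fun x y => by
    refine (hK.dist_le_mul _ _).trans_eq ?_
    rw [dist_eq_norm (embed x), dist_eq_norm x]
    congr 1
    rw [← norm_embed (x - y)]
    congr 1
    ext i
    fin_cases i <;> simp [embed]
  have hd : ∀ (y : Plane) (i : Fin 2), ‖fderiv ℝ S.param y (EuclideanSpace.single i 1)‖ ≤ K :=
    fun y i => by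
      refine (ContinuousLinearMap.le_opNorm _ _).trans ?_
      rw [PiLp.norm_single, norm_one, mul_one]
      exact norm_fderiv_le_of_lipschitz ℝ hp
  obtain ⟨C, hC⟩ := ((isCompact_closedBall (0 : Space) K).prod
    (isCompact_closedBall (0 : Space) K)).exists_bound_of_continuousOn
      continuous_crossNorm.continuousOn
  refine ⟨C, fun y => ?_⟩
  rw [Complex.norm_real, density_eq_crossNorm]
  exact hC (_, _) ⟨by simpa using hd y 0, by simpa using hd y 1⟩

theorem memLp_of_mem_sobolev {T : 𝓢'(Plane, ℂ)} (hT : T ∈ S.sobolev 0 0) {a : Plane → ℂ}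
    (ha : Represents T a) : MemLp a 2 := by
  refine ⟨ha.locallyIntegrable.aestronglyMeasurable, ?_⟩
  rw [← dnorm_eq_eLpNorm ha, ← surfaceNorm_zero_zero S]
  exact hT.2

/-- Fubini, Parseval in `α` for almost every `y`, and unfolding of the cell. The density factors out
because it is bounded, `Λ`-periodic and independent of `α`. -/
theorem innerCell_eq_innerSurface (hΛ : IsUnit Λ.det) {T G : 𝓢'(Plane, ℂ)}
    (hT : T ∈ S.sobolev 0 0) (hG : G ∈ S.sobolev 0 0) {φ g : S.surface → ℂ}
    {f h : Plane → S.surface → ℂ} (hφ : S.IsLift 0 T φ) (hg : S.IsLift 0 G g)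
    (hf : S.IsLift₂ 0 (blochJ hΛ T) f) (hh : S.IsLift₂ 0 (blochJ hΛ G) h) :
    S.innerCell f h = S.innerSurface φ g := by
  simp only [IsLift, IsLift₂, liftFactor, le_refl, if_true, one_mul] at hφ hg hf hh
  have ha2 := S.memLp_of_mem_sobolev hT hφ
  have hb2 := S.memLp_of_mem_sobolev hG hg
  obtain ⟨C, hC⟩ := S.exists_density_le
  have hρ : Measurable fun y => ((S.density y : ℝ) : ℂ) :=
    Complex.measurable_ofReal.comp S.measurable_density
  have hi2 : Integrable (fun p : Plane × Plane => f p.1 (S.point p.2) * star (h p.1 (S.point p.2)) *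
      ((S.density p.2 : ℝ) : ℂ))
      ((volume.restrict (cell (dualMat Λ))).prod (volume.restrict (cell Λ))) :=
    ((memLp_cell_blochJ hΛ hφ ha2 hf).integrable_mul
      (memLp_cell_blochJ hΛ hg hb2 hh).star).mul_of_top_left (memLp_top_of_bound
      (hρ.comp measurable_snd).aestronglyMeasurable C (Eventually.of_forall fun p => hC p.2))
  have hi : Integrable fun y => φ (S.point y) * star (g (S.point y)) * ((S.density y : ℝ) : ℂ) :=
    (ha2.integrable_mul hb2.star).mul_of_top_left (memLp_top_of_bound
      hρ.aestronglyMeasurable C (Eventually.of_forall hC))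
  rw [innerCell, innerSurface, integral_integral_swap hi2, ← integral_tsum_cell hΛ hi]
  refine integral_congr_ae ?_
  filter_upwards [ae_cell_blochJ hΛ hφ ha2 hf, ae_cell_blochJ hΛ hg hb2 hh] with y h1 h2
  rw [integral_mul_const, ← (hasSum_cellCoef hΛ h1.1 h2.1).tsum_eq, ← tsum_mul_right]
  simp only [h1.2, h2.2, S.density_add_latt]

end PeriodicDiffeo

end BlochSurface

end

/-! ### Assembly of the theorem -/

open BlochSurface in
theorem mainTheorem7 (Λ : Matrix (Fin 2) (Fin 2) ℝ) (hΛ : IsUnit Λ.det)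
    (S : PeriodicDiffeo Λ) :
    -- the Bloch transform on `Γ`, given by its series
    ∃ J : 𝓢'(Plane, ℂ) →ₗ[ℂ] Dist₂, (∀ T, S.IsBlochTransform T (J T)) ∧
      ∀ s ∈ Set.Icc (-1 : ℝ) 1, ∀ r : ℝ,
        -- pointwise formula for functions with bounded support
        (∀ (T : 𝓢'(Plane, ℂ)) (φ : S.surface → ℂ), S.IsLift s T φ →
          (∃ R : ℝ, ∀ x : S.surface, R < ‖(x : Space)‖ → φ x = 0) →
          S.IsLift₂ s (J T) (S.blochFun φ)) ∧
        -- isomorphism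
        Set.BijOn J (S.sobolev s r) (S.blochSobolev s r) ∧
        (∃ C : ℝ, 0 < C ∧ ∀ T ∈ S.sobolev s r,
          cellNorm Λ s r (J T) ≤ ENNReal.ofReal C * S.surfaceNorm s r T ∧
          S.surfaceNorm s r T ≤ ENNReal.ofReal C * cellNorm Λ s r (J T)) ∧
        -- isometry for `s = r = 0`
        (s = 0 → r = 0 → ∀ T ∈ S.sobolev s r, cellNorm Λ s r (J T) = S.surfaceNorm s r T) ∧
        -- the inverse is the adjoint: `⟨J T, ψ⟩ = ⟨T, J⁻¹ ψ⟩`, with `G = J⁻¹ ψ`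
        (∀ T ∈ S.sobolev s r, ∀ ψ ∈ S.blochSobolev (-s) (-r), ∀ G ∈ S.sobolev (-s) (-r),
          J G = ψ → ∃ z : ℂ, S.IsCellPairing s r (J T) ψ z ∧ S.IsSurfacePairing s r T G z) ∧
        -- the same for the scalar products of `L²(W*; L²(Γ_Λ))` and `L²(Γ)`
        (s = 0 → r = 0 → ∀ T ∈ S.sobolev s r, ∀ G ∈ S.sobolev s r,
          ∀ (φ g : S.surface → ℂ) (f h : Plane → S.surface → ℂ),
          S.IsLift s T φ → S.IsLift s G g → S.IsLift₂ s (J T) f → S.IsLift₂ s (J G) h →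
          S.innerCell f h = S.innerSurface φ g) ∧
        -- inversion formula for functions `f` on `ℝ² × Γ`
        (∀ ψ ∈ S.blochSobolev s r, ∀ f : Plane → S.surface → ℂ, S.IsLift₂ s ψ f →
          (∀ (α : Plane) (m : Idx) (x : S.surface), f (α + latt (dualMat Λ) m) x = f α x) →
          (∀ (α : Plane) (j : Idx) (x : S.surface),
            f α (S.shift j x) = phase α (latt Λ j) * f α x) →
          ∀ φ : S.surface → ℂ,
          (∀ x ∈ S.surfaceCell, ∀ j : Idx, φ (S.shift j x) =
            blochConst Λ * ∫ α in cell (dualMat Λ), f α x * phase α (latt Λ j)) →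
          ∃ T ∈ S.sobolev s r, S.IsLift s T φ ∧ J T = ψ) ∧
        -- inversion formula for distributions: the integral over `W*` of the `Λ*`-periodic
        -- distribution `α ↦ ψ(α, x) exp(i α·Λj)` is its value at any test function `η`
        -- such that the translates of `η` by the dual lattice sum up to `1`
        (∀ T ∈ S.sobolev s r, ∀ η : 𝓢(Plane, ℂ),
          (∀ α : Plane, HasSum (fun m : Idx => η (α + latt (dualMat Λ) m)) 1) →
          ∀ (j : Idx) (v : 𝓢(Plane, ℂ)), T (transl (latt Λ j) v) =
            blochConst Λ *
              J T (SchwartzMap.smulLeftCLM ℂ (fun α : Plane => phase α (latt Λ j)) η) v) := by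
  refine ⟨blochJ hΛ, fun T => isBlochTransform_blochJ hΛ S T, fun s hs r =>
    ⟨fun T φ hT hφ => S.isLift₂_blochFun hΛ hT hφ, bijOn_blochJ hΛ S hs r, ?_, ?_, ?_, ?_, ?_,
      fun T _ η hη j v => inversion hΛ hη T j v⟩⟩
  · obtain ⟨C, hC, h⟩ := (nequiv_surfaceNorm hΛ S hs r).exists_le
    exact ⟨C, hC, fun T _ => h T⟩
  · rintro rfl rfl T -
    exact cellNorm_zero_zero hΛ S T
  · rintro T hT ψ - G hG rfl
    exact exists_pairing hΛ S hs r hT hG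
  · rintro rfl rfl T hT G hG φ g f h hφ hg hf hh
    exact S.innerCell_eq_innerSurface hΛ hT hG hφ hg hf hh
  · intro ψ hψ f hf hper hquasi φ hφ
    have e := blochJ_blochInv hΛ hψ.1
    -- Surjectivity provides the membership, and injectivity identifies the preimage with `blochInv
    -- hΛ ψ`, whose lift is given by the integral formula.
    obtain ⟨T, hT, hTψ⟩ := (bijOn_blochJ hΛ S hs r).surjOn hψ
    have hT' : blochInv hΛ ψ = T := by rw [← hTψ, blochInv_blochJ]
    exact ⟨blochInv hΛ ψ, hT' ▸ hT, isLift_blochInv hΛ S hf hper hquasi hφ, e⟩
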